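/- Let $G$ be a compact connected Lie group with Lie algebra $\mathfrak g$. Choose a maximal torus $T$ with Lie algebra $\mathfrak t$, a $G$-invariant scalar product on $\mathfrak g$ (so that $\mathfrak t^*\subset\mathfrak g^*$ is the space of functionals vanishing on $\mathfrak t^\perp$), and a system $\Delta^+\subset\mathfrak t^*$ of positive roots. Let $\Lambda\subset\mathfrak t^*$ be the lattice of weights of $T$ (the character of weight $\lambda$ is $e^X\mapsto e^{i\langle\lambda,X\rangle}$), $\rho=\frac12\sum_{\alpha\in\Delta^+}\alpha$, $\tilde\Lambda$ the lattice generated by $\Lambda$ and $\rho$, $\mathfrak t^*_{>0}$ the open positive Weyl chamber, $A_G=(\rho+\Lambda)\cap\mathfrak t^*_{>0}$ and $r=\frac12\dim(G/T)$. For a coadjoint orbit $\mathcal O=G\xi$ of dimension $2n$ let $\beta_\xi$ be the measure $\Omega^n/((2\pi)^n n!)$ on $\mathcal O$, where $\Omega_\xi(X\cdot\xi,Y\cdot\xi)=\langle\xi,[X,Y]\rangle$, viewed as a measure on $\mathfrak g^*$. For a closed rational polyhedron $P\subset\mathfrak t^*$ let $E_P\subset\mathfrak t^*\times\mathbb R$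 be the span of the $(\xi,1)$, $\xi\in P$, and $\tilde\Lambda_P=(\tilde\Lambda\times\mathbb Z)\cap E_P$. Quasi-polynomials on a lattice are the elements of the algebra generated by polynomials and periodic functions. A function $m:\tilde\Lambda\times\mathbb Z_{>0}\to\mathbb C$ is piecewise quasi-polynomial if there are a collection $\mathcal A$ of closed rational polyhedra, only finitely many of which meet any given compact set, and quasi-polynomials $m_P$ on $\tilde\Lambda_P$, $P\in\mathcal A$, such that $m(\lambda,k)=\sum_{P\in\mathcal A,\ \lambda/k\in P}m_P(\lambda,k)$. For such an $m$ put $$\Theta_k(m)=k^r\sum_{\lambda\in A_G}m(\lambda,k)\,\beta_{\lambda/k},\qquad k\ge1 .$$ For a sequence of $G$-invariant distributions $\Theta_k$ $(k\ge1)$ on $\mathfrak g^*$ we write $\Theta_k\equiv\sum_{n\in\mathbb Z}k^{-n}\theta_n(k)$ if the $\theta_n(k)$ are $G$-invariant distributions such that, on test functions supported in any given compact set, (i) $\theta_n(k)$ vanishes for all $n$ below some bound, (ii) for each $n$, $\theta_n(k)=\sum_{\zeta^D=1}\zeta^k\theta_{n,\zeta}$ for some $D\ge1$ and some distributions $\theta_{n,\zeta}$,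 and if for every test function $\varphi$ and every $N\in\mathbb Z$ $$\langle\Theta_k,\varphi\rangle=\sum_{n\le N}k^{-n}\langle\theta_n(k),\varphi\rangle+o(k^{-N})\qquad(k\to\infty).$$ The expansion is called global if the bound in (i), and $D$ and $\theta_{n,\zeta}$ in (ii), can be chosen independently of the compact set. Let $j:\mathfrak g\to\mathbb C$ be a $G$-invariant analytic function of at most polynomial growth whose Fourier transform $B_j$, defined by $\langle B_j,\varphi\rangle=\int_{\mathfrak g}j(X)\Big(\frac1{(2\pi)^{\dim\mathfrak g}}\int_{\mathfrak g^*}\varphi(\xi)e^{-i\langle\xi,X\rangle}d\xi\Big)dX$ with dual volume forms $dX$, $d\xi$, is a compactly supported complex measure on $\mathfrak g^*$. Let $B_j^k$ be the image of $B_j$ under $\xi\mapsto\xi/k$. Let $j=\sum_{l\ge0}j_l$ be the Taylor series of $j$ at $0$, with $j_l$ homogeneous of degree $l$, and let $j_l(i\partial)$ be the corresponding constant coefficient differential operators on $\mathfrak g^*$. Then $\Theta_k(m)$ and the convolution $B_j^k\star\Theta_k(m)$ are well-defined distributions; $\Theta_k(m)$ has an asymptotic expansion $\Theta_k(m)\equiv\mathrm{AS}_k(m)=\sum_{n\in\mathbb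 Z}k^{-n}\theta_n(k)$, which can be taken global if $\mathcal A$ can be chosen finite; and for every asymptotic expansion $\mathrm{AS}_k(m)=\sum_n k^{-n}\theta_n(k)$ of $\Theta_k(m)$ one has $$B_j^k\star\Theta_k(m)\ \equiv\ j(i\partial/k)\,\mathrm{AS}_k(m):=\sum_{n\in\mathbb Z}k^{-n}\sum_{l\ge0}j_l(i\partial)\,\theta_{n-l}(k),$$ and this expansion is global if $\mathrm{AS}_k(m)$ is. -/

import Mathlib

open MeasureTheory Filter Asymptotics TopologicalSpace
open scoped Manifold ContDiff Distributions LineDeriv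

noncomputable section

namespace QuasiPolyAsymptotics

section LieGroup

variable {E : Type*} [NormedAddCommGroup E] [NormedSpace ℝ E]

/-- The dual `𝔤*` of the Lie algebra. For a Lie group `G` modelled on `E`, the Lie algebra
`𝔤 = T₁G` is, in Mathlib, the vector space `E` itself, equipped with the bracket of
`GroupLieAlgebra 𝓘(ℝ, E) G`. -/
abbrev Dual (E : Type*) [NormedAddCommGroup E] [NormedSpace ℝ E] : Type _ := E →L[ℝ] ℝ

variable (G : Type*) [TopologicalSpace G] [ChartedSpace E G] [Group G]

/-- The Lie bracket of `𝔤 = T₁G`. -/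
def bracket (X Y : E) : E :=
  (⁅(show GroupLieAlgebra 𝓘(ℝ, E) G from X), (show GroupLieAlgebra 𝓘(ℝ, E) G from Y)⁆ :
    GroupLieAlgebra 𝓘(ℝ, E) G)

variable {G}

/-- The adjoint action: the differential at `1` of `x ↦ g x g⁻¹`. -/
def Ad (g : G) : E →L[ℝ] E :=
  mfderiv 𝓘(ℝ, E) 𝓘(ℝ, E) (fun x : G => g * x * g⁻¹) (1 : G)

/-- The coadjoint action, `⟨g · ξ, X⟩ = ⟨ξ, Ad(g⁻¹) X⟩`. -/
def coAd (g : G) (ξ : Dual E) : Dual E := ξ.comp (Ad g⁻¹)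

variable (G)

/-- The coadjoint orbit `G ξ ⊆ 𝔤*`. -/
def coadjointOrbit (ξ : Dual E) : Set (Dual E) := Set.range fun g : G => coAd g ξ

/-- `v = X · ξ` for the infinitesimal coadjoint action, `⟨X · ξ, Y⟩ = -⟨ξ, [X, Y]⟩`. -/
def IsInfCoad (X : E) (ξ v : Dual E) : Prop := ∀ Y : E, v Y = -ξ (bracket G X Y)

open Classical in
/-- The Kirillov-Kostant-Souriau form `Ω_ξ(X · ξ, Y · ξ) = ⟨ξ, [X, Y]⟩` on the tangent space
`{X · ξ | X ∈ 𝔤}` of the coadjoint orbit at `ξ`; it does not depend on the choice of `X` and `Y`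
(see `kksForm_eq`). -/
def kksForm (ξ v w : Dual E) : ℝ :=
  if h : ∃ z : E × E, IsInfCoad G z.1 ξ v ∧ IsInfCoad G z.2 ξ w then
    ξ (bracket G h.choose.1 h.choose.2) else 0

lemma bracket_swap (X Y : E) : bracket G X Y = -bracket G Y X :=
  VectorField.mlieBracket_swap_apply

lemma kksForm_eq {ξ v w : Dual E} {X Y : E} (hX : IsInfCoad G X ξ v) (hY : IsInfCoad G Y ξ w) :
    kksForm G ξ v w = ξ (bracket G X Y) := by
  have h : ∃ z : E × E, IsInfCoad G z.1 ξ v ∧ IsInfCoad G z.2 ξ w := ⟨(X, Y), hX, hY⟩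
  rw [kksForm, dif_pos h]
  obtain ⟨h1, h2⟩ := h.choose_spec
  have e1 := h1 h.choose.2
  have e2 := hX h.choose.2
  have e3 := h2 X
  have e4 := hY X
  rw [bracket_swap G h.choose.2 X, map_neg] at e3
  rw [bracket_swap G Y X, map_neg] at e4
  linarith

/-- A local parametrization of the orbit `O`: an injective immersion of an open subset `U` of `ℝᵈ`
into `𝔤*`, with values in `O`, whose differential at every `u ∈ U` is onto the tangent space of the
orbit (so that `d` is the dimension of `O`). -/
structure IsLocalParam (O : Set (Dual E)) (d : ℕ) (U : Set (Fin d → ℝ))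
    (ψ : (Fin d → ℝ) → Dual E) : Prop where
  isOpen : IsOpen U
  contDiffOn : ContDiffOn ℝ ∞ ψ U
  injOn : Set.InjOn ψ U
  mapsTo : Set.MapsTo ψ U O
  immersion : ∀ u ∈ U, Function.Injective (fderiv ℝ ψ u)
  range_eq : ∀ u ∈ U, Set.range (fderiv ℝ ψ u) = {v | ∃ X, IsInfCoad G X (ψ u) v}

/-- The Gram matrix of the Kirillov-Kostant-Souriau form in the coordinates given by `ψ`. -/
def kksMatrix {d : ℕ} (ψ : (Fin d → ℝ) → Dual E) (u : Fin d → ℝ) : Matrix (Fin d) (Fin d) ℝ :=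
  Matrix.of fun i j =>
    kksForm G (ψ u) (fderiv ℝ ψ u (Pi.single i 1)) (fderiv ℝ ψ u (Pi.single j 1))

/-- The volume `Ωⁿ / ((2π)ⁿ n!)`, `n = d / 2`, in the coordinates `ψ`. For the orientation given by
`Ω` the form `Ωⁿ / n!` is the Pfaffian of the Gram matrix, taken positive, times Lebesgue measure,
that is the square root of its determinant. -/
def liouvilleInChart {d : ℕ} (U : Set (Fin d → ℝ)) (ψ : (Fin d → ℝ) → Dual E) :
    Measure (Dual E) :=
  Measure.map ψ ((volume.restrict U).withDensity fun u =>
    ENNReal.ofReal (((2 * Real.pi) ^ (d / 2))⁻¹ * Real.sqrt (kksMatrix G ψ u).det))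

/-- The canonical measure `β_O` on the coadjoint orbit `O` of `ξ`: it glues the measures given in
local parametrizations of `O` (these agree on overlaps, and `β_O` is the least measure above all
of them). -/
def liouville (ξ : Dual E) : Measure (Dual E) :=
  sSup {μ | ∃ (d : ℕ) (U : Set (Fin d → ℝ)) (ψ : (Fin d → ℝ) → Dual E),
    IsLocalParam G (coadjointOrbit G ξ) d U ψ ∧ μ = liouvilleInChart G U ψ}

/-- An isomorphism of `(ℝ / 2πℤ)^ℓ` with a subgroup of `G`, given as a smooth homomorphism
`p : ℝ^ℓ → G` with kernel `(2πℤ)^ℓ`. A torus in `G` is the range of such a map. -/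
structure IsTorusParam {ℓ : ℕ} (p : (Fin ℓ → ℝ) → G) : Prop where
  map_add : ∀ s t, p (s + t) = p s * p t
  smooth : ContMDiff 𝓘(ℝ, Fin ℓ → ℝ) 𝓘(ℝ, E) ∞ p
  ker : ∀ s, p s = 1 ↔ ∀ i, ∃ n : ℤ, s i = 2 * Real.pi * n

/-- The differential at `0` of a map `p` with `p 0 = 1`, as a map to `𝔤`. -/
def velocity {ℓ : ℕ} (p : (Fin ℓ → ℝ) → G) : (Fin ℓ → ℝ) →L[ℝ] E :=
  mfderiv 𝓘(ℝ, Fin ℓ → ℝ) 𝓘(ℝ, E) p 0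

/-- The Lie algebra of the torus `p(ℝ^ℓ)`. -/
def torusLieAlgebra {ℓ : ℕ} (p : (Fin ℓ → ℝ) → G) : Submodule ℝ E :=
  LinearMap.range (velocity (E := E) G p).toLinearMap

/-- For a torus with Lie algebra `𝔱` and a scalar product on `𝔤`, the subspace `𝔱* ⊆ 𝔤*` of
functionals that vanish on the orthogonal of `𝔱`. -/
def torusDual (𝔱 : Submodule ℝ E) (form : E →ₗ[ℝ] E →ₗ[ℝ] ℝ) : Submodule ℝ (Dual E) where
  carrier := {ξ | ∀ X, (∀ H ∈ 𝔱, form X H = 0) → ξ X = 0}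
  add_mem' := by
    intro a b ha hb X hX
    simp [ha X hX, hb X hX]
  zero_mem' := by
    intro X _
    simp
  smul_mem' := by
    intro c a ha X hX
    simp [ha X hX]

/-- The roots, as elements of `𝔱* ⊆ 𝔤*`: the nonzero `α` for which there is a nonzero
`Z = X + iY ∈ 𝔤 ⊗ ℂ` with `[H, Z] = i ⟨α, H⟩ Z` for all `H ∈ 𝔱`. -/
def roots (𝔱 : Submodule ℝ E) (form : E →ₗ[ℝ] E →ₗ[ℝ] ℝ) : Set (Dual E) :=
  {α | α ∈ torusDual 𝔱 form ∧ α ≠ 0 ∧ ∃ X Y : E, (X ≠ 0 ∨ Y ≠ 0) ∧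
    ∀ H ∈ 𝔱, bracket G H X = -(α H • Y) ∧ bracket G H Y = α H • X}

variable (E)

/-- The choices made for a compact connected Lie group `G`: a maximal torus, an invariant scalar
product on `𝔤`, and a regular element `H₀ ∈ 𝔱` giving the system of positive roots
`{α | ⟨α, H₀⟩ > 0}`. -/
structure CartanData where
  /-- the rank -/
  ℓ : ℕ
  /-- the identification of the maximal torus `T` with `(ℝ / 2πℤ)^ℓ` -/
  p : (Fin ℓ → ℝ) → G
  isTorusParam : IsTorusParam (E := E) G p
  maximal : ∀ (ℓ' : ℕ) (p' : (Fin ℓ' → ℝ) → G), IsTorusParam (E := E) G p' →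
    Set.range p ⊆ Set.range p' → Set.range p' = Set.range p
  /-- the scalar product on `𝔤` -/
  form : E →ₗ[ℝ] E →ₗ[ℝ] ℝ
  form_symm : ∀ X Y, form X Y = form Y X
  form_pos : ∀ X, X ≠ 0 → 0 < form X X
  form_inv : ∀ (g : G) (X Y : E), form (Ad g X) (Ad g Y) = form X Y
  /-- the regular element that defines the positive roots -/
  H₀ : E
  H₀_mem : H₀ ∈ torusLieAlgebra G p
  H₀_regular : ∀ α ∈ roots G (torusLieAlgebra G p) form, α H₀ ≠ 0

variable {E G}

namespace CartanData

variable (c : CartanData E G)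

/-- The Lie algebra `𝔱` of the maximal torus. -/
def t : Submodule ℝ E := torusLieAlgebra G c.p

/-- The dual `𝔱*`, as a subspace of `𝔤*`. -/
def tDual : Submodule ℝ (Dual E) := torusDual c.t c.form

/-- The lattice `Λ ⊆ 𝔱*` of weights of `T`: the `λ` that take values in `2πℤ` on the kernel of the
exponential map `𝔱 → T`, i.e. for which `exp X ↦ exp (i⟨λ, X⟩)` is a character of `T`. -/
def weightLattice : AddSubgroup (Dual E) where
  carrier := {l | l ∈ c.tDual ∧ ∀ s, c.p s = 1 → ∃ n : ℤ, l (velocity G c.p s) = 2 * Real.pi * n}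
  add_mem' := by
    rintro a b ⟨ha, ha'⟩ ⟨hb, hb'⟩
    refine ⟨add_mem ha hb, fun s hs => ?_⟩
    obtain ⟨n, hn⟩ := ha' s hs
    obtain ⟨k, hk⟩ := hb' s hs
    exact ⟨n + k, by simp [hn, hk, mul_add]⟩
  zero_mem' := ⟨zero_mem _, fun _ _ => ⟨0, by simp⟩⟩
  neg_mem' := by
    rintro a ⟨ha, ha'⟩
    refine ⟨neg_mem ha, fun s hs => ?_⟩
    obtain ⟨n, hn⟩ := ha' s hs
    exact ⟨-n, by simp [hn]⟩

/-- The positive roots `Δ⁺`. -/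
def posRoots : Set (Dual E) := {α | α ∈ roots G c.t c.form ∧ 0 < α c.H₀}

/-- Half the sum of the positive roots. -/
def rho : Dual E := (1 / 2 : ℝ) • ∑ᶠ α ∈ c.posRoots, α

/-- The open Weyl chamber `𝔱*_{>0}`: the `ξ ∈ 𝔱*` with `(ξ, α) > 0` for all positive roots `α`,
where `(ξ, α) = ⟨ξ, A⟩` for the vector `A ∈ 𝔤` dual to `α`. -/
def openChamber : Set (Dual E) :=
  {ξ | ξ ∈ c.tDual ∧ ∀ α ∈ c.posRoots, ∃ A : E, (∀ X, c.form A X = α X) ∧ 0 < ξ A}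

/-- The set `A_G = (ρ + Λ) ∩ 𝔱*_{>0}`, which parametrizes the irreducible representations. -/
def admissible : Set (Dual E) := {l | l - c.rho ∈ c.weightLattice ∧ l ∈ c.openChamber}

/-- The lattice `Λ̃` generated by `Λ` and `ρ`. -/
def extLattice : AddSubgroup (Dual E) := c.weightLattice ⊔ AddSubgroup.zmultiples c.rho

/-- `r = dim (G / T) / 2`. -/
def r : ℕ := (Module.finrank ℝ E - Module.finrank ℝ c.t) / 2

end CartanData

end LieGroup

section QuasiPolynomials

variable {V : Type*} [AddCommGroup V] [Module ℝ V]

/-- A function on a lattice is periodic if it is invariant under `D` times the lattice, for some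
positive integer `D`. -/
def IsPeriodic (L : AddSubgroup V) (f : L → ℂ) : Prop :=
  ∃ D : ℕ, 0 < D ∧ ∀ x₀ x : L, f (x₀ + D • x) = f x₀

/-- The algebra of quasi-polynomial functions on a lattice, generated by the periodic functions and
the polynomials (that is, by the periodic functions and the linear forms). -/
def quasiPolynomials (L : AddSubgroup V) : Subalgebra ℂ (L → ℂ) :=
  Algebra.adjoin ℂ ({f | IsPeriodic L f} ∪ {f | ∃ l : V →ₗ[ℝ] ℝ, ∀ x : L, f x = (l x : ℂ)})

variable {E : Type*} [NormedAddCommGroup E] [NormedSpace ℝ E]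
  {G : Type*} [TopologicalSpace G] [ChartedSpace E G] [Group G] (c : CartanData E G)

/-- Closed rational polyhedra in `𝔱*`: finite intersections of closed half-spaces of `𝔱*` given by
affine inequalities that are rational for the lattice `Λ̃`. -/
def IsRationalPolyhedron (P : Set (Dual E)) : Prop :=
  ∃ (N : ℕ) (a : Fin N → Dual E →ₗ[ℝ] ℝ) (b : Fin N → ℚ),
    (∀ i, ∀ l ∈ c.extLattice, ∃ q : ℚ, a i l = q) ∧
    P = {ξ | ξ ∈ c.tDual ∧ ∀ i, (b i : ℝ) ≤ a i ξ}

/-- The subspace `E_P` of `𝔱* × ℝ` generated by the `(ξ, 1)`, `ξ ∈ P`. -/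
def spanOver (P : Set (Dual E)) : Submodule ℝ (Dual E × ℝ) :=
  Submodule.span ℝ ((fun ξ => (ξ, (1 : ℝ))) '' P)

/-- The lattice `Λ̃_P = (Λ̃ × ℤ) ∩ E_P`. -/
def latticeOver (P : Set (Dual E)) : AddSubgroup (Dual E × ℝ) :=
  c.extLattice.prod (AddSubgroup.zmultiples (1 : ℝ)) ⊓ (spanOver P).toAddSubgroup

/-- The cone `C_P = {(tξ, t) | t ≥ 0, ξ ∈ P}`. -/
def coneOver (P : Set (Dual E)) : Set (Dual E × ℝ) :=
  {x | ∃ s : ℝ, 0 ≤ s ∧ ∃ ξ ∈ P, x = (s • ξ, s)}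

/-- `m = ∑_{P ∈ 𝒜} m_P [C_P]` on `Λ̃ × ℤ_{>0}`, for a locally finite collection `𝒜` of closed
rational polyhedra and functions `m_P = q P` whose restrictions to `Λ̃_P` are quasi-polynomial. -/
structure IsDecomposition (𝒜 : Set (Set (Dual E))) (q : Set (Dual E) → Dual E × ℝ → ℂ)
    (m : Dual E → ℕ → ℂ) : Prop where
  polyhedron : ∀ P ∈ 𝒜, IsRationalPolyhedron c P
  quasiPolynomial : ∀ P ∈ 𝒜,
    (fun x : latticeOver c P => q P x) ∈ quasiPolynomials (latticeOver c P)
  locallyFinite : ∀ K : Set (Dual E), IsCompact K → {P ∈ 𝒜 | (P ∩ K).Nonempty}.Finite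
  eq_sum : ∀ l ∈ c.extLattice, ∀ k : ℕ, 1 ≤ k →
    m l k = ∑ᶠ P ∈ 𝒜, (coneOver P).indicator (q P) (l, (k : ℝ))

/-- `m` is a piecewise quasi-polynomial function on `Λ̃ × ℤ_{>0}`; only the values of `m` on that
set matter. -/
def IsPiecewiseQuasiPolynomial (m : Dual E → ℕ → ℂ) : Prop :=
  ∃ 𝒜 q, IsDecomposition c 𝒜 q m

/-- `m` is piecewise quasi-polynomial with a finite collection of polyhedra. -/
def IsFinitelyPiecewise (m : Dual E → ℕ → ℂ) : Prop :=
  ∃ 𝒜 q, 𝒜.Finite ∧ IsDecomposition c 𝒜 q m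

end QuasiPolynomials

section Distributions

variable {E : Type*} [NormedAddCommGroup E] [NormedSpace ℝ E] [FiniteDimensional ℝ E]

/-- Real-valued test functions on `𝔤*`. -/
abbrev Test (E : Type*) [NormedAddCommGroup E] [NormedSpace ℝ E] : Type _ :=
  TestFunction (⊤ : Opens (Dual E)) ℝ ⊤

/-- Complex-valued distributions on `𝔤*`; as in Mathlib, they are determined by their values on
real-valued test functions. -/
abbrev Distr (E : Type*) [NormedAddCommGroup E] [NormedSpace ℝ E] : Type _ :=
  Distribution (⊤ : Opens (Dual E)) ℂ ⊤

/-- The value of a distribution on a complex-valued test function. -/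
def Distr.evalComplex (A : Distr E) (ψ : TestFunction (⊤ : Opens (Dual E)) ℂ ⊤) : ℂ :=
  A (TestFunction.postcompCLM Complex.reCLM ψ) +
    Complex.I * A (TestFunction.postcompCLM Complex.imCLM ψ)

/-- Invariance of a distribution under the coadjoint action of `G`. -/
def IsInvariant (G : Type*) [TopologicalSpace G] [ChartedSpace E G] [Group G]
    (A : Distr E) : Prop :=
  ∀ (g : G) (φ ψ : Test E), (∀ ξ, ψ ξ = φ (coAd g ξ)) → A ψ = A φ

/-- `C = B ⋆ A` for a compactly supported complex measure `B` and a distribution `A`: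
`⟨C, φ⟩ = ⟨A(ξ), ∫ φ(ξ + η) dB(η)⟩`. -/
def IsConvolution (B : ComplexMeasure (Dual E)) (A C : Distr E) : Prop :=
  ∀ φ : Test E, ∃ ψ : TestFunction (⊤ : Opens (Dual E)) ℂ ⊤,
    (∀ ξ, ψ ξ = B.integral (fun η => φ (ξ + η)) (ContinuousLinearMap.lsmul ℝ ℝ)) ∧
    C φ = A.evalComplex ψ

/-- The rescaling of a measure on `𝔤*`: `⟨B^k, φ⟩ = ⟨B(ξ), φ(ξ / k)⟩`. -/
def rescale (k : ℕ) (B : ComplexMeasure (Dual E)) : ComplexMeasure (Dual E) :=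
  B.map fun ξ : Dual E => (k : ℝ)⁻¹ • ξ

/-- The measure `B` vanishes outside some compact set. -/
def HasCompactSupportMeasure (B : ComplexMeasure (Dual E)) : Prop :=
  ∃ K : Set (Dual E), IsCompact K ∧ ∀ S, MeasurableSet S → Disjoint S K → B S = 0

variable (E) in
/-- A basis of `𝔤`. -/
def basis : Module.Basis (Fin (Module.finrank ℝ E)) ℝ E := Module.finBasis ℝ E

variable (E) in
/-- The dual basis of `𝔤*`. -/
def dualVec (a : Fin (Module.finrank ℝ E)) : Dual E :=
  LinearMap.toContinuousLinearMap ((basis E).coord a)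

/-- `φ̂(X) = (2π)^{-dim 𝔤} ∫ φ(ξ) exp(-i⟨ξ, X⟩) dξ`, with the Lebesgue measure `dξ` of the dual
basis. -/
def fourierHat (φ : Test E) (X : E) : ℂ :=
  ((2 * Real.pi : ℂ) ^ Module.finrank ℝ E)⁻¹ *
    ∫ y : Fin (Module.finrank ℝ E) → ℝ,
      (φ (∑ a, y a • dualVec E a) : ℂ) *
        Complex.exp (-Complex.I * (((∑ a, y a • dualVec E a : Dual E) X : ℝ) : ℂ))

/-- `⟨𝓕(f), φ⟩ = ∫ f(X) φ̂(X) dX`, with the Lebesgue measure `dX` of the basis (`dX` and `dξ` are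
dual volume forms, so the result does not depend on the basis). -/
def fourierPairing (f : E → ℂ) (φ : Test E) : ℂ :=
  ∫ x : Fin (Module.finrank ℝ E) → ℝ,
    f (∑ a, x a • basis E a) * fourierHat φ (∑ a, x a • basis E a)

/-- The Fourier transform of the function `f` on `𝔤` is the complex measure `B` on `𝔤*`. -/
def IsFourierTransform (f : E → ℂ) (B : ComplexMeasure (Dual E)) : Prop :=
  ∀ φ : Test E, B.integral (fun ξ => φ ξ) (ContinuousLinearMap.lsmul ℝ ℝ) = fourierPairing f φ

/-- At most polynomial growth. -/
def HasPolynomialGrowth (f : E → ℂ) : Prop :=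
  ∃ (C : ℝ) (N : ℕ), ∀ X, ‖f X‖ ≤ C * (1 + ‖X‖) ^ N

/-- The operator `f_n(i∂)` on distributions on `𝔤*`, where
`f_n(X) = D^n f(0)(X, …, X) / n! = ∑_a D^n f(0)(e_{a₁}, …, e_{aₙ}) x_{a₁} ⋯ x_{aₙ} / n!`
is the homogeneous part of degree `n` of the Taylor series of `f` at the origin: the coordinate
`x_a` is replaced by `i` times the derivative in the direction of the dual basis vector. -/
def taylorOp (f : E → ℂ) (n : ℕ) (A : Distr E) : Distr E :=
  (Complex.I ^ n / (n.factorial : ℂ)) •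
    ∑ a : Fin n → Fin (Module.finrank ℝ E),
      (iteratedFDeriv ℝ n f 0 fun i => basis E (a i)) • ∂^{fun i => dualVec E (a i)} A

/-- On test functions supported in `K`, the distributions `τ k`, `k ≥ 1`, depend periodically on
`k`: they are of the form `∑_{ζ^D = 1} ζ^k τ_ζ`. -/
def IsPeriodicOn (K : Set (Dual E)) (τ : ℕ → Distr E) : Prop :=
  ∃ D : ℕ, 0 < D ∧ ∃ σ : ℂ → Distr E, ∀ k : ℕ, 1 ≤ k → ∀ φ : Test E, tsupport φ ⊆ K →
    τ k φ = ∑ ζ ∈ Polynomial.nthRootsFinset D (1 : ℂ), ζ ^ k * σ ζ φ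

/-- On test functions supported in `K`, the formal series `∑_{n ∈ ℤ} k^{-n} Q n k` has only
finitely many terms with `n < 0`. -/
def IsBoundedBelowOn (K : Set (Dual E)) (Q : ℤ → ℕ → Distr E) : Prop :=
  ∃ n₀ : ℤ, ∀ n < n₀, ∀ k : ℕ, 1 ≤ k → ∀ φ : Test E, tsupport φ ⊆ K → Q n k φ = 0

/-- The asymptotic expansion `Θ_k ≡ ∑_{n ∈ ℤ} k^{-n} θ_n(k)`, `θ_n(k) = Q n k`, of a family of
invariant distributions. The coefficients are invariant distributions; on every compact set they
vanish for `n` sufficiently negative and depend periodically on `k`. -/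
structure IsAsymptoticExpansion (G : Type*) [TopologicalSpace G] [ChartedSpace E G] [Group G]
    (Θ : ℕ → Distr E) (Q : ℤ → ℕ → Distr E) : Prop where
  invariant : ∀ k : ℕ, 1 ≤ k → IsInvariant G (Θ k)
  coeff_invariant : ∀ (n : ℤ) (k : ℕ), 1 ≤ k → IsInvariant G (Q n k)
  boundedBelow : ∀ K : Set (Dual E), IsCompact K → IsBoundedBelowOn K Q
  periodic : ∀ K : Set (Dual E), IsCompact K → ∀ n : ℤ, IsPeriodicOn K (Q n)
  expansion : ∀ (φ : Test E) (N : ℤ),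
    (fun k : ℕ => Θ k φ - ∑ᶠ (n : ℤ) (_ : n ≤ N), (k : ℂ) ^ (-n) * Q n k φ)
      =o[atTop] fun k : ℕ => (k : ℝ) ^ (-N)

/-- The coefficients of `∑ k^{-n} Q n k` vanish for `n < n₀` and depend periodically on `k`,
globally on `𝔤*`. -/
def IsGlobal (Q : ℤ → ℕ → Distr E) : Prop :=
  IsBoundedBelowOn Set.univ Q ∧ ∀ n : ℤ, IsPeriodicOn Set.univ (Q n)

/-- `S = f(i∂/k) Q` as formal series: `S n k = ∑_{l ≥ 0} f_l(i∂) Q (n - l) k`. -/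
def IsTaylorImage (f : E → ℂ) (Q S : ℤ → ℕ → Distr E) : Prop :=
  ∀ (n : ℤ) (k : ℕ), 1 ≤ k → ∀ φ : Test E,
    HasSum (fun l : ℕ => taylorOp f l (Q (n - l) k) φ) (S n k φ)

variable {G : Type*} [TopologicalSpace G] [ChartedSpace E G] [Group G]

/-- `A = Θ_k(m) = k^r ∑_{λ ∈ A_G} m(λ, k) β_{λ/k}`. -/
def IsTheta (c : CartanData E G) (m : Dual E → ℕ → ℂ) (k : ℕ) (A : Distr E) : Prop :=
  (∀ l ∈ c.admissible, IsFiniteMeasure (liouville G ((k : ℝ)⁻¹ • l))) ∧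
  ∀ φ : Test E, HasSum (fun l : c.admissible =>
    (k : ℂ) ^ c.r * (m l k * ((∫ ξ, φ ξ ∂(liouville G ((k : ℝ)⁻¹ • (l : Dual E))) : ℝ) : ℂ)))
    (A φ)

end Distributions

end QuasiPolyAsymptotics

end

noncomputable section

open Finset (sum_congr range mul_sum Icc Ico mem_range sum_add_distrib sum_comm mem_Icc sum_mul sum_sub_distrib sum_le_sum smul_sum mem_univ sum_nonneg mem_Ico single_le_sum prod_pos)
open ContinuousLinearMap (comp_apply inr inl lsmul id_apply proj coe_coe comp_id compL coprod_apply comp_assoc)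
open Complex (I exp real_smul ofReal_zero norm_real ofReal_mul reCLM imCLM ofReal_one)
open Real (cos sin)
open scoped Real
open Submodule (subset_span span smul_mem span_induction)
open Filter.Eventually (of_forall)
open TestFunction (ofSupportedIn postcompCLM postcompCLM_apply)
open ENNReal (ofReal)
open LinearMap (toContinuousLinearMap)
open Function (Injective)
open Module (finrank)
open Fin (tail cons)
open Pi (single mul_apply)

namespace QuasiPolyAsymptotics

set_option linter.unusedSectionVars false

section EulerMaclaurin

/-- The coefficients `B_q(θ) / q!` of the Euler-Maclaurin formula. -/
def emCoeff (θ : ℝ) (q : ℕ) : ℝ :=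
  θ ^ q / q.factorial - ∑ i : Fin q, emCoeff θ i / (q + 1 - i).factorial
termination_by q
decreasing_by exact i.2

lemma sum_emCoeff (θ : ℝ) (q : ℕ) :
    ∑ i ∈ range (q + 1), emCoeff θ i / (q + 1 - i).factorial = θ ^ q / q.factorial := by
  rw [Finset.sum_range_succ, emCoeff.eq_def θ q]
  simp only [Finset.sum_range, Nat.add_sub_cancel_left, Nat.factorial_one, Nat.cast_one, div_one]
  ring

lemma taylor_bound {n : ℕ} {M : ℝ} (hM : 0 ≤ M) {F : ℕ → ℝ → ℂ}
    (hF : ∀ i x, HasDerivAt (F i) (F (i + 1) x) x) (hb : ∀ x, ‖F n x‖ ≤ M) (x : ℝ) {h : ℝ}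
    (hh : 0 ≤ h) :
    ‖F 0 (x + h) - ∑ r ∈ range n, ((h ^ r / r.factorial : ℝ) : ℂ) * F r x‖ ≤ M * h ^ n := by
  induction n generalizing F h with
  | zero => simpa using hb (x + h)
  | succ n ih =>
    let φ : ℝ → ℂ := fun h => F 0 (x + h) -
      ∑ r ∈ range (n + 1), ((h ^ r / r.factorial : ℝ) : ℂ) * F r x
    have hφ : ∀ h, HasDerivAt φ (F 1 (x + h) -
        ∑ r ∈ range n, ((h ^ r / r.factorial : ℝ) : ℂ) * F (r + 1) x) h := by
      intro h
      have h1 : HasDerivAt (fun h => F 0 (x + h)) (F 1 (x + h)) h :=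
        HasDerivAt.comp_const_add x h (hF 0 (x + h))
      refine h1.sub ?_
      have h2 : ∀ r ∈ range (n + 1), HasDerivAt
          (fun h : ℝ => ((h ^ r / r.factorial : ℝ) : ℂ) * F r x)
          (((r * h ^ (r - 1) / r.factorial : ℝ) : ℂ) * F r x) h := fun r _ =>
        (((hasDerivAt_pow r h).div_const _).ofReal_comp).mul_const _
      refine (HasDerivAt.fun_sum h2).congr_deriv ?_
      rw [Finset.sum_range_succ']
      simp only [Nat.cast_zero, zero_mul, zero_div, ofReal_zero, add_zero,
        Nat.add_sub_cancel]
      refine sum_congr rfl fun r _ => ?_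
      congr 2
      rw [Nat.factorial_succ]
      push_cast
      have : (r.factorial : ℝ) ≠ 0 := by positivity
      field_simp
    have hbd : ∀ t ∈ Set.Ico (0 : ℝ) h, ‖F 1 (x + t) -
        ∑ r ∈ range n, ((t ^ r / r.factorial : ℝ) : ℂ) * F (r + 1) x‖ ≤ M * h ^ n := by
      intro t ht
      refine (ih (F := fun i => F (i + 1)) (fun i => hF (i + 1)) hb ht.1).trans ?_
      gcongr
      exacts [ht.1, ht.2.le]
    have := norm_image_sub_le_of_norm_deriv_le_segment' (f := φ) (a := 0) (b := h)
      (fun t _ => (hφ t).hasDerivWithinAt) hbd h ⟨hh, le_rfl⟩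
    have h0 : φ 0 = 0 := by
      simp only [φ, add_zero, Finset.sum_range_succ']
      simp
    rw [h0, sub_zero, sub_zero] at this
    calc _ = ‖φ h‖ := rfl
      _ ≤ M * h ^ n * h := this
      _ = M * h ^ (n + 1) := by ring

/-- The constant in the one-step Euler-Maclaurin estimate. -/
def emConst (J : ℕ) (θ : ℝ) : ℝ := (∑ i ∈ range (J + 1), |emCoeff θ i|) + 1

lemma em_step {J : ℕ} {M : ℝ} (hM : 0 ≤ M) {F : ℕ → ℝ → ℂ}
    (hF : ∀ i x, HasDerivAt (F i) (F (i + 1) x) x) (hb : ∀ x, ‖F (J + 1) x‖ ≤ M) (x : ℝ)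
    {θ : ℝ} (hθ : θ ∈ Set.Icc (0 : ℝ) 1) {δ : ℝ} (hδ : 0 ≤ δ) :
    ‖∑ i ∈ range (J + 1), ((δ ^ i * emCoeff θ i : ℝ) : ℂ) * (F i (x + δ) - F i x) -
      (δ : ℂ) * F 1 (x + θ * δ)‖ ≤ emConst J θ * M * δ ^ (J + 1) := by
  have hT : ∀ i ∈ range (J + 1),
      ‖F i (x + δ) - ∑ s ∈ Ico i (J + 1),
        ((δ ^ (s - i) / (s - i).factorial : ℝ) : ℂ) * F s x‖ ≤ M * δ ^ (J + 1 - i) := by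
    intro i hi
    have hi' : i ≤ J + 1 := by simp at hi; omega
    have := taylor_bound (n := J + 1 - i) hM (F := fun r => F (i + r)) (fun r => hF (i + r))
      (by intro x; rw [Nat.add_sub_cancel' hi']; exact hb x) x hδ
    rw [Finset.sum_Ico_eq_sum_range]
    simpa using this
  have hT1 : ‖F 1 (x + θ * δ) - ∑ r ∈ range J,
      (((θ * δ) ^ r / r.factorial : ℝ) : ℂ) * F (r + 1) x‖ ≤ M * (θ * δ) ^ J :=
    taylor_bound (n := J) hM (F := fun r => F (r + 1)) (fun r => hF (r + 1)) hb x
      (mul_nonneg hθ.1 hδ)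
  have halg : ∑ i ∈ range (J + 1), ((δ ^ i * emCoeff θ i : ℝ) : ℂ) *
      ((∑ s ∈ Ico i (J + 1), ((δ ^ (s - i) / (s - i).factorial : ℝ) : ℂ) * F s x) - F i x) =
      (δ : ℂ) * ∑ r ∈ range J, (((θ * δ) ^ r / r.factorial : ℝ) : ℂ) * F (r + 1) x := by
    have h1 : ∀ i ∈ range (J + 1), ((δ ^ i * emCoeff θ i : ℝ) : ℂ) *
      ((∑ s ∈ Ico i (J + 1), ((δ ^ (s - i) / (s - i).factorial : ℝ) : ℂ) * F s x) - F i x) =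
      ∑ s ∈ Ico (i + 1) (J + 1), ((δ ^ s * (emCoeff θ i / (s - i).factorial) : ℝ) : ℂ) *
        F s x := by
      intro i hi
      rw [Finset.sum_eq_sum_Ico_succ_bot (by simpa using hi)]
      simp only [Nat.sub_self, pow_zero, Nat.factorial_zero, Nat.cast_one, div_one,
        ofReal_one, one_mul, add_sub_cancel_left, mul_sum]
      refine sum_congr rfl fun s hs => ?_
      rw [← mul_assoc, ← ofReal_mul]
      congr 2
      have : δ ^ s = δ ^ i * δ ^ (s - i) := by
        rw [← pow_add]; congr 1; simp at hs; omega
      rw [this]; ring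
    rw [sum_congr rfl h1, Finset.sum_comm' (s' := fun s => range s)
      (t' := Ico 1 (J + 1)) (by intro i s; simp only [mem_range, mem_Ico]; omega),
      Finset.sum_Ico_eq_sum_range, mul_sum, Nat.add_sub_cancel]
    refine sum_congr rfl fun r _ => ?_
    rw [← sum_mul, ← Complex.ofReal_sum, ← mul_sum, add_comm 1 r, sum_emCoeff,
      ← mul_assoc, ← ofReal_mul]
    congr 2
    rw [mul_pow, pow_succ]; ring
  have hsplit : ∑ i ∈ range (J + 1), ((δ ^ i * emCoeff θ i : ℝ) : ℂ) *
      (F i (x + δ) - F i x) - (δ : ℂ) * F 1 (x + θ * δ) =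
      (∑ i ∈ range (J + 1), ((δ ^ i * emCoeff θ i : ℝ) : ℂ) *
        (F i (x + δ) - ∑ s ∈ Ico i (J + 1),
          ((δ ^ (s - i) / (s - i).factorial : ℝ) : ℂ) * F s x)) -
      (δ : ℂ) * (F 1 (x + θ * δ) - ∑ r ∈ range J,
        (((θ * δ) ^ r / r.factorial : ℝ) : ℂ) * F (r + 1) x) := by
    rw [mul_sub, ← halg]
    simp only [mul_sub, sum_sub_distrib]
    ring
  rw [hsplit]
  refine (norm_sub_le _ _).trans ?_
  have e1 : ‖∑ i ∈ range (J + 1), ((δ ^ i * emCoeff θ i : ℝ) : ℂ) *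
        (F i (x + δ) - ∑ s ∈ Ico i (J + 1),
          ((δ ^ (s - i) / (s - i).factorial : ℝ) : ℂ) * F s x)‖ ≤
      (∑ i ∈ range (J + 1), |emCoeff θ i|) * (M * δ ^ (J + 1)) := by
    rw [sum_mul]
    refine (norm_sum_le _ _).trans (sum_le_sum fun i hi => ?_)
    rw [norm_mul, norm_real, norm_mul, Real.norm_eq_abs, Real.norm_eq_abs,
      abs_of_nonneg (pow_nonneg hδ i)]
    have hi' : i ≤ J + 1 := by simp at hi; omega
    calc _ ≤ δ ^ i * |emCoeff θ i| * (M * δ ^ (J + 1 - i)) := by gcongr; exact hT i hi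
      _ = |emCoeff θ i| * (M * (δ ^ i * δ ^ (J + 1 - i))) := by ring
      _ = _ := by rw [← pow_add, Nat.add_sub_cancel' hi']
  have e2 : ‖(δ : ℂ) * (F 1 (x + θ * δ) - ∑ r ∈ range J,
        (((θ * δ) ^ r / r.factorial : ℝ) : ℂ) * F (r + 1) x)‖ ≤ 1 * (M * δ ^ (J + 1)) := by
    rw [norm_mul, norm_real, Real.norm_eq_abs, abs_of_nonneg hδ]
    calc _ ≤ δ * (M * (θ * δ) ^ J) := by gcongr
      _ ≤ δ * (M * δ ^ J) := by
        gcongr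
        · exact mul_nonneg hθ.1 hδ
        · exact mul_le_of_le_one_left hδ hθ.2
      _ = 1 * (M * δ ^ (J + 1)) := by ring
  calc _ ≤ (∑ i ∈ range (J + 1), |emCoeff θ i|) * (M * δ ^ (J + 1)) +
        1 * (M * δ ^ (J + 1)) := add_le_add e1 e2
    _ = emConst J θ * M * δ ^ (J + 1) := by rw [emConst]; ring

/-- The Euler-Maclaurin formula for a function that vanishes to the right. -/
lemma em_sum {J : ℕ} {M : ℝ} (hM : 0 ≤ M) {F : ℕ → ℝ → ℂ}
    (hF : ∀ i x, HasDerivAt (F i) (F (i + 1) x) x) (hb : ∀ x, ‖F (J + 1) x‖ ≤ M) (x : ℝ)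
    {θ : ℝ} (hθ : θ ∈ Set.Icc (0 : ℝ) 1) {δ : ℝ} (hδ : 0 < δ) {Ns : ℕ}
    (hNs : ∀ i, F i (x + Ns * δ) = 0) :
    ‖(∑ m ∈ range Ns, F 1 (x + (θ + m) * δ)) +
      ((δ⁻¹ : ℝ) : ℂ) * ∑ i ∈ range (J + 1), ((δ ^ i * emCoeff θ i : ℝ) : ℂ) * F i x‖ ≤
      Ns * (emConst J θ * M * δ ^ J) := by
  let Ψ : ℝ → ℂ := fun x => ∑ i ∈ range (J + 1), ((δ ^ i * emCoeff θ i : ℝ) : ℂ) * F i x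
  have h1 : ∀ m ∈ range Ns, ‖(δ : ℂ) * F 1 (x + (θ + m) * δ) -
      (Ψ (x + (m + 1 : ℕ) * δ) - Ψ (x + m * δ))‖ ≤ emConst J θ * M * δ ^ (J + 1) := by
    intro m _
    have := em_step hM hF hb (x + m * δ) hθ hδ.le
    rw [norm_sub_rev] at this
    refine le_of_eq_of_le (congrArg norm ?_) this
    rw [show x + (θ + m) * δ = x + m * δ + θ * δ by ring]
    congr 1
    simp only [Ψ, ← sum_sub_distrib, ← mul_sub]
    push_cast
    rw [show x + ((m : ℝ) + 1) * δ = x + m * δ + δ by ring]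
  have h2 : ∑ m ∈ range Ns, (Ψ (x + (m + 1 : ℕ) * δ) - Ψ (x + m * δ)) = -Ψ x := by
    rw [Finset.sum_range_sub (fun m : ℕ => Ψ (x + m * δ))]
    have : Ψ (x + Ns * δ) = 0 := by simp only [Ψ, hNs, mul_zero, Finset.sum_const_zero]
    rw [this]; simp
  have h3 : ‖(δ : ℂ) * (∑ m ∈ range Ns, F 1 (x + (θ + m) * δ)) + Ψ x‖ ≤
      Ns * (emConst J θ * M * δ ^ (J + 1)) := by
    rw [← sub_neg_eq_add, ← h2, mul_sum, ← sum_sub_distrib]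
    refine (norm_sum_le _ _).trans ((sum_le_sum h1).trans ?_)
    simp
  have h4 : (∑ m ∈ range Ns, F 1 (x + (θ + m) * δ)) + ((δ⁻¹ : ℝ) : ℂ) * Ψ x =
      ((δ⁻¹ : ℝ) : ℂ) * ((δ : ℂ) * (∑ m ∈ range Ns, F 1 (x + (θ + m) * δ)) + Ψ x) := by
    rw [mul_add, ← mul_assoc, ← ofReal_mul, inv_mul_cancel₀ hδ.ne', ofReal_one,
      one_mul]
  change ‖_ + ((δ⁻¹ : ℝ) : ℂ) * Ψ x‖ ≤ _
  rw [h4, norm_mul, norm_real, Real.norm_eq_abs, abs_of_pos (inv_pos.2 hδ)]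
  calc _ ≤ δ⁻¹ * (Ns * (emConst J θ * M * δ ^ (J + 1))) := by gcongr
    _ = Ns * (emConst J θ * M * δ ^ J) := by rw [pow_succ]; field_simp

end EulerMaclaurin

section Expansions

/-- The sequence `a` has the asymptotic expansion `∑ k^{-n} p n k`, with `p n = 0` for `n < n₀` and
`p n` of period `D n`. -/
structure HasExp (n₀ : ℤ) (D : ℤ → ℕ) (a : ℕ → ℂ) (p : ℤ → ℕ → ℂ) : Prop where
  pos : ∀ n, 0 < D n
  periodic : ∀ n k, p n (k + D n) = p n k
  eq_zero : ∀ n < n₀, ∀ k, p n k = 0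
  isLittleO : ∀ N : ℤ, (fun k : ℕ => a k - ∑ n ∈ Icc n₀ N, (k : ℂ) ^ (-n) * p n k)
    =o[atTop] fun k : ℕ => (k : ℝ) ^ (-N)

variable {n₀ : ℤ} {D : ℤ → ℕ} {a b : ℕ → ℂ} {p q : ℤ → ℕ → ℂ}

lemma periodic_mul {f : ℕ → ℂ} {D : ℕ} (h : ∀ k, f (k + D) = f k) (k j : ℕ) :
    f (k + D * j) = f k := by
  induction j with
  | zero => simp
  | succ j ih => rw [Nat.mul_succ, ← add_assoc, h, ih]

lemma isBigO_one_of_periodic {f : ℕ → ℂ} {D : ℕ} (hD : 0 < D) (h : ∀ k, f (k + D) = f k) :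
    ∃ C, ∀ k, ‖f k‖ ≤ C := by
  refine ⟨∑ r ∈ range D, ‖f r‖, fun k => ?_⟩
  have h1 : f k = f (k % D) := by
    conv_lhs => rw [← Nat.mod_add_div k D]
    exact periodic_mul h _ _
  rw [h1]
  exact single_le_sum (f := fun r => ‖f r‖) (fun _ _ => norm_nonneg _)
    (Finset.mem_range.2 (Nat.mod_lt _ hD))

lemma eq_zero_of_periodic_of_tendsto {f : ℕ → ℂ} {D : ℕ} (hD : 0 < D) (h : ∀ k, f (k + D) = f k)
    (ht : Tendsto f atTop (nhds 0)) (k : ℕ) : f k = 0 := by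
  have h1 : Tendsto (fun j : ℕ => f (k + D * j)) atTop (nhds 0) := by
    refine ht.comp (tendsto_atTop_mono (fun j => ?_) tendsto_id)
    simp only [id]
    nlinarith
  simp only [periodic_mul h] at h1
  exact tendsto_nhds_unique tendsto_const_nhds h1

lemma zpow_isLittleO {m n : ℤ} (h : m < n) :
    (fun k : ℕ => (k : ℝ) ^ m) =o[atTop] fun k : ℕ => (k : ℝ) ^ n := by
  have h1 : Tendsto (fun k : ℕ => (k : ℝ) ^ (m - n)) atTop (nhds 0) := by
    have := (tendsto_pow_neg_atTop (𝕜 := ℝ) (n := (n - m).toNat) (by omega)).comp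
      tendsto_natCast_atTop_atTop
    refine this.congr fun k => ?_
    simp only [Function.comp]
    congr 1
    omega
  refine (isLittleO_iff_tendsto' ?_).2 ?_
  · filter_upwards [eventually_gt_atTop 0] with k hk h0
    exact absurd h0 (zpow_ne_zero _ (by positivity))
  · refine h1.congr' ?_
    filter_upwards [eventually_gt_atTop 0] with k hk
    rw [zpow_sub₀ (by positivity)]

lemma zpow_isBigO {m n : ℤ} (h : m ≤ n) :
    (fun k : ℕ => (k : ℝ) ^ m) =O[atTop] fun k : ℕ => (k : ℝ) ^ n := by
  rcases h.lt_or_eq with h | rfl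
  · exact (zpow_isLittleO h).isBigO
  · exact isBigO_refl _ _

lemma isBigO_zpow_mul {n : ℤ} {f : ℕ → ℂ} {C : ℝ} (h : ∀ k, ‖f k‖ ≤ C) :
    (fun k : ℕ => (k : ℂ) ^ n * f k) =O[atTop] fun k : ℕ => (k : ℝ) ^ n := by
  refine IsBigO.of_bound C (of_forall fun k => ?_)
  rw [norm_mul, norm_zpow, norm_zpow, Complex.norm_natCast, Real.norm_natCast, mul_comm]
  gcongr
  exact h k

lemma HasExp.add (ha : HasExp n₀ D a p) (hb : HasExp n₀ D b q) :
    HasExp n₀ D (fun k => a k + b k) (fun n k => p n k + q n k) where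
  pos := ha.pos
  periodic := fun n k => by rw [ha.periodic, hb.periodic]
  eq_zero := fun n hn k => by rw [ha.eq_zero n hn, hb.eq_zero n hn, add_zero]
  isLittleO := fun N => by
    refine ((ha.isLittleO N).add (hb.isLittleO N)).congr_left fun k => ?_
    simp only [mul_add, sum_add_distrib]
    ring

lemma HasExp.const_mul (ha : HasExp n₀ D a p) (c : ℂ) :
    HasExp n₀ D (fun k => c * a k) (fun n k => c * p n k) where
  pos := ha.pos
  periodic := fun n k => by rw [ha.periodic]
  eq_zero := fun n hn k => by rw [ha.eq_zero n hn, mul_zero]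
  isLittleO := fun N => by
    refine ((ha.isLittleO N).const_mul_left c).congr_left fun k => ?_
    rw [mul_sub, mul_sum]
    congr 1
    exact sum_congr rfl fun n _ => by ring

lemma HasExp.zero (hD : ∀ n, 0 < D n) : HasExp n₀ D (fun _ => 0) (fun _ _ => 0) where
  pos := hD
  periodic := fun n k => rfl
  eq_zero := fun n hn k => rfl
  isLittleO := fun N => by simp

lemma HasExp.congr (ha : HasExp n₀ D a p) (h : ∀ᶠ k in atTop, a k = b k) : HasExp n₀ D b p where
  pos := ha.pos
  periodic := ha.periodic
  eq_zero := ha.eq_zero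
  isLittleO := fun N => by
    refine (ha.isLittleO N).congr' ?_ EventuallyEq.rfl
    filter_upwards [h] with k hk
    rw [hk]

lemma HasExp.mono_period {D' : ℤ → ℕ} (ha : HasExp n₀ D a p) (hpos : ∀ n, 0 < D' n)
    (h : ∀ n, D n ∣ D' n) : HasExp n₀ D' a p where
  pos := hpos
  periodic := fun n k => by
    obtain ⟨j, hj⟩ := h n
    rw [hj]; exact periodic_mul (ha.periodic n) k j
  eq_zero := ha.eq_zero
  isLittleO := ha.isLittleO

lemma sum_Icc_eq_of_eq_zero {f : ℤ → ℂ} {n₀ n₁ N : ℤ} (h : n₁ ≤ n₀) (hf : ∀ n < n₀, f n = 0) :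
    ∑ n ∈ Icc n₁ N, f n = ∑ n ∈ Icc n₀ N, f n := by
  symm
  refine Finset.sum_subset (Finset.Icc_subset_Icc_left h) fun n hn hn' => hf n ?_
  simp only [mem_Icc] at hn hn'
  by_contra! h'
  exact hn' ⟨h', hn.2⟩

lemma HasExp.mono_bound {n₁ : ℤ} (ha : HasExp n₀ D a p) (h : n₁ ≤ n₀) : HasExp n₁ D a p where
  pos := ha.pos
  periodic := ha.periodic
  eq_zero := fun n hn k => ha.eq_zero n (by omega) k
  isLittleO := fun N => by
    refine (ha.isLittleO N).congr_left fun k => ?_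
    rw [sum_Icc_eq_of_eq_zero h fun n hn => by rw [ha.eq_zero n hn, mul_zero]]

lemma HasExp.zpow_mul (ha : HasExp n₀ D a p) (j : ℤ) :
    HasExp (n₀ + j) (fun n => D (n - j)) (fun k => (k : ℂ) ^ (-j) * a k) (fun n k => p (n - j) k) where
  pos := fun n => ha.pos _
  periodic := fun n k => ha.periodic _ _
  eq_zero := fun n hn k => ha.eq_zero _ (by omega) k
  isLittleO := fun N => by
    have h1 := ha.isLittleO (N - j)
    have h2 : (fun k : ℕ => (k : ℂ) ^ (-j)) =O[atTop] fun k : ℕ => (k : ℝ) ^ (-j) := by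
      simpa using isBigO_zpow_mul (n := -j) (f := fun _ => 1) (C := 1) (by simp)
    refine (h2.mul_isLittleO h1).congr' ?_ ?_
    · filter_upwards [eventually_gt_atTop 0] with k hk
      rw [mul_sub, mul_sum]
      congr 1
      have hk' : (k : ℂ) ≠ 0 := by exact_mod_cast hk.ne'
      refine Finset.sum_bij' (fun n _ => n + j) (fun n _ => n - j) ?_ ?_ ?_ ?_ ?_
      · intro n hn; simp at hn ⊢; omega
      · intro n hn; simp at hn ⊢; omega
      · intro n _; ring
      · intro n _; ring
      · intro n _
        rw [add_sub_cancel_right, ← mul_assoc, ← zpow_add₀ hk']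
        congr 2; ring
    · filter_upwards [eventually_gt_atTop 0] with k hk
      rw [← zpow_add₀ (by positivity)]
      congr 1; ring

lemma HasExp.unique (ha : HasExp n₀ D a p) (hb : HasExp n₀ D a q) : p = q := by
  have key : ∀ m : ℕ, ∀ n < n₀ + m, ∀ k, p n k = q n k := by
    intro m
    induction m with
    | zero => intro n hn k; rw [ha.eq_zero n (by simpa using hn), hb.eq_zero n (by simpa using hn)]
    | succ m ih =>
      intro n hn k
      by_cases hlt : n < n₀ + m
      · exact ih n hlt k
      have hn' : n = n₀ + m := by push_cast at hn; omega
      have h1 := (hb.isLittleO n).sub (ha.isLittleO n)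
      have h2 : ∀ k : ℕ, (a k - ∑ n ∈ Icc n₀ n, (k : ℂ) ^ (-n) * q n k) -
          (a k - ∑ n ∈ Icc n₀ n, (k : ℂ) ^ (-n) * p n k) =
          (k : ℂ) ^ (-n) * (p n k - q n k) := by
        intro k
        rw [sub_sub_sub_cancel_left, ← sum_sub_distrib,
          Finset.sum_eq_single_of_mem n (by simp; omega)]
        · ring
        · intro i hi hne
          simp only [mem_Icc] at hi
          rw [ih i (by omega) k, sub_self]
      simp only [h2] at h1
      have h3 : Tendsto (fun k : ℕ => p n k - q n k) atTop (nhds 0) := by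
        rw [← isLittleO_one_iff ℝ]
        have h4 : (fun k : ℕ => (k : ℂ) ^ n) =O[atTop] fun k : ℕ => (k : ℝ) ^ n := by
          simpa using isBigO_zpow_mul (n := n) (f := fun _ => 1) (C := 1) (by simp)
        refine (h4.mul_isLittleO h1).congr' ?_ ?_
        · filter_upwards [eventually_gt_atTop 0] with k hk
          have hk' : (k : ℂ) ≠ 0 := by exact_mod_cast hk.ne'
          rw [← mul_assoc, ← zpow_add₀ hk']; simp
        · filter_upwards [eventually_gt_atTop 0] with k hk
          rw [← zpow_add₀ (by positivity)]; simp
      have h5 := eq_zero_of_periodic_of_tendsto (ha.pos n)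
        (fun k => by rw [ha.periodic, hb.periodic]) h3 k
      exact sub_eq_zero.1 h5
  funext n k
  exact key (n - n₀ + 1).toNat n (by omega) k

/-- A sequence that is asymptotically a series of sequences with expansions has an expansion. -/
lemma HasExp.series {n₁ : ℤ} {a : ℕ → ℂ} {b : ℕ → ℕ → ℂ} {D : ℕ → ℤ → ℕ} {p : ℕ → ℤ → ℕ → ℂ}
    (hb : ∀ j, HasExp n₁ (D j) (b j) (p j)) (M : ℤ)
    (hr : ∀ J : ℕ, (fun k : ℕ => a k - ∑ j ∈ range (J + 1), (k : ℂ) ^ (-(j : ℤ)) * b j k)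
      =O[atTop] fun k : ℕ => (k : ℝ) ^ (M - J)) :
    HasExp n₁ (fun n => ∏ j ∈ range (n - n₁ + 1).toNat, D j (n - j)) a
      (fun n k => ∑ j ∈ range (n - n₁ + 1).toNat, p j (n - j) k) where
  pos := fun n => prod_pos fun j _ => (hb j).pos _
  periodic := fun n k => sum_congr rfl fun j hj => by
    obtain ⟨i, hi⟩ := Finset.dvd_prod_of_mem (fun j : ℕ => D j (n - j)) hj
    rw [hi]; exact periodic_mul ((hb j).periodic _) k i
  eq_zero := fun n hn k => by
    rw [show (n - n₁ + 1).toNat = 0 by omega]; simp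
  isLittleO := fun N => by
    set J : ℕ := max (N - n₁ + 1).toNat (M + N + 1).toNat with hJ
    have h1 : (fun k : ℕ => a k - ∑ j ∈ range (J + 1), (k : ℂ) ^ (-(j : ℤ)) * b j k)
        =o[atTop] fun k : ℕ => (k : ℝ) ^ (-N) := (hr J).trans_isLittleO (zpow_isLittleO (by omega))
    have h2 : ∀ j ∈ range (J + 1), (fun k : ℕ => (k : ℂ) ^ (-(j : ℤ)) * b j k -
        ∑ n ∈ Icc n₁ N, (k : ℂ) ^ (-n) * p j (n - j) k)
        =o[atTop] fun k : ℕ => (k : ℝ) ^ (-N) := by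
      intro j _
      have := (((hb j).zpow_mul j).mono_bound (n₁ := n₁) (by omega)).isLittleO N
      exact this
    have h3 := h1.add (IsLittleO.sum h2)
    refine h3.congr_left fun k => ?_
    rw [Finset.sum_apply, sum_sub_distrib]
    simp only [sub_add_sub_cancel]
    congr 1
    rw [sum_comm]
    refine sum_congr rfl fun n hn => ?_
    rw [← mul_sum]
    congr 1
    simp only [mem_Icc] at hn
    symm
    refine Finset.sum_subset (fun j hj => ?_) fun j _ hj => ?_
    · simp only [mem_range] at hj ⊢; omega
    · simp only [mem_range, not_lt] at hj
      exact (hb j).eq_zero _ (by omega) k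

end Expansions

section ParametricIntegral


variable {K : Type*} [TopologicalSpace K] [MeasurableSpace K] [OpensMeasurableSpace K]
  {V W : Type*} [NormedAddCommGroup V] [NormedSpace ℝ V] [FiniteDimensional ℝ V]
  [NormedAddCommGroup W] [NormedSpace ℝ W] [FiniteDimensional ℝ W]
  {μ : Measure K} [IsFiniteMeasure μ] {L : K → V →L[ℝ] W} {τ : K → W} {CL : ℝ}

lemma exists_bound_of_hasCompactSupport {X F : Type*} [TopologicalSpace X] [NormedAddCommGroup F]
    {f : X → F} (hf : Continuous f) (hs : HasCompactSupport f) : ∃ C, 0 ≤ C ∧ ∀ x, ‖f x‖ ≤ C := by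
  obtain ⟨C, hC⟩ := hf.bounded_above_of_compact_support hs
  exact ⟨max C 0, le_max_right _ _, fun x => (hC x).trans (le_max_left _ _)⟩

lemma hasFDerivAt_integral_comp_affine (hL : Continuous L) (hLb : ∀ k, ‖L k‖ ≤ CL)
    (hτ : Continuous τ) {w : K → ℝ} (hw : Continuous w) {Cw : ℝ} (hwb : ∀ k, ‖w k‖ ≤ Cw)
    {φ : W → ℂ} (hφ : ContDiff ℝ ∞ φ) (hs : HasCompactSupport φ) (y : V) :
    Integrable (fun k => w k • (fderiv ℝ φ (L k y + τ k)).comp (L k)) μ ∧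
    HasFDerivAt (fun y => ∫ k, w k • φ (L k y + τ k) ∂μ)
      (∫ k, w k • (fderiv ℝ φ (L k y + τ k)).comp (L k) ∂μ) y := by
  obtain ⟨C0, h0, hC0⟩ := exists_bound_of_hasCompactSupport hφ.continuous hs
  have hφ' : Continuous (fderiv ℝ φ) := hφ.continuous_fderiv (by simp)
  obtain ⟨C1, h1, hC1⟩ := exists_bound_of_hasCompactSupport hφ' (hs.fderiv ℝ)
  have hc : ∀ y, Continuous fun k => L k y + τ k := fun y => by fun_prop
  have hc' : ∀ y, Continuous fun k => w k • (fderiv ℝ φ (L k y + τ k)).comp (L k) := fun y =>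
    hw.smul ((hφ'.comp (hc y)).clm_comp hL)
  have hbd : ∀ k y, ‖w k • (fderiv ℝ φ (L k y + τ k)).comp (L k)‖ ≤ Cw * (C1 * CL) := by
    intro k y
    rw [norm_smul]
    have := norm_nonneg (w k)
    gcongr
    · exact this.trans (hwb k)
    · exact hwb k
    · refine (ContinuousLinearMap.opNorm_comp_le _ _).trans ?_
      gcongr
      exacts [hC1 _, hLb k]
  have hc0 : ∀ y, Continuous fun k => w k • φ (L k y + τ k) := fun y =>
    hw.smul (hφ.continuous.comp (hc y))
  refine ⟨Integrable.of_bound (hc' y).aestronglyMeasurable _ (of_forall fun k => hbd k y),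
    hasFDerivAt_integral_of_dominated_of_fderiv_le (bound := fun _ => Cw * (C1 * CL))
    (s := Set.univ) Filter.univ_mem ?_ ?_ (hc' y).aestronglyMeasurable
    (of_forall fun k y _ => hbd k y) (integrable_const _)
    (of_forall fun k y _ => ?_)⟩
  · exact of_forall fun y => (hc0 y).aestronglyMeasurable
  · refine Integrable.of_bound (C := Cw * C0) (hc0 y).aestronglyMeasurable
      (of_forall fun k => ?_)
    rw [norm_smul]
    have := norm_nonneg (w k)
    gcongr
    · exact this.trans (hwb k)
    · exact hwb k
    · exact hC0 _
  · have h2 := (hφ.differentiable (by simp) (L k y + τ k)).hasFDerivAt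
    have h3 : HasFDerivAt (fun y => L k y + τ k) (L k) y := (L k).hasFDerivAt.add_const _
    exact (h2.comp y h3).const_smul (w k)

lemma contDiff_integral_comp_affine (hL : Continuous L) (hLb : ∀ k, ‖L k‖ ≤ CL)
    (hτ : Continuous τ) {w : K → ℝ} (hw : Continuous w) {Cw : ℝ} (hwb : ∀ k, ‖w k‖ ≤ Cw)
    {φ : W → ℂ} (hφ : ContDiff ℝ ∞ φ) (hs : HasCompactSupport φ) :
    ContDiff ℝ ∞ (fun y => ∫ k, w k • φ (L k y + τ k) ∂μ) := by
  rw [contDiff_infty]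
  intro n
  induction n generalizing w Cw φ with
  | zero =>
    exact contDiff_zero.2 (continuous_iff_continuousAt.2 fun y =>
      (hasFDerivAt_integral_comp_affine hL hLb hτ hw hwb hφ hs y).2.continuousAt)
  | succ n ih =>
    have hd := hasFDerivAt_integral_comp_affine (μ := μ) hL hLb hτ hw hwb hφ hs
    push_cast
    rw [contDiff_succ_iff_fderiv_apply]
    refine ⟨fun y => (hd y).2.differentiableAt, by simp, fun v => ?_⟩
    let b := Module.finBasis ℝ W
    have hwc : ∀ i, Continuous fun k => w k * b.repr (L k v) i := fun i =>
      hw.mul ((b.coord i).continuous_of_finiteDimensional.comp (hL.clm_apply continuous_const))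
    have hwb' : ∀ i, ∀ k, ‖w k * b.repr (L k v) i‖ ≤
        Cw * (‖(b.coord i).toContinuousLinearMap‖ * (CL * ‖v‖)) := by
      intro i k
      rw [norm_mul]
      have := norm_nonneg (w k)
      gcongr
      · exact this.trans (hwb k)
      · exact hwb k
      · exact ((b.coord i).toContinuousLinearMap.le_opNorm (L k v)).trans
          (by gcongr; exact (L k).le_of_opNorm_le (hLb k) v)
    have hφi : ∀ i, ContDiff ℝ ∞ fun y => fderiv ℝ φ y (b i) := fun i =>
      (hφ.fderiv_right (by simp)).clm_apply contDiff_const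
    have hsi : ∀ i, HasCompactSupport fun y => fderiv ℝ φ y (b i) := fun i => hs.fderiv_apply ℝ (b i)
    have h1 : (fun y => fderiv ℝ (fun y => ∫ k, w k • φ (L k y + τ k) ∂μ) y v) = fun y =>
        ∑ i, ∫ k, (w k * b.repr (L k v) i) • fderiv ℝ φ (L k y + τ k) (b i) ∂μ := by
      funext y
      rw [(hd y).2.fderiv, ContinuousLinearMap.integral_apply (hd y).1 v, ← integral_finsetSum]
      · refine integral_congr_ae (of_forall fun k => ?_)
        simp only [smul_apply, comp_apply]
        conv_lhs => rw [← b.sum_repr (L k v)]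
        rw [map_sum, smul_sum]
        refine sum_congr rfl fun i _ => ?_
        rw [map_smul, smul_smul]
      · intro i _
        obtain ⟨C, h0, hC⟩ := exists_bound_of_hasCompactSupport (hφi i).continuous (hsi i)
        refine Integrable.of_bound (C := Cw * (‖(b.coord i).toContinuousLinearMap‖ * (CL * ‖v‖)) * C)
          ((hwc i).smul ((hφi i).continuous.comp (by fun_prop))).aestronglyMeasurable
          (of_forall fun k => ?_)
        rw [norm_smul]
        exact mul_le_mul (hwb' i k) (hC _) (norm_nonneg _) ((norm_nonneg _).trans (hwb' i k))
    rw [h1]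
    exact ContDiff.sum fun i _ => ih (hwc i) (hwb' i) (hφi i) (hsi i)

end ParametricIntegral

section StepFunctions

/-- Functions of `(x, k)`. -/
abbrev LatFun (d : ℕ) : Type := (Fin d → ℤ) → ℕ → ℂ

/-- A function of `(x, k)` that is invariant under `D ℤ^{d+1}` for some `D > 0`. -/
def IsPer {d : ℕ} {β : Type*} (h : (Fin d → ℤ) → ℕ → β) : Prop :=
  ∃ D : ℕ, 0 < D ∧ ∀ x y k j, h (x + (D : ℤ) • y) (k + D * j) = h x k

/-- An integral linear form in `(x, k)`. -/
def linForm {d : ℕ} (a : Fin d → ℤ) (b : ℤ) (x : Fin d → ℤ) (k : ℕ) : ℤ := ∑ i, a i * x i + b * k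

/-- The indicator function of a half-space. -/
def halfInd {d : ℕ} (a : Fin d → ℤ) (b : ℤ) (x : Fin d → ℤ) (k : ℕ) : ℂ :=
  if 0 ≤ linForm a b x k then 1 else 0

/-- The algebra generated by periodic functions and indicator functions of half-spaces. -/
def stepAlg (d : ℕ) : Subalgebra ℂ (LatFun d) :=
  Algebra.adjoin ℂ ({h | IsPer h} ∪ {h | ∃ a b, h = halfInd a b})

variable {d : ℕ}

lemma IsPer.mem_stepAlg {h : LatFun d} (hh : IsPer h) : h ∈ stepAlg d :=
  Algebra.subset_adjoin (Or.inl hh)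

lemma halfInd_mem_stepAlg (a : Fin d → ℤ) (b : ℤ) : halfInd a b ∈ stepAlg d :=
  Algebra.subset_adjoin (Or.inr ⟨a, b, rfl⟩)

lemma linForm_neg (a : Fin d → ℤ) (b : ℤ) (x k) : linForm (-a) (-b) x k = -linForm a b x k := by
  simp only [linForm, Pi.neg_apply, neg_mul, Finset.sum_neg_distrib]; ring

lemma linForm_comb (s t : ℤ) (a a' : Fin d → ℤ) (b b' : ℤ) (x k) :
    linForm (s • a - t • a') (s * b - t * b') x k = s * linForm a b x k - t * linForm a' b' x k := by
  simp only [linForm, Pi.sub_apply, Pi.smul_apply, smul_eq_mul, sub_mul, sum_sub_distrib,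
    mul_add, mul_sum, mul_assoc]
  ring

lemma strictInd_mem_stepAlg (a : Fin d → ℤ) (b : ℤ) :
    (fun x k => if 0 < linForm a b x k then (1 : ℂ) else 0) ∈ stepAlg d := by
  have : (fun x k => if 0 < linForm a b x k then (1 : ℂ) else 0) = 1 - halfInd (-a) (-b) := by
    funext x k
    simp only [Pi.sub_apply, Pi.one_apply, halfInd, linForm_neg, Left.nonneg_neg_iff]
    by_cases h : 0 < linForm a b x k
    · simp [h, not_le.2 h]
    · simp [h, not_lt.1 h]
  rw [this]
  exact sub_mem (one_mem _) (halfInd_mem_stepAlg _ _)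

lemma IsPer.eq_of_modEq {β : Type*} {h : (Fin d → ℤ) → ℕ → β} {D : ℕ}
    (hh : ∀ x y k j, h (x + (D : ℤ) • y) (k + D * j) = h x k) {x x' : Fin d → ℤ}
    {k : ℕ} (hx : ∀ i, x i ≡ x' i [ZMOD D]) : h x k = h x' k := by
  have h1 : ∀ i, ∃ y, x' i = x i + D * y := fun i => by
    obtain ⟨y, hy⟩ := (hx i).dvd
    exact ⟨y, by rw [← hy]; ring⟩
  choose y hy using h1
  have h2 : x' = x + (D : ℤ) • y := by funext i; simp [hy]
  rw [h2]
  simpa using (hh x y k 0).symm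

lemma exists_bound_of_isPer {h : LatFun d} (hh : IsPer h) :
    ∃ C, ∀ x k, ‖h x k‖ ≤ C := by
  obtain ⟨D, hD, hper⟩ := hh
  let S := Fintype.piFinset fun _ : Fin d => Ico (0 : ℤ) D
  refine ⟨∑ x ∈ S, ∑ k ∈ range D, ‖h x k‖, fun x k => ?_⟩
  have hD' : (0 : ℤ) < D := by exact_mod_cast hD
  have h1 : h x k = h (fun i => x i % D) (k % D) := by
    have := hper (fun i => x i % D) (fun i => x i / D) (k % D) (k / D)
    rw [Nat.mod_add_div] at this
    rw [← this]
    congr 1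
    funext i
    simp [Int.emod_add_mul_ediv]
  rw [h1]
  have h2 : (fun i => x i % D) ∈ S := by
    simp only [S, Fintype.mem_piFinset, mem_Ico]
    exact fun i => ⟨Int.emod_nonneg _ hD'.ne', Int.emod_lt_of_pos _ hD'⟩
  refine le_trans ?_ (single_le_sum (f := fun x => ∑ k ∈ range D, ‖h x k‖)
    (fun _ _ => sum_nonneg fun _ _ => norm_nonneg _) h2)
  exact single_le_sum (f := fun k => ‖h (fun i => x i % D) k‖)
    (fun _ _ => norm_nonneg _) (Finset.mem_range.2 (Nat.mod_lt _ hD))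

lemma exists_bound_of_mem_stepAlg {h : LatFun d} (hh : h ∈ stepAlg d) :
    ∃ C, ∀ x k, ‖h x k‖ ≤ C := by
  induction hh using Algebra.adjoin_induction with
  | mem h hh =>
    rcases hh with hh | ⟨a, b, rfl⟩
    · exact exists_bound_of_isPer hh
    · refine ⟨1, fun x k => ?_⟩
      rw [halfInd]; split_ifs <;> simp
  | algebraMap r => exact ⟨‖r‖, fun x k => le_of_eq rfl⟩
  | add f g _ _ hf hg =>
    obtain ⟨C, hC⟩ := hf
    obtain ⟨C', hC'⟩ := hg
    exact ⟨C + C', fun x k => (norm_add_le _ _).trans (add_le_add (hC x k) (hC' x k))⟩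
  | mul f g _ _ hf hg =>
    obtain ⟨C, hC⟩ := hf
    obtain ⟨C', hC'⟩ := hg
    refine ⟨C * C', fun x k => ?_⟩
    rw [mul_apply, mul_apply, norm_mul]
    exact mul_le_mul (hC x k) (hC' x k) (norm_nonneg _) ((norm_nonneg _).trans (hC x k))

/-- Indicator function of the half-space `s ≤ a x₀ + …`. -/
def lowerInd (a s : ℤ) (a' : Fin d → ℤ) (b : ℤ) (x : Fin (d + 1) → ℤ) (k : ℕ) : ℂ :=
  if s ≤ a * x 0 + linForm a' b (tail x) k then 1 else 0

/-- The lower bounds for the first variable. -/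
def lowerBounds (d : ℕ) : Set (LatFun (d + 1)) :=
  {J | J = 1 ∨ ∃ a s a' b, 0 < a ∧ (s = 0 ∨ s = 1) ∧ J = lowerInd a s a' b}

/-- Products of a function of the last variables, a periodic function of the first, and at most one
lower bound for the first. -/
def sliceGen (d : ℕ) : Set (LatFun (d + 1)) :=
  {h | ∃ h' ∈ stepAlg d, ∃ (D : ℕ) (ϖ : ℤ → ℂ), 0 < D ∧ (∀ n, ϖ (n + D) = ϖ n) ∧
    ∃ J ∈ lowerBounds d, h = fun x k => h' (tail x) k * ϖ (x 0) * J x k}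

lemma lowerBounds_mul {J₁ J₂ : LatFun (d + 1)} (h₁ : J₁ ∈ lowerBounds d)
    (h₂ : J₂ ∈ lowerBounds d) : ∃ P ∈ stepAlg d, ∀ x k, J₁ x k * J₂ x k =
      P (tail x) k * J₁ x k + (1 - P (tail x) k) * J₂ x k := by
  rcases h₁ with rfl | ⟨a₁, s₁, a₁', b₁, ha₁, hs₁, rfl⟩
  · exact ⟨0, zero_mem _, fun x k => by simp⟩
  rcases h₂ with rfl | ⟨a₂, s₂, a₂', b₂, ha₂, hs₂, rfl⟩
  · exact ⟨1, one_mem _, fun x k => by simp⟩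
  have hs₂' : 0 ≤ s₂ ∧ s₂ ≤ 1 := by omega
  rcases hs₁ with rfl | rfl
  · refine ⟨_, strictInd_mem_stepAlg (a₁ • a₂' - a₂ • a₁') (a₁ * b₂ - a₂ * b₁), fun x k => ?_⟩
    simp only [lowerInd, linForm_comb]
    set L₁ := linForm a₁' b₁ (tail x) k
    set L₂ := linForm a₂' b₂ (tail x) k
    set n := x 0
    have key : a₁ * (a₂ * n + L₂) = a₂ * (a₁ * n + L₁) + (a₁ * L₂ - a₂ * L₁) := by ring
    by_cases hc : 0 < a₁ * L₂ - a₂ * L₁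
    · have : 0 ≤ a₁ * n + L₁ → s₂ ≤ a₂ * n + L₂ := fun h => by
        have : 0 < a₂ * n + L₂ := by
          refine pos_of_mul_pos_right (a := a₁) ?_ ha₁.le
          rw [key]; positivity
        omega
      by_cases h : 0 ≤ a₁ * n + L₁
      · simp [h, this h]
      · rw [if_neg h, if_pos hc]; simp
    · have : s₂ ≤ a₂ * n + L₂ → 0 ≤ a₁ * n + L₁ := fun h => by
        refine nonneg_of_mul_nonneg_right (b := a₁ * n + L₁) (a := a₂) ?_ ha₂
        have := mul_nonneg ha₁.le (hs₂'.1.trans h)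
        linarith
      by_cases h : s₂ ≤ a₂ * n + L₂
      · simp [h, this h]
      · rw [if_neg h, if_neg hc]; simp
  · refine ⟨_, halfInd_mem_stepAlg (a₁ • a₂' - a₂ • a₁') (a₁ * b₂ - a₂ * b₁), fun x k => ?_⟩
    simp only [lowerInd, halfInd, linForm_comb]
    set L₁ := linForm a₁' b₁ (tail x) k
    set L₂ := linForm a₂' b₂ (tail x) k
    set n := x 0
    have key : a₁ * (a₂ * n + L₂) = a₂ * (a₁ * n + L₁) + (a₁ * L₂ - a₂ * L₁) := by ring
    by_cases hc : 0 ≤ a₁ * L₂ - a₂ * L₁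
    · have : 1 ≤ a₁ * n + L₁ → s₂ ≤ a₂ * n + L₂ := fun h => by
        have : 0 < a₂ * n + L₂ := by
          refine pos_of_mul_pos_right (a := a₁) ?_ ha₁.le
          have : 0 < a₂ * (a₁ * n + L₁) := mul_pos ha₂ (by omega)
          linarith
        omega
      by_cases h : 1 ≤ a₁ * n + L₁
      · simp [h, this h]
      · rw [if_neg h, if_pos hc]; simp
    · have : s₂ ≤ a₂ * n + L₂ → 1 ≤ a₁ * n + L₁ := fun h => by
        have : 0 < a₁ * n + L₁ := by
          refine pos_of_mul_pos_right (a := a₂) ?_ ha₂.le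
          have := mul_nonneg ha₁.le (hs₂'.1.trans h)
          linarith
        omega
      by_cases h : s₂ ≤ a₂ * n + L₂
      · simp [h, this h]
      · rw [if_neg h, if_neg hc]; simp

lemma int_periodic_mul {ϖ : ℤ → ℂ} {D : ℕ} (h : ∀ n, ϖ (n + D) = ϖ n) (n : ℤ) (j : ℕ) :
    ϖ (n + D * j) = ϖ n := by
  induction j with
  | zero => simp
  | succ j ih => push_cast; rw [mul_add, mul_one, ← add_assoc, h, ih]

lemma sliceGen_mul {f g : LatFun (d + 1)} (hf : f ∈ sliceGen d) (hg : g ∈ sliceGen d) :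
    f * g ∈ span ℂ (sliceGen d) := by
  obtain ⟨h₁, hh₁, D₁, ϖ₁, hD₁, hϖ₁, J₁, hJ₁, rfl⟩ := hf
  obtain ⟨h₂, hh₂, D₂, ϖ₂, hD₂, hϖ₂, J₂, hJ₂, rfl⟩ := hg
  obtain ⟨P, hP, hJ⟩ := lowerBounds_mul hJ₁ hJ₂
  have hϖ : ∀ n, ϖ₁ (n + (D₁ * D₂ : ℕ)) * ϖ₂ (n + (D₁ * D₂ : ℕ)) = ϖ₁ n * ϖ₂ n := by
    intro n
    congr 1
    · push_cast; exact int_periodic_mul hϖ₁ n D₂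
    · push_cast; rw [mul_comm]; exact int_periodic_mul hϖ₂ n D₁
  have e : (fun x k => h₁ (tail x) k * ϖ₁ (x 0) * J₁ x k) *
      (fun x k => h₂ (tail x) k * ϖ₂ (x 0) * J₂ x k) =
      (fun x k => (h₁ * h₂ * P) (tail x) k * (ϖ₁ (x 0) * ϖ₂ (x 0)) * J₁ x k) +
      (fun x k => (h₁ * h₂ * (1 - P)) (tail x) k * (ϖ₁ (x 0) * ϖ₂ (x 0)) * J₂ x k) := by
    funext x k
    simp only [mul_apply, Pi.add_apply, Pi.sub_apply, Pi.one_apply]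
    linear_combination h₁ (tail x) k * ϖ₁ (x 0) * h₂ (tail x) k * ϖ₂ (x 0) * hJ x k
  rw [e]
  refine add_mem (subset_span ?_) (subset_span ?_)
  · exact ⟨_, mul_mem (mul_mem hh₁ hh₂) hP, D₁ * D₂, fun n => ϖ₁ n * ϖ₂ n, Nat.mul_pos hD₁ hD₂, hϖ,
      J₁, hJ₁, rfl⟩
  · exact ⟨_, mul_mem (mul_mem hh₁ hh₂) (sub_mem (one_mem _) hP), D₁ * D₂, fun n => ϖ₁ n * ϖ₂ n,
      Nat.mul_pos hD₁ hD₂, hϖ, J₂, hJ₂, rfl⟩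

lemma mem_sliceGen_of_tail {h : LatFun d} (hh : h ∈ stepAlg d) {J}
    (hJ : J ∈ lowerBounds d) : (fun x k => h (tail x) k * J x k) ∈ sliceGen d :=
  ⟨h, hh, 1, fun _ => 1, one_pos, fun _ => rfl, J, hJ, by simp⟩

lemma one_mem_lowerBounds : (1 : LatFun (d + 1)) ∈ lowerBounds d := Or.inl rfl

lemma linForm_succ (a : Fin (d + 1) → ℤ) (b : ℤ) (x : Fin (d + 1) → ℤ) (k : ℕ) :
    linForm a b x k = a 0 * x 0 + linForm (tail a) b (tail x) k := by
  simp only [linForm, Fin.sum_univ_succ, tail]; ring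

lemma isPer_mem_span_sliceGen {h : LatFun (d + 1)} (hh : IsPer h) :
    h ∈ span ℂ (sliceGen d) := by
  obtain ⟨D, hD, hper⟩ := hh
  have hD' : (0 : ℤ) < D := by exact_mod_cast hD
  have e : h = ∑ r ∈ Ico (0 : ℤ) D, fun x k => h (cons r (tail x)) k *
      (if x 0 % D = r then 1 else 0) * (1 : LatFun (d + 1)) x k := by
    funext x k
    simp only [Finset.sum_apply, Pi.one_apply, mul_one, mul_ite, mul_zero]
    rw [Finset.sum_ite_eq, if_pos]
    · refine IsPer.eq_of_modEq hper fun i => ?_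
      refine Fin.cases ?_ (fun i => ?_) i
      · simp only [Fin.cons_zero]
        exact (Int.mod_modEq _ _).symm
      · simp only [Fin.cons_succ, tail]
        exact Int.ModEq.refl _
    · simp only [mem_Ico]
      exact ⟨Int.emod_nonneg _ hD'.ne', Int.emod_lt_of_pos _ hD'⟩
  rw [e]
  refine Submodule.sum_mem _ fun r _ => subset_span ?_
  refine ⟨fun x k => h (cons r x) k, IsPer.mem_stepAlg ⟨D, hD, fun x y k j => ?_⟩, D,
    fun n => if n % D = r then 1 else 0, hD, fun n => by simp, 1, one_mem_lowerBounds, rfl⟩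
  refine Eq.trans ?_ (hper (cons r x) (cons 0 y) k j)
  change h _ _ = h _ _
  congr 1
  funext i
  refine Fin.cases ?_ (fun i => ?_) i <;> simp

lemma halfInd_mem_span_sliceGen (a : Fin (d + 1) → ℤ) (b : ℤ) :
    halfInd a b ∈ span ℂ (sliceGen d) := by
  rcases lt_trichotomy (a 0) 0 with ha | ha | ha
  · have e : halfInd a b = (fun x k => (1 : LatFun d) (tail x) k *
        (1 : LatFun (d + 1)) x k) - fun x k => (1 : LatFun d) (tail x) k *
        lowerInd (-a 0) 1 (-tail a) (-b) x k := by
      funext x k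
      simp only [Pi.sub_apply, Pi.one_apply, one_mul, halfInd, lowerInd, linForm_neg, linForm_succ]
      by_cases h : 0 ≤ a 0 * x 0 + linForm (tail a) b (tail x) k
      · rw [if_pos h, if_neg (by linarith)]; simp
      · rw [if_neg h, if_pos (by linarith)]; simp
    rw [e]
    exact sub_mem (subset_span (mem_sliceGen_of_tail (one_mem _) one_mem_lowerBounds))
      (subset_span (mem_sliceGen_of_tail (one_mem _)
        (Or.inr ⟨_, _, _, _, by linarith, Or.inr rfl, rfl⟩)))
  · have e : halfInd a b = fun x k => halfInd (tail a) b (tail x) k *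
        (1 : LatFun (d + 1)) x k := by
      funext x k
      simp [halfInd, linForm_succ, ha]
    rw [e]
    exact subset_span (mem_sliceGen_of_tail (halfInd_mem_stepAlg _ _) one_mem_lowerBounds)
  · have e : halfInd a b = fun x k => (1 : LatFun d) (tail x) k *
        lowerInd (a 0) 0 (tail a) b x k := by
      funext x k
      simp [halfInd, lowerInd, linForm_succ]
    rw [e]
    exact subset_span (mem_sliceGen_of_tail (one_mem _)
      (Or.inr ⟨_, _, _, _, ha, Or.inl rfl, rfl⟩))

lemma stepAlg_le_span_sliceGen {h : LatFun (d + 1)} (hh : h ∈ stepAlg (d + 1)) :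
    h ∈ span ℂ (sliceGen d) := by
  induction hh using Algebra.adjoin_induction with
  | mem h hh =>
    rcases hh with hh | ⟨a, b, rfl⟩
    · exact isPer_mem_span_sliceGen hh
    · exact halfInd_mem_span_sliceGen a b
  | algebraMap r =>
    rw [Algebra.algebraMap_eq_smul_one]
    refine smul_mem _ _ (subset_span ?_)
    have := mem_sliceGen_of_tail (d := d) (one_mem _) one_mem_lowerBounds
    convert this using 1
    funext x k; simp
  | add f g _ _ hf hg => exact add_mem hf hg
  | mul f g _ _ hf hg =>
    have h1 := Submodule.mul_mem_mul hf hg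
    rw [Submodule.span_mul_span] at h1
    refine Submodule.span_le.2 ?_ h1
    rintro _ ⟨f, hf, g, hg, rfl⟩
    exact sliceGen_mul hf hg

end StepFunctions

section LatticeSums

variable {d : ℕ}

/-- `f` vanishes outside `[-R, R]^d`. -/
def SuppIn (R : ℕ) (f : (Fin d → ℝ) → ℂ) : Prop := ∀ y, f y ≠ 0 → ∀ i, |y i| ≤ R

/-- The lattice points in `[-R k, R k]^d`. -/
def latBox (d R k : ℕ) : Finset (Fin d → ℤ) :=
  Fintype.piFinset fun _ => Icc (-(R * k : ℤ)) (R * k)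

/-- The point `x / k`. -/
def scaled (x : Fin d → ℤ) (k : ℕ) : Fin d → ℝ := fun i => (x i : ℝ) / k

/-- The sums `∑ h(x, k) f(x / k)` have an asymptotic expansion, whose coefficients have periods
that do not depend on `f`. -/
def HasUniformExp (h : LatFun d) : Prop :=
  ∃ D : ℤ → ℕ, ∀ f : (Fin d → ℝ) → ℂ, ContDiff ℝ ∞ f → ∀ R : ℕ, SuppIn R f →
    ∃ p, HasExp (-d) D (fun k => ∑ x ∈ latBox d R k, h x k * f (scaled x k)) p

lemma SuppIn.hasCompactSupport {R : ℕ} {f : (Fin d → ℝ) → ℂ} (hf : SuppIn R f) :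
    HasCompactSupport f := by
  refine HasCompactSupport.intro (K := Set.univ.pi fun _ : Fin d => Set.Icc (-(R : ℝ)) R)
    (isCompact_univ_pi fun _ => isCompact_Icc) fun y hy => ?_
  by_contra h
  exact hy fun i _ => abs_le.1 (hf y h i)

lemma SuppIn.eq_zero {R : ℕ} {f : (Fin d → ℝ) → ℂ} (hf : SuppIn R f) {y : Fin d → ℝ} {i : Fin d}
    (h : (R : ℝ) < |y i|) : f y = 0 := by
  by_contra h'
  exact absurd (hf y h' i) (not_le.2 h)

lemma abs_scaled_le {R k : ℕ} {x : Fin d → ℤ} (hx : x ∈ latBox d R k) (hk : 0 < k) (i : Fin d) :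
    |scaled x k i| ≤ R := by
  simp only [latBox, Fintype.mem_piFinset, mem_Icc] at hx
  have hk' : (0 : ℝ) < k := by exact_mod_cast hk
  rw [scaled, abs_div, abs_of_pos hk', div_le_iff₀ hk']
  exact_mod_cast abs_le.2 (hx i)

lemma card_latBox (d R k : ℕ) : (latBox d R k).card = (2 * R * k + 1) ^ d := by
  simp only [latBox, Fintype.card_piFinset, Int.card_Icc, Finset.prod_const, Finset.card_univ,
    Fintype.card_fin]
  congr 1
  have : (0 : ℤ) ≤ R * k := by positivity
  zify
  rw [Int.toNat_of_nonneg (by omega)]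
  ring

lemma HasUniformExp.add {f g : LatFun d} (hf : HasUniformExp f) (hg : HasUniformExp g) :
    HasUniformExp (f + g) := by
  obtain ⟨D, hD⟩ := hf
  obtain ⟨D', hD'⟩ := hg
  refine ⟨fun n => D n * D' n, fun φ hφ R hR => ?_⟩
  obtain ⟨p, hp⟩ := hD φ hφ R hR
  obtain ⟨q, hq⟩ := hD' φ hφ R hR
  have hpos : ∀ n, 0 < D n * D' n := fun n => Nat.mul_pos (hp.pos n) (hq.pos n)
  refine ⟨_, ((hp.mono_period hpos fun n => dvd_mul_right _ _).add
    (hq.mono_period hpos fun n => dvd_mul_left _ _)).congr (of_forall fun k => ?_)⟩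
  rw [← sum_add_distrib]
  exact sum_congr rfl fun x _ => by simp [add_mul]

lemma HasUniformExp.smul {f : LatFun d} (hf : HasUniformExp f) (c : ℂ) :
    HasUniformExp (c • f) := by
  obtain ⟨D, hD⟩ := hf
  refine ⟨D, fun φ hφ R hR => ?_⟩
  obtain ⟨p, hp⟩ := hD φ hφ R hR
  refine ⟨_, (hp.const_mul c).congr (of_forall fun k => ?_)⟩
  rw [mul_sum]
  exact sum_congr rfl fun x _ => by simp [mul_assoc]

lemma HasUniformExp.zero : HasUniformExp (0 : LatFun d) :=
  ⟨fun _ => 1, fun _ _ _ _ => ⟨_, (HasExp.zero fun _ => one_pos).congr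
    (of_forall fun k => by simp)⟩⟩

lemma HasUniformExp.of_mem_span {S : Set (LatFun d)} (hS : ∀ f ∈ S, HasUniformExp f)
    {f : LatFun d} (hf : f ∈ span ℂ S) : HasUniformExp f := by
  induction hf using span_induction with
  | mem f hf => exact hS f hf
  | zero => exact .zero
  | add f g _ _ hf hg => exact hf.add hg
  | smul c f _ hf => exact hf.smul c

/-- The partial derivative in the first variable. -/
def partialZero (f : (Fin (d + 1) → ℝ) → ℂ) (z : Fin (d + 1) → ℝ) : ℂ :=
  fderiv ℝ f z (single 0 1)

lemma contDiff_partialZero {f : (Fin (d + 1) → ℝ) → ℂ} (hf : ContDiff ℝ ∞ f) :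
    ContDiff ℝ ∞ (partialZero f) :=
  (hf.fderiv_right (by simp)).clm_apply contDiff_const

lemma SuppIn.partialZero {R : ℕ} {f : (Fin (d + 1) → ℝ) → ℂ} (hf : SuppIn R f) :
    SuppIn R (partialZero f) := by
  intro z hz i
  have h1 : z ∈ tsupport f := by
    refine support_fderiv_subset ℝ fun h => hz ?_
    rw [QuasiPolyAsymptotics.partialZero, h]; rfl
  have h2 : tsupport f ⊆ {z | |z i| ≤ R} :=
    closure_minimal (fun z hz => hf z hz i) (isClosed_le (by fun_prop) continuous_const)
  exact h2 h1

lemma contDiff_partialZero_iterate {f : (Fin (d + 1) → ℝ) → ℂ} (hf : ContDiff ℝ ∞ f) (j : ℕ) :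
    ContDiff ℝ ∞ (partialZero^[j] f) := by
  induction j with
  | zero => exact hf
  | succ j ih => rw [Function.iterate_succ_apply']; exact contDiff_partialZero ih

lemma SuppIn.partialZero_iterate {R : ℕ} {f : (Fin (d + 1) → ℝ) → ℂ} (hf : SuppIn R f) (j : ℕ) :
    SuppIn R (QuasiPolyAsymptotics.partialZero^[j] f) := by
  induction j with
  | zero => exact hf
  | succ j ih => rw [Function.iterate_succ_apply']; exact ih.partialZero

lemma hasDerivAt_comp_cons {f : (Fin (d + 1) → ℝ) → ℂ} (hf : ContDiff ℝ ∞ f) (y : Fin d → ℝ)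
    (t : ℝ) : HasDerivAt (fun t => f (cons t y)) (partialZero f (cons t y)) t := by
  have h1 : HasDerivAt (fun t : ℝ => (cons t y : Fin (d + 1) → ℝ)) (single 0 1) t := by
    refine hasDerivAt_pi.2 fun i => ?_
    refine Fin.cases ?_ (fun i => ?_) i
    · simpa using hasDerivAt_id' t
    · simpa using hasDerivAt_const t (y i)
  exact ((hf.differentiable (by simp) _).hasFDerivAt).comp_hasDerivAt t h1

/-- The primitives and derivatives of `f` in the first variable. -/
def sliceFamily (f : (Fin (d + 1) → ℝ) → ℂ) (R : ℕ) (y : Fin d → ℝ) : ℕ → ℝ → ℂ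
  | 0, t => ∫ s in (R : ℝ)..t, f (cons s y)
  | i + 1, t => partialZero^[i] f (cons t y)

lemma continuous_cons (y : Fin d → ℝ) : Continuous fun t : ℝ => (cons t y : Fin (d + 1) → ℝ) :=
  continuous_pi fun i => by
    refine Fin.cases ?_ (fun i => ?_) i
    · simpa using continuous_id'
    · simpa using continuous_const

lemma hasDerivAt_sliceFamily {f : (Fin (d + 1) → ℝ) → ℂ} (hf : ContDiff ℝ ∞ f) (R : ℕ)
    (y : Fin d → ℝ) (i : ℕ) (t : ℝ) :
    HasDerivAt (sliceFamily f R y i) (sliceFamily f R y (i + 1) t) t := by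
  cases i with
  | zero =>
    exact ((hf.continuous.comp (continuous_cons y)).integral_hasStrictDerivAt (R : ℝ) t).hasDerivAt
  | succ i =>
    have := hasDerivAt_comp_cons (contDiff_partialZero_iterate hf i) y t
    rw [← Function.iterate_succ_apply' partialZero i f] at this
    exact this

lemma SuppIn.comp_cons_eq_zero {R : ℕ} {f : (Fin (d + 1) → ℝ) → ℂ} (hR : SuppIn R f)
    (y : Fin d → ℝ) {t : ℝ} (ht : R < |t|) : f (cons t y) = 0 :=
  hR.eq_zero (i := 0) (by simpa using ht)

lemma sliceFamily_eq_zero {f : (Fin (d + 1) → ℝ) → ℂ} {R : ℕ} (hR : SuppIn R f)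
    (y : Fin d → ℝ) (i : ℕ) {t : ℝ} (ht : R < t) : sliceFamily f R y i t = 0 := by
  cases i with
  | zero =>
    rw [sliceFamily, intervalIntegral.integral_of_le ht.le]
    refine setIntegral_eq_zero_of_forall_eq_zero fun s hs => hR.comp_cons_eq_zero y ?_
    exact hs.1.trans_le (le_abs_self s)
  | succ i => exact (hR.partialZero_iterate i).comp_cons_eq_zero y (ht.trans_le (le_abs_self t))

/-- The linear map `y ↦ (l y, y)`. -/
def consCLM (l : (Fin d → ℝ) →L[ℝ] ℝ) : (Fin d → ℝ) →L[ℝ] (Fin (d + 1) → ℝ) :=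
  ContinuousLinearMap.pi (cons (α := fun _ => (Fin d → ℝ) →L[ℝ] ℝ) l
    fun i => proj i)

lemma cons_eq_consCLM (l : (Fin d → ℝ) →L[ℝ] ℝ) (y : Fin d → ℝ) (c : ℝ) :
    (cons (l y + c) y : Fin (d + 1) → ℝ) = consCLM l y + single 0 c := by
  funext i
  refine Fin.cases ?_ (fun i => ?_) i <;> simp [consCLM]

/-- The functions `sliceFamily f R y i (l y + c)`, made smooth for `i = 0` by cutting off the
integral. -/
def boundaryFamily (f : (Fin (d + 1) → ℝ) → ℂ) (l : (Fin d → ℝ) →L[ℝ] ℝ) (c s : ℝ) :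
    ℕ → (Fin d → ℝ) → ℂ
  | 0, y => -∫ t in Set.Icc 0 s, (1 : ℝ) • f (consCLM l y + single 0 (c + t))
  | i + 1, y => partialZero^[i] f (consCLM l y + single 0 c)

lemma contDiff_boundaryFamily {f : (Fin (d + 1) → ℝ) → ℂ} (hf : ContDiff ℝ ∞ f) {R : ℕ}
    (hR : SuppIn R f) (l : (Fin d → ℝ) →L[ℝ] ℝ) (c s : ℝ) (i : ℕ) :
    ContDiff ℝ ∞ (boundaryFamily f l c s i) := by
  cases i with
  | zero =>
    have : ContDiff ℝ ∞ fun y => ∫ t in Set.Icc 0 s, (1 : ℝ) • f (consCLM l y + single 0 (c + t)) :=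
      contDiff_integral_comp_affine (L := fun _ => consCLM l) (w := fun _ => 1) (Cw := 1)
        (CL := ‖consCLM l‖) (τ := fun t : ℝ => single 0 (c + t))
        continuous_const (fun _ => le_rfl)
        ((continuous_single (A := fun _ : Fin (d + 1) => ℝ) 0).comp (continuous_const.add continuous_id))
        continuous_const (by simp) hf hR.hasCompactSupport
    exact this.neg
  | succ i =>
    exact (contDiff_partialZero_iterate hf i).comp ((consCLM l).contDiff.add contDiff_const)

lemma SuppIn.boundaryFamily {f : (Fin (d + 1) → ℝ) → ℂ} {R : ℕ}
    (hR : SuppIn R f) (l : (Fin d → ℝ) →L[ℝ] ℝ) (c s : ℝ) (i : ℕ) :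
    SuppIn R (boundaryFamily f l c s i) := by
  intro y hy m
  by_contra! h
  refine hy ?_
  have key : ∀ g : (Fin (d + 1) → ℝ) → ℂ, SuppIn R g → ∀ c, g (consCLM l y + single 0 c) = 0 :=
    fun g hg c => by rw [← cons_eq_consCLM]; exact hg.eq_zero (i := m.succ) (by simpa using h)
  cases i with
  | zero => simp [QuasiPolyAsymptotics.boundaryFamily, key f hR]
  | succ i => exact key _ (hR.partialZero_iterate i) _

lemma boundaryFamily_eq {f : (Fin (d + 1) → ℝ) → ℂ} {R : ℕ}
    (hR : SuppIn R f) (l : (Fin d → ℝ) →L[ℝ] ℝ) (c s : ℝ) (i : ℕ) (y : Fin d → ℝ) (hs : 0 ≤ s)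
    (hRs : R ≤ l y + c + s) (hf : Continuous f) :
    boundaryFamily f l c s i y = sliceFamily f R y i (l y + c) := by
  cases i with
  | zero =>
    simp only [boundaryFamily, sliceFamily, one_smul, ← cons_eq_consCLM]
    rw [intervalIntegral.integral_symm, integral_Icc_eq_integral_Ioc,
      ← intervalIntegral.integral_of_le hs]
    congr 1
    have h1 : ∀ t, l y + (c + t) = l y + c + t := fun t => by ring
    simp only [h1]
    rw [intervalIntegral.integral_comp_add_left (fun t => f (cons t y)), add_zero]
    have hi : ∀ a b, IntervalIntegrable (fun t => f (cons t y)) volume a b := fun a b =>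
      (hf.comp (continuous_cons y)).intervalIntegrable a b
    rw [← intervalIntegral.integral_add_adjacent_intervals (hi _ (R : ℝ)) (hi _ _),
      add_eq_left, intervalIntegral.integral_of_le hRs]
    refine setIntegral_eq_zero_of_forall_eq_zero fun t ht => hR.comp_cons_eq_zero y ?_
    exact ht.1.trans_le (le_abs_self t)
  | succ i => rw [boundaryFamily, sliceFamily, cons_eq_consCLM]

lemma sum_progression_eq {f : (Fin (d + 1) → ℝ) → ℂ} {R k : ℕ} (hR : SuppIn R f) (hk : 0 < k)
    (y : Fin d → ℝ) {D Ns : ℕ} (hD : 0 < D) {n₁ : ℤ} {c θ : ℝ} (hn₁ : (n₁ : ℝ) = k * c + D * θ)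
    (hθ : 0 ≤ θ) (hNs : R < c + Ns * (D / k)) :
    ∑ n ∈ Icc (-(R * k : ℤ)) (R * k),
      (if n ≡ n₁ [ZMOD D] ∧ n₁ ≤ n then f (cons ((n : ℝ) / k) y) else 0) =
    ∑ m ∈ range Ns, f (cons (c + (θ + m) * (D / k)) y) := by
  have hk' : (0 : ℝ) < k := by exact_mod_cast hk
  have hD' : (0 : ℝ) < D := by exact_mod_cast hD
  have hpt : ∀ m : ℕ, ((n₁ + D * m : ℤ) : ℝ) / k = c + (θ + m) * (D / k) := by
    intro m
    push_cast
    rw [hn₁]; field_simp; ring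
  have hinj : Set.InjOn (fun m : ℕ => n₁ + D * m) (range Ns) := by
    intro m _ m' _ h
    have : (D : ℤ) * m = D * m' := by simpa using h
    exact_mod_cast mul_left_cancel₀ (by exact_mod_cast hD.ne') this
  have hRHS : ∑ m ∈ range Ns, f (cons (c + (θ + m) * (D / k)) y) =
      ∑ n ∈ (range Ns).image (fun m : ℕ => n₁ + D * m),
        (if n ≡ n₁ [ZMOD D] ∧ n₁ ≤ n then f (cons ((n : ℝ) / k) y) else 0) := by
    rw [Finset.sum_image hinj]
    refine sum_congr rfl fun m _ => ?_
    rw [if_pos ⟨by simp [Int.ModEq], by simp; positivity⟩, hpt]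
  rw [hRHS]
  refine Finset.sum_congr_of_eq_on_inter (fun n _ hn => ?_) (fun n _ hn => ?_) fun _ _ _ => rfl
  · split_ifs with h
    · obtain ⟨m, hm⟩ := h.1.symm.dvd
      have hm0 : 0 ≤ m := by
        have : 0 ≤ (D : ℤ) * m := by omega
        exact nonneg_of_mul_nonneg_right this (by exact_mod_cast hD)
      lift m to ℕ using hm0
      have hn' : n = n₁ + D * m := by omega
      have hmN : Ns ≤ m := by
        by_contra! hlt
        exact hn (Finset.mem_image.2 ⟨m, Finset.mem_range.2 hlt, hn'.symm⟩)
      refine hR.comp_cons_eq_zero y (lt_of_lt_of_le ?_ (le_abs_self _))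
      rw [hn', hpt]
      refine hNs.trans_le ?_
      have : (Ns : ℝ) ≤ m := by exact_mod_cast hmN
      gcongr
      linarith
    · rfl
  · split_ifs with h
    · refine hR.comp_cons_eq_zero y ?_
      rw [abs_div, abs_of_pos hk', lt_div_iff₀ hk']
      have : ¬ |n| ≤ (R * k : ℤ) := fun h => hn (Finset.mem_Icc.2 (abs_le.1 h))
      exact_mod_cast not_le.1 this
    · rfl

end LatticeSums

section LatticeSums

variable {d : ℕ}

lemma IsPer.comp {β γ : Type*} {h : (Fin d → ℤ) → ℕ → β} (hh : IsPer h) (u : β → γ) :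
    IsPer fun x k => u (h x k) := by
  obtain ⟨D, hD, h⟩ := hh
  exact ⟨D, hD, fun x y k j => congrArg u (h x y k j)⟩

/-- The sums over the part of an arithmetic progression of step `D` that starts at `n₁`. -/
def sliceSum (h : LatFun d) (D : ℕ) (n₁ : (Fin d → ℤ) → ℕ → ℤ) (R : ℕ)
    (f : (Fin (d + 1) → ℝ) → ℂ) (k : ℕ) : ℂ :=
  ∑ x ∈ latBox d R k, h x k * ∑ n ∈ Icc (-(R * k : ℤ)) (R * k),
    if n ≡ n₁ x k [ZMOD D] ∧ n₁ x k ≤ n then f (cons ((n : ℝ) / k) (scaled x k)) else 0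

/-- The coefficients in the Euler-Maclaurin formula. -/
def emWeight (D : ℕ) (θ : (Fin d → ℤ) → ℕ → ℝ) (i : ℕ) (x : Fin d → ℤ) (k : ℕ) : ℂ :=
  -((D : ℂ)⁻¹ * ((D ^ i * emCoeff (θ x k) i : ℝ) : ℂ))

lemma sliceSum_sub_le {h : LatFun d} (hh : h ∈ stepAlg d) {D : ℕ} (hD : 0 < D)
    {θ : (Fin d → ℤ) → ℕ → ℝ} (hθper : IsPer θ) (hθ : ∀ x k, θ x k ∈ Set.Icc (0 : ℝ) 1)
    (l : (Fin d → ℝ) →L[ℝ] ℝ) (c : ℝ) {n₁ : (Fin d → ℤ) → ℕ → ℤ}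
    (hn₁ : ∀ x k, 0 < k → (n₁ x k : ℝ) = k * (l (scaled x k) + c) + D * θ x k)
    {f : (Fin (d + 1) → ℝ) → ℂ} (hf : ContDiff ℝ ∞ f) {R : ℕ} (hR : SuppIn R f) {C : ℕ}
    (hC : ∀ y : Fin d → ℝ, (∀ i, |y i| ≤ R) → |l y + c| ≤ C) (J : ℕ) :
    (fun k : ℕ => (k : ℂ)⁻¹ * sliceSum h D n₁ R f k - ∑ i ∈ range (J + 1),
      (k : ℂ) ^ (-(i : ℤ)) * ∑ x ∈ latBox d R k, (h * emWeight D θ i) x k *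
        boundaryFamily f l c (C + R) i (scaled x k))
      =O[atTop] fun k : ℕ => (k : ℝ) ^ ((d : ℤ) - J) := by
  obtain ⟨Ch, hCh⟩ := exists_bound_of_mem_stepAlg hh
  obtain ⟨M, hM0, hM⟩ := exists_bound_of_hasCompactSupport
    (contDiff_partialZero_iterate hf J).continuous (hR.partialZero_iterate J).hasCompactSupport
  obtain ⟨CE, hCE⟩ := exists_bound_of_isPer (hθper.comp fun t => ((emConst J t : ℝ) : ℂ))
  have hCE' : ∀ x k, emConst J (θ x k) ≤ CE := fun x k => by
    have := hCE x k
    rw [norm_real] at this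
    exact (le_abs_self _).trans this
  have hCh0 : 0 ≤ Ch := (norm_nonneg _).trans (hCh 0 0)
  have hCE0 : 0 ≤ CE := (norm_nonneg _).trans (hCE 0 0)
  have hD' : (0 : ℝ) < D := by exact_mod_cast hD
  refine IsBigO.of_bound ((2 * R + 1) ^ d * (Ch * ((C + R + 1) * (CE * M * D ^ J)))) ?_
  filter_upwards [eventually_gt_atTop 0] with k hk
  have hk' : (0 : ℝ) < k := by exact_mod_cast hk
  have hkC : (k : ℂ) ≠ 0 := by exact_mod_cast hk.ne'
  have hDC : (D : ℂ) ≠ 0 := by exact_mod_cast hD.ne'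
  set Ns : ℕ := (C + R + 1) * k with hNs
  set δ : ℝ := D / k with hδ
  have hδ0 : 0 < δ := div_pos hD' hk'
  have hrw : (k : ℂ)⁻¹ * sliceSum h D n₁ R f k - ∑ i ∈ range (J + 1),
      (k : ℂ) ^ (-(i : ℤ)) * ∑ x ∈ latBox d R k, (h * emWeight D θ i) x k *
        boundaryFamily f l c (C + R) i (scaled x k) =
      ∑ x ∈ latBox d R k, (k : ℂ)⁻¹ * (h x k * ((∑ m ∈ range Ns,
        sliceFamily f R (scaled x k) 1 (l (scaled x k) + c + (θ x k + m) * δ)) +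
        ((δ⁻¹ : ℝ) : ℂ) * ∑ i ∈ range (J + 1), ((δ ^ i * emCoeff (θ x k) i : ℝ) : ℂ) *
          sliceFamily f R (scaled x k) i (l (scaled x k) + c))) := by
    rw [sliceSum, mul_sum]
    simp only [mul_sum (latBox d R k)]
    rw [sum_comm, ← sum_sub_distrib]
    refine sum_congr rfl fun x hx => ?_
    have hb := abs_le.1 (hC (scaled x k) (abs_scaled_le hx hk))
    rw [sum_progression_eq (Ns := Ns) hR hk _ hD (hn₁ x k hk) (hθ x k).1]
    · rw [mul_add (h x k), mul_add, sub_eq_add_neg]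
      congr 1
      rw [mul_sum, mul_sum, mul_sum, ← Finset.sum_neg_distrib]
      refine sum_congr rfl fun i _ => ?_
      rw [boundaryFamily_eq hR l c _ i _ (by positivity) (by linarith [hb.1]) hf.continuous]
      simp only [mul_apply, emWeight, hδ, zpow_neg, zpow_natCast]
      push_cast
      rw [div_pow]
      field_simp
    · rw [hNs]
      push_cast
      have : ((C : ℝ) + R + 1) * k * (D / k) = (C + R + 1) * D := by field_simp
      rw [this]
      have : ((C : ℝ) + R + 1) * 1 ≤ (C + R + 1) * D := by
        gcongr
        exact_mod_cast hD
      linarith [hb.1]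
  rw [hrw]
  refine (norm_sum_le _ _).trans ?_
  have hterm : ∀ x ∈ latBox d R k, ‖(k : ℂ)⁻¹ * (h x k * ((∑ m ∈ range Ns,
        sliceFamily f R (scaled x k) 1 (l (scaled x k) + c + (θ x k + m) * δ)) +
        ((δ⁻¹ : ℝ) : ℂ) * ∑ i ∈ range (J + 1), ((δ ^ i * emCoeff (θ x k) i : ℝ) : ℂ) *
          sliceFamily f R (scaled x k) i (l (scaled x k) + c)))‖ ≤
      (k : ℝ)⁻¹ * (Ch * (Ns * (CE * M * δ ^ J))) := by
    intro x hx
    have hb := abs_le.1 (hC (scaled x k) (abs_scaled_le hx hk))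
    rw [norm_mul, norm_mul, norm_inv, Complex.norm_natCast]
    gcongr
    · exact hCh x k
    · refine (em_sum hM0 (hasDerivAt_sliceFamily hf R (scaled x k)) (fun t => hM _) _ (hθ x k) hδ0
        (fun i => sliceFamily_eq_zero hR _ i ?_)).trans ?_
      · rw [hNs, hδ]
        push_cast
        have : ((C : ℝ) + R + 1) * k * (D / k) = (C + R + 1) * D := by field_simp
        rw [this]
        have : ((C : ℝ) + R + 1) * 1 ≤ (C + R + 1) * D := by
          gcongr
          exact_mod_cast hD
        linarith [hb.1]
      · gcongr
        exact hCE' x k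
  refine (sum_le_sum hterm).trans ?_
  rw [Finset.sum_const, card_latBox, nsmul_eq_mul, hNs, hδ, norm_zpow, Real.norm_natCast]
  have h1 : (((2 * R * k + 1) ^ d : ℕ) : ℝ) ≤ ((2 * R + 1) * k) ^ d := by
    push_cast
    gcongr
    have : (1 : ℝ) ≤ k := by exact_mod_cast hk
    nlinarith
  calc _ ≤ ((2 * R + 1) * (k : ℝ)) ^ d * ((k : ℝ)⁻¹ * (Ch * (((C + R + 1) * k : ℕ) *
        (CE * M * (D / k) ^ J)))) := by gcongr
    _ = _ := by
      rw [zpow_sub₀ hk'.ne', zpow_natCast, zpow_natCast, mul_pow, div_pow]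
      push_cast
      field_simp

lemma exists_hasExp_sliceSum (hB : ∀ h ∈ stepAlg d, HasUniformExp h) {h : LatFun d}
    (hh : h ∈ stepAlg d) {D : ℕ} (hD : 0 < D) {θ : (Fin d → ℤ) → ℕ → ℝ} (hθper : IsPer θ)
    (hθ : ∀ x k, θ x k ∈ Set.Icc (0 : ℝ) 1) :
    ∃ D' : ℤ → ℕ, ∀ (l : (Fin d → ℝ) →L[ℝ] ℝ) (c : ℝ) (n₁ : (Fin d → ℤ) → ℕ → ℤ),
      (∀ x k, 0 < k → (n₁ x k : ℝ) = k * (l (scaled x k) + c) + D * θ x k) →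
      ∀ f : (Fin (d + 1) → ℝ) → ℂ, ContDiff ℝ ∞ f → ∀ R : ℕ, SuppIn R f →
        ∃ p, HasExp (-(d + 1 : ℕ)) D' (sliceSum h D n₁ R f) p := by
  have hw : ∀ i, h * emWeight D θ i ∈ stepAlg d := fun i =>
    mul_mem hh (IsPer.mem_stepAlg (hθper.comp fun t => -((D : ℂ)⁻¹ * ((D ^ i * emCoeff t i : ℝ) : ℂ))))
  choose D₀ hD₀ using fun i => hB _ (hw i)
  refine ⟨fun n => ∏ j ∈ range (n - -1 - -(d : ℤ) + 1).toNat, D₀ j (n - -1 - j),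
    fun l c n₁ hn₁ f hf R hR => ?_⟩
  obtain ⟨C, hC⟩ : ∃ C : ℕ, ∀ y : Fin d → ℝ, (∀ i, |y i| ≤ R) → |l y + c| ≤ C := by
    have hK : IsCompact (Set.univ.pi fun _ : Fin d => Set.Icc (-(R : ℝ)) R) :=
      isCompact_univ_pi fun _ => isCompact_Icc
    obtain ⟨C, hC⟩ := hK.exists_bound_of_continuousOn (f := fun y => l y + c) (by fun_prop)
    refine ⟨⌈C⌉₊, fun y hy => ?_⟩
    exact (hC y fun i _ => abs_le.1 (hy i)).trans (Nat.le_ceil C)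
  choose p hp using fun i => hD₀ i _ (contDiff_boundaryFamily hf hR l c (C + R) i) R
    (hR.boundaryFamily l c (C + R) i)
  have h1 := HasExp.series hp d (sliceSum_sub_le hh hD hθper hθ l c hn₁ hf hR hC)
  have h2 := h1.zpow_mul (-1)
  rw [show (-(d : ℤ) + -1) = -(d + 1 : ℕ) by push_cast; ring] at h2
  refine ⟨_, h2.congr ?_⟩
  filter_upwards [eventually_gt_atTop 0] with k hk
  have hkC : (k : ℂ) ≠ 0 := by exact_mod_cast hk.ne'
  simp [hkC]

end LatticeSums

section LatticeSums

variable {d : ℕ}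

lemma sum_latBox_succ {R k : ℕ} (F : (Fin (d + 1) → ℤ) → ℂ) :
    ∑ x ∈ latBox (d + 1) R k, F x =
      ∑ x ∈ latBox d R k, ∑ n ∈ Icc (-(R * k : ℤ)) (R * k), F (cons n x) := by
  rw [← Finset.sum_product']
  refine Finset.sum_nbij' (fun x => (tail x, x 0)) (fun q => cons q.2 q.1) ?_ ?_ ?_ ?_ ?_
  · intro x hx
    simp only [latBox, Fintype.mem_piFinset, Finset.mem_product, tail] at hx ⊢
    exact ⟨fun i => hx _, hx 0⟩
  · rintro ⟨x, n⟩ hx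
    simp only [latBox, Fintype.mem_piFinset, Finset.mem_product] at hx ⊢
    intro i
    refine Fin.cases ?_ (fun i => ?_) i
    · simpa using hx.2
    · simpa using hx.1 i
  · intro x _; exact Fin.cons_self_tail x
  · rintro ⟨x, n⟩ _; simp
  · intro x _; rw [Fin.cons_self_tail]

lemma scaled_cons (n : ℤ) (x : Fin d → ℤ) (k : ℕ) :
    scaled (cons n x) k = cons ((n : ℝ) / k) (scaled x k) := by
  funext i
  refine Fin.cases ?_ (fun i => ?_) i <;> simp [scaled]

/-- The function that cuts out a residue class of `x₀`. -/
def residueTerm (h : LatFun d) (D : ℕ) (r : ℤ) (J : LatFun (d + 1)) :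
    LatFun (d + 1) :=
  fun x k => h (tail x) k * ((if x 0 ≡ r [ZMOD D] then 1 else 0) * J x k)

lemma residueTerm_sum_eq {h : LatFun d} {D : ℕ} {r : ℤ}
    {J : LatFun (d + 1)} {R k : ℕ} {f : (Fin (d + 1) → ℝ) → ℂ}
    {n₁ : (Fin d → ℤ) → ℕ → ℤ} (hn₁ : ∀ x n, n ∈ Icc (-(R * k : ℤ)) (R * k) →
      (if n ≡ r [ZMOD D] then 1 else 0) * J (cons n x) k =
        if n ≡ n₁ x k [ZMOD D] ∧ n₁ x k ≤ n then 1 else 0) :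
    ∑ x ∈ latBox (d + 1) R k, residueTerm h D r J x k * f (scaled x k) =
      sliceSum h D n₁ R f k := by
  rw [sum_latBox_succ, sliceSum]
  refine sum_congr rfl fun x _ => ?_
  rw [mul_sum]
  refine sum_congr rfl fun n hn => ?_
  rw [residueTerm, Fin.cons_zero, Fin.tail_cons, hn₁ x n hn, scaled_cons]
  split_ifs <;> simp

lemma hasUniformExp_residueTerm_one (hB : ∀ h ∈ stepAlg d, HasUniformExp h)
    {h : LatFun d} (hh : h ∈ stepAlg d) {D : ℕ} (hD : 0 < D) {r : ℤ} (hr : 0 ≤ r)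
    (hrD : r < D) : HasUniformExp (residueTerm h D r 1) := by
  have hD' : (0 : ℝ) < D := by exact_mod_cast hD
  obtain ⟨D', hD'⟩ := exists_hasExp_sliceSum hB hh hD (θ := fun _ _ => (r : ℝ) / D)
    ⟨1, one_pos, fun _ _ _ _ => rfl⟩ (fun _ _ => ⟨by positivity, by
      rw [div_le_one hD']; exact_mod_cast hrD.le⟩)
  refine ⟨D', fun f hf R hR => ?_⟩
  obtain ⟨p, hp⟩ := hD' 0 (-(D * (R + 1))) (fun _ k => r - D * ((R + 1) * k))
    (fun x k hk => by push_cast; simp; field_simp; ring) f hf R hR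
  refine ⟨p, hp.congr ?_⟩
  filter_upwards [eventually_gt_atTop 0] with k hk
  refine (residueTerm_sum_eq fun x n hn => ?_).symm
  have h1 : r - D * ((R + 1) * k) ≡ r [ZMOD D] := by simp [Int.ModEq]
  have h2 : r - D * ((R + 1) * k) ≤ n := by
    rw [mem_Icc] at hn
    have hk' : (1 : ℤ) ≤ k := by exact_mod_cast hk
    have hD1 : (1 : ℤ) ≤ D := by exact_mod_cast hD
    have h3 : (R * k : ℤ) ≤ D * (R * k) := le_mul_of_one_le_left (by positivity) hD1
    have h4 : (D : ℤ) ≤ D * k := le_mul_of_one_le_right (by positivity) hk'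
    linarith [hn.1, show (D : ℤ) * ((R + 1) * k) = D * (R * k) + D * k by ring]
  have h3 : (n ≡ r - D * ((R + 1) * k) [ZMOD D] ∧ r - D * ((R + 1) * k) ≤ n) ↔ n ≡ r [ZMOD D] :=
    ⟨fun h => h.1.trans h1, fun h => ⟨h.trans h1.symm, h2⟩⟩
  simp only [h3, Pi.one_apply, mul_one]

lemma linForm_per (a : Fin d → ℤ) (b : ℤ) (N : ℕ) (x y : Fin d → ℤ) (k j : ℕ) :
    linForm a b (x + (N : ℤ) • y) (k + N * j) = linForm a b x k + N * linForm a b y j := by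
  simp only [linForm, Pi.add_apply, Pi.smul_apply, smul_eq_mul, mul_add, sum_add_distrib,
    mul_sum]
  push_cast
  rw [mul_add, sum_congr rfl fun i _ => show a i * (N * y i) = N * (a i * y i) by ring]
  ring

lemma linForm_scaled (a : Fin d → ℤ) (b : ℤ) (x : Fin d → ℤ) {k : ℕ} (hk : 0 < k) :
    (linForm a b x k : ℝ) = k * (∑ i, (a i : ℝ) * scaled x k i + b) := by
  have hk' : (k : ℝ) ≠ 0 := by positivity
  simp only [linForm, scaled]
  push_cast
  rw [mul_add, mul_sum, mul_comm (b : ℝ)]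
  congr 1
  exact sum_congr rfl fun i _ => by field_simp

lemma hasUniformExp_residueTerm_lowerInd (hB : ∀ h ∈ stepAlg d, HasUniformExp h)
    {h : LatFun d} (hh : h ∈ stepAlg d) {D : ℕ} (hD : 0 < D) (r : ℤ)
    {a s : ℤ} (ha : 0 < a) (hs : s = 0 ∨ s = 1) (a' : Fin d → ℤ) (b : ℤ) :
    HasUniformExp (residueTerm h D r (lowerInd a s a' b)) := by
  have hD' : (0 : ℤ) < D := by exact_mod_cast hD
  have haD : 0 < a * D := mul_pos ha hD'
  set θ : (Fin d → ℤ) → ℕ → ℝ := fun x k =>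
    (((linForm a' b x k + a * r - s) % (a * D) + s : ℤ) : ℝ) / ((a * D : ℤ) : ℝ) with hθ
  have hθper : IsPer θ := by
    lift a to ℕ using ha.le
    have ha0 : 0 < a := by exact_mod_cast ha
    refine ⟨a * D, Nat.mul_pos ha0 hD, fun x y k j => ?_⟩
    simp only [hθ, linForm_per]
    congr 3
    rw [show linForm a' b x k + ((a * D : ℕ) : ℤ) * linForm a' b y j + a * r - s =
      linForm a' b x k + a * r - s + (a * D : ℤ) * linForm a' b y j by push_cast; ring]
    exact Int.add_mul_emod_self_left _ _ _
  have hθI : ∀ x k, θ x k ∈ Set.Icc (0 : ℝ) 1 := by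
    intro x k
    have h1 := Int.emod_nonneg (linForm a' b x k + a * r - s) haD.ne'
    have h2 := Int.emod_lt_of_pos (linForm a' b x k + a * r - s) haD
    have h3 : (0 : ℝ) < ((a * D : ℤ) : ℝ) := by exact_mod_cast haD
    constructor
    · exact div_nonneg (by exact_mod_cast (by omega)) h3.le
    · rw [hθ, div_le_one h3]
      exact_mod_cast (by omega)
  obtain ⟨D', hD''⟩ := exists_hasExp_sliceSum hB hh hD hθper hθI
  refine ⟨D', fun f hf R hR => ?_⟩
  let l : (Fin d → ℝ) →L[ℝ] ℝ :=
    -((a : ℝ)⁻¹ • ∑ i, (a' i : ℝ) • proj (R := ℝ) (φ := fun _ : Fin d => ℝ) i)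
  have hl : ∀ y, l y = -((a : ℝ)⁻¹ * ∑ i, (a' i : ℝ) * y i) := fun y => by simp [l]
  obtain ⟨p, hp⟩ := hD'' l (-((a : ℝ)⁻¹ * b))
    (fun x k => r - D * ((linForm a' b x k + a * r - s) / (a * D))) (fun x k hk => by
      have h1 := Int.emod_add_mul_ediv (linForm a' b x k + a * r - s) (a * D)
      have h2 : (((linForm a' b x k + a * r - s) % (a * D) : ℤ) : ℝ) =
          linForm a' b x k + a * r - s - a * D * ((linForm a' b x k + a * r - s) / (a * D) : ℤ) := by
        have : (linForm a' b x k + a * r - s) % (a * D) = (linForm a' b x k + a * r - s) -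
          a * D * ((linForm a' b x k + a * r - s) / (a * D)) := by linarith
        rw [this]; push_cast; ring
      have ha' : (a : ℝ) ≠ 0 := by exact_mod_cast ha.ne'
      have hDr : (D : ℝ) ≠ 0 := by positivity
      simp only [hθ]
      rw [Int.cast_add, h2, hl, linForm_scaled a' b x hk]
      push_cast
      field_simp
      ring) f hf R hR
  refine ⟨p, hp.congr ?_⟩
  filter_upwards [eventually_gt_atTop 0] with k hk
  refine (residueTerm_sum_eq fun x n hn => ?_).symm
  set L := linForm a' b x k with hL
  set q := (L + a * r - s) / (a * D) with hq
  have h1 : r - D * q ≡ r [ZMOD D] := by simp [Int.ModEq]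
  have key : (n ≡ r - D * q [ZMOD D] ∧ r - D * q ≤ n) ↔ (n ≡ r [ZMOD D] ∧ s ≤ a * n + L) := by
    have h2 : n ≡ r - D * q [ZMOD D] ↔ n ≡ r [ZMOD D] := ⟨fun h => h.trans h1, fun h => h.trans h1.symm⟩
    rw [h2]
    refine and_congr_right fun hnr => ?_
    obtain ⟨m, hm⟩ := hnr.symm.dvd
    have hn' : n = r + D * m := by omega
    subst hn'
    have h3 : r - D * q ≤ r + D * m ↔ -m ≤ q := by
      constructor
      · intro h
        have : (D : ℤ) * (-m) ≤ D * q := by linarith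
        exact le_of_mul_le_mul_left this hD'
      · intro h
        have := mul_le_mul_of_nonneg_left h hD'.le
        linarith
    rw [h3, hq, Int.le_ediv_iff_mul_le haD]
    constructor <;> intro h <;> nlinarith
  simp only [key, lowerInd, Fin.cons_zero, Fin.tail_cons]
  by_cases c1 : n ≡ r [ZMOD D] <;> by_cases c2 : s ≤ a * n + L <;> simp [c1, c2, ← hL]

lemma HasExp.of_periodic {ϖ : ℕ → ℂ} {D : ℕ} (hD : 0 < D) (hϖ : ∀ k, ϖ (k + D) = ϖ k) :
    HasExp 0 (fun _ => D) ϖ (fun n k => if n = 0 then ϖ k else 0) where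
  pos := fun _ => hD
  periodic := fun n k => by rw [hϖ]
  eq_zero := fun n hn k => if_neg hn.ne
  isLittleO := fun N => by
    rcases lt_or_ge N 0 with hN | hN
    · obtain ⟨C, hC⟩ := isBigO_one_of_periodic hD hϖ
      rw [Finset.Icc_eq_empty (by omega)]
      have h1 := isBigO_zpow_mul (n := 0) hC
      simp only [zpow_zero, one_mul] at h1
      have h2 : (fun k : ℕ => (1 : ℝ)) =o[atTop] fun k : ℕ => (k : ℝ) ^ (-N) := by
        simpa using zpow_isLittleO (m := 0) (n := -N) (by omega)
      simpa using h1.trans_isLittleO h2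
    · have : ∀ k : ℕ, ϖ k - ∑ n ∈ Icc 0 N, (k : ℂ) ^ (-n) * (if n = 0 then ϖ k else 0) = 0 := by
        intro k
        rw [Finset.sum_eq_single_of_mem 0 (by simpa using hN) (fun n _ hn => by simp [hn])]
        simp
      simp only [this]
      exact isLittleO_zero _ _

lemma exists_periodic_of_mem_stepAlg_zero {h : (Fin 0 → ℤ) → ℕ → ℂ} (hh : h ∈ stepAlg 0) :
    ∃ D : ℕ, 0 < D ∧ ∃ ϖ : ℕ → ℂ, (∀ k, ϖ (k + D) = ϖ k) ∧ ∀ x k, 0 < k → h x k = ϖ k := by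
  induction hh using Algebra.adjoin_induction with
  | mem h hh =>
    rcases hh with ⟨D, hD, hper⟩ | ⟨a, b, rfl⟩
    · refine ⟨D, hD, h 0, fun k => ?_, fun x k _ => by rw [Subsingleton.elim x 0]⟩
      simpa using hper 0 0 k 1
    · refine ⟨1, one_pos, fun _ => if 0 ≤ b then 1 else 0, fun _ => rfl, fun x k hk => ?_⟩
      have : (0 : ℤ) < k := by exact_mod_cast hk
      simp [halfInd, linForm, mul_nonneg_iff_of_pos_right this]
  | algebraMap r => exact ⟨1, one_pos, fun _ => r, fun _ => rfl, fun _ _ _ => rfl⟩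
  | add f g _ _ hf hg =>
    obtain ⟨D, hD, ϖ, hϖ, hf⟩ := hf
    obtain ⟨D', hD', ϖ', hϖ', hg⟩ := hg
    refine ⟨D * D', Nat.mul_pos hD hD', ϖ + ϖ', fun k => ?_, fun x k hk => ?_⟩
    · rw [Pi.add_apply, periodic_mul hϖ, mul_comm, Pi.add_apply, periodic_mul hϖ']
    · rw [Pi.add_apply, Pi.add_apply, hf x k hk, hg x k hk, Pi.add_apply]
  | mul f g _ _ hf hg =>
    obtain ⟨D, hD, ϖ, hϖ, hf⟩ := hf
    obtain ⟨D', hD', ϖ', hϖ', hg⟩ := hg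
    refine ⟨D * D', Nat.mul_pos hD hD', ϖ * ϖ', fun k => ?_, fun x k hk => ?_⟩
    · rw [mul_apply, periodic_mul hϖ, mul_comm D, mul_apply, periodic_mul hϖ']
    · rw [mul_apply, mul_apply, hf x k hk, hg x k hk, mul_apply]

/-- Lattice sums weighted by step functions have asymptotic expansions. -/
theorem hasUniformExp_of_mem_stepAlg : ∀ (d : ℕ) {h : LatFun d}, h ∈ stepAlg d →
    HasUniformExp h := by
  intro d
  induction d with
  | zero =>
    intro h hh
    obtain ⟨D, hD, ϖ, hϖ, hh⟩ := exists_periodic_of_mem_stepAlg_zero hh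
    refine ⟨fun _ => D, fun f _ R _ => ⟨_, ((HasExp.of_periodic hD hϖ).const_mul (f 0)).congr ?_⟩⟩
    filter_upwards [eventually_gt_atTop 0] with k hk
    have h1 : latBox 0 R k = {0} := by
      ext x
      rw [Subsingleton.elim x 0]
      simpa [latBox] using Subsingleton.elim _ _
    rw [h1, Finset.sum_singleton, hh 0 k hk, Subsingleton.elim (scaled 0 k) 0, mul_comm]
  | succ d ih =>
    intro h hh
    refine HasUniformExp.of_mem_span ?_ (stepAlg_le_span_sliceGen hh)
    rintro _ ⟨h, hh, D, ϖ, hD, hϖ, J, hJ, rfl⟩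
    have hD' : (0 : ℤ) < D := by exact_mod_cast hD
    have hres : ∀ r ∈ Ico (0 : ℤ) D, HasUniformExp (residueTerm h D r J) := by
      intro r hr
      rw [mem_Ico] at hr
      rcases hJ with rfl | ⟨a, s, a', b, ha, hs, rfl⟩
      · exact hasUniformExp_residueTerm_one (fun h hh => ih hh) hh hD hr.1 hr.2
      · exact hasUniformExp_residueTerm_lowerInd (fun h hh => ih hh) hh hD r ha hs a' b
    have e : (fun x k => h (tail x) k * ϖ (x 0) * J x k) =
        ∑ r ∈ Ico (0 : ℤ) D, ϖ r • residueTerm h D r J := by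
      funext x k
      have hmem : x 0 % D ∈ Ico (0 : ℤ) D := by
        rw [mem_Ico]
        exact ⟨Int.emod_nonneg _ hD'.ne', Int.emod_lt_of_pos _ hD'⟩
      have hϖ' : ϖ (x 0) = ϖ (x 0 % D) := by
        have hp : Function.Periodic ϖ (D : ℤ) := hϖ
        conv_lhs => rw [← Int.emod_add_mul_ediv (x 0) D, mul_comm (D : ℤ)]
        exact hp.int_mul _ _
      simp only [Finset.sum_apply, Pi.smul_apply, residueTerm, smul_eq_mul]
      rw [Finset.sum_eq_single_of_mem _ hmem]
      · rw [if_pos (Int.mod_modEq _ _).symm, hϖ']; ring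
      · intro r hr hne
        rw [if_neg, zero_mul, mul_zero, mul_zero]
        intro hc
        rw [mem_Ico] at hr
        exact hne (by rw [hc.eq, Int.emod_eq_of_lt hr.1 hr.2])
    rw [e]
    refine HasUniformExp.of_mem_span (S := {f | HasUniformExp f}) (fun f hf => hf)
      (Submodule.sum_mem _ fun r hr => smul_mem _ _ (subset_span (hres r hr)))

end LatticeSums

section QuasiPolynomialSums

variable {d : ℕ}

/-- The sums `∑ F(x, k) f(x / k)` have an asymptotic expansion, whose order and periods do not
depend on `f`. -/
def HasLatticeExp (F : LatFun d) : Prop :=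
  ∃ (n₀ : ℤ) (D : ℤ → ℕ), ∀ f : (Fin d → ℝ) → ℂ, ContDiff ℝ ∞ f → ∀ R : ℕ, SuppIn R f →
    ∃ p, HasExp n₀ D (fun k => ∑ x ∈ latBox d R k, F x k * f (scaled x k)) p

/-- Products of a power of `k`, a smooth function of `x / k` and a step function. -/
def quasiGen (d : ℕ) : Set (LatFun d) :=
  {F | ∃ (e : ℕ) (g : (Fin d → ℝ) → ℂ), ContDiff ℝ ∞ g ∧ ∃ h ∈ stepAlg d,
    F = fun x (k : ℕ) => (k : ℂ) ^ e * g (scaled x k) * h x k}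

lemma mem_quasiGen_of_mem_stepAlg {h : LatFun d} (hh : h ∈ stepAlg d) :
    h ∈ quasiGen d := ⟨0, fun _ => 1, contDiff_const, h, hh, by simp⟩

/-- The algebra of finite sums of such products. -/
def quasiAlg (d : ℕ) : Subalgebra ℂ (LatFun d) :=
  (span ℂ (quasiGen d)).toSubalgebra
    (subset_span (mem_quasiGen_of_mem_stepAlg (one_mem _))) (by
      intro F₁ F₂ h₁ h₂
      have h := Submodule.mul_mem_mul h₁ h₂
      rw [Submodule.span_mul_span] at h
      refine Submodule.span_mono ?_ h
      rintro _ ⟨_, ⟨e, g, hg, h, hh, rfl⟩, _, ⟨e', g', hg', h', hh', rfl⟩, rfl⟩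
      refine ⟨e + e', _, hg.mul hg', _, mul_mem hh hh', ?_⟩
      funext x k
      simp only [mul_apply, pow_add]
      ring)

lemma quasiGen_subset {F : LatFun d} (hF : F ∈ quasiGen d) : F ∈ quasiAlg d :=
  subset_span hF

lemma stepAlg_le_quasiAlg {h : LatFun d} (hh : h ∈ stepAlg d) : h ∈ quasiAlg d :=
  quasiGen_subset (mem_quasiGen_of_mem_stepAlg hh)

lemma HasLatticeExp.add {F F' : LatFun d} (hF : HasLatticeExp F)
    (hF' : HasLatticeExp F') : HasLatticeExp (F + F') := by
  obtain ⟨n₀, D, hD⟩ := hF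
  obtain ⟨n₀', D', hD'⟩ := hF'
  refine ⟨min n₀ n₀', fun n => D n * D' n, fun φ hφ R hR => ?_⟩
  obtain ⟨p, hp⟩ := hD φ hφ R hR
  obtain ⟨q, hq⟩ := hD' φ hφ R hR
  have hpos : ∀ n, 0 < D n * D' n := fun n => Nat.mul_pos (hp.pos n) (hq.pos n)
  refine ⟨_, (((hp.mono_bound (min_le_left _ _)).mono_period hpos fun n => dvd_mul_right _ _).add
    ((hq.mono_bound (min_le_right _ _)).mono_period hpos fun n => dvd_mul_left _ _)).congr
      (of_forall fun k => ?_)⟩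
  rw [← sum_add_distrib]
  exact sum_congr rfl fun x _ => by simp [add_mul]

lemma HasLatticeExp.of_mem_quasiAlg {F : LatFun d} (hF : F ∈ quasiAlg d) :
    HasLatticeExp F := by
  change F ∈ span ℂ (quasiGen d) at hF
  induction hF using span_induction with
  | mem F hF =>
    obtain ⟨e, g, hg, h, hh, rfl⟩ := hF
    obtain ⟨D, hD⟩ := hasUniformExp_of_mem_stepAlg d hh
    refine ⟨-d + -e, fun n => D (n - -e), fun f hf R hR => ?_⟩
    obtain ⟨p, hp⟩ := hD _ (hg.mul hf) R fun y hy => hR y (right_ne_zero_of_mul hy)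
    refine ⟨_, (hp.zpow_mul (-e)).congr (of_forall fun k => ?_)⟩
    rw [neg_neg, zpow_natCast, mul_sum]
    exact sum_congr rfl fun x _ => by ring
  | zero =>
    exact ⟨0, fun _ => 1, fun _ _ _ _ => ⟨_, (HasExp.zero fun _ => one_pos).congr
      (of_forall fun k => by simp)⟩⟩
  | add f g _ _ hf hg => exact hf.add hg
  | smul c f _ hf =>
    obtain ⟨n₀, D, hD⟩ := hf
    refine ⟨n₀, D, fun φ hφ R hR => ?_⟩
    obtain ⟨p, hp⟩ := hD φ hφ R hR
    refine ⟨_, (hp.const_mul c).congr (of_forall fun k => ?_)⟩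
    rw [mul_sum]
    exact sum_congr rfl fun x _ => by simp [mul_assoc]

open Classical in
/-- The indicator function of a predicate. -/
def stepInd (p : (Fin d → ℤ) → ℕ → Prop) (x : Fin d → ℤ) (k : ℕ) : ℂ := if p x k then 1 else 0

lemma stepInd_not_mem {p : (Fin d → ℤ) → ℕ → Prop} (hp : stepInd p ∈ stepAlg d) :
    stepInd (fun x k => ¬ p x k) ∈ stepAlg d := by
  have : stepInd (fun x k => ¬ p x k) = 1 - stepInd p := by
    funext x k; by_cases h : p x k <;> simp [stepInd, h]
  rw [this]; exact sub_mem (one_mem _) hp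

lemma stepInd_and_mem {p q : (Fin d → ℤ) → ℕ → Prop} (hp : stepInd p ∈ stepAlg d)
    (hq : stepInd q ∈ stepAlg d) : stepInd (fun x k => p x k ∧ q x k) ∈ stepAlg d := by
  have : stepInd (fun x k => p x k ∧ q x k) = stepInd p * stepInd q := by
    funext x k; by_cases h : p x k <;> by_cases h' : q x k <;> simp [stepInd, h, h']
  rw [this]; exact mul_mem hp hq

lemma stepInd_const_mem (p : Prop) : stepInd (fun (_ : Fin d → ℤ) _ => p) ∈ stepAlg d :=
  IsPer.mem_stepAlg ⟨1, one_pos, fun _ _ _ _ => rfl⟩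

lemma stepInd_forall_mem {ι : Type*} (s : Finset ι) {p : ι → (Fin d → ℤ) → ℕ → Prop}
    (hp : ∀ i ∈ s, stepInd (p i) ∈ stepAlg d) : stepInd (fun x k => ∀ i ∈ s, p i x k) ∈ stepAlg d := by
  classical
  induction s using Finset.induction_on with
  | empty => simpa using stepInd_const_mem True
  | insert i s hi ih =>
    have := stepInd_and_mem (hp i (Finset.mem_insert_self i s))
      (ih fun i hi => hp i (Finset.mem_insert_of_mem hi))
    simpa [Finset.forall_mem_insert] using this

lemma exists_common_denom (q : Fin d → ℚ) (b : ℚ) :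
    ∃ (N : ℕ) (a : Fin d → ℤ) (b' : ℤ), 0 < N ∧ (∀ i, N * q i = a i) ∧ N * b = b' := by
  have key : ∀ (N : ℕ) (r : ℚ), r.den ∣ N → ∃ z : ℤ, N * r = z := by
    rintro N r ⟨m, rfl⟩
    refine ⟨m * r.num, ?_⟩
    push_cast
    rw [mul_right_comm, mul_comm (r.den : ℚ) r, Rat.mul_den_eq_num, mul_comm]
  refine ⟨b.den * ∏ i, (q i).den, ?_⟩
  choose a ha using fun i => key (b.den * ∏ i, (q i).den) (q i)
    ((Finset.dvd_prod_of_mem _ (mem_univ i)).mul_left _)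
  obtain ⟨b', hb'⟩ := key (b.den * ∏ i, (q i).den) b (dvd_mul_right _ _)
  exact ⟨a, b', Nat.mul_pos b.pos (prod_pos fun i _ => (q i).pos), ha, hb'⟩

lemma exists_linForm_eq (q : Fin d → ℚ) (b : ℚ) : ∃ (N : ℕ) (a : Fin d → ℤ) (b' : ℤ), 0 < N ∧
    ∀ x k, (linForm a b' x k : ℝ) = N * (∑ i, (q i : ℝ) * x i + b * k) := by
  obtain ⟨N, a, b', hN, ha, hb⟩ := exists_common_denom q b
  refine ⟨N, a, b', hN, fun x k => ?_⟩
  have ha' : ∀ i, (a i : ℝ) = N * q i := fun i => by exact_mod_cast (ha i).symm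
  have hb'' : (b' : ℝ) = N * b := by exact_mod_cast hb.symm
  rw [linForm]
  push_cast
  rw [hb'', sum_congr rfl fun i _ => by rw [ha' i], mul_add, mul_sum]
  simp only [mul_assoc]

lemma stepInd_le_mem (q : Fin d → ℚ) (b : ℚ) :
    stepInd (fun x k => 0 ≤ ∑ i, (q i : ℝ) * x i + b * k) ∈ stepAlg d := by
  obtain ⟨N, a, b', hN, h⟩ := exists_linForm_eq q b
  have hN' : (0 : ℝ) < N := by exact_mod_cast hN
  convert halfInd_mem_stepAlg a b' using 1
  funext x k
  rw [stepInd, halfInd, ← mul_nonneg_iff_of_pos_left hN', ← h, Int.cast_nonneg_iff]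
  congr

lemma stepInd_lt_mem (q : Fin d → ℚ) (b : ℚ) :
    stepInd (fun x k => 0 < ∑ i, (q i : ℝ) * x i + b * k) ∈ stepAlg d := by
  obtain ⟨N, a, b', hN, h⟩ := exists_linForm_eq q b
  have hN' : (0 : ℝ) < N := by exact_mod_cast hN
  convert strictInd_mem_stepAlg a b' using 1
  funext x k
  rw [stepInd, ← mul_pos_iff_of_pos_left hN', ← h, Int.cast_pos]
  congr

lemma stepInd_eq_zero_mem (q : Fin d → ℚ) :
    stepInd (fun x _ => ∑ i, (q i : ℝ) * x i = 0) ∈ stepAlg d := by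
  have := stepInd_and_mem (stepInd_le_mem q 0) (stepInd_le_mem (-q) 0)
  convert this using 3 with x k
  simp [le_antisymm_iff, and_comm]

end QuasiPolynomialSums

section Barrelled

open ContDiffMapSupportedIn

variable {V F : Type*} [NormedAddCommGroup V] [NormedSpace ℝ V] [NormedAddCommGroup F]
  [NormedSpace ℝ F] {K : Compacts V}

lemma isUniformInducing_structureMap :
    IsUniformInducing (ContinuousLinearMap.pi (structureMapCLM ℝ ⊤) :
      𝓓_{K}(V, F) →L[ℝ] Π i, BoundedContinuousFunction V (V [×i]→L[ℝ] F)) :=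
  isUniformEmbedding_pi_structureMapCLM ℝ |>.isUniformInducing

instance : (uniformity 𝓓_{K}(V, F)).IsCountablyGenerated := by
  rw [← (isUniformInducing_structureMap (K := K) (V := V) (F := F)).comap_uniformity]
  infer_instance

lemma hasFTaylorSeriesUpTo_of_tendstoUniformly {u : ℕ → V → F} (hu : ∀ n, ContDiff ℝ ∞ (u n))
    {g : ∀ i, V → V [×i]→L[ℝ] F} (hg : ∀ i, Continuous (g i))
    (hunif : ∀ i, TendstoUniformly (fun n x => iteratedFDeriv ℝ i (u n) x) (g i) atTop) :
    HasFTaylorSeriesUpTo ∞ (fun x => g 0 x 0) fun x i => g i x := by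
  refine ⟨fun x => congrArg (g 0 x) (Subsingleton.elim _ _), fun i _ x => ?_, fun i _ => hg i⟩
  let e := continuousMultilinearCurryLeftEquiv ℝ (fun _ : Fin (i + 1) => V) F
  have h2 : TendstoUniformly (fun n x => e (iteratedFDeriv ℝ (i + 1) (u n) x))
      (fun x => e (g (i + 1) x)) atTop :=
    e.isometry.uniformContinuous.comp_tendstoUniformly (hunif (i + 1))
  refine hasFDerivAt_of_tendstoUniformly h2 (fun n x => ?_) (fun x => (hunif i).tendsto_at x) x
  exact (contDiff_iff_ftaylorSeries.1 (hu n)).fderiv i (by exact_mod_cast WithTop.coe_lt_top i) x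

instance [CompleteSpace F] : CompleteSpace 𝓓_{K}(V, F) := by
  refine UniformSpace.complete_of_cauchySeq_tendsto fun u hu => ?_
  obtain ⟨g, hg⟩ := cauchySeq_tendsto_of_complete
    (isUniformInducing_structureMap.uniformContinuous.comp_cauchySeq hu)
  rw [tendsto_pi_nhds] at hg
  have hunif : ∀ i, TendstoUniformly (fun n x => iteratedFDeriv ℝ i (u n) x) (g i) atTop := by
    intro i
    have := BoundedContinuousFunction.tendsto_iff_tendstoUniformly.1 (hg i)
    simpa only [Function.comp_apply, ContinuousLinearMap.coe_pi', structureMapCLM_top_apply] using this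
  have hf := hasFTaylorSeriesUpTo_of_tendstoUniformly (fun n => (u n).contDiff)
    (fun i => (g i).continuous) hunif
  have hsupp : Set.EqOn (fun x => g 0 x 0) 0 (K : Set V)ᶜ := by
    intro x hx
    have h1 := (hunif 0).tendsto_at x
    have h2 : ∀ n, iteratedFDeriv ℝ 0 (u n) x = 0 := fun n => by
      ext; simpa using (u n).zero_on_compl hx
    simp only [h2] at h1
    simp [tendsto_nhds_unique h1 tendsto_const_nhds]
  let v : 𝓓_{K}(V, F) := ⟨_, hf.contDiff, hsupp⟩
  refine ⟨v, ?_⟩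
  rw [(isUniformInducing_structureMap (K := K) (V := V) (F := F)).isInducing.tendsto_nhds_iff,
    tendsto_pi_nhds]
  intro i
  have : structureMapCLM ℝ ⊤ i v = g i := by
    ext1 x
    rw [structureMapCLM_top_apply]
    exact (hf.eq_iteratedFDeriv (m := i) (by exact_mod_cast le_top) x).symm
  change Tendsto _ _ (nhds (structureMapCLM ℝ ⊤ i v))
  rw [this]
  exact hg i

/-- A pointwise bounded sequence of functionals is equicontinuous. -/
lemma exists_uniform_bound {ι : Type*} (A : ι → 𝓓_{K}(V, ℝ) →L[ℝ] ℂ)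
    (hA : ∀ f, ∃ C, ∀ i, ‖A i f‖ ≤ C) : ∃ (s : Finset ℕ) (C : ℝ), 0 ≤ C ∧ ∀ i f,
      ‖A i f‖ ≤ C * (s.sup fun j => ContDiffMapSupportedIn.seminorm ℝ V ℝ ⊤ K j) f := by
  let p : ι → Seminorm ℝ 𝓓_{K}(V, ℝ) := fun i => (normSeminorm ℝ ℂ).comp (A i).toLinearMap
  have hbdd : BddAbove (Set.range p) := by
    rw [Seminorm.bddAbove_range_iff]
    intro f
    obtain ⟨C, hC⟩ := hA f
    exact ⟨C, by rintro _ ⟨i, rfl⟩; exact hC i⟩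
  have hp : Continuous (⨆ i, p i : Seminorm ℝ 𝓓_{K}(V, ℝ)) := by
    rw [Seminorm.coe_iSup_eq hbdd]
    exact Seminorm.continuous_iSup p (fun i => (A i).continuous.norm) hbdd
  obtain ⟨s, C, -, h⟩ := Seminorm.bound_of_continuous (ContDiffMapSupportedIn.withSeminorms ℝ V ℝ ⊤ K) _ hp
  refine ⟨s, C, C.2, fun i f => ?_⟩
  exact (show p i f ≤ (⨆ i, p i : Seminorm ℝ 𝓓_{K}(V, ℝ)) f from le_ciSup hbdd i f).trans (h f)

end Barrelled

section

variable {E : Type*} [NormedAddCommGroup E] [NormedSpace ℝ E] {G : Type*} [TopologicalSpace G]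
  [ChartedSpace E G] [Group G] [LieGroup 𝓘(ℝ, E) ∞ G] [IsTopologicalGroup G]
local notation "𝓔" => 𝓘(ℝ, E)
local notation "𝓛" => mulInvariantVectorField (I := 𝓘(ℝ, E)) (G := G)

variable (E G) in
/-- The chart at the identity. -/
def oneChart : PartialEquiv G E := extChartAt 𝓔 (1 : G)

local notation "κ" => oneChart E G

variable (E G) in
/-- The multiplication in the chart at the identity. -/
def chartMul (z : E × E) : E :=
  κ ((κ).symm z.1 * (κ).symm z.2)

variable (E G) in
/-- The conjugation in the chart at the identity. -/
def chartConj (z : E × E) : E :=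
  κ ((κ).symm z.1 * (κ).symm z.2 * ((κ).symm z.1)⁻¹)

lemma oneChart_symm_oneChart_one : (κ).symm (κ 1) = 1 :=
  extChartAt_to_inv (I := 𝓔) (1 : G)

lemma oneChart_target_mem_nhds : (κ).target ∈ nhds (κ 1) :=
  extChartAt_target_mem_nhds (I := 𝓔) (1 : G)

lemma oneChart_source_mem_nhds : (κ).source ∈ nhds (1 : G) :=
  extChartAt_source_mem_nhds (I := 𝓔) (1 : G)

lemma continuousAt_oneChart : ContinuousAt κ (1 : G) :=
  continuousAt_extChartAt (I := 𝓔) (1 : G)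

lemma continuousAt_oneChart_symm : ContinuousAt (κ).symm (κ (1 : G)) :=
  continuousAt_extChartAt_symm (I := 𝓔) (1 : G)

lemma contMDiffAt_oneChart_symm :
    ContMDiffAt 𝓔 𝓔 ∞ (κ).symm (κ 1) :=
  (contMDiffOn_extChartAt_symm (n := ∞) (I := 𝓔) (1 : G)).contMDiffAt
    oneChart_target_mem_nhds

lemma contMDiffAt_oneChart :
    ContMDiffAt 𝓔 𝓔 ∞ κ (1 : G) :=
  contMDiffAt_extChartAt (I := 𝓔)

lemma contMDiffAt_oneChart_symm_prod :
    ContMDiffAt 𝓘(ℝ, E × E) 𝓔 ∞ (fun z : E × E => (κ).symm z.1) (κ 1, κ 1) ∧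
    ContMDiffAt 𝓘(ℝ, E × E) 𝓔 ∞ (fun z : E × E => (κ).symm z.2) (κ 1, κ 1) :=
  ⟨ContMDiffAt.comp (I' := 𝓔) (κ 1, κ 1) contMDiffAt_oneChart_symm
    (contMDiffAt_iff_contDiffAt.2 contDiffAt_fst),
  ContMDiffAt.comp (I' := 𝓔) (κ 1, κ 1) contMDiffAt_oneChart_symm
    (contMDiffAt_iff_contDiffAt.2 contDiffAt_snd)⟩

lemma eventually_differentiableAt {f : E × E → E} (hf : ContDiffAt ℝ ∞ f (κ 1, κ 1)) :
    ∀ᶠ x in nhds (κ 1), DifferentiableAt ℝ f (x, κ 1) ∧ DifferentiableAt ℝ f (κ 1, x) := by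
  have h := ((hf.of_le (m := 1) (by simp)).eventually (by simp)).mono fun _ h =>
    h.differentiableAt one_ne_zero
  exact (((Continuous.prodMk_left (κ 1)).tendsto _).eventually h).and
    (((Continuous.prodMk_right (κ 1)).tendsto _).eventually h)

lemma contDiffAt_chartMul :
    ContDiffAt ℝ ∞ (chartMul E G) (κ 1, κ 1) := by
  rw [← contMDiffAt_iff_contDiffAt]
  obtain ⟨h1, h2⟩ := contMDiffAt_oneChart_symm_prod (E := E) (G := G)
  have h3 := h1.mul h2
  refine ContMDiffAt.comp (I' := 𝓔) _ ?_ h3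
  simp only [oneChart_symm_oneChart_one, mul_one]
  exact contMDiffAt_oneChart

lemma contDiffAt_chartConj :
    ContDiffAt ℝ ∞ (chartConj E G) (κ 1, κ 1) := by
  rw [← contMDiffAt_iff_contDiffAt]
  obtain ⟨h1, h2⟩ := contMDiffAt_oneChart_symm_prod (E := E) (G := G)
  have h3 := (h1.mul h2).mul h1.inv
  refine ContMDiffAt.comp (I' := 𝓔) _ ?_ h3
  simp only [oneChart_symm_oneChart_one, mul_one, inv_one]
  exact contMDiffAt_oneChart

lemma chartMul_one_right {x : E} (hx : x ∈ (κ).target) :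
    chartMul E G (x, κ 1) = x := by
  simp [chartMul, oneChart_symm_oneChart_one, (κ).right_inv hx]

lemma chartMul_one_left {x : E} (hx : x ∈ (κ).target) :
    chartMul E G (κ 1, x) = x := by
  simp [chartMul, oneChart_symm_oneChart_one, (κ).right_inv hx]

lemma chartConj_one_right (x : E) :
    chartConj E G (x, κ 1) = κ 1 := by
  simp [chartConj, oneChart_symm_oneChart_one]

lemma Ad_eq_fderiv (g : G) :
    Ad g = fderiv ℝ (fun y => κ (g * (κ).symm y * g⁻¹)) (κ 1) := by
  have hd : MDifferentiableAt 𝓔 𝓔 (fun x : G => g * x * g⁻¹) 1 := by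
    have : ContMDiff 𝓔 𝓔 ∞ (fun x : G => g * x * g⁻¹) :=
      (contMDiff_const.mul contMDiff_id).mul contMDiff_const
    exact (this 1).mdifferentiableAt (by simp)
  refine Eq.trans (b := fderivWithin ℝ (writtenInExtChartAt 𝓔 𝓔 1
    fun x : G => g * x * g⁻¹) (Set.range 𝓔) (extChartAt 𝓔 (1 : G) 1)) hd.mfderiv ?_
  have h1 : g * 1 * g⁻¹ = 1 := by simp
  simp only [writtenInExtChartAt, h1, modelWithCornersSelf_coe, Set.range_id, fderivWithin_univ]
  rfl

/-- In the chart at the identity, the adjoint representation is a partial derivative of the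
conjugation. -/
lemma eventually_Ad_eq :
    ∀ᶠ x in nhds (κ 1), Ad ((κ).symm x) =
      (fderiv ℝ (chartConj E G) (x, κ 1)).comp (inr ℝ E E) := by
  filter_upwards [eventually_differentiableAt (contDiffAt_chartConj (G := G))] with x hx
  rw [Ad_eq_fderiv]
  exact (hx.1.hasFDerivAt.comp (κ 1) (hasFDerivAt_prodMk_right x (κ 1))).fderiv

lemma contDiffAt_Ad_chart :
    ContDiffAt ℝ ∞ (fun x : E => (Ad ((κ).symm x) : E →L[ℝ] E)) (κ 1) := by
  have h1 : ContDiffAt ℝ ∞ (fun x : E => (fderiv ℝ (chartConj E G) (x, κ 1)).comp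
      (inr ℝ E E)) (κ 1) := by
    have h2 : ContDiffAt ℝ ∞ (fderiv ℝ (chartConj E G)) (κ 1, κ 1) :=
      (contDiffAt_chartConj (E := E) (G := G)).fderiv_right (m := ∞) (by simp)
    have h3 : ContDiffAt ℝ ∞ (fun x : E => (x, κ 1)) (κ 1) :=
      contDiffAt_id.prodMk contDiffAt_const
    exact ContDiffAt.clm_comp (ContDiffAt.comp (f := fun x : E => (x, κ (1 : G)))
      (κ 1) h2 h3) contDiffAt_const
  exact h1.congr_of_eventuallyEq eventually_Ad_eq

/-- The left invariant vector field in the chart at the identity. -/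
lemma eventually_pullback_mulInvariantVectorField (X : E) :
    ∀ᶠ x in nhds (κ 1),
      VectorField.mpullbackWithin 𝓔 𝓔 (κ).symm
        (𝓛 X) (Set.range 𝓔) x =
      fderiv ℝ (chartMul E G) (x, κ 1) (0, X) := by
  filter_upwards [eventually_differentiableAt (contDiffAt_chartMul (G := G)),
    oneChart_target_mem_nhds] with x hx hxt
  have e1 := (hx.1.hasFDerivAt.comp (κ 1)
    (hasFDerivAt_prodMk_right x (κ 1))).fderiv
  set g : G := (κ).symm x with hg
  have hgs : g ∈ (chartAt E (1 : G)).source := by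
    have := (κ).map_target hxt
    rwa [oneChart, extChartAt_source] at this
  have hmul : MDifferentiableAt 𝓔 𝓔 (fun y : G => g * y) 1 :=
    (contMDiff_mul_left (I := 𝓔) (n := ∞) (a := g) 1).mdifferentiableAt (by simp)
  have hch : MDifferentiableAt 𝓔 𝓔 κ (g * 1) := by
    rw [mul_one]
    exact mdifferentiableAt_extChartAt hgs
  have e2 := mfderiv_comp (1 : G) hch hmul
  have e3 : mfderiv 𝓔 𝓔 (κ ∘ fun y : G => g * y) 1 =
      fderiv ℝ (fun y => chartMul E G (x, y)) (κ 1) := by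
    refine Eq.trans (b := fderivWithin ℝ (writtenInExtChartAt 𝓔 𝓔 1
      (κ ∘ fun y : G => g * y)) (Set.range 𝓔) (extChartAt 𝓔 (1 : G) 1))
      (MDifferentiableAt.comp (1 : G) hch hmul).mfderiv ?_
    simp only [writtenInExtChartAt, extChartAt_model_space_eq_id, modelWithCornersSelf_coe,
      Set.range_id, fderivWithin_univ]
    rfl
  have e4 : mfderiv 𝓔 𝓔 κ g
      (𝓛 X g) =
      fderiv ℝ (chartMul E G) (x, κ 1) (0, X) := by
    have := congrArg (fun L : E →L[ℝ] E => L X) ((e2.symm.trans e3).trans e1)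
    refine Eq.trans ?_ this
    simp only [mulInvariantVectorField]
    congr 2
    simp
  rw [← e4, VectorField.mpullbackWithin_apply]
  have e7 := ContinuousLinearMap.inverse_eq
    (mfderivWithin_extChartAt_symm_comp_mfderiv_extChartAt (I := 𝓔) hxt)
    (mfderiv_extChartAt_comp_mfderivWithin_extChartAt_symm (I := 𝓔) hxt)
  exact congrArg (fun L : E →L[ℝ] E =>
    L (𝓛 X g)) e7

variable (E G) in
/-- The second derivative of the multiplication at the identity. -/
def chartHess :
    E × E →L[ℝ] E × E →L[ℝ] E :=
  fderiv ℝ (fderiv ℝ (chartMul E G)) (κ 1, κ 1)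

lemma hasFDerivAt_fderiv_chartMul :
    HasFDerivAt (fderiv ℝ (chartMul E G)) (chartHess E G) (κ 1, κ 1) := by
  have h2 : ContDiffAt ℝ ∞ (fderiv ℝ (chartMul E G)) (κ 1, κ 1) :=
    (contDiffAt_chartMul (E := E) (G := G)).fderiv_right (m := ∞) (by simp)
  exact (h2.differentiableAt (by simp)).hasFDerivAt

lemma chartHess_symm (v w : E × E) : chartHess E G v w = chartHess E G w v := by
  have h := (contDiffAt_chartMul (E := E) (G := G)).isSymmSndFDerivAt
    (by simp only [minSmoothness_of_isRCLikeNormedField]; exact WithTop.coe_le_coe.2 le_top)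
  exact h v w

lemma hasFDerivAt_fderiv_chartMul_left (Y : E) :
    HasFDerivAt (fun x => fderiv ℝ (chartMul E G) (x, κ 1) (0, Y))
      (((chartHess E G).flip (0, Y)).comp (inl ℝ E E)) (κ 1) := by
  have h1 := (hasFDerivAt_fderiv_chartMul (E := E) (G := G)).comp
    (f := fun x : E => (x, κ (1 : G))) (κ 1)
    (hasFDerivAt_prodMk_left (κ 1) (κ 1))
  have h2 := h1.clm_apply (hasFDerivAt_const ((0, Y) : E × E) (κ 1))
  refine h2.congr_fderiv ?_
  ext v
  simp

lemma fderiv_chartMul_right (Y : E) :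
    fderiv ℝ (chartMul E G) (κ 1, κ 1) (0, Y) = Y := by
  have hd : DifferentiableAt ℝ (chartMul E G) (κ 1, κ 1) :=
    contDiffAt_chartMul.differentiableAt (by simp)
  have h1 := hd.hasFDerivAt.comp (κ 1)
    (hasFDerivAt_prodMk_right (κ 1) (κ 1))
  have h2 : HasFDerivAt (chartMul E G ∘ fun y => (κ 1, y))
      (ContinuousLinearMap.id ℝ E) (κ 1) := by
    refine (hasFDerivAt_id _).congr_of_eventuallyEq ?_
    filter_upwards [oneChart_target_mem_nhds] with x hx
    exact chartMul_one_left hx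
  have := congrArg (fun L : E →L[ℝ] E => L Y) (h1.unique h2)
  simpa using this

lemma fderiv_chartMul_left (Y : E) :
    fderiv ℝ (chartMul E G) (κ 1, κ 1) (Y, 0) = Y := by
  have hd : DifferentiableAt ℝ (chartMul E G) (κ 1, κ 1) :=
    contDiffAt_chartMul.differentiableAt (by simp)
  have h1 := hd.hasFDerivAt.comp (f := fun x : E => (x, κ (1 : G))) (κ 1)
    (hasFDerivAt_prodMk_left (κ 1) (κ 1))
  have h2 : HasFDerivAt (chartMul E G ∘ fun y => (y, κ 1))
      (ContinuousLinearMap.id ℝ E) (κ 1) := by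
    refine (hasFDerivAt_id _).congr_of_eventuallyEq ?_
    filter_upwards [oneChart_target_mem_nhds] with x hx
    exact chartMul_one_right hx
  have := congrArg (fun L : E →L[ℝ] E => L Y) (h1.unique h2)
  simpa using this

variable (E G) in
/-- The left invariant vector fields in the chart at the identity. -/
def chartField (X : E) : E → E := fun x =>
  VectorField.mpullbackWithin 𝓔 𝓔 (κ).symm
    (𝓛 X) (Set.range 𝓔) x

lemma mfderiv_oneChart_inverse :
    ContinuousLinearMap.inverse (show E →L[ℝ] E from
      mfderiv 𝓔 𝓔 (extChartAt 𝓔 (1 : G)) 1) = ContinuousLinearMap.id ℝ E := by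
  have : (show E →L[ℝ] E from
      mfderiv 𝓔 𝓔 (extChartAt 𝓔 (1 : G)) 1) = ContinuousLinearMap.id ℝ E := by
    have : IsManifold 𝓔 1 G := IsManifold.of_le (n := ∞) (by simp)
    exact mfderiv_extChartAt_self (I := 𝓔) (x := (1 : G))
  rw [this, ContinuousLinearMap.inverse_id]

lemma bracket_eq_chartHess (X Y : E) :
    bracket G X Y = chartHess E G (X, 0) (0, Y) - chartHess E G (Y, 0) (0, X) := by
  have key : bracket G X Y = ContinuousLinearMap.inverse (show E →L[ℝ] E from
      mfderiv 𝓔 𝓔 (extChartAt 𝓔 (1 : G)) 1)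
    (VectorField.lieBracketWithin ℝ (chartField E G X) (chartField E G Y)
      ((extChartAt 𝓔 (1 : G)).symm ⁻¹' Set.univ ∩ Set.range 𝓔)
      (κ (1 : G))) := rfl
  have hset : (extChartAt 𝓔 (1 : G)).symm ⁻¹' Set.univ ∩ Set.range 𝓔 = Set.univ := by
    simp
  rw [key, mfderiv_oneChart_inverse, hset, VectorField.lieBracketWithin_univ,
    VectorField.lieBracket, id_apply]
  have eX : chartField E G X =ᶠ[nhds (κ 1)]
      fun x => fderiv ℝ (chartMul E G) (x, κ 1) (0, X) :=
    eventually_pullback_mulInvariantVectorField X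
  have eY : chartField E G Y =ᶠ[nhds (κ 1)]
      fun x => fderiv ℝ (chartMul E G) (x, κ 1) (0, Y) :=
    eventually_pullback_mulInvariantVectorField Y
  have eX0 := eX.eq_of_nhds
  have eY0 := eY.eq_of_nhds
  have fX := ((hasFDerivAt_fderiv_chartMul_left (G := G) X).congr_of_eventuallyEq eX).fderiv
  have fY := ((hasFDerivAt_fderiv_chartMul_left (G := G) Y).congr_of_eventuallyEq eY).fderiv
  rw [fderiv_chartMul_right] at eX0 eY0
  rw [eX0, eY0, fX, fY]
  simp

lemma Ad_one : (Ad (1 : G) : E →L[ℝ] E) = ContinuousLinearMap.id ℝ E := by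
  have : (fun x : G => 1 * x * (1 : G)⁻¹) = id := by ext; simp
  unfold Ad
  rw [this]
  exact mfderiv_id

lemma Ad_mul (g h : G) : (Ad (g * h) : E →L[ℝ] E) = (Ad g).comp (Ad h) := by
  have hd : ∀ g x : G, MDifferentiableAt 𝓔 𝓔 (fun x : G => g * x * g⁻¹) x := by
    intro g x
    have : ContMDiff 𝓔 𝓔 ∞ (fun x : G => g * x * g⁻¹) :=
      (contMDiff_const.mul contMDiff_id).mul contMDiff_const
    exact (this x).mdifferentiableAt (by simp)
  have h1 : (fun x : G => g * h * x * (g * h)⁻¹) =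
      (fun x : G => g * x * g⁻¹) ∘ (fun x : G => h * x * h⁻¹) := by
    ext x; simp [mul_assoc]
  have h3 : h * 1 * h⁻¹ = 1 := by simp
  have h2 := mfderiv_comp_of_eq (x := (1 : G)) (hd g 1) (hd h 1) h3
  have h4 : ∀ y : G, y = 1 → ∀ B : E →L[ℝ] E,
      (show E →L[ℝ] E from mfderiv 𝓔 𝓔 (fun x : G => g * x * g⁻¹) y).comp B =
      (Ad g).comp B := by
    rintro _ rfl B
    rfl
  rw [← h4 _ h3]
  unfold Ad
  rw [h1]
  exact h2

/-- The derivative at the identity of the adjoint representation. -/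
lemma hasFDerivAt_Ad_chart :
    ∃ A' : E →L[ℝ] E →L[ℝ] E,
      HasFDerivAt (fun x : E => (Ad ((κ).symm x) : E →L[ℝ] E)) A' (κ 1) ∧
      ∀ X Y, A' X Y = bracket G X Y := by
  have hd := (contDiffAt_Ad_chart (E := E) (G := G)).differentiableAt (by simp)
  refine ⟨_, hd.hasFDerivAt, fun X Y => ?_⟩
  set A' := fderiv ℝ (fun x : E => (Ad ((κ).symm x) : E →L[ℝ] E)) (κ 1)
  -- `M(C(x, y), x) = M(x, y)`, differentiated at `y = 1` and then at `x = 1`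
  have hsrc : ∀ᶠ z : E × E in nhds (κ 1, κ 1),
      (κ).symm z.1 * (κ).symm z.2 * ((κ).symm z.1)⁻¹ ∈
        (κ).source := by
    have c1 : ContinuousAt (fun z : E × E => (κ).symm z.1)
        (κ (1 : G), κ (1 : G)) :=
      ContinuousAt.comp (f := Prod.fst) continuousAt_oneChart_symm continuousAt_fst
    have c2 : ContinuousAt (fun z : E × E => (κ).symm z.2)
        (κ (1 : G), κ (1 : G)) :=
      ContinuousAt.comp (f := Prod.snd) continuousAt_oneChart_symm continuousAt_snd
    have c3 := (c1.mul c2).mul c1.inv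
    exact c3.eventually_mem (by
      simpa [oneChart_symm_oneChart_one] using oneChart_source_mem_nhds (E := E) (G := G))
  have hrel : ∀ᶠ x in nhds (κ 1), ∀ Z : E,
      fderiv ℝ (chartMul E G) (κ 1, x) (Ad ((κ).symm x) Z, 0) =
      fderiv ℝ (chartMul E G) (x, κ 1) (0, Z) := by
    filter_upwards [eventually_differentiableAt (contDiffAt_chartConj (G := G)),
      eventually_differentiableAt (contDiffAt_chartMul (G := G)), eventually_Ad_eq, hsrc.curry_nhds]
      with x h1 h2 h4 h5 Z
    have e1 : (fun y => chartMul E G (chartConj E G (x, y), x)) =ᶠ[nhds (κ 1)]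
        fun y => chartMul E G (x, y) := by
      filter_upwards [h5] with y hy
      simp only [chartMul, chartConj]
      rw [(κ).left_inv hy]
      simp
    have d1 := h1.1.hasFDerivAt.comp (κ 1)
      (hasFDerivAt_prodMk_right x (κ 1))
    have d2 := h2.1.hasFDerivAt.comp (κ 1)
      (hasFDerivAt_prodMk_right x (κ 1))
    have d3 := d1.prodMk (hasFDerivAt_const x (κ 1))
    have h3' : HasFDerivAt (chartMul E G) (fderiv ℝ (chartMul E G) (κ 1, x))
        (chartConj E G (x, κ 1), x) := by
      rw [chartConj_one_right]
      exact h2.2.hasFDerivAt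
    have d4 := HasFDerivAt.comp (f := fun y => (chartConj E G (x, y), x)) (κ 1) h3' d3
    have := d4.unique (d2.congr_of_eventuallyEq e1)
    have := congrArg (fun L : E →L[ℝ] E => L Z) this
    rw [h4]
    simpa using this
  have hl : HasFDerivAt (fun x => fderiv ℝ (chartMul E G) (κ 1, x)
      (Ad ((κ).symm x) Y, 0))
      ((fderiv ℝ (chartMul E G) (κ 1, κ 1)).comp
          ((inl ℝ E E).comp (A'.flip Y)) +
        ((chartHess E G).flip (Y, 0)).comp (inr ℝ E E)) (κ 1) := by
    have h1 := (hasFDerivAt_fderiv_chartMul (E := E) (G := G)).comp (κ 1)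
      (hasFDerivAt_prodMk_right (κ 1) (κ 1))
    have h2 := (hd.hasFDerivAt.clm_apply (hasFDerivAt_const Y (κ 1))).prodMk
      (hasFDerivAt_const (0 : E) (κ 1))
    have h3 := h1.clm_apply h2
    refine h3.congr_fderiv ?_
    ext v
    simp [oneChart_symm_oneChart_one, Ad_one, A']
  have hr := hasFDerivAt_fderiv_chartMul_left (G := G) Y
  have huniq := hl.unique (hr.congr_of_eventuallyEq (hrel.mono fun x hx => hx Y))
  have := congrArg (fun L : E →L[ℝ] E => L X) huniq
  simp [fderiv_chartMul_left] at this
  rw [bracket_eq_chartHess, ← this, chartHess_symm (0, X) (Y, 0)]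
  simp

variable (G) in
/-- The bracket as a continuous bilinear map. -/
def adL : E →L[ℝ] E →L[ℝ] E := (hasFDerivAt_Ad_chart (E := E) (G := G)).choose

lemma adL_apply (X Y : E) : adL G X Y = bracket G X Y :=
  (hasFDerivAt_Ad_chart (E := E) (G := G)).choose_spec.2 X Y

lemma hasFDerivAt_Ad_oneChart :
    HasFDerivAt (fun x : E => (Ad ((κ).symm x) : E →L[ℝ] E)) (adL G)
      (κ (1 : G)) :=
  (hasFDerivAt_Ad_chart (E := E) (G := G)).choose_spec.1

lemma Ad_inv_comp (g : G) : (Ad g⁻¹ : E →L[ℝ] E).comp (Ad g) = ContinuousLinearMap.id ℝ E := by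
  rw [← Ad_mul, inv_mul_cancel, Ad_one]

lemma Ad_comp_inv (g : G) : (Ad g : E →L[ℝ] E).comp (Ad g⁻¹) = ContinuousLinearMap.id ℝ E := by
  rw [← Ad_mul, mul_inv_cancel, Ad_one]

lemma continuous_Ad : Continuous (fun g : G => (Ad g : E →L[ℝ] E)) := by
  have h1 : ContinuousAt (fun g : G => (Ad g : E →L[ℝ] E)) 1 := by
    have h2 : ContinuousAt (fun g : G => (Ad ((κ).symm (κ g)) : E →L[ℝ] E))
        1 := ContinuousAt.comp (g := fun x : E => (Ad ((κ).symm x) : E →L[ℝ] E))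
          contDiffAt_Ad_chart.continuousAt continuousAt_oneChart
    refine h2.congr ?_
    filter_upwards [oneChart_source_mem_nhds (E := E) (G := G)] with g hg
    rw [(κ).left_inv hg]
  rw [continuous_iff_continuousAt]
  intro g₀
  have h3 : (fun g : G => (Ad g : E →L[ℝ] E)) = fun g => (Ad g₀).comp (Ad (g₀⁻¹ * g)) := by
    ext1 g
    rw [← Ad_mul, mul_inv_cancel_left]
  rw [h3]
  have h4 : ContinuousAt (fun g : G => (Ad (g₀⁻¹ * g) : E →L[ℝ] E)) g₀ :=
    ContinuousAt.comp (g := fun g : G => (Ad g : E →L[ℝ] E)) (by simpa using h1)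
      (continuous_const_mul g₀⁻¹).continuousAt
  exact continuousAt_const.clm_comp h4

/-- The curve `γ` passes through the identity at time `0` with velocity `X`. -/
structure HasVelocity (γ : ℝ → G) (X : E) : Prop where
  zero : γ 0 = 1
  continuousAt : ContinuousAt γ 0
  deriv : HasDerivAt (fun s => κ (γ s)) X 0

lemma HasVelocity.hasDerivAt_Ad {γ : ℝ → G} {X : E} (h : HasVelocity γ X) :
    HasDerivAt (fun s => (Ad (γ s) : E →L[ℝ] E)) (adL G X) 0 := by
  have h0 : HasFDerivAt (fun x : E => (Ad ((κ).symm x) : E →L[ℝ] E)) (adL G)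
      (κ (γ 0)) := by
    rw [h.zero]; exact hasFDerivAt_Ad_oneChart
  have h1 := h0.comp_hasDerivAt (0 : ℝ) h.deriv
  refine h1.congr_of_eventuallyEq ?_
  have h2 : ∀ᶠ s in nhds (0 : ℝ), γ s ∈ (κ).source :=
    h.continuousAt.eventually_mem (by rw [h.zero]; exact oneChart_source_mem_nhds)
  filter_upwards [h2] with s hs
  simp only [Function.comp]
  rw [(κ).left_inv hs]

lemma HasVelocity.conj {γ : ℝ → G} {X : E} (h : HasVelocity γ X) (g : G) :
    HasVelocity (fun s => g * γ s * g⁻¹) (Ad g X) := by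
  refine ⟨by simp [h.zero], ?_, ?_⟩
  · exact (continuousAt_const.mul h.continuousAt).mul continuousAt_const
  · have hd : DifferentiableAt ℝ (fun y => κ (g * (κ).symm y * g⁻¹))
        (κ 1) := by
      have h1 : ContMDiffAt 𝓔 𝓔 ∞
          (fun y => κ (g * (κ).symm y * g⁻¹)) (κ 1) := by
        have h3 : ContMDiffAt 𝓔 𝓔 ∞ (fun y => g * (κ).symm y * g⁻¹)
            (κ 1) :=
          (contMDiffAt_const.mul (contMDiffAt_oneChart_symm (E := E) (G := G))).mul
            contMDiffAt_const
        refine ContMDiffAt.comp (I' := 𝓔) _ ?_ h3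
        simp only [oneChart_symm_oneChart_one, mul_one, mul_inv_cancel]
        exact contMDiffAt_oneChart
      exact (contMDiffAt_iff_contDiffAt.1 h1).differentiableAt (by simp)
    have h2 := hd.hasFDerivAt
    rw [← Ad_eq_fderiv] at h2
    have h0 : HasFDerivAt (fun y => κ (g * (κ).symm y * g⁻¹)) (Ad g)
      (κ (γ 0)) := by rw [h.zero]; exact h2
    have h3 := h0.comp_hasDerivAt (0 : ℝ) h.deriv
    refine h3.congr_of_eventuallyEq ?_
    have h4 : ∀ᶠ s in nhds (0 : ℝ), γ s ∈ (κ).source :=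
      h.continuousAt.eventually_mem (by rw [h.zero]; exact oneChart_source_mem_nhds)
    filter_upwards [h4] with s hs
    simp only [Function.comp]
    rw [(κ).left_inv hs]

/-- A one-parameter subgroup of `G` with velocity `X`. -/
structure IsOneParam (γ : ℝ → G) (X : E) : Prop where
  map_add : ∀ s t, γ (s + t) = γ s * γ t
  hasVelocity : HasVelocity γ X

variable {γ : ℝ → G} {X : E}

lemma IsOneParam.map_zero (h : IsOneParam γ X) : γ 0 = 1 := h.hasVelocity.zero

lemma IsOneParam.map_neg (h : IsOneParam γ X) (s : ℝ) : γ (-s) = (γ s)⁻¹ := by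
  rw [eq_inv_iff_mul_eq_one, ← h.map_add, neg_add_cancel, h.map_zero]

lemma hasMFDerivAt_iff_hasVelocity (h0 : γ 0 = 1) :
    HasMFDerivAt 𝓘(ℝ, ℝ) 𝓔 γ 0
      ((1 : ℝ →L[ℝ] ℝ).smulRight (show TangentSpace 𝓔 (γ 0) from X)) ↔ HasVelocity γ X := by
  have key : HasMFDerivAt 𝓘(ℝ, ℝ) 𝓔 γ 0
      ((1 : ℝ →L[ℝ] ℝ).smulRight (show TangentSpace 𝓔 (γ 0) from X)) ↔
      ContinuousAt γ 0 ∧ HasFDerivWithinAt (fun s => extChartAt 𝓔 (γ 0) (γ s))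
        ((1 : ℝ →L[ℝ] ℝ).smulRight X) (Set.range 𝓘(ℝ, ℝ)) 0 := Iff.rfl
  rw [key]
  simp only [modelWithCornersSelf_coe, Set.range_id, hasFDerivWithinAt_univ, h0]
  constructor
  · rintro ⟨h1, h2⟩
    exact ⟨h0, h1, hasDerivAt_iff_hasFDerivAt.2 (h2.congr_fderiv (by ext; simp))⟩
  · rintro ⟨_, h1, h2⟩
    exact ⟨h1, (hasDerivAt_iff_hasFDerivAt.1 h2).congr_fderiv (by ext; simp)⟩

/-- Left translates of integral curves of left invariant fields are integral curves. -/
lemma hasMFDerivAt_mul_left {t : ℝ}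
    (h : HasMFDerivAt 𝓘(ℝ, ℝ) 𝓔 γ t
      ((1 : ℝ →L[ℝ] ℝ).smulRight (𝓛 X (γ t)))) (g : G) :
    HasMFDerivAt 𝓘(ℝ, ℝ) 𝓔 (fun s => g * γ s) t
      ((1 : ℝ →L[ℝ] ℝ).smulRight (𝓛 X (g * γ t))) := by
  have hm : ∀ a b : G, MDifferentiableAt 𝓔 𝓔 (fun y : G => a * y) b := fun a b =>
    (contMDiff_mul_left (I := 𝓔) (n := ∞) (a := a) b).mdifferentiableAt (by simp)
  have h1 := (hm g (γ t)).hasMFDerivAt.comp t h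
  refine h1.congr_mfderiv ?_
  have h2 := mfderiv_comp_of_eq (x := (1 : G)) (hm g (γ t)) (hm (γ t) 1) (mul_one _)
  have h3 : ((fun y : G => g * y) ∘ fun y : G => γ t * y) = fun y => g * γ t * y := by
    ext y; simp [mul_assoc]
  rw [h3] at h2
  have h4 : ∀ y : G, y = γ t → ∀ B : E →L[ℝ] E,
      (show E →L[ℝ] E from mfderiv 𝓔 𝓔 (fun x : G => g * x) y).comp B =
      (show E →L[ℝ] E from mfderiv 𝓔 𝓔 (fun x : G => g * x) (γ t)).comp B := by
    rintro _ rfl B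
    rfl
  have h5 := congrArg (fun L : E →L[ℝ] E => L X) (h2.trans (h4 (γ t * 1) (mul_one _) _))
  refine ContinuousLinearMap.ext fun (r : ℝ) => ?_
  change (show E →L[ℝ] E from mfderiv 𝓔 𝓔 (fun x : G => g * x) (γ t))
    (r • (show E from 𝓛 X (γ t))) =
    r • (show E from 𝓛 X (g * γ t))
  rw [map_smul]
  congr 1
  exact h5.symm

lemma mulInvariantVectorField_one (X : E) :
    (𝓛 X 1 : E) = X := by
  have h : (fun y : G => 1 * y) = id := by ext; simp
  unfold mulInvariantVectorField
  rw [h, mfderiv_id]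
  rfl

lemma hasMFDerivAt_comp_add {γ : ℝ → G} {a t : ℝ} {L : ℝ →L[ℝ] E}
    (h : HasMFDerivAt 𝓘(ℝ, ℝ) 𝓔 γ (a + t) L) :
    HasMFDerivAt 𝓘(ℝ, ℝ) 𝓔 (fun s => γ (a + s)) t L := by
  have h1 : HasMFDerivAt 𝓘(ℝ, ℝ) 𝓘(ℝ, ℝ) (fun s : ℝ => a + s) t (ContinuousLinearMap.id ℝ ℝ) :=
    ((hasFDerivAt_id t).const_add a).hasMFDerivAt
  exact (HasMFDerivAt.comp t h h1).congr_mfderiv (comp_id _)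

lemma IsOneParam.isMIntegralCurve (h : IsOneParam γ X) :
    IsMIntegralCurve γ (𝓛 X) := by
  intro t
  have h0 := (hasMFDerivAt_iff_hasVelocity h.map_zero).2 h.hasVelocity
  have h1 : HasMFDerivAt 𝓘(ℝ, ℝ) 𝓔 γ 0
      ((1 : ℝ →L[ℝ] ℝ).smulRight (𝓛 X (γ 0))) := by
    refine h0.congr_mfderiv ?_
    have : (show E from 𝓛 X (γ 0)) = X := by
      rw [h.map_zero]; exact mulInvariantVectorField_one X
    refine ContinuousLinearMap.ext fun r => ?_
    change r • X = r • (show E from 𝓛 X (γ 0))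
    rw [this]
  have h2 := hasMFDerivAt_mul_left h1 (γ t)
  have h3 : ∀ g : G, g = γ t → ∀ f : ℝ → G, f 0 = g → HasMFDerivAt 𝓘(ℝ, ℝ) 𝓔 f 0
      (show ℝ →L[ℝ] E from
        ((1 : ℝ →L[ℝ] ℝ).smulRight (show E from 𝓛 X g))) →
      HasMFDerivAt 𝓘(ℝ, ℝ) 𝓔 f 0 (show ℝ →L[ℝ] E from
        ((1 : ℝ →L[ℝ] ℝ).smulRight
          (show E from 𝓛 X (γ t)))) := by
    rintro g rfl f hf h
    exact h
  have h4 := h3 (γ t * γ 0) (by simp [h.map_zero]) (fun s => γ t * γ s) rfl h2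
  have h5 : (fun s => γ t * γ s) = fun s => γ (t + s) := by ext s; rw [h.map_add]
  rw [h5] at h4
  have h6 := hasMFDerivAt_comp_add (γ := fun s => γ (t + s)) (a := -t) (t := t)
    (L := (show ℝ →L[ℝ] E from ((1 : ℝ →L[ℝ] ℝ).smulRight
          (show E from 𝓛 X (γ t)))))
  rw [neg_add_cancel] at h6
  have h7 := h6 h4
  have h8 : (fun s => γ (t + (-t + s))) = γ := by ext s; simp
  rw [h8] at h7
  exact h7

lemma contMDiff_invariantField [CompleteSpace E] (X : E) :
    ContMDiff 𝓔 𝓘(ℝ, E).tangent 1 (fun g : G =>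
      (⟨g, 𝓛 X g⟩ : TangentBundle 𝓔 G)) := by
  have : LieGroup 𝓔 (minSmoothness ℝ 3) G := by
    rw [minSmoothness_of_isRCLikeNormedField]
    exact LieGroup.of_le (n := ∞) (WithTop.coe_le_coe.2 le_top)
  exact (contMDiff_mulInvariantVectorField (I := 𝓔) (G := G) X).of_le (by
    rw [minSmoothness_of_isRCLikeNormedField]; norm_num)

lemma IsOneParam.unique [CompleteSpace E] [T2Space G] {γ' : ℝ → G}
    (h : IsOneParam γ X) (h' : IsOneParam γ' X) : γ = γ' := by
  have : IsManifold 𝓔 1 G := IsManifold.of_le (n := ∞) (by simp)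
  exact isMIntegralCurve_Ioo_eq_of_contMDiff_boundaryless (t₀ := 0) (contMDiff_invariantField X)
    h.isMIntegralCurve h'.isMIntegralCurve (by rw [h.map_zero, h'.map_zero])

lemma exists_isOneParam [CompleteSpace E] [T2Space G] (X : E) :
    ∃ γ : ℝ → G, IsOneParam γ X := by
  have : IsManifold 𝓔 1 G := IsManifold.of_le (n := ∞) (by simp)
  have hv := contMDiff_invariantField (G := G) X
  obtain ⟨γ, hγ0, hγ⟩ := exists_isMIntegralCurveAt_of_contMDiffAt_boundaryless (t₀ := 0)
    (hv (1 : G))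
  rw [isMIntegralCurveAt_iff'] at hγ
  obtain ⟨ε, hε, hγ⟩ := hγ
  have hball : Metric.ball (0 : ℝ) ε = Set.Ioo (-ε) ε := by simp [Real.ball_eq_Ioo]
  obtain ⟨Γ, hΓ0, hΓ⟩ := exists_isMIntegralCurve_of_isMIntegralCurveOn hv hε (fun g => by
    refine ⟨fun s => g * γ s, by simp [hγ0], fun t ht => ?_⟩
    have h1 := hγ t (by rwa [hball])
    have h2 : HasMFDerivAt 𝓘(ℝ, ℝ) 𝓔 γ t _ :=
      h1.hasMFDerivAt (Metric.isOpen_ball.mem_nhds (by rwa [hball]))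
    exact (hasMFDerivAt_mul_left h2 g).hasMFDerivWithinAt) 1
  have hadd : ∀ s t, Γ (s + t) = Γ s * Γ t := by
    intro s t
    have h1 : IsMIntegralCurve (fun t => Γ (s + t)) (𝓛 X) :=
      fun t => hasMFDerivAt_comp_add (hΓ (s + t))
    have h2 : IsMIntegralCurve (fun t => Γ s * Γ t) (𝓛 X) :=
      fun t => hasMFDerivAt_mul_left (hΓ t) (Γ s)
    exact congrFun (isMIntegralCurve_Ioo_eq_of_contMDiff_boundaryless (t₀ := 0) hv h1 h2
      (by simp [hΓ0])) t
  refine ⟨Γ, hadd, (hasMFDerivAt_iff_hasVelocity hΓ0).1 ?_⟩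
  refine (hΓ 0).congr_mfderiv ?_
  have : (show E from 𝓛 X (Γ 0)) = X := by
    rw [hΓ0]; exact mulInvariantVectorField_one X
  refine ContinuousLinearMap.ext fun r => ?_
  change r • (show E from 𝓛 X (Γ 0)) = r • X
  rw [this]

/-- Solutions of `u' = F(u)` with smooth `F` are smooth. -/
lemma contDiffAt_of_hasDerivAt_eq {V : Type*} [NormedAddCommGroup V] [NormedSpace ℝ V]
    {F : V → V} {u : ℝ → V} {t₀ : ℝ} (hF : ContDiffAt ℝ ∞ F (u t₀))
    (hu : ∀ᶠ t in nhds t₀, HasDerivAt u (F (u t)) t) : ContDiffAt ℝ ∞ u t₀ := by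
  rw [contDiffAt_infty]
  intro n
  have hc : ContinuousAt u t₀ := hu.self_of_nhds.continuousAt
  have key : ∀ n : ℕ, ∀ᶠ t in nhds t₀, ContDiffAt ℝ n u t := by
    intro n
    induction n with
    | zero =>
      filter_upwards [hu.eventually_nhds] with t ht
      have : ContDiffAt ℝ 0 u t := by
        rw [contDiffAt_zero]
        exact ⟨_, ht, fun s hs => HasDerivAt.continuousAt hs |>.continuousWithinAt⟩
      exact_mod_cast this
    | succ n ih =>
      have hF' : ∀ᶠ t in nhds t₀, ContDiffAt ℝ n F (u t) :=
        hc.eventually ((hF.of_le (m := n) (by exact_mod_cast le_top)).eventually (by simp))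
      filter_upwards [ih, hF', hu.eventually_nhds] with t h1 h2 h3
      have h4 : ContDiffAt ℝ n (fun s => F (u s)) t := h2.comp t h1
      have h5 : ContDiffAt ℝ ((n : ℕ∞ω) + 1) u t := by
        rw [contDiffAt_succ_iff_hasFDerivAt]
        refine ⟨fun s => (1 : ℝ →L[ℝ] ℝ).smulRight (F (u s)),
          ⟨_, h3, fun s hs => ?_⟩, ?_⟩
        · exact (hasDerivAt_iff_hasFDerivAt.1 hs).congr_fderiv (by ext; simp)
        · exact contDiffAt_const.smulRight h4
      exact_mod_cast h5
  exact (key n).self_of_nhds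

lemma IsOneParam.contMDiff (h : IsOneParam γ X) :
    ContMDiff 𝓘(ℝ, ℝ) 𝓔 ∞ γ := by
  have hcont : Continuous γ := by
    rw [continuous_iff_continuousAt]
    intro t
    have h1 : γ = fun s => γ t * γ (-t + s) := by
      ext s; rw [← h.map_add]; simp
    rw [h1]
    refine continuousAt_const.mul (ContinuousAt.comp (g := γ) ?_ (by fun_prop))
    simpa using h.hasVelocity.continuousAt
  set u : ℝ → E := fun s => κ (γ s) with hu
  have hu0 : u 0 = κ 1 := by simp [hu, h.map_zero]
  have hsrc : ∀ᶠ s in nhds (0 : ℝ), γ s ∈ (κ).source :=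
    h.hasVelocity.continuousAt.eventually_mem (by
      rw [h.map_zero]; exact oneChart_source_mem_nhds)
  have hM := eventually_differentiableAt (contDiffAt_chartMul (E := E) (G := G))
  have hcu : ContinuousAt u 0 := h.hasVelocity.deriv.continuousAt
  have hsmooth : ContDiffAt ℝ ∞ u 0 := by
    refine contDiffAt_of_hasDerivAt_eq
      (F := fun x => fderiv ℝ (chartMul E G) (x, κ 1) (0, X)) ?_ ?_
    · rw [hu0]
      have h2 : ContDiffAt ℝ ∞ (fderiv ℝ (chartMul E G)) (κ 1, κ 1) :=
        (contDiffAt_chartMul (E := E) (G := G)).fderiv_right (m := ∞) (by simp)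
      have h3 : ContDiffAt ℝ ∞ (fun x : E => (x, κ (1 : G))) (κ 1) :=
        contDiffAt_id.prodMk contDiffAt_const
      exact ContDiffAt.clm_apply (ContDiffAt.comp (f := fun x : E => (x, κ (1 : G)))
        (κ 1) h2 h3) contDiffAt_const
    · filter_upwards [hsrc, hcu.eventually (hu0 ▸ hM)] with t ht1 ht2
      have e1 : (fun s => u (t + s)) =ᶠ[nhds 0] fun s => chartMul E G (u t, u s) := by
        filter_upwards [hsrc] with s hs
        simp only [hu, chartMul]
        rw [(κ).left_inv ht1, (κ).left_inv hs, h.map_add]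
      have d1 : HasFDerivAt (fun y => chartMul E G (u t, y))
          ((fderiv ℝ (chartMul E G) (u t, κ 1)).comp (inr ℝ E E))
          (u 0) := by
        rw [hu0]
        rw [hu0] at ht2
        exact ht2.1.hasFDerivAt.comp _ (hasFDerivAt_prodMk_right _ _)
      have d2 := (d1.comp_hasDerivAt (0 : ℝ) h.hasVelocity.deriv).congr_of_eventuallyEq e1
      have d3 : HasDerivAt (fun s => u (t + (-t + s))) _ t :=
        HasDerivAt.comp_const_add (-t) t (f := fun s => u (t + s)) (by simpa using d2)
      simpa using d3
  have h0 : ContMDiffAt 𝓘(ℝ, ℝ) 𝓔 ∞ γ 0 := by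
    have h1 : ContMDiffAt 𝓘(ℝ, ℝ) 𝓔 ∞ (fun s => (κ).symm (u s)) 0 :=
      ContMDiffAt.comp (I' := 𝓔) (0 : ℝ) (by rw [hu0]; exact contMDiffAt_oneChart_symm)
        (contMDiffAt_iff_contDiffAt.2 hsmooth)
    refine h1.congr_of_eventuallyEq ?_
    filter_upwards [hsrc] with s hs
    simp only [hu]
    rw [(κ).left_inv hs]
  intro t
  have h1 : γ = fun s => γ t * γ (-t + s) := by
    ext s; rw [← h.map_add]; simp
  rw [h1]
  have h2 : ContMDiffAt 𝓘(ℝ, ℝ) 𝓔 ∞ (fun s => γ (-t + s)) t := by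
    refine ContMDiffAt.comp (I' := 𝓘(ℝ, ℝ)) t (by simpa using h0) ?_
    exact contMDiffAt_iff_contDiffAt.2 (by fun_prop)
  exact contMDiffAt_const.mul h2

lemma IsOneParam.hasDerivAt_Ad (h : IsOneParam γ X) (t : ℝ) :
    HasDerivAt (fun s => (Ad (γ s) : E →L[ℝ] E)) ((Ad (γ t)).comp (adL G X)) t := by
  have h0 := h.hasVelocity.hasDerivAt_Ad
  have h1 : (fun s => (Ad (γ s) : E →L[ℝ] E)) = fun s => (Ad (γ t)).comp (Ad (γ (-t + s))) := by
    ext1 s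
    rw [← Ad_mul, ← h.map_add]; simp
  rw [h1]
  have h2 : HasDerivAt (fun s => (Ad (γ (-t + s)) : E →L[ℝ] E)) (adL G X) t :=
    HasDerivAt.comp_const_add (-t) t (f := fun s => (Ad (γ s) : E →L[ℝ] E)) (by simpa using h0)
  have h3 := (hasDerivAt_const t (Ad (γ t) : E →L[ℝ] E)).clm_comp h2
  simpa using h3

/-- A curve `Z` with `Z' = [X, Z]` is moved by `Ad (γ (-s))` to a constant. -/
lemma IsOneParam.Ad_apply_eq (h : IsOneParam γ X) {Z : ℝ → E}
    (hZ : ∀ s, HasDerivAt Z (adL G X (Z s)) s) (s : ℝ) : Ad (γ s) (Z 0) = Z s := by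
  have hd : ∀ t, HasDerivAt (fun s => Ad (γ (-s)) (Z s)) 0 t := by
    intro t
    have h1 : HasDerivAt (fun s => (Ad (γ (-s)) : E →L[ℝ] E))
        (-((Ad (γ (-t))).comp (adL G X))) t := by
      have := (h.hasDerivAt_Ad (-t)).scomp t (hasDerivAt_neg t)
      rw [neg_one_smul] at this
      exact this
    have h2 := h1.clm_apply (hZ t)
    simpa using h2
  have hc : ∀ t, (fun s => Ad (γ (-s)) (Z s)) t = (fun s => Ad (γ (-s)) (Z s)) 0 := by
    intro t
    exact is_const_of_deriv_eq_zero (fun t => (hd t).differentiableAt) (fun t => (hd t).deriv) t 0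
  have h3 := hc s
  simp only [neg_zero, h.map_zero, Ad_one, id_apply] at h3
  rw [← h3, ← comp_apply, ← Ad_mul, ← h.map_add]
  simp [h.map_zero, Ad_one]

lemma IsOneParam.Ad_eq_self {Y : E} (h : IsOneParam γ X) (hY : adL G X Y = 0)
    (s : ℝ) : Ad (γ s) Y = Y :=
  h.Ad_apply_eq (Z := fun _ => Y) (fun s => by rw [hY]; exact hasDerivAt_const s Y) s

lemma Ad_adL [CompleteSpace E] [T2Space G] (g : G) (X Y : E) :
    Ad g (adL G X Y) = adL G (Ad g X) (Ad g Y) := by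
  obtain ⟨γ, hγ⟩ := exists_isOneParam (G := G) X
  have h1 := hγ.hasVelocity.hasDerivAt_Ad
  have h2 := (hγ.hasVelocity.conj g).hasDerivAt_Ad
  have h3 := ((hasDerivAt_const (0 : ℝ) (Ad g : E →L[ℝ] E)).clm_comp h1).clm_apply
    (hasDerivAt_const (0 : ℝ) Y)
  have h4 := h2.clm_apply (hasDerivAt_const (0 : ℝ) (Ad g Y))
  have h5 : (fun s => (Ad g ∘SL Ad (γ s)) Y) =
      fun s => Ad (g * γ s * g⁻¹) (Ad g Y) := by
    ext1 s
    rw [← Ad_mul, ← comp_apply, ← Ad_mul]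
    simp
  rw [h5] at h3
  simpa using h3.unique h4

lemma adL_swap (X Y : E) : adL G X Y = -adL G Y X := by
  rw [adL_apply, adL_apply, bracket_swap]

lemma adL_self (X : E) : adL G X X = 0 := by
  have := adL_swap (G := G) X X
  have h2 : (2 : ℝ) • adL G X X = 0 := by
    rw [two_smul]; nth_rewrite 1 [this]; simp
  simpa using h2

lemma adL_jacobi [CompleteSpace E] [T2Space G] (X Y Z : E) :
    adL G X (adL G Y Z) = adL G (adL G X Y) Z + adL G Y (adL G X Z) := by
  obtain ⟨γ, hγ⟩ := exists_isOneParam (G := G) X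
  have h1 := hγ.hasVelocity.hasDerivAt_Ad
  have h2 := h1.clm_apply (hasDerivAt_const (0 : ℝ) (adL G Y Z))
  have hY := h1.clm_apply (hasDerivAt_const (0 : ℝ) Y)
  have hZ := h1.clm_apply (hasDerivAt_const (0 : ℝ) Z)
  have h3 := ((adL G (E := E)).hasFDerivAt.comp_hasDerivAt (0 : ℝ) hY).clm_apply hZ
  have h5 : (fun s => Ad (γ s) (adL G Y Z)) =
      fun s => adL G (Ad (γ s) Y) (Ad (γ s) Z) := by
    ext1 s
    rw [Ad_adL]
  rw [h5] at h2
  have := h2.unique h3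
  simpa [hγ.map_zero, Ad_one] using this

section SecondKind

variable {V : Type*} [NormedAddCommGroup V] [NormedSpace ℝ V]

lemma hasFDerivAt_oneChart_comp {Ψ : V → G} (h0 : Ψ 0 = 1)
    (hΨ : MDifferentiableAt 𝓘(ℝ, V) 𝓔 Ψ 0) :
    HasFDerivAt (fun v => κ (Ψ v))
      (show V →L[ℝ] E from mfderiv 𝓘(ℝ, V) 𝓔 Ψ 0) 0 := by
  have h1 : HasFDerivWithinAt (fun v => extChartAt 𝓔 (Ψ 0) (Ψ v))
      (show V →L[ℝ] E from mfderiv 𝓘(ℝ, V) 𝓔 Ψ 0) (Set.range 𝓘(ℝ, V)) 0 :=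
    hΨ.hasMFDerivAt.2
  simp only [modelWithCornersSelf_coe, Set.range_id, h0] at h1
  exact hasFDerivWithinAt_univ.1 h1

lemma hasVelocity_line {Ψ : V → G} (h0 : Ψ 0 = 1) (hc : ContinuousAt Ψ 0) {L : V →L[ℝ] E}
    (hL : HasFDerivAt (fun v => κ (Ψ v)) L 0) (v : V) :
    HasVelocity (fun s : ℝ => Ψ (s • v)) (L v) := by
  refine ⟨by simp [h0], ?_, ?_⟩
  · exact ContinuousAt.comp (g := Ψ) (by simpa using hc) (by fun_prop)
  · have h1 : HasDerivAt (fun s : ℝ => s • v) v 0 := by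
      simpa using (hasDerivAt_id (0 : ℝ)).smul_const v
    have h2 : HasFDerivAt (fun v => κ (Ψ v)) L ((0 : ℝ) • v) := by simpa using hL
    exact h2.comp_hasDerivAt (0 : ℝ) h1

lemma contDiffAt_oneChart_comp {Ψ : V → G} (h0 : Ψ 0 = 1)
    (hΨ : ContMDiffAt 𝓘(ℝ, V) 𝓔 ∞ Ψ 0) :
    ContDiffAt ℝ ∞ (fun v => κ (Ψ v)) 0 := by
  rw [← contMDiffAt_iff_contDiffAt]
  exact ContMDiffAt.comp (I' := 𝓔) _ (by rw [h0]; exact contMDiffAt_oneChart) hΨ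

lemma map_nhds_eq_of_surjective [CompleteSpace V] [CompleteSpace E] [FiniteDimensional ℝ E]
    {Ψ : V → G} (h0 : Ψ 0 = 1)
    (hΨ : ContMDiffAt 𝓘(ℝ, V) 𝓔 ∞ Ψ 0) {L : V →L[ℝ] E}
    (hL : HasFDerivAt (fun v => κ (Ψ v)) L 0) (hs : Function.Surjective L) :
    map Ψ (nhds 0) = nhds 1 := by
  have h1 := (contDiffAt_oneChart_comp h0 hΨ).hasStrictFDerivAt' hL (by simp)
  have h2 := h1.map_nhds_eq_of_surj (LinearMap.range_eq_top.2 hs)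
  have h3 : map (κ).symm (map (fun v => κ (Ψ v)) (nhds 0)) =
      map Ψ (nhds 0) := by
    rw [Filter.map_map]
    refine Filter.map_congr ?_
    have : ∀ᶠ v in nhds (0 : V), Ψ v ∈ (κ).source :=
      hΨ.continuousAt.eventually_mem (by rw [h0]; exact oneChart_source_mem_nhds)
    filter_upwards [this] with v hv
    exact (κ).left_inv hv
  rw [← h3, h2, h0]
  have h4 := map_extChartAt_symm_nhdsWithin_range (I := 𝓔) (x := (1 : G))
  simp only [modelWithCornersSelf_coe, Set.range_id, nhdsWithin_univ] at h4
  exact h4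

lemma exists_injOn_of_injective [FiniteDimensional ℝ V] [FiniteDimensional ℝ E]
    {Ψ : V → G} (h0 : Ψ 0 = 1)
    (hΨ : ContMDiffAt 𝓘(ℝ, V) 𝓔 ∞ Ψ 0) {L : V →L[ℝ] E}
    (hL : HasFDerivAt (fun v => κ (Ψ v)) L 0) (hi : Injective L) :
    ∃ U ∈ nhds (0 : V), Set.InjOn Ψ U := by
  have := FiniteDimensional.complete ℝ V
  have h1 := (contDiffAt_oneChart_comp h0 hΨ).hasStrictFDerivAt' hL (by simp)
  obtain ⟨P, hP⟩ := L.toLinearMap.exists_leftInverse_of_injective (LinearMap.ker_eq_bot.2 hi)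
  have h2 : HasStrictFDerivAt (fun v => P.toContinuousLinearMap (κ (Ψ v)))
      ((ContinuousLinearEquiv.refl ℝ V : V ≃L[ℝ] V) : V →L[ℝ] V) 0 := by
    have := P.toContinuousLinearMap.hasStrictFDerivAt.comp (0 : V) h1
    refine this.congr_fderiv ?_
    ext v
    exact congrArg (fun f : V →ₗ[ℝ] V => f v) hP
  refine ⟨(h2.toOpenPartialHomeomorph _).source,
    (h2.toOpenPartialHomeomorph _).open_source.mem_nhds h2.mem_toOpenPartialHomeomorph_source, ?_⟩
  intro x hx y hy hxy
  refine (h2.toOpenPartialHomeomorph _).injOn hx hy ?_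
  simp [hxy]

/-- The product `γ₁(u₁) ⋯ γₙ(uₙ)` of one-parameter subgroups. -/
def prodCurve : {n : ℕ} → (Fin n → ℝ → G) → (Fin n → ℝ) → G
  | 0, _, _ => 1
  | _ + 1, γ, u => γ 0 (u 0) * prodCurve (fun i => γ i.succ) (fun i => u i.succ)

lemma prodCurve_mem {n : ℕ} (K : Subgroup G) {γ : Fin n → ℝ → G} (h : ∀ i s, γ i s ∈ K)
    (u : Fin n → ℝ) : prodCurve γ u ∈ K := by
  induction n with
  | zero => exact K.one_mem
  | succ n ih => exact K.mul_mem (h 0 _) (ih (fun i s => h i.succ s) _)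

lemma prodCurve_zero {n : ℕ} {γ : Fin n → ℝ → G} (h : ∀ i, γ i 0 = 1) : prodCurve γ 0 = 1 := by
  induction n with
  | zero => rfl
  | succ n ih =>
    have := ih (γ := fun i => γ i.succ) (fun i => h i.succ)
    simp only [prodCurve, Pi.zero_apply, h 0, one_mul]
    exact this

lemma prodCurve_single {n : ℕ} {γ : Fin n → ℝ → G} (h : ∀ i, γ i 0 = 1) (i : Fin n) (s : ℝ) :
    prodCurve γ (single i s) = γ i s := by
  induction n with
  | zero => exact i.elim0
  | succ n ih =>
    rw [prodCurve]
    refine Fin.cases ?_ (fun j => ?_) i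
    · have : (fun i : Fin n => (single (0 : Fin (n + 1)) s : Fin (n + 1) → ℝ) i.succ) = 0 := by
        ext j; simp
      rw [this, prodCurve_zero (fun i => h i.succ)]
      simp
    · have : (fun i : Fin n => (single j.succ s : Fin (n + 1) → ℝ) i.succ) =
          single j s := by
        ext k
        by_cases hk : k = j
        · subst hk; simp
        · simp [hk]
      rw [this, ih (fun i => h i.succ) j]
      simp [h 0]

lemma contMDiff_prodCurve {n : ℕ} {γ : Fin n → ℝ → G}
    (h : ∀ i, ContMDiff 𝓘(ℝ, ℝ) 𝓔 ∞ (γ i)) :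
    ContMDiff 𝓘(ℝ, Fin n → ℝ) 𝓔 ∞ (prodCurve γ) := by
  induction n with
  | zero => exact contMDiff_const
  | succ n ih =>
    have h1 : ContMDiff 𝓘(ℝ, Fin (n + 1) → ℝ) 𝓔 ∞ (fun u : Fin (n + 1) → ℝ => γ 0 (u 0)) :=
      (h 0).comp (contMDiff_iff_contDiff.2 (by fun_prop))
    have h2 : ContMDiff 𝓘(ℝ, Fin (n + 1) → ℝ) 𝓔 ∞
        (fun u : Fin (n + 1) → ℝ => prodCurve (fun i => γ i.succ) (fun i => u i.succ)) :=
      (ih (fun i => h i.succ)).comp (contMDiff_iff_contDiff.2 (by fun_prop))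
    exact h1.mul h2

/-- The linear map `u ↦ ∑ uᵢ Xᵢ`. -/
def combo {n : ℕ} {W : Type*} [NormedAddCommGroup W] [NormedSpace ℝ W] (X : Fin n → W) :
    (Fin n → ℝ) →L[ℝ] W :=
  ∑ i, (proj (R := ℝ) (φ := fun _ : Fin n => ℝ) i).smulRight (X i)

@[simp] lemma combo_apply {n : ℕ} {W : Type*} [NormedAddCommGroup W] [NormedSpace ℝ W]
    (X : Fin n → W) (u : Fin n → ℝ) : combo X u = ∑ i, u i • X i := by
  simp [combo]

lemma hasFDerivAt_prodCurve {n : ℕ} {γ : Fin n → ℝ → G} {X : Fin n → E}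
    (h : ∀ i, IsOneParam (γ i) (X i)) :
    HasFDerivAt (fun u => κ (prodCurve γ u)) (combo X) 0 := by
  have h0 := prodCurve_zero (fun i => (h i).map_zero)
  have hs := contMDiff_prodCurve (fun i => (h i).contMDiff)
  have h1 := ((contDiffAt_oneChart_comp h0 (hs 0)).differentiableAt (by simp)).hasFDerivAt
  refine h1.congr_fderiv ?_
  refine ContinuousLinearMap.coe_injective (LinearMap.pi_ext' fun i => ?_)
  ext
  have h2 := hasVelocity_line h0 (hs 0).continuousAt h1 (single i 1)
  have h3 : (fun s : ℝ => prodCurve γ (s • (single i (1 : ℝ) : Fin n → ℝ))) = γ i := by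
    ext s
    rw [← prodCurve_single (fun i => (h i).map_zero) i s]
    congr 1
    ext j
    by_cases hj : j = i
    · subst hj; simp
    · simp [hj]
  rw [h3] at h2
  have h4 := h2.deriv.unique (h i).hasVelocity.deriv
  simp only [LinearMap.coe_comp, LinearMap.coe_single, Function.comp]
  simp [h4, Pi.single_apply]

lemma IsOneParam.contDiff_Ad {γ : ℝ → G} {X : E} (h : IsOneParam γ X) :
    ContDiff ℝ ∞ (fun s => (Ad (γ s) : E →L[ℝ] E)) := by
  rw [contDiff_iff_contDiffAt]
  intro t
  refine contDiffAt_of_hasDerivAt_eq (F := fun B : E →L[ℝ] E => B.comp (adL G X)) ?_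
    (of_forall fun s => h.hasDerivAt_Ad s)
  exact contDiffAt_id.clm_comp contDiffAt_const

/-- The logarithmic derivative of `u ↦ Ad(γ₁(u₁) ⋯ γₙ(uₙ))`. -/
lemma exists_logDeriv_Ad_prodCurve [CompleteSpace E] [T2Space G]
    {n : ℕ} {γ : Fin n → ℝ → G} {X : Fin n → E}
    (h : ∀ i, IsOneParam (γ i) (X i)) :
    ∃ A : (Fin n → ℝ) → (Fin n → ℝ) →L[ℝ] E, ContDiff ℝ ∞ A ∧ A 0 = combo X ∧
      ContDiff ℝ ∞ (fun u => (Ad (prodCurve γ u) : E →L[ℝ] E)) ∧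
      ContDiff ℝ ∞ (fun u => (Ad (prodCurve γ u)⁻¹ : E →L[ℝ] E)) ∧
      ∀ u, HasFDerivAt (fun u => (Ad (prodCurve γ u) : E →L[ℝ] E))
        ((compL ℝ E E E (Ad (prodCurve γ u))).comp ((adL G).comp (A u))) u := by
  induction n with
  | zero =>
    refine ⟨fun _ => 0, contDiff_const, ?_, contDiff_const (c := (Ad (1 : G) : E →L[ℝ] E)),
      contDiff_const (c := (Ad (1 : G)⁻¹ : E →L[ℝ] E)), fun u => ?_⟩
    · ext v; simp
    · refine (hasFDerivAt_const (Ad (1 : G) : E →L[ℝ] E) u).congr_fderiv ?_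
      simp
  | succ n ih =>
    obtain ⟨A, hA, hA0, hs, hsi, hd⟩ := ih (γ := fun i => γ i.succ) (X := fun i => X i.succ)
      (fun i => h i.succ)
    let T : (Fin (n + 1) → ℝ) →L[ℝ] (Fin n → ℝ) :=
      ContinuousLinearMap.pi fun i => proj i.succ
    let p0 : (Fin (n + 1) → ℝ) →L[ℝ] ℝ := proj 0
    have hT : ∀ u : Fin (n + 1) → ℝ, (fun i : Fin n => u i.succ) = T u := fun u => rfl
    have hγ := (h 0).contDiff_Ad
    have hAd : ∀ u : Fin (n + 1) → ℝ, (Ad (prodCurve γ u) : E →L[ℝ] E) =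
        (Ad (γ 0 (p0 u))).comp (Ad (prodCurve (fun i => γ i.succ) (T u))) := by
      intro u
      rw [← Ad_mul]
      rfl
    have hAdi : ∀ u : Fin (n + 1) → ℝ, (Ad (prodCurve γ u)⁻¹ : E →L[ℝ] E) =
        (Ad (prodCurve (fun i => γ i.succ) (T u))⁻¹).comp (Ad (γ 0 (-p0 u))) := by
      intro u
      rw [← Ad_mul, (h 0).map_neg, ← mul_inv_rev]
      rfl
    refine ⟨fun u => p0.smulRight ((Ad (prodCurve (fun i => γ i.succ) (T u))⁻¹ : E →L[ℝ] E) (X 0)) +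
      (A (T u)).comp T, ?_, ?_, ?_, ?_, fun u => ?_⟩
    · refine ContDiff.add ?_ ?_
      · exact contDiff_const.smulRight ((hsi.comp T.contDiff).clm_apply contDiff_const)
      · exact (hA.comp T.contDiff).clm_comp contDiff_const
    · have : T 0 = 0 := map_zero T
      ext v
      simp only [this, hA0, prodCurve_zero (fun i => (h (Fin.succ i)).map_zero), inv_one, Ad_one]
      simp [Fin.sum_univ_succ, T, p0]
    · simp only [hAd]
      exact (hγ.comp p0.contDiff).clm_comp (hs.comp T.contDiff)
    · simp only [hAdi]
      exact (hsi.comp T.contDiff).clm_comp (hγ.comp p0.contDiff.neg)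
    · have h1 : HasFDerivAt (fun u : Fin (n + 1) → ℝ => (Ad (γ 0 (p0 u)) : E →L[ℝ] E))
          (p0.smulRight ((Ad (γ 0 (p0 u))).comp (adL G (X 0)))) u := by
        have := ((h 0).hasDerivAt_Ad (p0 u)).hasFDerivAt.comp u p0.hasFDerivAt
        refine this.congr_fderiv ?_
        ext v
        simp
      have h2 := (hd (T u)).comp u T.hasFDerivAt
      have h3 := h1.clm_comp h2
      have h4 : (fun u => (Ad (prodCurve γ u) : E →L[ℝ] E)) = fun u => (Ad (γ 0 (p0 u))).comp
        (((fun u => (Ad (prodCurve (fun i => γ i.succ) u) : E →L[ℝ] E)) ∘ T) u) := by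
        ext1 u; exact hAd u
      rw [h4]
      refine h3.congr_fderiv ?_
      ext v Z
      have key : ∀ (g : G) (W Z : E), Ad g (adL G ((Ad g⁻¹ : E →L[ℝ] E) W) Z) = adL G W (Ad g Z) := by
        intro g W Z
        rw [Ad_adL, ← comp_apply (Ad g), Ad_comp_inv]
        rfl
      simp [hAd, key]
      abel

end SecondKind

section Tori

variable {V : Type*} [NormedAddCommGroup V] [NormedSpace ℝ V]
  {W : Type*} [NormedAddCommGroup W] [NormedSpace ℝ W]

lemma exists_injOn_of_hasStrictFDerivAt [FiniteDimensional ℝ V] [FiniteDimensional ℝ W]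
    {f : V → W} {L : V →L[ℝ] W} {x : V} (h : HasStrictFDerivAt f L x)
    (hi : Injective L) : ∃ U ∈ nhds x, Set.InjOn f U := by
  have := FiniteDimensional.complete ℝ V
  obtain ⟨P, hP⟩ := L.toLinearMap.exists_leftInverse_of_injective (LinearMap.ker_eq_bot.2 hi)
  have h2 : HasStrictFDerivAt (fun v => P.toContinuousLinearMap (f v))
      ((ContinuousLinearEquiv.refl ℝ V : V ≃L[ℝ] V) : V →L[ℝ] V) x := by
    have := P.toContinuousLinearMap.hasStrictFDerivAt.comp x h
    refine this.congr_fderiv ?_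
    ext v
    exact congrArg (fun f : V →ₗ[ℝ] V => f v) hP
  refine ⟨(h2.toOpenPartialHomeomorph _).source,
    (h2.toOpenPartialHomeomorph _).open_source.mem_nhds h2.mem_toOpenPartialHomeomorph_source, ?_⟩
  intro x hx y hy hxy
  refine (h2.toOpenPartialHomeomorph _).injOn hx hy ?_
  simp [hxy]

lemma map_zero_of_map_add {A : Type*} [AddGroup A] {e : A → G} (hadd : ∀ x y, e (x + y) = e x * e y) :
    e 0 = 1 := by
  have := hadd 0 0
  simpa using this

lemma map_neg_of_map_add {A : Type*} [AddGroup A] {e : A → G} (hadd : ∀ x y, e (x + y) = e x * e y)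
    (x : A) : e (-x) = (e x)⁻¹ := by
  rw [eq_inv_iff_mul_eq_one, ← hadd, neg_add_cancel, map_zero_of_map_add hadd]

lemma isOneParam_line {e : V → G} (hadd : ∀ x y, e (x + y) = e x * e y) (hc : ContinuousAt e 0)
    {L : V →L[ℝ] E} (hL : HasFDerivAt (fun v => κ (e v)) L 0) (v : V) :
    IsOneParam (fun s : ℝ => e (s • v)) (L v) :=
  ⟨fun s t => by rw [add_smul, hadd], hasVelocity_line (map_zero_of_map_add hadd) hc hL v⟩

lemma IsTorusParam.hasFDerivAt {ℓ : ℕ} {p : (Fin ℓ → ℝ) → G} (hp : IsTorusParam (E := E) G p) :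
    HasFDerivAt (fun v => κ (p v)) (velocity G p) 0 :=
  hasFDerivAt_oneChart_comp (map_zero_of_map_add hp.map_add)
    ((hp.smooth 0).mdifferentiableAt (by simp))

lemma IsTorusParam.isOneParam {ℓ : ℕ} {p : (Fin ℓ → ℝ) → G} (hp : IsTorusParam (E := E) G p)
    (v : Fin ℓ → ℝ) : IsOneParam (fun s : ℝ => p (s • v)) (velocity (E := E) G p v) :=
  isOneParam_line hp.map_add (hp.smooth 0).continuousAt hp.hasFDerivAt v

lemma IsOneParam.conj {γ : ℝ → G} {X : E} (h : IsOneParam γ X) (g : G) :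
    IsOneParam (fun s => g * γ s * g⁻¹) (Ad g X) :=
  ⟨fun s t => by rw [h.map_add]; group, h.hasVelocity.conj g⟩

lemma IsOneParam.comm_of_Ad_eq [CompleteSpace E] [T2Space G] {γ : ℝ → G} {X : E}
    (h : IsOneParam γ X) {g : G} (hg : Ad g X = X) (s : ℝ) : g * γ s = γ s * g := by
  have h1 := h.conj g
  rw [hg] at h1
  have h2 := congrFun (h1.unique h) s
  exact mul_inv_eq_iff_eq_mul.1 h2

lemma IsOneParam.Ad_eq_of_comm {γ : ℝ → G} {X : E}
    (h : IsOneParam γ X) {g : G} (hg : ∀ s, g * γ s = γ s * g) : Ad g X = X := by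
  have h1 := (h.conj g).hasVelocity.deriv
  have h2 : (fun s => g * γ s * g⁻¹) = γ := by ext s; rw [hg]; group
  rw [show (fun s => κ (g * γ s * g⁻¹)) = fun s => κ (γ s) from
    funext fun s => congrArg _ (congrFun h2 s)] at h1
  exact h1.unique h.hasVelocity.deriv

lemma IsOneParam.comm_of_adL [CompleteSpace E] [T2Space G] {γ δ : ℝ → G} {X Y : E}
    (hγ : IsOneParam γ X) (hδ : IsOneParam δ Y) (h : adL G X Y = 0) (s t : ℝ) :
    γ s * δ t = δ t * γ s :=
  hδ.comm_of_Ad_eq (hγ.Ad_eq_self h s) t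

lemma IsOneParam.adL_of_comm {γ δ : ℝ → G} {X Y : E}
    (hγ : IsOneParam γ X) (hδ : IsOneParam δ Y) (h : ∀ s t, γ s * δ t = δ t * γ s) :
    adL G X Y = 0 := by
  have h1 := hγ.hasVelocity.hasDerivAt_Ad.clm_apply (hasDerivAt_const (0 : ℝ) Y)
  have h2 : (fun s => (Ad (γ s) : E →L[ℝ] E) Y) = fun _ => Y :=
    funext fun s => hδ.Ad_eq_of_comm (h s)
  rw [h2] at h1
  simpa using h1.unique (hasDerivAt_const (0 : ℝ) Y)

lemma IsTorusParam.adL_velocity {ℓ : ℕ} {p : (Fin ℓ → ℝ) → G} (hp : IsTorusParam (E := E) G p)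
    (v w : Fin ℓ → ℝ) : adL G (velocity (E := E) G p v) (velocity G p w) = 0 :=
  (hp.isOneParam v).adL_of_comm (hp.isOneParam w) fun s t => by
    rw [← hp.map_add, ← hp.map_add, add_comm]

lemma isOneParam_one : IsOneParam (fun _ : ℝ => (1 : G)) (0 : E) :=
  ⟨by simp, rfl, continuousAt_const, hasDerivAt_const _ _⟩

lemma IsTorusParam.velocity_injective [CompleteSpace E] [T2Space G]
    {ℓ : ℕ} {p : (Fin ℓ → ℝ) → G} (hp : IsTorusParam (E := E) G p) :
    Injective (velocity (E := E) G p) := by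
  rw [injective_iff_map_eq_zero]
  intro v hv
  have h1 := hp.isOneParam v
  rw [hv] at h1
  have h2 := h1.unique isOneParam_one
  by_contra hne
  obtain ⟨i, hi⟩ := Function.ne_iff.1 hne
  simp only [Pi.zero_apply] at hi
  have h3 := (hp.ker _).1 (congrFun h2 (π / v i)) i
  obtain ⟨n, hn⟩ := h3
  simp only [Pi.smul_apply, smul_eq_mul] at hn
  field_simp at hn
  have h4 : (1 : ℤ) = 2 * n := by exact_mod_cast hn
  omega

lemma hasFDerivAt_mul_pair {Φ : V → G} {Χ : W → G} (h0 : Φ 0 = 1) (h0' : Χ 0 = 1)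
    (hΦ : ContMDiffAt 𝓘(ℝ, V) 𝓔 ∞ Φ 0) (hΧ : ContMDiffAt 𝓘(ℝ, W) 𝓔 ∞ Χ 0)
    {L : V →L[ℝ] E} {M : W →L[ℝ] E} (hL : HasFDerivAt (fun v => κ (Φ v)) L 0)
    (hM : HasFDerivAt (fun v => κ (Χ v)) M 0) :
    ContMDiffAt 𝓘(ℝ, V × W) 𝓔 ∞ (fun z : V × W => Φ z.1 * Χ z.2) 0 ∧
    HasFDerivAt (fun z : V × W => κ (Φ z.1 * Χ z.2)) (L.coprod M) 0 := by
  have hsm : ContMDiffAt 𝓘(ℝ, V × W) 𝓔 ∞ (fun z : V × W => Φ z.1 * Χ z.2) 0 := by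
    refine ContMDiffAt.mul ?_ ?_
    · exact ContMDiffAt.comp (I' := 𝓘(ℝ, V)) (g := Φ) (f := Prod.fst) (0 : V × W) hΦ
        (contMDiffAt_iff_contDiffAt.2 contDiffAt_fst)
    · exact ContMDiffAt.comp (I' := 𝓘(ℝ, W)) (g := Χ) (f := Prod.snd) (0 : V × W) hΧ
        (contMDiffAt_iff_contDiffAt.2 contDiffAt_snd)
  refine ⟨hsm, ?_⟩
  have hd := ((contDiffAt_oneChart_comp (by simp [h0, h0']) hsm).differentiableAt
    (by simp)).hasFDerivAt
  refine hd.congr_fderiv ?_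
  set D := fderiv ℝ (fun z : V × W => κ (Φ z.1 * Χ z.2)) 0 with hD
  have h1 : D.comp (inl ℝ V W) = L := by
    have hd' : HasFDerivAt (fun z : V × W => κ (Φ z.1 * Χ z.2)) D
      (inl ℝ V W 0) := by rw [map_zero]; exact hd
    have := hd'.comp (0 : V) (inl ℝ V W).hasFDerivAt
    refine this.unique (hL.congr_of_eventuallyEq (of_forall fun v => ?_))
    simp [h0']
  have h2 : D.comp (inr ℝ V W) = M := by
    have hd' : HasFDerivAt (fun z : V × W => κ (Φ z.1 * Χ z.2)) D
      (inr ℝ V W 0) := by rw [map_zero]; exact hd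
    have := hd'.comp (0 : W) (inr ℝ V W).hasFDerivAt
    refine this.unique (hM.congr_of_eventuallyEq (of_forall fun v => ?_))
    simp [h0]
  rw [← h1, ← h2]
  ext v <;> simp

/-- The kernel of a homomorphism, as a `ℤ`-submodule. -/
def kerLattice (e : V → G) (hadd : ∀ x y, e (x + y) = e x * e y) : Submodule ℤ V :=
  AddSubgroup.toIntSubmodule
    { carrier := {y | e y = 1}
      add_mem' := fun {a b} ha hb => by
        simp only [Set.mem_ofPred_eq] at *; rw [hadd, ha, hb, one_mul]
      zero_mem' := map_zero_of_map_add hadd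
      neg_mem' := fun {a} ha => by
        simp only [Set.mem_ofPred_eq] at *; rw [map_neg_of_map_add hadd, ha, inv_one] }

lemma mem_kerLattice {e : V → G} {hadd : ∀ x y, e (x + y) = e x * e y} {y : V} :
    y ∈ kerLattice e hadd ↔ e y = 1 := Iff.rfl

lemma discreteTopology_kerLattice [FiniteDimensional ℝ V] [FiniteDimensional ℝ E]
    {e : V → G} (hadd : ∀ x y, e (x + y) = e x * e y)
    (hs : ContMDiffAt 𝓘(ℝ, V) 𝓔 ∞ e 0) {L : V →L[ℝ] E}
    (hL : HasFDerivAt (fun v => κ (e v)) L 0) (hi : Injective L) :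
    DiscreteTopology (kerLattice e hadd) := by
  obtain ⟨U, hU, hinj⟩ := exists_injOn_of_injective (map_zero_of_map_add hadd) hs hL hi
  have h0 : IsOpen ({0} : Set (kerLattice e hadd)) := by
    have h1 : (Subtype.val ⁻¹' U : Set (kerLattice e hadd)) ∈ nhds 0 :=
      continuous_subtype_val.continuousAt.preimage_mem_nhds (by simpa using hU)
    rw [isOpen_singleton_iff_nhds_eq_pure]
    refine le_antisymm ?_ (pure_le_nhds _)
    rw [le_pure_iff]
    filter_upwards [h1] with x hx
    have := hinj hx (mem_of_mem_nhds hU) (by rw [map_zero_of_map_add hadd]; exact x.2)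
    simpa using this
  exact discreteTopology_of_isOpen_singleton_zero h0

lemma prodCurve_add {n : ℕ} {γ : Fin n → ℝ → G} (hadd : ∀ i s t, γ i (s + t) = γ i s * γ i t)
    (hc : ∀ i j s t, γ i s * γ j t = γ j t * γ i s) (x y : Fin n → ℝ) :
    prodCurve γ (x + y) = prodCurve γ x * prodCurve γ y := by
  induction n with
  | zero => simp [prodCurve]
  | succ n ih =>
    have h1 : prodCurve (fun i => γ (Fin.succ i)) (fun i => x (Fin.succ i)) ∈
        Subgroup.centralizer {γ 0 (y 0)} :=
      prodCurve_mem _ (fun i s => by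
        rw [Subgroup.mem_centralizer_singleton_iff]; exact hc _ _ _ _) _
    rw [Subgroup.mem_centralizer_singleton_iff] at h1
    have h2 := ih (γ := fun i => γ (Fin.succ i)) (fun i => hadd _) (fun i j => hc _ _)
      (fun i => x (Fin.succ i)) (fun i => y (Fin.succ i))
    have h3 : prodCurve γ (x + y) = γ 0 (x 0 + y 0) *
      prodCurve (fun i => γ (Fin.succ i)) ((fun i => x (Fin.succ i)) + fun i => y (Fin.succ i)) := rfl
    have h4 : ∀ z, prodCurve γ z = γ 0 (z 0) *
      prodCurve (fun i => γ (Fin.succ i)) (fun i => z (Fin.succ i)) := fun z => rfl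
    rw [h3, h2, hadd, h4 x, h4 y]
    simp only [mul_assoc]
    congr 1
    rw [← mul_assoc, ← h1, mul_assoc]

lemma combo_injective {n : ℕ} {X : Fin n → W} (h : LinearIndependent ℝ X) :
    Injective (combo X) := by
  rw [injective_iff_map_eq_zero]
  intro v hv
  rw [combo_apply] at hv
  exact funext (Fintype.linearIndependent_iff.1 h v hv)

end Tori

variable [FiniteDimensional ℝ E] [CompleteSpace E] [T2Space G] [CompactSpace G]

/-- A subspace that is its own centralizer and contains commuting vectors only: near the identity,
the subgroup it generates lies in the image of a ball. -/
lemma exists_nhds_range_subset {q : ℕ} {b : Fin q → E} {a : Submodule ℝ E}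
    (hspan : span ℝ (Set.range b) = a)
    (hself : ∀ Z, (∀ X ∈ a, adL G Z X = 0) → Z ∈ a) {e : (Fin q → ℝ) → G}
    (hadd : ∀ x y, e (x + y) = e x * e y) (hs : ContMDiff 𝓘(ℝ, Fin q → ℝ) 𝓔 ∞ e)
    (hL : HasFDerivAt (fun v => κ (e v)) (combo b) 0)
    (hfix : ∀ y i, Ad (e y) (b i) = b i) :
    ∃ O ∈ nhds (1 : G), ∀ y, e y ∈ O → ∃ y', ‖y'‖ ≤ 1 ∧ e y' = e y := by
  have hab : ∀ i, b i ∈ a := fun i => hspan ▸ subset_span ⟨i, rfl⟩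
  obtain ⟨a', ha'⟩ := Submodule.exists_isCompl a
  let z := Module.finBasis ℝ a'
  let Z : Fin (finrank ℝ a') → E := fun i => z i
  choose δ hδ using fun i => exists_isOneParam (G := G) (Z i)
  obtain ⟨A, hA, hA0, hsm, -, hder⟩ := exists_logDeriv_Ad_prodCurve hδ
  have hzero := prodCurve_zero (fun i => (hδ i).map_zero)
  have hZind : LinearIndependent ℝ Z := z.linearIndependent.map' a'.subtype (by simp)
  have hmemc : ∀ v, combo Z v ∈ a' := fun v => by
    rw [combo_apply]; exact Submodule.sum_mem _ fun i _ => smul_mem _ _ (z i).2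
  let F : (Fin (finrank ℝ a') → ℝ) → (Fin q → E) := fun v i => Ad (prodCurve δ v) (b i)
  have hF : HasStrictFDerivAt F (ContinuousLinearMap.pi fun i =>
      ((adL G).flip (b i)).comp (combo Z)) 0 := by
    rw [hasStrictFDerivAt_pi']
    intro i
    have h1 := (hsm.contDiffAt (x := 0)).hasStrictFDerivAt' (hder 0) (by simp)
    have h2 := h1.clm_apply (hasStrictFDerivAt_const (b i) _)
    refine h2.congr_fderiv ?_
    ext v
    simp [hA0, hzero, Ad_one]
  have hFi : Injective (ContinuousLinearMap.pi fun i : Fin q =>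
      ((adL G).flip (b i)).comp (combo Z)) := by
    rw [injective_iff_map_eq_zero]
    intro v hv
    have h1 : ∀ i, adL G (combo Z v) (b i) = 0 := fun i => congrFun hv i
    have h2 : combo Z v ∈ a := by
      refine hself _ fun X hX => ?_
      rw [← hspan] at hX
      induction hX using span_induction with
      | mem x hx => obtain ⟨i, rfl⟩ := hx; exact h1 i
      | zero => simp
      | add x y _ _ hx hy => rw [map_add, hx, hy, add_zero]
      | smul c x _ hx => rw [map_smul, hx, smul_zero]
    have h3 : combo Z v = 0 := (Submodule.disjoint_def.1 ha'.disjoint) _ h2 (hmemc v)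
    exact combo_injective hZind (by rw [h3, map_zero])
  obtain ⟨U, hU, hinj⟩ := exists_injOn_of_hasStrictFDerivAt hF hFi
  have hsδ := contMDiff_prodCurve (fun i => (hδ i).contMDiff)
  obtain ⟨hs1, hs2⟩ := hasFDerivAt_mul_pair hzero (map_zero_of_map_add hadd) (hsδ 0) (hs 0)
    (hasFDerivAt_prodCurve hδ) hL
  have hmap := map_nhds_eq_of_surjective (by simp [hzero, map_zero_of_map_add hadd]) hs1 hs2 (by
    intro w
    have hw : w ∈ a' ⊔ a := by rw [ha'.symm.sup_eq_top]; trivial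
    obtain ⟨w1, h1, w2, h2, rfl⟩ := Submodule.mem_sup.1 hw
    rw [← hspan, Submodule.mem_span_range_iff_exists_fun] at h2
    obtain ⟨y, rfl⟩ := h2
    refine ⟨(z.equivFun ⟨w1, h1⟩, y), ?_⟩
    simp only [coprod_apply, combo_apply]
    congr 1
    have := congrArg Subtype.val (z.sum_equivFun ⟨w1, h1⟩)
    refine Eq.trans ?_ this
    rw [AddSubmonoidClass.coe_finsetSum]
    rfl)
  refine ⟨_, hmap ▸ image_mem_map (prod_mem_nhds hU (Metric.closedBall_mem_nhds 0 one_pos)), ?_⟩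
  rintro y ⟨⟨v, y'⟩, ⟨hv, hy'⟩, hvy⟩
  simp only at hv hy' hvy
  have h1 : F v = F 0 := by
    ext i
    simp only [F, hzero, Ad_one, id_apply]
    rw [show prodCurve δ v = e y * (e y')⁻¹ from eq_mul_inv_of_mul_eq hvy,
      ← map_neg_of_map_add hadd, ← hadd, hfix]
  have h2 := hinj hv (mem_of_mem_nhds hU) h1
  refine ⟨y', by simpa using hy', ?_⟩
  rw [← hvy, h2, hzero, one_mul]

lemma exists_bound_of_nhds {V : Type*} [NormedAddCommGroup V] {e : V → G}
    (hadd : ∀ x y, e (x + y) = e x * e y)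
    (hO : ∃ O ∈ nhds (1 : G), ∀ y, e y ∈ O → ∃ y', ‖y'‖ ≤ 1 ∧ e y' = e y) :
    ∃ R : ℝ, ∀ y, ∃ y', ‖y'‖ ≤ R ∧ e y' = e y := by
  obtain ⟨O, hO, hO'⟩ := hO
  obtain ⟨O', hO'O, hOo, h1⟩ := mem_nhds_iff.1 hO
  have hcov : closure (Set.range e) ⊆ ⋃ y : V, (fun g => (e y)⁻¹ * g) ⁻¹' O' := by
    intro h hh
    have hn : (fun g : G => g⁻¹ * h) ⁻¹' O' ∈ nhds h := by
      have hc : ContinuousAt (fun g : G => g⁻¹ * h) h := by fun_prop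
      exact hc.preimage_mem_nhds (by simpa using hOo.mem_nhds h1)
    obtain ⟨_, hg, ⟨y, rfl⟩⟩ := mem_closure_iff_nhds.1 hh _ hn
    exact Set.mem_iUnion.2 ⟨y, hg⟩
  obtain ⟨t, ht⟩ := isClosed_closure.isCompact.elim_finite_subcover _
    (fun y => hOo.preimage (by fun_prop)) hcov
  obtain ⟨R, hR⟩ := (t.finite_toSet.isBounded).exists_norm_le
  refine ⟨R + 1, fun y => ?_⟩
  have hy := ht (subset_closure ⟨y, rfl⟩)
  simp only [Set.mem_iUnion, Set.mem_preimage] at hy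
  obtain ⟨i, hi, hy⟩ := hy
  rw [← map_neg_of_map_add hadd, ← hadd] at hy
  obtain ⟨y', hy', he⟩ := hO' _ (hO'O hy)
  refine ⟨i + y', (norm_add_le _ _).trans (add_le_add (hR i hi) hy'), ?_⟩
  rw [hadd, he, ← hadd]; simp

lemma exists_isTorusParam (a : Submodule ℝ E)
    (hcomm : ∀ X ∈ a, ∀ Y ∈ a, adL G X Y = 0)
    (hself : ∀ Z, (∀ X ∈ a, adL G Z X = 0) → Z ∈ a) :
    ∃ (q : ℕ) (p : (Fin q → ℝ) → G), IsTorusParam (E := E) G p ∧ torusLieAlgebra G p = a := by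
  let z := Module.finBasis ℝ a
  let b : Fin (finrank ℝ a) → E := fun i => z i
  have hb : ∀ i, b i ∈ a := fun i => (z i).2
  have hspan : span ℝ (Set.range b) = a := by
    have h1 := z.span_eq
    have h2 := congrArg (Submodule.map a.subtype) h1
    rw [Submodule.map_span, Submodule.map_top, Submodule.range_subtype, ← Set.range_comp] at h2
    exact h2
  have hind : LinearIndependent ℝ b := z.linearIndependent.map' a.subtype (by simp)
  choose γ hγ using fun i => exists_isOneParam (G := G) (b i)
  set e := prodCurve γ with he
  have hc : ∀ i j s t, γ i s * γ j t = γ j t * γ i s := fun i j s t =>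
    (hγ i).comm_of_adL (hγ j) (hcomm _ (hb i) _ (hb j)) s t
  have hadd : ∀ x y, e (x + y) = e x * e y := prodCurve_add (fun i => (hγ i).map_add) hc
  have hs : ContMDiff 𝓘(ℝ, Fin _ → ℝ) 𝓔 ∞ e :=
    contMDiff_prodCurve (fun i => (hγ i).contMDiff)
  have hL := hasFDerivAt_prodCurve hγ
  have hinj := combo_injective hind
  have hfix : ∀ y i, Ad (e y) (b i) = b i := by
    intro y i
    refine (hγ i).Ad_eq_of_comm fun s => ?_
    have h1 : e y ∈ Subgroup.centralizer {γ i s} :=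
      prodCurve_mem _ (fun j t => by
        rw [Subgroup.mem_centralizer_singleton_iff]; exact hc _ _ _ _) _
    rw [Subgroup.mem_centralizer_singleton_iff] at h1
    exact h1
  obtain ⟨R, hR⟩ := exists_bound_of_nhds hadd
    (exists_nhds_range_subset hspan hself hadd hs hL hfix)
  have hdisc := discreteTopology_kerLattice hadd (hs 0) hL hinj
  have hlat : IsZLattice ℝ (kerLattice e hadd) := by
    refine ⟨?_⟩
    by_contra hne
    obtain ⟨f, hf, hf'⟩ := Submodule.exists_le_ker_of_lt_top _ (lt_top_iff_ne_top.2 hne)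
    obtain ⟨w, hw⟩ : ∃ w, f w ≠ 0 := by
      by_contra! h; exact hf (LinearMap.ext h)
    have hbd : ∀ y, |f y| ≤ ‖f.toContinuousLinearMap‖ * R := by
      intro y
      obtain ⟨y', hy', hee⟩ := hR y
      have h1 : y - y' ∈ kerLattice e hadd := by
        rw [mem_kerLattice, sub_eq_add_neg, hadd, map_neg_of_map_add hadd, hee, mul_inv_cancel]
      have h2 := hf' (subset_span h1)
      rw [LinearMap.mem_ker, map_sub, sub_eq_zero] at h2
      rw [h2]
      exact (f.toContinuousLinearMap.le_opNorm y').trans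
        (mul_le_mul_of_nonneg_left hy' (norm_nonneg _))
    have h3 := hbd (((‖f.toContinuousLinearMap‖ * R + 1) / f w) • w)
    rw [map_smul, smul_eq_mul, div_mul_cancel₀ _ hw] at h3
    have := le_abs_self (‖f.toContinuousLinearMap‖ * R + 1)
    linarith
  let B := Module.finBasis ℤ (kerLattice e hadd)
  let C := B.ofZLatticeBasis ℝ (kerLattice e hadd)
  let T : (Fin _ → ℝ) →L[ℝ] (Fin (finrank ℝ a) → ℝ) := combo fun i => (2 * π)⁻¹ • C i
  have hTs : Function.Surjective T := by
    intro y
    refine ⟨fun i => 2 * π * C.repr y i, ?_⟩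
    simp only [T, combo_apply, smul_smul]
    conv_rhs => rw [← C.sum_repr y]
    refine sum_congr rfl fun i _ => ?_
    congr 1
    field_simp
  have hp : IsTorusParam (E := E) G (fun s => e (T s)) := by
    refine ⟨fun s t => by rw [map_add, hadd], hs.comp (contMDiff_iff_contDiff.2 T.contDiff), ?_⟩
    intro s
    have h0 := C.mem_span_iff_repr_mem ℤ (T s)
    rw [B.ofZLatticeBasis_span ℝ (kerLattice e hadd)] at h0
    rw [← mem_kerLattice (hadd := hadd), h0]
    refine forall_congr' fun i => ?_
    have h1 : C.repr (T s) i = (2 * π)⁻¹ * s i := by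
      simp [T, Finsupp.single_apply, mul_comm]
    rw [h1]
    constructor
    · rintro ⟨n, hn⟩
      refine ⟨n, ?_⟩
      simp only [algebraMap_int_eq, eq_intCast] at hn
      rw [hn]; field_simp
    · rintro ⟨n, hn⟩
      refine ⟨n, ?_⟩
      simp only [algebraMap_int_eq, eq_intCast]
      rw [hn]; field_simp
  refine ⟨_, _, hp, ?_⟩
  have h1 : velocity (E := E) G (fun s => e (T s)) = (combo b).comp T := by
    have hL' : HasFDerivAt (fun v => κ (e v)) (combo b) (T 0) := by
      rw [map_zero]; exact hL
    exact hp.hasFDerivAt.unique (hL'.comp 0 T.hasFDerivAt)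
  rw [torusLieAlgebra, h1]
  refine Eq.trans ?_ hspan
  ext w
  rw [Submodule.mem_span_range_iff_exists_fun, LinearMap.mem_range]
  constructor
  · rintro ⟨s, rfl⟩
    exact ⟨T s, by simp⟩
  · rintro ⟨y, rfl⟩
    obtain ⟨s, rfl⟩ := hTs y
    exact ⟨s, by simp⟩

lemma torusLieAlgebra_le_of_range_subset {ℓ ℓ' : ℕ} {p : (Fin ℓ → ℝ) → G} {p' : (Fin ℓ' → ℝ) → G}
    (hp : IsTorusParam (E := E) G p) (hp' : IsTorusParam (E := E) G p')
    (h : Set.range p' ⊆ Set.range p) : torusLieAlgebra (E := E) G p' ≤ torusLieAlgebra G p := by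
  rintro _ ⟨w, rfl⟩
  by_contra hw
  let e : (Fin ℓ → ℝ) × ℝ → G := fun z => p z.1 * p' (z.2 • w)
  have hcomm : ∀ x y, p x * p' y = p' y * p x := by
    intro x y
    obtain ⟨y', hy'⟩ := h ⟨y, rfl⟩
    rw [← hy', ← hp.map_add, add_comm, hp.map_add]
  have hadd : ∀ x y, e (x + y) = e x * e y := by
    intro x y
    simp only [e, Prod.fst_add, Prod.snd_add, add_smul, hp.map_add, hp'.map_add]
    rw [mul_assoc, mul_assoc, ← mul_assoc (p y.1), hcomm y.1, mul_assoc]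
  have h1 := hp'.isOneParam w
  have hsm1 : ContMDiffAt 𝓘(ℝ, ℝ) 𝓔 ∞ (fun s : ℝ => p' (s • w)) 0 := h1.contMDiff 0
  obtain ⟨hs1, hs2⟩ := hasFDerivAt_mul_pair (map_zero_of_map_add hp.map_add) h1.map_zero
    (hp.smooth 0) hsm1 hp.hasFDerivAt h1.hasVelocity.deriv.hasFDerivAt
  have hinj : Injective ((velocity (E := E) G p).coprod
      (ContinuousLinearMap.toSpanSingleton ℝ (velocity (E := E) G p' w))) := by
    rw [injective_iff_map_eq_zero]
    rintro ⟨x, s⟩ hx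
    simp only [coprod_apply, ContinuousLinearMap.toSpanSingleton_apply] at hx
    by_cases hs : s = 0
    · subst hs
      simp only [zero_smul, add_zero] at hx
      have := (injective_iff_map_eq_zero _).1 hp.velocity_injective x hx
      simp [this]
    · refine absurd ⟨-s⁻¹ • x, ?_⟩ hw
      have h3 : velocity (E := E) G p x = -(s • velocity (E := E) G p' w) :=
        eq_neg_of_add_eq_zero_left hx
      simp only [coe_coe, map_smul, h3]
      rw [smul_neg, neg_smul, neg_neg, smul_smul, inv_mul_cancel₀ hs, one_smul]
  have hd := discreteTopology_kerLattice hadd hs1 hs2 hinj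
  have hcount : Countable (kerLattice e hadd) := countable_of_Lindelof_of_discrete
  have hex : ∀ s : ℝ, ∃ x, e (x, s) = 1 := by
    intro s
    obtain ⟨x, hx⟩ := h ⟨s • w, rfl⟩
    exact ⟨-x, by simp only [e]; rw [map_neg_of_map_add hp.map_add, hx, inv_mul_cancel]⟩
  choose x hx using hex
  have hinj2 : Injective (fun s : ℝ => (⟨(x s, s), hx s⟩ : kerLattice e hadd)) := by
    intro s t hst
    exact congrArg (fun z : kerLattice e hadd => z.1.2) hst
  have : Countable ℝ := hinj2.countable
  exact not_countable (α := ℝ) this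

/-- The Lie algebra of a maximal torus is its own centralizer. -/
theorem mem_torusLieAlgebra_of_commute {ℓ : ℕ} {p : (Fin ℓ → ℝ) → G}
    (hp : IsTorusParam (E := E) G p)
    (hmax : ∀ (ℓ' : ℕ) (p' : (Fin ℓ' → ℝ) → G), IsTorusParam (E := E) G p' →
      Set.range p ⊆ Set.range p' → Set.range p' = Set.range p)
    {Z : E} (hZ : ∀ X ∈ torusLieAlgebra G p, adL G X Z = 0) : Z ∈ torusLieAlgebra G p := by
  let S : Set (Submodule ℝ E) :=
    {a | torusLieAlgebra G p ≤ a ∧ ∀ X ∈ a, ∀ Y ∈ a, adL G X Y = 0}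
  have hne : torusLieAlgebra G p ∈ S := ⟨le_rfl, by
    rintro _ ⟨v, rfl⟩ _ ⟨w, rfl⟩; exact hp.adL_velocity v w⟩
  obtain ⟨a, haS, hmaxa⟩ := (wellFounded_gt (α := Submodule ℝ E)).has_min S ⟨_, hne⟩
  have hself : ∀ Z, (∀ X ∈ a, adL G Z X = 0) → Z ∈ a := by
    intro Z hZ
    have h1 : a ⊔ span ℝ {Z} ∈ S := by
      refine ⟨haS.1.trans le_sup_left, ?_⟩
      intro X hX Y hY
      obtain ⟨x, hx, z, hz, rfl⟩ := Submodule.mem_sup.1 hX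
      obtain ⟨y, hy, z', hz', rfl⟩ := Submodule.mem_sup.1 hY
      obtain ⟨c, rfl⟩ := Submodule.mem_span_singleton.1 hz
      obtain ⟨c', rfl⟩ := Submodule.mem_span_singleton.1 hz'
      have h2 : adL G x Z = 0 := by rw [adL_swap, hZ x hx, neg_zero]
      simp [haS.2 x hx y hy, hZ y hy, h2, adL_self]
    have h3 : a ⊔ span ℝ {Z} ≤ a := by
      by_contra hlt
      exact hmaxa _ h1 (lt_of_le_not_ge le_sup_left hlt)
    exact h3 (Submodule.mem_sup_right (Submodule.mem_span_singleton_self Z))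
  obtain ⟨q, p', hp', hpa⟩ := exists_isTorusParam a haS.2 hself
  have hsub : Set.range p ⊆ Set.range p' := by
    rintro _ ⟨v, rfl⟩
    have h1 : velocity (E := E) G p v ∈ torusLieAlgebra G p' := hpa ▸ haS.1 ⟨v, rfl⟩
    obtain ⟨w, hw⟩ := h1
    have h2 := hp'.isOneParam w
    rw [show velocity (E := E) G p' w = velocity G p v from hw] at h2
    have h3 := congrFun (h2.unique (hp.isOneParam v)) 1
    simp only [one_smul] at h3
    exact ⟨w, h3⟩
  have hle := torusLieAlgebra_le_of_range_subset hp hp' (hmax q p' hp' hsub).subset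
  rw [hpa] at hle
  refine hle (hself Z fun X hX => ?_)
  rw [adL_swap, hZ X (hle hX), neg_zero]

section

variable {W : Type*} [AddCommGroup W] [Module ℝ W] [FiniteDimensional ℝ W]

lemma exists_eigenvector_of_symmetric [Nontrivial W] (B : W →ₗ[ℝ] W →ₗ[ℝ] ℝ)
    (hB : ∀ x y, B x y = B y x) (hpos : ∀ x, x ≠ 0 → 0 < B x x) (S : W →ₗ[ℝ] W)
    (hS : ∀ x y, B (S x) y = B x (S y)) : ∃ (μ : ℝ) (x : W), x ≠ 0 ∧ S x = μ • x := by
  let core : InnerProductSpace.Core ℝ W :=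
    { inner := fun x y => B x y
      conj_inner_symm := fun x y => by simp [hB x y]
      re_inner_nonneg := fun x => by
        by_cases hx : x = 0
        · simp [hx]
        · simpa using (hpos x hx).le
      add_left := fun x y z => by simp
      smul_left := fun x y r => by simp
      definite := fun x hx => by
        by_contra h
        exact (hpos x h).ne' hx }
  let _ := core.toNormedAddCommGroup
  let _ := InnerProductSpace.ofCore core.toCore
  have hsym : S.IsSymmetric := fun x y => hS x y
  obtain ⟨x, hx⟩ := hsym.hasEigenvalue_iSup_of_finiteDimensional.exists_hasEigenvector
  exact ⟨_, x, hx.2, hx.apply_eq_smul⟩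

lemma exists_orthogonal_projection (B : W →ₗ[ℝ] W →ₗ[ℝ] ℝ)
    (hpos : ∀ x, x ≠ 0 → 0 < B x x) (U : Submodule ℝ W) (f : U →ₗ[ℝ] ℝ) :
    ∃ u ∈ U, ∀ u' : U, B u u' = f u' := by
  let Φ : U →ₗ[ℝ] (Module.Dual ℝ U) := (U.subtype.dualMap.comp B).comp U.subtype
  have hinj : Injective Φ := by
    rw [injective_iff_map_eq_zero]
    intro u hu
    by_contra hne
    have h1 : B u u = 0 := congrArg (fun f : Module.Dual ℝ U => f u) hu
    exact (hpos u (by simpa using hne)).ne' h1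
  have hsurj := (LinearMap.injective_iff_surjective_of_finrank_eq_finrank
    (Subspace.dual_finrank_eq (K := ℝ) (V := U)).symm).1 hinj
  obtain ⟨u, hu⟩ := hsurj f
  exact ⟨u, u.2, fun u' => congrArg (fun f : Module.Dual ℝ U => f u') hu⟩

namespace CartanData

variable (c : CartanData E G)

lemma form_adL (X Y Z : E) : c.form (adL G X Y) Z = -c.form Y (adL G X Z) := by
  obtain ⟨γ, hγ⟩ := exists_isOneParam (G := G) X
  have h1 := hγ.hasVelocity.hasDerivAt_Ad
  have hY := h1.clm_apply (hasDerivAt_const (0 : ℝ) Y)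
  have hZ := h1.clm_apply (hasDerivAt_const (0 : ℝ) Z)
  let F : E →L[ℝ] E →L[ℝ] ℝ :=
    toContinuousLinearMap
      ((toContinuousLinearMap : (E →ₗ[ℝ] ℝ) ≃ₗ[ℝ] _).toLinearMap.comp c.form)
  have hF : ∀ x y, F x y = c.form x y := fun x y => rfl
  have h2 := ((hasDerivAt_const (0 : ℝ) F).clm_apply hY).clm_apply hZ
  have h3 : (fun s => F ((Ad (γ s) : E →L[ℝ] E) Y) ((Ad (γ s) : E →L[ℝ] E) Z)) =
      fun _ => c.form Y Z := by
    ext s; rw [hF, c.form_inv]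
  rw [h3] at h2
  have h4 := h2.unique (hasDerivAt_const (0 : ℝ) (c.form Y Z))
  simp only [hγ.map_zero, Ad_one, id_apply, map_zero, add_zero,
    zero_apply, zero_add, hF] at h4
  linarith

lemma form_eq_zero {X : E} (h : c.form X X = 0) : X = 0 := by
  by_contra hne
  exact (c.form_pos X hne).ne' h

lemma adL_t {H H' : E} (h : H ∈ c.t) (h' : H' ∈ c.t) : adL G H H' = 0 := by
  obtain ⟨v, rfl⟩ := h
  obtain ⟨w, rfl⟩ := h'
  exact c.isTorusParam.adL_velocity v w

lemma mem_t_of_commute {Z : E} (hZ : ∀ H ∈ c.t, adL G H Z = 0) : Z ∈ c.t :=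
  mem_torusLieAlgebra_of_commute c.isTorusParam c.maximal hZ

lemma adL_comm_t {H H' : E} (h : H ∈ c.t) (h' : H' ∈ c.t) (X : E) :
    adL G H (adL G H' X) = adL G H' (adL G H X) := by
  rw [adL_jacobi, c.adL_t h h']
  simp

/-- The orthogonal of `𝔱`. -/
def tPerp : Submodule ℝ E where
  carrier := {X | ∀ H ∈ c.t, c.form X H = 0}
  add_mem' := fun {a b} ha hb H hH => by simp [ha H hH, hb H hH]
  zero_mem' := fun H _ => by simp
  smul_mem' := fun r a ha H hH => by simp [ha H hH]

lemma exists_t_add_tPerp (X : E) : ∃ H ∈ c.t, X - H ∈ c.tPerp := by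
  obtain ⟨H, hH, h⟩ := exists_orthogonal_projection c.form c.form_pos c.t
    ((c.form X).comp c.t.subtype)
  refine ⟨H, hH, fun H' hH' => ?_⟩
  have := h ⟨H', hH'⟩
  simp only [LinearMap.comp_apply, Submodule.subtype_apply] at this
  simp [this]

lemma disjoint_t_tPerp {X : E} (h : X ∈ c.t) (h' : X ∈ c.tPerp) : X = 0 :=
  c.form_eq_zero (h' X h)

lemma adL_mem_tPerp {H X : E} (hH : H ∈ c.t) : adL G H X ∈ c.tPerp := by
  intro H' hH'
  rw [form_adL, c.adL_t hH hH']
  simp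

/-- The vector representing a functional. -/
def sharp (ξ : Dual E) : E :=
  (exists_orthogonal_projection c.form c.form_pos ⊤ (ξ.toLinearMap.comp (⊤ : Submodule ℝ E).subtype)).choose

lemma form_sharp (ξ : Dual E) (X : E) : c.form (c.sharp ξ) X = ξ X :=
  (exists_orthogonal_projection c.form c.form_pos ⊤
    (ξ.toLinearMap.comp (⊤ : Submodule ℝ E).subtype)).choose_spec.2 ⟨X, trivial⟩

lemma eq_of_form_eq {X Y : E} (h : ∀ Z, c.form X Z = c.form Y Z) : X = Y := by
  rw [← sub_eq_zero]
  refine c.form_eq_zero ?_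
  rw [c.form.map_sub, LinearMap.sub_apply, h, sub_self]

lemma sharp_mem_t {ξ : Dual E} (h : ξ ∈ c.tDual) : c.sharp ξ ∈ c.t := by
  obtain ⟨H, hH, h1⟩ := c.exists_t_add_tPerp (c.sharp ξ)
  have h2 : c.form (c.sharp ξ - H) (c.sharp ξ - H) = 0 := by
    rw [map_sub (c.form (c.sharp ξ - H)), h1 H hH, sub_zero, c.form_symm, form_sharp]
    exact h _ h1
  rwa [sub_eq_zero.1 (c.form_eq_zero h2)]

/-- The functional represented by a vector. -/
def flat (X : E) : Dual E := toContinuousLinearMap (c.form X)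

lemma flat_apply (X Y : E) : c.flat X Y = c.form X Y := rfl

lemma flat_mem_tDual {H : E} (hH : H ∈ c.t) : c.flat H ∈ c.tDual := by
  intro X hX
  rw [flat_apply, c.form_symm]
  exact hX H hH

/-- A vector pair on which `𝔱` acts by rotations of weight `α`. -/
def IsRootPair (α : Dual E) (X Y : E) : Prop :=
  ∀ H ∈ c.t, adL G H X = -(α H • Y) ∧ adL G H Y = α H • X

variable {c}

lemma IsRootPair.swap {α : Dual E} {X Y : E} (h : c.IsRootPair α X Y) : c.IsRootPair (-α) Y X :=
  fun H hH => ⟨by simp [(h H hH).2], by simp [(h H hH).1]⟩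

lemma IsRootPair.mem_roots {α : Dual E} {X Y : E} (h : c.IsRootPair α X Y) (hα : α ∈ c.tDual)
    (hne : α ≠ 0) (hX : X ≠ 0) : α ∈ roots G c.t c.form :=
  ⟨hα, hne, X, Y, Or.inl hX, fun H hH => by rw [← adL_apply, ← adL_apply]; exact h H hH⟩

lemma IsRootPair.smul {α : Dual E} {X Y : E} (h : c.IsRootPair α X Y) (r : ℝ) :
    c.IsRootPair α (r • X) (r • Y) :=
  fun H hH => ⟨by rw [map_smul, (h H hH).1, smul_neg, smul_comm],
    by rw [map_smul, (h H hH).2, smul_comm]⟩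

variable (c)

/-- Every nonzero `𝔱`-invariant subspace of `𝔱^⊥` contains an orthonormal root pair. -/
lemma exists_rootPair (W : Submodule ℝ E) (hW : W ≠ ⊥) (hWp : W ≤ c.tPerp)
    (hinv : ∀ H ∈ c.t, ∀ X ∈ W, adL G H X ∈ W) :
    ∃ α ∈ c.posRoots, ∃ X ∈ W, ∃ Y ∈ W, c.IsRootPair α X Y ∧ c.form X X = 1 ∧ c.form Y Y = 1 ∧
      c.form X Y = 0 := by
  let S : Set (Submodule ℝ E) := {U | U ≤ W ∧ U ≠ ⊥ ∧ ∀ H ∈ c.t, ∀ X ∈ U, adL G H X ∈ U}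
  obtain ⟨U, ⟨hUW, hU0, hUinv⟩, hmin⟩ :=
    (wellFounded_lt (α := Submodule ℝ E)).has_min S ⟨W, le_rfl, hW, hinv⟩
  have hnt : Nontrivial U := Submodule.nontrivial_iff_ne_bot.2 hU0
  -- symmetric operators commuting with `𝔱` are scalar on `U`
  have hscalar : ∀ T : E →ₗ[ℝ] E, (∀ X ∈ U, T X ∈ U) →
      (∀ X ∈ U, ∀ Y ∈ U, c.form (T X) Y = c.form X (T Y)) →
      (∀ H ∈ c.t, ∀ X ∈ U, T (adL G H X) = adL G H (T X)) → ∃ μ : ℝ, ∀ X ∈ U, T X = μ • X := by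
    intro T hTU hTs hTc
    obtain ⟨μ, x, hx, hμ⟩ := exists_eigenvector_of_symmetric (W := U)
      ((U.subtype.dualMap.comp c.form).comp U.subtype) (fun x y => c.form_symm _ _)
      (fun x hx => c.form_pos _ (by simpa using hx)) (T.restrict hTU)
      (fun x y => hTs x x.2 y y.2)
    refine ⟨μ, ?_⟩
    let U' : Submodule ℝ E := U ⊓ LinearMap.ker (T - μ • LinearMap.id)
    have hU' : U' ∈ S := by
      refine ⟨inf_le_left.trans hUW, ?_, ?_⟩
      · intro h
        have hxm : (x : E) ∈ U' := ⟨x.2, by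
          have := congrArg Subtype.val hμ
          simp only [LinearMap.coe_restrict_apply, Submodule.coe_smul] at this
          simp [this]⟩
        rw [h] at hxm
        exact hx (by simpa using hxm)
      · rintro H hH X ⟨hX, hX'⟩
        refine ⟨hUinv H hH X hX, ?_⟩
        simp only [LinearMap.mem_ker, LinearMap.sub_apply, LinearMap.smul_apply,
          LinearMap.id_apply, SetLike.mem_coe] at hX' ⊢
        rw [hTc H hH X hX, sub_eq_zero.1 hX', map_smul, sub_self]
    have hle : U ≤ U' := by
      by_contra hlt
      exact hmin _ hU' (lt_of_le_not_ge inf_le_left hlt)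
    intro X hX
    have := (hle hX).2
    simpa [sub_eq_zero] using this
  -- the square of `ad H`
  have hsq : ∀ H ∈ c.t, ∃ a : ℝ, ∀ X ∈ U, adL G H (adL G H X) = a • X := by
    intro H hH
    obtain ⟨a, ha⟩ := hscalar ((adL G H).toLinearMap.comp (adL G H).toLinearMap)
      (fun X hX => hUinv H hH _ (hUinv H hH X hX))
      (fun X _ Y _ => by simp [form_adL])
      (fun H' hH' X _ => by
        simp only [LinearMap.comp_apply, coe_coe]
        rw [c.adL_comm_t hH hH', c.adL_comm_t hH hH'])
    exact ⟨a, fun X hX => by simpa using ha X hX⟩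
  obtain ⟨X, hX0⟩ := exists_ne (0 : U)
  have hX : (X : E) ∈ U := X.2
  have hX0 : (X : E) ≠ 0 := by simpa using hX0
  generalize (X : E) = X at hX hX0
  obtain ⟨H1, hH1, hne⟩ : ∃ H ∈ c.t, adL G H X ≠ 0 := by
    by_contra! h
    exact hX0 (c.disjoint_t_tPerp (c.mem_t_of_commute h) (hWp (hUW hX)))
  obtain ⟨a, ha⟩ := hsq H1 hH1
  have ha0 : a < 0 := by
    have h1 := c.form_pos _ hne
    rw [form_adL, ha X hX, map_smul, smul_eq_mul] at h1
    have h2 := c.form_pos X hX0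
    by_contra! h
    have := mul_nonneg h h2.le
    linarith
  set ϰ : ℝ := (Real.sqrt (-a))⁻¹ with hϰ
  have hϰa : ϰ * ϰ * a = -1 := by
    rw [hϰ, ← mul_inv, Real.mul_self_sqrt (by linarith)]
    have := ha0.ne
    field_simp
  have hJ2 : ∀ X ∈ U, ϰ • adL G H1 (ϰ • adL G H1 X) = -X := by
    intro X hX
    rw [map_smul, ha X hX, smul_smul, smul_smul, hϰa, neg_one_smul]
  have hμ : ∀ H ∈ c.t, ∃ μ : ℝ, ∀ X ∈ U, adL G H (ϰ • adL G H1 X) = μ • X := by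
    intro H hH
    obtain ⟨a, ha⟩ := hscalar ((adL G H).toLinearMap.comp (ϰ • (adL G H1).toLinearMap))
      (fun X hX => hUinv H hH _ (U.smul_mem _ (hUinv H1 hH1 X hX)))
      (fun X _ Y _ => by simp [form_adL, c.adL_comm_t hH hH1])
      (fun H' hH' X _ => by
        simp only [LinearMap.comp_apply, coe_coe, LinearMap.smul_apply,
          map_smul]
        rw [c.adL_comm_t hH1 hH', c.adL_comm_t hH hH'])
    exact ⟨a, fun X hX => by simpa using ha X hX⟩
  set Y := ϰ • adL G H1 X with hY
  have hYU : Y ∈ U := U.smul_mem _ (hUinv H1 hH1 X hX)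
  have hXX := c.form_pos X hX0
  have hXY : c.form X Y = 0 := by
    have h1 : c.form Y X = -c.form X Y := by simp [hY, form_adL]
    rw [c.form_symm] at h1
    linarith
  have hYY : c.form Y Y = c.form X X := by
    have h1 : c.form Y Y = -c.form X (ϰ • adL G H1 Y) := by
      nth_rewrite 1 [hY]; simp [form_adL]
    rw [h1, hY, hJ2 X hX]; simp
  -- the weight
  let f : c.t →ₗ[ℝ] ℝ :=
    { toFun := fun H => (c.form X X)⁻¹ * c.form (adL G (H : E) Y) X
      map_add' := fun a b => by simp [mul_add]
      map_smul' := fun r a => by simp [mul_left_comm] }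
  have hf : ∀ (H : E) (hH : H ∈ c.t), ∀ Z ∈ U, adL G H (ϰ • adL G H1 Z) = f ⟨H, hH⟩ • Z := by
    intro H hH
    obtain ⟨μ, h⟩ := hμ H hH
    have : f ⟨H, hH⟩ = μ := by
      change (c.form X X)⁻¹ * c.form (adL G H Y) X = μ
      rw [h X hX]; simp; field_simp
    rw [this]; exact h
  obtain ⟨A, hA, hAf⟩ := exists_orthogonal_projection c.form c.form_pos c.t f
  have hpair : c.IsRootPair (c.flat A) X Y := by
    intro H hH
    rw [flat_apply, show c.form A H = f ⟨H, hH⟩ from hAf ⟨H, hH⟩]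
    refine ⟨?_, hf H hH X hX⟩
    have h1 := hf H hH Y hYU
    rw [hY, hJ2 X hX, map_neg, ← hY] at h1
    rw [← h1, neg_neg]
  have hAne : c.flat A ≠ 0 := by
    intro h
    have := (hpair H1 hH1).1
    rw [h] at this
    exact hne (by simpa using this)
  have hY0 : Y ≠ 0 := fun h => by rw [h] at hYY; simp at hYY; linarith
  set r : ℝ := (Real.sqrt (c.form X X))⁻¹ with hr
  have hr2 : r * (r * c.form X X) = 1 := by
    rw [← mul_assoc, hr, ← mul_inv, Real.mul_self_sqrt hXX.le]
    field_simp
  have hXr : c.form (r • X) (r • X) = 1 := by simpa using hr2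
  have hYr : c.form (r • Y) (r • Y) = 1 := by simpa [hYY] using hr2
  have hXYr : c.form (r • X) (r • Y) = 0 := by simp [hXY]
  have hX' := W.smul_mem r (hUW hX)
  have hY' := W.smul_mem r (hUW hYU)
  have hroot := hpair.mem_roots (c.flat_mem_tDual hA) hAne hX0
  rcases lt_or_gt_of_ne (c.H₀_regular _ hroot) with h | h
  · exact ⟨-c.flat A, ⟨hpair.swap.mem_roots (neg_mem (c.flat_mem_tDual hA)) (neg_ne_zero.2 hAne) hY0,
      by simpa using h⟩, r • Y, hY', r • X, hX', hpair.swap.smul r, hYr, hXr,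
      by rw [c.form_symm]; exact hXYr⟩
  · exact ⟨c.flat A, ⟨hroot, h⟩, r • X, hX', r • Y, hY', hpair.smul r, hXr, hYr, hXYr⟩

/-- An orthonormal basis of a subspace made of root pairs. -/
structure IsRootBasis (W : Submodule ℝ E) {n : ℕ} (α : Fin n → Dual E) (X Y : Fin n → E) : Prop where
  pos : ∀ i, α i ∈ c.posRoots
  pair : ∀ i, c.IsRootPair (α i) (X i) (Y i)
  formXX : ∀ i j, c.form (X i) (X j) = if i = j then 1 else 0
  formYY : ∀ i j, c.form (Y i) (Y j) = if i = j then 1 else 0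
  formXY : ∀ i j, c.form (X i) (Y j) = 0
  span : span ℝ (Set.range X ∪ Set.range Y) = W

lemma exists_isRootBasis_of_le (d : ℕ) : ∀ (W : Submodule ℝ E),
    finrank ℝ W = d → W ≤ c.tPerp → (∀ H ∈ c.t, ∀ X ∈ W, adL G H X ∈ W) →
    ∃ (n : ℕ) (α : Fin n → Dual E) (X Y : Fin n → E), c.IsRootBasis W α X Y := by
  induction d using Nat.strong_induction_on with
  | _ d ih =>
  intro W hd hWp hinv
  by_cases hW : W = ⊥
  · exact ⟨0, Fin.elim0, Fin.elim0, Fin.elim0, fun i => i.elim0, fun i => i.elim0,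
      fun i => i.elim0, fun i => i.elim0, fun i => i.elim0, by simp [hW]⟩
  obtain ⟨α, hα, X, hX, Y, hY, hpair, hXX, hYY, hXY⟩ := c.exists_rootPair W hW hWp hinv
  let W' : Submodule ℝ E := W ⊓ (LinearMap.ker (c.form X) ⊓ LinearMap.ker (c.form Y))
  have hlt : W' < W := by
    refine lt_of_le_of_ne inf_le_left fun h => ?_
    have : X ∈ W' := h ▸ hX
    have h2 : c.form X X = 0 := this.2.1
    rw [hXX] at h2
    exact one_ne_zero h2
  have hinv' : ∀ H ∈ c.t, ∀ Z ∈ W', adL G H Z ∈ W' := by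
    rintro H hH Z ⟨hZ, hZX, hZY⟩
    simp only [SetLike.mem_coe, LinearMap.mem_ker] at hZX hZY
    refine ⟨hinv H hH Z hZ, ?_, ?_⟩
    · simp only [SetLike.mem_coe, LinearMap.mem_ker]
      rw [c.form_symm, form_adL, (hpair H hH).1, c.form_symm]; simp [hZY]
    · simp only [SetLike.mem_coe, LinearMap.mem_ker]
      rw [c.form_symm, form_adL, (hpair H hH).2, c.form_symm]; simp [hZX]
  obtain ⟨n, α', X', Y', h⟩ := ih _ (hd ▸ Submodule.finrank_lt_finrank_of_lt hlt) W' rfl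
    (inf_le_left.trans hWp) hinv'
  have hXm : ∀ i, X' i ∈ W' := fun i => h.span ▸ subset_span (Or.inl ⟨i, rfl⟩)
  have hYm : ∀ i, Y' i ∈ W' := fun i => h.span ▸ subset_span (Or.inr ⟨i, rfl⟩)
  have e1 : ∀ i, c.form X (X' i) = 0 := fun i => (hXm i).2.1
  have e2 : ∀ i, c.form X (Y' i) = 0 := fun i => (hYm i).2.1
  have e3 : ∀ i, c.form Y (X' i) = 0 := fun i => (hXm i).2.2
  have e4 : ∀ i, c.form Y (Y' i) = 0 := fun i => (hYm i).2.2
  refine ⟨n + 1, cons α α', cons X X', cons Y Y', ?_, ?_, ?_, ?_, ?_, ?_⟩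
  · intro i; refine Fin.cases ?_ (fun i => ?_) i
    · simpa using hα
    · simpa using h.pos i
  · intro i; refine Fin.cases ?_ (fun i => ?_) i
    · simpa using hpair
    · simpa using h.pair i
  · intro i j
    refine Fin.cases ?_ (fun i => ?_) i <;> refine Fin.cases ?_ (fun j => ?_) j
    · simpa using hXX
    · simp [e1, (Fin.succ_ne_zero j).symm]
    · simp [c.form_symm _ X, e1]
    · simp [h.formXX]
  · intro i j
    refine Fin.cases ?_ (fun i => ?_) i <;> refine Fin.cases ?_ (fun j => ?_) j
    · simpa using hYY
    · simp [e4, (Fin.succ_ne_zero j).symm]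
    · simp [c.form_symm _ Y, e4]
    · simp [h.formYY]
  · intro i j
    refine Fin.cases ?_ (fun i => ?_) i <;> refine Fin.cases ?_ (fun j => ?_) j
    · simpa using hXY
    · simp [e2]
    · simp [c.form_symm _ Y, e3]
    · simp [h.formXY]
  · rw [Fin.range_cons, Fin.range_cons]
    refine le_antisymm (Submodule.span_le.2 ?_) ?_
    · rintro z ((rfl | ⟨i, rfl⟩) | (rfl | ⟨i, rfl⟩))
      exacts [hX, (hXm i).1, hY, (hYm i).1]
    · intro Z hZ
      have hZ' : Z - c.form X Z • X - c.form Y Z • Y ∈ W' := by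
        refine ⟨W.sub_mem (W.sub_mem hZ (W.smul_mem _ hX)) (W.smul_mem _ hY), ?_, ?_⟩
        · simp [hXX, hXY]
        · simp [hYY, c.form_symm Y X, hXY]
      rw [← h.span] at hZ'
      have h1 := Submodule.span_mono (s := Set.range X' ∪ Set.range Y')
        (t := insert X (Set.range X') ∪ insert Y (Set.range Y'))
        (Set.union_subset_union (Set.subset_insert _ _) (Set.subset_insert _ _)) hZ'
      have h2 : X ∈ span ℝ (insert X (Set.range X') ∪ insert Y (Set.range Y')) :=
        subset_span (Or.inl (Set.mem_insert _ _))
      have h3 : Y ∈ span ℝ (insert X (Set.range X') ∪ insert Y (Set.range Y')) :=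
        subset_span (Or.inr (Set.mem_insert _ _))
      have h4 := Submodule.add_mem _ (Submodule.add_mem _ h1 (smul_mem _ (c.form Y Z) h3))
        (smul_mem _ (c.form X Z) h2)
      convert h4 using 1
      abel

lemma exists_isRootBasis :
    ∃ (n : ℕ) (α : Fin n → Dual E) (X Y : Fin n → E), c.IsRootBasis c.tPerp α X Y :=
  c.exists_isRootBasis_of_le _ _ rfl le_rfl fun _ hH _ _ => c.adL_mem_tPerp hH

end CartanData

end

section

namespace CartanData

variable {c : CartanData E G}

lemma tDual_ext {ξ η : Dual E} (hξ : ξ ∈ c.tDual) (hη : η ∈ c.tDual)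
    (h : ∀ H ∈ c.t, ξ H = η H) : ξ = η := by
  ext X
  obtain ⟨H, hH, hX⟩ := c.exists_t_add_tPerp X
  have h1 := hξ _ hX
  have h2 := hη _ hX
  rw [map_sub, sub_eq_zero] at h1 h2
  rw [h1, h2, h H hH]

lemma IsRootBasis.mem_t {n : ℕ} {α : Fin n → Dual E} {X Y : Fin n → E}
    (h : c.IsRootBasis c.tPerp α X Y) {Z : E} (h1 : ∀ i, c.form Z (X i) = 0)
    (h2 : ∀ i, c.form Z (Y i) = 0) : Z ∈ c.t := by
  obtain ⟨H, hH, hN⟩ := c.exists_t_add_tPerp Z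
  have h3 : ∀ N ∈ c.tPerp, c.form (Z - H) N = 0 := by
    intro N hN
    have e1 : c.form H N = 0 := by rw [c.form_symm]; exact hN H hH
    rw [map_sub, LinearMap.sub_apply, e1, sub_zero]
    clear e1
    rw [← h.span] at hN
    induction hN using span_induction with
    | mem x hx => rcases hx with ⟨i, rfl⟩ | ⟨i, rfl⟩; exacts [h1 i, h2 i]
    | zero => simp
    | add x y _ _ hx hy => simp [hx, hy]
    | smul r x _ hx => simp [hx]
  rwa [sub_eq_zero.1 (c.form_eq_zero (h3 _ hN))]

lemma IsRootBasis.mem_range {n : ℕ} {α : Fin n → Dual E} {X Y : Fin n → E}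
    (h : c.IsRootBasis c.tPerp α X Y) {β : Dual E} (hβ : β ∈ c.posRoots) : ∃ i, α i = β := by
  by_contra! hne
  obtain ⟨⟨hβt, hβ0, X', Y', hXY, hpair⟩, hβpos⟩ := hβ
  have hpair : c.IsRootPair β X' Y' := fun H hH => by
    rw [adL_apply, adL_apply]; exact hpair H hH
  have hH : ∀ i, ∃ H ∈ c.t, β H ^ 2 - α i H ^ 2 ≠ 0 := by
    intro i
    obtain ⟨H1, hH1, e1⟩ : ∃ H ∈ c.t, (β - α i) H ≠ 0 := by
      by_contra! h0
      refine hne i (tDual_ext (h.pos i).1.1 hβt fun H hH => ?_)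
      have := h0 H hH
      simp only [sub_apply] at this
      linarith
    obtain ⟨H2, hH2, e2⟩ : ∃ H ∈ c.t, (β + α i) H ≠ 0 := by
      refine ⟨c.H₀, c.H₀_mem, ?_⟩
      have := (h.pos i).2
      simp only [add_apply]
      linarith
    have key : ∃ H ∈ c.t, (β - α i) H ≠ 0 ∧ (β + α i) H ≠ 0 := by
      by_cases e3 : (β + α i) H1 = 0
      · by_cases e4 : (β - α i) H2 = 0
        · exact ⟨H1 + H2, add_mem hH1 hH2, by rw [map_add, e4, add_zero]; exact e1,
            by rw [map_add, e3, zero_add]; exact e2⟩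
        · exact ⟨H2, hH2, e4, e2⟩
      · exact ⟨H1, hH1, e1, e3⟩
    obtain ⟨H, hH, e5, e6⟩ := key
    refine ⟨H, hH, ?_⟩
    have := mul_ne_zero e5 e6
    simp only [sub_apply, add_apply] at this
    intro h0; apply this; linear_combination h0
  have hz : ∀ i, (c.form X' (X i) = 0 ∧ c.form X' (Y i) = 0) ∧
      (c.form Y' (X i) = 0 ∧ c.form Y' (Y i) = 0) := by
    intro i
    obtain ⟨H, hH, hne⟩ := hH i
    obtain ⟨p1, p2⟩ := hpair H hH
    obtain ⟨q1, q2⟩ := h.pair i H hH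
    have e1 := c.form_adL H X' (X i)
    have e2 := c.form_adL H X' (Y i)
    have e3 := c.form_adL H Y' (X i)
    have e4 := c.form_adL H Y' (Y i)
    rw [p1, q1] at e1
    rw [p1, q2] at e2
    rw [p2, q1] at e3
    rw [p2, q2] at e4
    simp only [map_neg, map_smul, LinearMap.neg_apply, LinearMap.smul_apply, smul_eq_mul,
      neg_neg, neg_inj] at e1 e2 e3 e4
    refine ⟨⟨?_, ?_⟩, ?_, ?_⟩ <;> refine (mul_eq_zero.1 ?_).resolve_left hne
    · linear_combination β H * e3 + α i H * e2
    · linear_combination β H * e4 + α i H * e1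
    · linear_combination -α i H * e4 - β H * e1
    · linear_combination β H * e2 + α i H * e3
  have hX := h.mem_t (fun i => (hz i).1.1) (fun i => (hz i).1.2)
  have hY := h.mem_t (fun i => (hz i).2.1) (fun i => (hz i).2.2)
  have e1 := (hpair c.H₀ c.H₀_mem).1
  have e2 := (hpair c.H₀ c.H₀_mem).2
  rw [c.adL_t c.H₀_mem hX] at e1
  rw [c.adL_t c.H₀_mem hY] at e2
  rcases hXY with h0 | h0
  · exact h0 ((smul_eq_zero.1 e2.symm).resolve_left hβpos.ne')
  · exact h0 ((smul_eq_zero.1 (neg_eq_zero.1 e1.symm)).resolve_left hβpos.ne')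

variable (c)

/-- The tangent vectors of the coordinate lines of the torus. -/
def coordVec (i : Fin c.ℓ) : E := velocity (E := E) G c.p (single i 1)

lemma velocity_eq_sum (v : Fin c.ℓ → ℝ) :
    velocity (E := E) G c.p v = ∑ i, v i • c.coordVec i := by
  conv_lhs => rw [← Finset.univ_sum_single v, map_sum]
  refine sum_congr rfl fun i _ => ?_
  rw [coordVec, ← map_smul]
  congr 1
  ext j
  by_cases hj : j = i
  · subst hj; simp
  · simp [hj]

lemma velocity_mem_t (v : Fin c.ℓ → ℝ) : velocity (E := E) G c.p v ∈ c.t := ⟨v, rfl⟩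

lemma coordVec_mem_t (i : Fin c.ℓ) : c.coordVec i ∈ c.t := ⟨_, rfl⟩

/-- The coordinates of a functional in the basis of `𝔱*` dual to the torus coordinates. -/
def coord : Dual E →L[ℝ] (Fin c.ℓ → ℝ) :=
  ContinuousLinearMap.pi fun i => ContinuousLinearMap.apply ℝ ℝ (c.coordVec i)

@[simp] lemma coord_apply (ξ : Dual E) (i : Fin c.ℓ) : c.coord ξ i = ξ (c.coordVec i) := rfl

lemma apply_velocity (ξ : Dual E) (v : Fin c.ℓ → ℝ) :
    ξ (velocity (E := E) G c.p v) = ∑ i, v i * c.coord ξ i := by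
  rw [velocity_eq_sum, map_sum]
  simp

/-- The linear isomorphism of `𝔱*` with `ℝ^ℓ`. -/
def coordEquiv : c.tDual ≃ₗ[ℝ] (Fin c.ℓ → ℝ) :=
  LinearEquiv.ofBijective (c.coord.toLinearMap.comp c.tDual.subtype) (by
    constructor
    · rw [injective_iff_map_eq_zero]
      intro ξ hξ
      have : (ξ : Dual E) = 0 := by
        refine tDual_ext ξ.2 (zero_mem _) ?_
        rintro _ ⟨v, rfl⟩
        have h1 := c.apply_velocity ξ v
        rw [show c.coord (ξ : Dual E) = 0 from hξ] at h1
        simpa using h1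
      simpa using this
    · intro x
      let e := LinearEquiv.ofInjective (velocity (E := E) G c.p).toLinearMap
        c.isTorusParam.velocity_injective
      obtain ⟨A, hA, h⟩ := exists_orthogonal_projection c.form c.form_pos c.t
        ((Fintype.linearCombination ℝ x).comp e.symm.toLinearMap)
      refine ⟨⟨c.flat A, c.flat_mem_tDual hA⟩, ?_⟩
      ext i
      refine (h (e (single i 1))).trans ?_
      change Fintype.linearCombination ℝ x (e.symm (e (single i 1))) = x i
      rw [LinearEquiv.symm_apply_apply]
      simp)

/-- The inverse of the coordinates, as a map to `𝔤*`. -/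
def lift : (Fin c.ℓ → ℝ) →L[ℝ] Dual E :=
  toContinuousLinearMap (c.tDual.subtype.comp c.coordEquiv.symm.toLinearMap)

lemma lift_mem (x : Fin c.ℓ → ℝ) : c.lift x ∈ c.tDual := (c.coordEquiv.symm x).2

@[simp] lemma coord_lift (x : Fin c.ℓ → ℝ) : c.coord (c.lift x) = x :=
  c.coordEquiv.apply_symm_apply x

lemma lift_coord {ξ : Dual E} (hξ : ξ ∈ c.tDual) : c.lift (c.coord ξ) = ξ :=
  congrArg Subtype.val (c.coordEquiv.symm_apply_apply ⟨ξ, hξ⟩)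

lemma mem_weightLattice_iff {l : Dual E} :
    l ∈ c.weightLattice ↔ l ∈ c.tDual ∧ ∀ i, ∃ n : ℤ, c.coord l i = n := by
  refine and_congr_right fun _ => ⟨fun h i => ?_, fun h s hs => ?_⟩
  · obtain ⟨n, hn⟩ := h (single i (2 * π)) ((c.isTorusParam.ker _).2 fun j => by
      by_cases hj : j = i
      · subst hj; exact ⟨1, by simp⟩
      · exact ⟨0, by simp [hj]⟩)
    refine ⟨n, ?_⟩
    rw [apply_velocity, Finset.sum_eq_single i] at hn
    · simpa [Real.pi_ne_zero] using hn
    · intro j _ hj; simp [hj]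
    · simp
  · choose n hn using h
    choose m hm using (c.isTorusParam.ker s).1 hs
    refine ⟨∑ i, m i * n i, ?_⟩
    rw [apply_velocity]
    push_cast
    rw [mul_sum]
    exact sum_congr rfl fun i _ => by rw [hm, hn]; ring

lemma root_mem_weightLattice {α : Dual E} (hα : α ∈ roots G c.t c.form) : α ∈ c.weightLattice := by
  obtain ⟨hαt, hα0, X, Y, hXY, hpair⟩ := hα
  refine ⟨hαt, fun s hs => ?_⟩
  obtain ⟨h1, h2⟩ := hpair _ (c.velocity_mem_t s)
  rw [← adL_apply] at h1 h2
  set a := α (velocity (E := E) G c.p s) with ha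
  have hγ := c.isTorusParam.isOneParam s
  have d1 : ∀ u : ℝ, HasDerivAt (fun u : ℝ => cos (u * a)) (-sin (u * a) * a) u :=
    fun u => (((hasDerivAt_id' u).mul_const a).cos).congr_deriv (by simp)
  have d2 : ∀ u : ℝ, HasDerivAt (fun u : ℝ => sin (u * a)) (cos (u * a) * a) u :=
    fun u => (((hasDerivAt_id' u).mul_const a).sin).congr_deriv (by simp)
  have e1 := hγ.Ad_apply_eq (Z := fun u => cos (u * a) • X - sin (u * a) • Y) (fun u => by
    have := ((d1 u).smul_const X).sub ((d2 u).smul_const Y)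
    refine this.congr_deriv ?_
    rw [map_sub, map_smul, map_smul, h1, h2]
    module) 1
  have e2 := hγ.Ad_apply_eq (Z := fun u => sin (u * a) • X + cos (u * a) • Y) (fun u => by
    have := ((d2 u).smul_const X).add ((d1 u).smul_const Y)
    refine this.congr_deriv ?_
    rw [map_add, map_smul, map_smul, h1, h2]
    module) 1
  simp only [one_smul, hs, Ad_one, id_apply, zero_mul, Real.cos_zero,
    Real.sin_zero, zero_smul, sub_zero, one_mul, zero_add] at e1 e2
  have hcs := Real.sin_sq_add_cos_sq a
  have f1 : (2 - 2 * cos a) • X = 0 := by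
    have : (1 - cos a) • X + sin a • Y = 0 := by
      nth_rewrite 1 [sub_smul, one_smul, e1]; abel
    have h3 : (1 - cos a) • Y - sin a • X = 0 := by
      nth_rewrite 1 [sub_smul, one_smul, e2]; abel
    have h4 : (2 - 2 * cos a) • X = (1 - cos a) • ((1 - cos a) • X + sin a • Y)
        - sin a • ((1 - cos a) • Y - sin a • X) := by
      rw [show 2 - 2 * cos a = (1 - cos a) * (1 - cos a) + sin a * sin a by
        linear_combination -hcs]
      module
    rw [h4, this, h3]; simp
  have f2 : (2 - 2 * cos a) • Y = 0 := by
    have : (1 - cos a) • X + sin a • Y = 0 := by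
      nth_rewrite 1 [sub_smul, one_smul, e1]; abel
    have h3 : (1 - cos a) • Y - sin a • X = 0 := by
      nth_rewrite 1 [sub_smul, one_smul, e2]; abel
    have h4 : (2 - 2 * cos a) • Y = sin a • ((1 - cos a) • X + sin a • Y)
        + (1 - cos a) • ((1 - cos a) • Y - sin a • X) := by
      rw [show 2 - 2 * cos a = (1 - cos a) * (1 - cos a) + sin a * sin a by
        linear_combination -hcs]
      module
    rw [h4, this, h3]; simp
  have f3 : 2 - 2 * cos a = 0 := by
    rcases hXY with h | h
    · exact (smul_eq_zero.1 f1).resolve_right h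
    · exact (smul_eq_zero.1 f2).resolve_right h
  obtain ⟨n, hn⟩ := (Real.cos_eq_one_iff a).1 (by linarith)
  exact ⟨n, by rw [← hn]; ring⟩

lemma two_smul_rho_mem : (2 : ℝ) • c.rho ∈ c.weightLattice := by
  rw [rho, smul_smul]
  norm_num
  refine finsum_mem_induction (· ∈ c.weightLattice) (zero_mem _) (fun _ _ => add_mem) ?_
  exact fun α hα => c.root_mem_weightLattice hα.1

/-- An integral matrix that describes the action of some element of `G` on `𝔱`. -/
def IsWeylMatrix (M : Matrix (Fin c.ℓ) (Fin c.ℓ) ℤ) (g : G) : Prop :=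
  ∀ v, Ad g (velocity (E := E) G c.p v) =
    velocity (E := E) G c.p ((M.map (Int.cast : ℤ → ℝ)).mulVec v)

/-- The Weyl group, as a set of integral matrices. -/
def weyl : Set (Matrix (Fin c.ℓ) (Fin c.ℓ) ℤ) := {M | ∃ g, c.IsWeylMatrix M g}

lemma exists_isWeylMatrix {g : G} (hg : ∀ H ∈ c.t, Ad g H ∈ c.t) : ∃ M, c.IsWeylMatrix M g := by
  have h1 : ∀ i, ∃ w, velocity (E := E) G c.p w = Ad g (c.coordVec i) := fun i =>
    hg _ (c.coordVec_mem_t i)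
  choose w hw using h1
  have h2 : ∀ i j, ∃ n : ℤ, w i j = n := by
    intro i j
    have e1 := (c.isTorusParam.isOneParam (single i 1)).conj g
    have e2 := c.isTorusParam.isOneParam (w i)
    rw [hw i] at e2
    have e3 := congrFun (e1.unique e2) (2 * π)
    have e4 : c.p ((2 * π) • (single i (1 : ℝ) : Fin c.ℓ → ℝ)) = 1 := by
      rw [c.isTorusParam.ker]
      intro j
      by_cases hj : j = i
      · subst hj; exact ⟨1, by simp⟩
      · exact ⟨0, by simp [hj]⟩
    rw [e4, mul_one, mul_inv_cancel] at e3
    obtain ⟨n, hn⟩ := (c.isTorusParam.ker _).1 e3.symm j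
    refine ⟨n, ?_⟩
    simp only [Pi.smul_apply, smul_eq_mul] at hn
    have := Real.pi_ne_zero
    field_simp at hn
    linarith
  choose n hn using h2
  refine ⟨Matrix.of fun j i => n i j, fun v => ?_⟩
  rw [velocity_eq_sum, map_sum]
  have : ((Matrix.of fun j i => n i j).map (Int.cast : ℤ → ℝ)).mulVec v = ∑ i, v i • w i := by
    ext j
    simp [Matrix.mulVec, dotProduct, hn, mul_comm]
  rw [this, map_sum]
  simp [hw]

lemma weyl_finite : c.weyl.Finite := by
  obtain ⟨ϰ, hϰ, hb⟩ : ∃ ϰ > 0, ∀ v : Fin c.ℓ → ℝ,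
      ϰ * ‖v‖ ^ 2 ≤ c.form (velocity (E := E) G c.p v) (velocity (E := E) G c.p v) := by
    let q : (Fin c.ℓ → ℝ) → ℝ := fun v =>
      c.form (velocity (E := E) G c.p v) (velocity (E := E) G c.p v)
    have hq : Continuous q := by
      let F : E →L[ℝ] E →L[ℝ] ℝ := toContinuousLinearMap
        ((toContinuousLinearMap : (E →ₗ[ℝ] ℝ) ≃ₗ[ℝ] _).toLinearMap.comp c.form)
      exact (show Continuous fun v => F (velocity (E := E) G c.p v) (velocity (E := E) G c.p v) by
        fun_prop)
    rcases isEmpty_or_nonempty (Fin c.ℓ) with he | he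
    · exact ⟨1, one_pos, fun v => by
        rw [Subsingleton.elim v 0]; simp⟩
    obtain ⟨v0, hv0, hmin⟩ := (isCompact_sphere (0 : Fin c.ℓ → ℝ) 1).exists_isMinOn
      (NormedSpace.sphere_nonempty.2 zero_le_one) hq.continuousOn
    have hv0' : v0 ≠ 0 := fun h => by simp [h] at hv0
    refine ⟨q v0, c.form_pos _ fun h => hv0' (c.isTorusParam.velocity_injective (by simpa using h)),
      fun v => ?_⟩
    by_cases hv : v = 0
    · simp [hv]
    have h1 : q v0 ≤ q (‖v‖⁻¹ • v) := hmin (by simp [norm_smul, hv])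
    have h2 : q (‖v‖⁻¹ • v) = (‖v‖⁻¹) ^ 2 * q v := by simp [q]; ring
    have h3 : 0 < ‖v‖ := norm_pos_iff.2 hv
    rw [h2] at h1
    calc q v0 * ‖v‖ ^ 2 ≤ ((‖v‖⁻¹) ^ 2 * q v) * ‖v‖ ^ 2 := by gcongr
      _ = q v := by field_simp
  obtain ⟨R, hR⟩ : ∃ R : ℝ, ∀ i, c.form (c.coordVec i) (c.coordVec i) ≤ R :=
    (Finite.exists_le fun i => c.form (c.coordVec i) (c.coordVec i))
  obtain ⟨B, hB⟩ := exists_nat_gt (R / ϰ + 1)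
  have hfin : (Set.univ.pi fun _ : Fin c.ℓ => Set.univ.pi fun _ : Fin c.ℓ =>
      Set.Icc (-(B : ℤ)) B).Finite :=
    Set.Finite.pi fun _ => Set.Finite.pi fun _ => Set.finite_Icc _ _
  refine hfin.subset fun (M : Matrix (Fin c.ℓ) (Fin c.ℓ) ℤ) hM => ?_
  obtain ⟨g, hg⟩ := hM
  intro i _ j _
  have h1 := hb ((M.map (Int.cast : ℤ → ℝ)).mulVec (single j 1))
  rw [← hg, c.form_inv] at h1
  have h2 := h1.trans (hR j)
  have h3 : |(M i j : ℝ)| ≤ ‖(M.map (Int.cast : ℤ → ℝ)).mulVec (single j 1)‖ := by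
    have := norm_le_pi_norm ((M.map (Int.cast : ℤ → ℝ)).mulVec (single j 1)) i
    simpa using this
  have h4 : |(M i j : ℝ)| ^ 2 ≤ R / ϰ := by
    rw [le_div_iff₀ hϰ]
    calc |(M i j : ℝ)| ^ 2 * ϰ ≤ ‖(M.map (Int.cast : ℤ → ℝ)).mulVec (single j 1)‖ ^ 2 * ϰ := by
          gcongr
      _ ≤ R := by linarith
  have h5 : |(M i j : ℝ)| ≤ B := by nlinarith [abs_nonneg (M i j : ℝ), sq_nonneg (|(M i j : ℝ)| - 1)]
  have h6 : |M i j| ≤ (B : ℤ) := by exact_mod_cast h5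
  exact abs_le.1 h6

variable {c}

lemma IsWeylMatrix.Ad_mem_t {M} {g : G} (h : c.IsWeylMatrix M g) {H : E} (hH : H ∈ c.t) :
    Ad g H ∈ c.t := by
  obtain ⟨v, rfl⟩ := hH
  exact ⟨_, (h v).symm⟩

lemma Ad_inv_apply (g : G) (X : E) : Ad g⁻¹ (Ad g X) = X :=
  congrArg (fun f : E →L[ℝ] E => f X) (Ad_inv_comp g)

lemma Ad_apply_inv (g : G) (X : E) : Ad g (Ad g⁻¹ X) = X :=
  congrArg (fun f : E →L[ℝ] E => f X) (Ad_comp_inv g)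

lemma Ad_inv_mem_t {g : G} (hg : ∀ H ∈ c.t, Ad g H ∈ c.t) {H : E} (hH : H ∈ c.t) :
    Ad g⁻¹ H ∈ c.t := by
  let f : c.t →ₗ[ℝ] c.t := (Ad g : E →L[ℝ] E).toLinearMap.restrict hg
  have hinj : Injective f := by
    intro x y hxy
    have h1 : Ad g (x : E) = Ad g (y : E) := congrArg Subtype.val hxy
    have := congrArg (Ad g⁻¹ : E →L[ℝ] E) h1
    rw [Ad_inv_apply, Ad_inv_apply] at this
    exact Subtype.ext this
  obtain ⟨H', hH'⟩ := LinearMap.injective_iff_surjective.1 hinj ⟨H, hH⟩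
  have h1 : Ad g (H' : E) = H := congrArg Subtype.val hH'
  rw [← h1, Ad_inv_apply]
  exact H'.2

lemma comp_Ad_mem_tDual {g : G} (hg : ∀ H ∈ c.t, Ad g H ∈ c.t) {ξ : Dual E} (hξ : ξ ∈ c.tDual) :
    ξ.comp (Ad g) ∈ c.tDual := by
  intro X hX
  refine hξ _ fun H hH => ?_
  change c.form (Ad g X) H = 0
  rw [← Ad_apply_inv g H, c.form_inv]
  exact hX _ (Ad_inv_mem_t hg hH)

lemma IsWeylMatrix.coord_comp {M} {g : G} (h : c.IsWeylMatrix M g) (ξ : Dual E) (j : Fin c.ℓ) :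
    c.coord (ξ.comp (Ad g)) j = ∑ i, c.coord ξ i * M i j := by
  rw [coord_apply, comp_apply, coordVec, h, apply_velocity]
  refine sum_congr rfl fun i _ => ?_
  simp [mul_comm]

lemma comp_Ad_eq_iff {g : G} {ξ : Dual E} : coAd g ξ = ξ ↔ ξ.comp (Ad g) = ξ := by
  constructor
  · intro h
    nth_rewrite 1 [← h]
    rw [coAd, comp_assoc, Ad_inv_comp, comp_id]
  · intro h
    nth_rewrite 1 [← h]
    rw [coAd, comp_assoc, Ad_comp_inv, comp_id]

lemma IsWeylMatrix.coAd_eq_iff {M} {g : G} (h : c.IsWeylMatrix M g) {ξ : Dual E}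
    (hξ : ξ ∈ c.tDual) : coAd g ξ = ξ ↔ ∀ j, ∑ i, c.coord ξ i * M i j = c.coord ξ j := by
  rw [comp_Ad_eq_iff]
  simp only [← h.coord_comp]
  constructor
  · intro h j; rw [h]
  · intro h1
    have h2 := comp_Ad_mem_tDual (fun H hH => h.Ad_mem_t hH) hξ
    rw [← c.lift_coord h2, ← c.lift_coord hξ]
    congr 1
    rw [c.lift_coord hξ]
    exact funext h1

lemma IsRootBasis.mem_openChamber_iff {n : ℕ} {α : Fin n → Dual E} {X Y : Fin n → E}
    (h : c.IsRootBasis c.tPerp α X Y) {ξ : Dual E} :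
    ξ ∈ c.openChamber ↔ ξ ∈ c.tDual ∧ ∀ i, 0 < ξ (c.sharp (α i)) := by
  refine and_congr_right fun _ => ⟨fun h1 i => ?_, fun h1 β hβ => ?_⟩
  · obtain ⟨A, hA, hpos⟩ := h1 _ (h.pos i)
    have : A = c.sharp (α i) := c.eq_of_form_eq fun Z => by rw [hA, form_sharp]
    rwa [← this]
  · obtain ⟨i, rfl⟩ := h.mem_range hβ
    exact ⟨_, fun X => form_sharp c _ X, h1 i⟩

lemma IsRootBasis.eq_zero_of_adL {n : ℕ} {α : Fin n → Dual E} {X Y : Fin n → E}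
    (h : c.IsRootBasis c.tPerp α X Y) {ξ : Dual E} (hξ : ξ ∈ c.openChamber) {Z : E}
    (hZ : adL G (c.sharp ξ) Z = 0) : Z ∈ c.t := by
  obtain ⟨hξt, hpos⟩ := h.mem_openChamber_iff.1 hξ
  have hpos : ∀ i, 0 < α i (c.sharp ξ) := fun i => by
    have := hpos i
    rwa [← form_sharp c ξ, c.form_symm, form_sharp] at this
  refine h.mem_t (fun i => ?_) (fun i => ?_)
  · have e1 := c.form_adL (c.sharp ξ) Z (Y i)
    rw [hZ, (h.pair i _ (c.sharp_mem_t hξt)).2] at e1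
    simp only [map_zero, LinearMap.zero_apply, map_smul, smul_eq_mul] at e1
    exact (mul_eq_zero.1 (neg_eq_zero.1 e1.symm)).resolve_left (hpos i).ne'
  · have e1 := c.form_adL (c.sharp ξ) Z (X i)
    rw [hZ, (h.pair i _ (c.sharp_mem_t hξt)).1] at e1
    simp only [map_zero, LinearMap.zero_apply, map_smul, map_neg, neg_neg, smul_eq_mul] at e1
    exact (mul_eq_zero.1 e1.symm).resolve_left (hpos i).ne'

lemma Ad_sharp {g : G} {ξ : Dual E} (h : coAd g ξ = ξ) : Ad g (c.sharp ξ) = c.sharp ξ := by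
  refine c.eq_of_form_eq fun Z => ?_
  rw [form_sharp, ← Ad_apply_inv g Z, c.form_inv, form_sharp, Ad_apply_inv]
  exact congrArg (fun f : Dual E => f Z) h

lemma IsRootBasis.Ad_mem_t_of_coAd_eq {n : ℕ} {α : Fin n → Dual E} {X Y : Fin n → E}
    (h : c.IsRootBasis c.tPerp α X Y) {ξ : Dual E} (hξ : ξ ∈ c.openChamber) {g : G}
    (hg : coAd g ξ = ξ) {H : E} (hH : H ∈ c.t) : Ad g H ∈ c.t := by
  refine h.eq_zero_of_adL hξ ?_
  rw [← Ad_sharp (c := c) hg, ← Ad_adL, c.adL_t (c.sharp_mem_t hξ.1) hH, map_zero]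

/-- The reflection in a root is induced by an element of `G`. -/
lemma exists_reflection {α : Dual E} (hα : α ∈ c.tDual) (hα0 : α ≠ 0) {X Y : E}
    (hp : c.IsRootPair α X Y) (hY1 : c.form Y Y = 1) :
    ∃ g : G, ∀ H ∈ c.t, Ad g H = H - (2 * α H / α (c.sharp α)) • c.sharp α := by
  set A := c.sharp α with hA
  have hAt : A ∈ c.t := c.sharp_mem_t hα
  have hA0 : A ≠ 0 := fun h => hα0 (by
    ext Z; rw [← form_sharp c, ← hA, h]; simp)
  have hpos : 0 < α A := by rw [← form_sharp c]; exact c.form_pos A hA0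
  have hXH : ∀ H ∈ c.t, adL G X H = α H • Y := fun H hH => by
    rw [adL_swap, (hp H hH).1, neg_neg]
  have hXY : adL G X Y = -A := by
    have h1 : adL G X Y ∈ c.t := c.mem_t_of_commute fun H hH => by
      rw [adL_jacobi, (hp H hH).1, (hp H hH).2]
      simp [adL_self]
    rw [← add_eq_zero_iff_eq_neg]
    refine c.disjoint_t_tPerp (add_mem h1 hAt) fun H hH => ?_
    rw [map_add, LinearMap.add_apply, form_sharp, form_adL, hXH H hH]
    simp [hY1]
  obtain ⟨γ, hγ⟩ := exists_isOneParam (G := G) X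
  set w := Real.sqrt (α A) with hw
  have hw0 : 0 < w := Real.sqrt_pos.2 hpos
  have hww : w * w = α A := Real.mul_self_sqrt hpos.le
  have hrot : Ad (γ (π / w)) A = -A := by
    have d1 : ∀ u : ℝ, HasDerivAt (fun u : ℝ => cos (u * w)) (-sin (u * w) * w) u :=
      fun u => (((hasDerivAt_id' u).mul_const w).cos).congr_deriv (by simp)
    have d2 : ∀ u : ℝ, HasDerivAt (fun u : ℝ => sin (u * w)) (cos (u * w) * w) u :=
      fun u => (((hasDerivAt_id' u).mul_const w).sin).congr_deriv (by simp)
    have e1 := hγ.Ad_apply_eq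
      (Z := fun u => cos (u * w) • A + sin (u * w) • (w • Y)) (fun u => by
      have := ((d1 u).smul_const A).add ((d2 u).smul_const (w • Y))
      refine this.congr_deriv ?_
      rw [map_add, map_smul, map_smul, map_smul, hXH A hAt, hXY, ← hww]
      module) (π / w)
    simpa [div_mul_cancel₀ _ hw0.ne'] using e1
  refine ⟨γ (π / w), fun H hH => ?_⟩
  have h1 : Ad (γ (π / w)) (H - (α H / α A) • A) = H - (α H / α A) • A := by
    refine hγ.Ad_eq_self ?_ _
    rw [hXH _ (sub_mem hH (c.t.smul_mem _ hAt))]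
    simp [div_mul_cancel₀ _ hpos.ne']
  have h2 : H = (H - (α H / α A) • A) + (α H / α A) • A := by abel
  conv_lhs => rw [h2, map_add, map_smul, h1, hrot]
  module

/-- Up to positive factors, the inequalities that define the open chamber are rational. -/
lemma IsRootBasis.exists_rational {n : ℕ} {α : Fin n → Dual E} {X Y : Fin n → E}
    (h : c.IsRootBasis c.tPerp α X Y) (i : Fin n) :
    ∃ (r : ℝ) (q : Fin c.ℓ → ℚ), 0 < r ∧
      ∀ ξ ∈ c.tDual, ξ (c.sharp (α i)) = r * ∑ j, q j * c.coord ξ j := by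
  obtain ⟨⟨hαt, hα0, -⟩, -⟩ := (h.pos i).1, (h.pos i).2
  obtain ⟨g, hg⟩ := exists_reflection hαt hα0 (h.pair i) (by simpa using h.formYY i i)
  set A := c.sharp (α i) with hA
  have hAt : A ∈ c.t := c.sharp_mem_t hαt
  have hA0 : A ≠ 0 := fun h => hα0 (by
    ext Z; rw [← form_sharp c, ← hA, h]; simp)
  have hpos : 0 < α i A := by rw [← form_sharp c]; exact c.form_pos A hA0
  have hgt : ∀ H ∈ c.t, Ad g H ∈ c.t := fun H hH => by
    rw [hg H hH]; exact sub_mem hH (c.t.smul_mem _ hAt)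
  obtain ⟨M, hM⟩ := c.exists_isWeylMatrix hgt
  obtain ⟨-, hint⟩ := c.mem_weightLattice_iff.1 (c.root_mem_weightLattice (h.pos i).1)
  choose m hm using hint
  obtain ⟨k, hk⟩ : ∃ k, c.coord (α i) k ≠ 0 := by
    by_contra! h0
    refine hα0 ?_
    rw [← c.lift_coord hαt, show c.coord (α i) = 0 from funext h0, map_zero]
  have hmk : (m k : ℝ) ≠ 0 := by rw [← hm]; exact hk
  have hq : ∀ j, ∃ q : ℚ, 2 * c.lift (single j 1) A / α i A = q := by
    intro j
    set l := c.lift (single j 1) with hl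
    have e1 := hM.coord_comp l k
    rw [coord_apply, comp_apply, hg _ (c.coordVec_mem_t k), map_sub, map_smul,
      ← coord_apply, ← coord_apply, hl, coord_lift, ← hl, hm k] at e1
    have e2 : ∑ i, (single j (1 : ℝ) : Fin c.ℓ → ℝ) i * (M i k : ℝ) = M j k := by
      rw [Finset.sum_eq_single j]
      · simp
      · intro b _ hb; simp [hb]
      · simp
    rw [e2] at e1
    have e3 : (single j (1 : ℝ) : Fin c.ℓ → ℝ) k = ((if k = j then 1 else 0 : ℤ) : ℝ) := by
      simp [Pi.single_apply]
    rw [e3] at e1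
    refine ⟨(((if k = j then 1 else 0 : ℤ) - M j k : ℤ) : ℚ) / (m k : ℚ), ?_⟩
    generalize (if k = j then 1 else 0 : ℤ) = δ at e1 ⊢
    push_cast
    rw [eq_div_iff hmk]
    simp only [smul_eq_mul] at e1
    linear_combination -e1
  choose q hq using hq
  refine ⟨α i A / 2, q, by positivity, fun ξ hξ => ?_⟩
  have h1 : ξ A = ∑ j, c.coord ξ j * c.lift (single j 1) A := by
    conv_lhs => rw [← c.lift_coord hξ]
    have h2 : c.coord ξ = ∑ j, c.coord ξ j • (single j 1 : Fin c.ℓ → ℝ) := by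
      ext k; simp [Pi.single_apply]
    conv_lhs => rw [h2, map_sum]
    simp
  rw [h1, mul_sum]
  refine sum_congr rfl fun j _ => ?_
  rw [← hq j]
  field_simp

end CartanData

end

section

variable (E) in
/-- The coadjoint action of `g` as a continuous linear map. -/
def coAdL (g : G) : Dual E →L[ℝ] Dual E :=
  (compL ℝ E E ℝ).flip (Ad g⁻¹)

@[simp] lemma coAdL_apply (g : G) (ξ : Dual E) : coAdL E g ξ = coAd g ξ := rfl

lemma coAd_apply (g : G) (ξ : Dual E) (X : E) : coAd g ξ X = ξ (Ad g⁻¹ X) := rfl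

lemma coAd_one (ξ : Dual E) : coAd (1 : G) ξ = ξ := by
  ext X; simp [coAd_apply, Ad_one]

lemma coAd_mul (g h : G) (ξ : Dual E) : coAd (g * h) ξ = coAd g (coAd h ξ) := by
  ext X; simp [coAd_apply, Ad_mul]

lemma coAd_inv_coAd (g : G) (ξ : Dual E) : coAd g⁻¹ (coAd g ξ) = ξ := by
  rw [← coAd_mul, inv_mul_cancel, coAd_one]

lemma coAd_coAd_inv (g : G) (ξ : Dual E) : coAd g (coAd g⁻¹ ξ) = ξ := by
  rw [← coAd_mul, mul_inv_cancel, coAd_one]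

lemma coAd_mem_orbit {g : G} {ξ η : Dual E} (h : η ∈ coadjointOrbit G ξ) :
    coAd g η ∈ coadjointOrbit G ξ := by
  obtain ⟨k, rfl⟩ := h
  exact ⟨g * k, coAd_mul g k ξ⟩

lemma continuous_coAd : Continuous fun z : G × Dual E => coAd z.1 z.2 := by
  exact continuous_snd.clm_comp ((continuous_Ad (E := E) (G := G)).comp continuous_fst.inv)

lemma isInfCoad_iff {X : E} {ξ v : Dual E} :
    IsInfCoad G X ξ v ↔ v = -(ξ.comp (adL G X)) := by
  constructor
  · intro h; ext Y; rw [h Y]; simp [adL_apply]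
  · rintro rfl Y; simp [adL_apply]

lemma IsInfCoad.smul_sum {ι : Type*} {s : Finset ι} {ξ : Dual E} {X : ι → E} {v : ι → Dual E}
    (h : ∀ i, IsInfCoad G (X i) ξ (v i)) (a : ι → ℝ) :
    IsInfCoad G (∑ i ∈ s, a i • X i) ξ (∑ i ∈ s, a i • v i) := by
  intro Y
  have h1 : ∀ i, v i Y = -ξ (adL G (X i) Y) := fun i => by rw [h i Y, adL_apply]
  rw [← adL_apply]
  simp [map_sum, h1]

lemma IsInfCoad.coAd {X : E} {ξ v : Dual E} (h : IsInfCoad G X ξ v)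
    (g : G) : IsInfCoad G (Ad g X) (coAd g ξ) (coAd g v) := by
  rw [isInfCoad_iff] at h ⊢
  subst h
  ext Y
  simp only [coAd_apply, neg_apply, comp_apply]
  rw [Ad_adL, CartanData.Ad_inv_apply]

lemma kksForm_coAd {ξ v w : Dual E} {X Y : E}
    (hX : IsInfCoad G X ξ v) (hY : IsInfCoad G Y ξ w) (g : G) :
    kksForm G (coAd g ξ) (coAd g v) (coAd g w) = kksForm G ξ v w := by
  rw [kksForm_eq G (hX.coAd g) (hY.coAd g), kksForm_eq G hX hY, ← adL_apply, ← adL_apply,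
    coAd_apply, Ad_adL, CartanData.Ad_inv_apply, CartanData.Ad_inv_apply]

lemma kksForm_sum {ι : Type*} {s : Finset ι} {ξ : Dual E} {X : ι → E} {v : ι → Dual E}
    (h : ∀ i, IsInfCoad G (X i) ξ (v i)) (a b : ι → ℝ) :
    kksForm G ξ (∑ i ∈ s, a i • v i) (∑ i ∈ s, b i • v i) =
      ∑ i ∈ s, ∑ j ∈ s, a i * b j * kksForm G ξ (v i) (v j) := by
  rw [kksForm_eq G (IsInfCoad.smul_sum h a) (IsInfCoad.smul_sum h b), ← adL_apply]
  simp only [map_sum, map_smul, sum_apply, smul_apply, smul_sum, smul_eq_mul]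
  rw [sum_comm]
  refine sum_congr rfl fun i _ => sum_congr rfl fun j _ => ?_
  rw [kksForm_eq G (h i) (h j), ← adL_apply]
  ring

namespace CartanData

variable {c : CartanData E G}

/-- The orthonormal basis `X₁, …, Xₙ, Y₁, …, Yₙ`. -/
def frame {n : ℕ} (X Y : Fin n → E) (k : Fin (2 * n)) : E :=
  ![X (finProdFinEquiv.symm k).2, Y (finProdFinEquiv.symm k).2] (finProdFinEquiv.symm k).1

variable (c) in
/-- Coordinates of the second kind transversal to the maximal torus. -/
structure Slice where
  n : ℕ
  α : Fin n → Dual E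
  X : Fin n → E
  Y : Fin n → E
  isRootBasis : c.IsRootBasis c.tPerp α X Y
  γ : Fin (2 * n) → ℝ → G
  isOneParam : ∀ k, IsOneParam (γ k) (frame X Y k)
  /-- the logarithmic derivative -/
  A : (Fin (2 * n) → ℝ) → (Fin (2 * n) → ℝ) →L[ℝ] E
  contDiff_A : ContDiff ℝ ∞ A
  A_zero : A 0 = combo (frame X Y)
  contDiff_Ad_inv : ContDiff ℝ ∞ (fun u => (Ad (prodCurve γ u)⁻¹ : E →L[ℝ] E))
  hasFDerivAt_Ad : ∀ u, HasFDerivAt (fun u => (Ad (prodCurve γ u) : E →L[ℝ] E))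
    ((compL ℝ E E E (Ad (prodCurve γ u))).comp ((adL G).comp (A u))) u

variable (c) in
lemma nonempty_slice : Nonempty c.Slice := by
  obtain ⟨n, α, X, Y, h⟩ := c.exists_isRootBasis
  choose γ hγ using fun k => exists_isOneParam (G := G) (frame X Y k)
  obtain ⟨A, h1, h2, -, h4, h5⟩ := exists_logDeriv_Ad_prodCurve hγ
  exact ⟨⟨n, α, X, Y, h, γ, hγ, A, h1, h2, h4, h5⟩⟩

namespace Slice

variable (S : c.Slice)

lemma form_frame (k l : Fin (2 * S.n)) :
    c.form (frame S.X S.Y k) (frame S.X S.Y l) = if k = l then 1 else 0 := by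
  obtain ⟨⟨a, i⟩, rfl⟩ := finProdFinEquiv.surjective k
  obtain ⟨⟨b, j⟩, rfl⟩ := finProdFinEquiv.surjective l
  simp only [frame, Equiv.symm_apply_apply, EmbeddingLike.apply_eq_iff_eq, Prod.mk.injEq]
  fin_cases a <;> fin_cases b
  · simp [S.isRootBasis.formXX]
  · simp [S.isRootBasis.formXY]
  · simp [c.form_symm _ (S.X j), S.isRootBasis.formXY]
  · simp [S.isRootBasis.formYY]

lemma X_mem (i : Fin S.n) : S.X i ∈ c.tPerp :=
  S.isRootBasis.span ▸ subset_span (Or.inl ⟨i, rfl⟩)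

lemma Y_mem (i : Fin S.n) : S.Y i ∈ c.tPerp :=
  S.isRootBasis.span ▸ subset_span (Or.inr ⟨i, rfl⟩)

/-- The coordinates of the projection to `𝔱^⊥`. -/
def proj : E →L[ℝ] (Fin (2 * S.n) → ℝ) :=
  ContinuousLinearMap.pi fun k => c.flat (frame S.X S.Y k)

lemma proj_apply (Z : E) (k : Fin (2 * S.n)) : S.proj Z k = c.form (frame S.X S.Y k) Z := rfl

lemma proj_combo (u : Fin (2 * S.n) → ℝ) : S.proj (combo (frame S.X S.Y) u) = u := by
  ext k
  simp [proj_apply, form_frame]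

lemma mem_t_of_proj_eq_zero {Z : E} (h : S.proj Z = 0) : Z ∈ c.t := by
  refine S.isRootBasis.mem_t (fun i => ?_) (fun i => ?_)
  · have := congrFun h (finProdFinEquiv (0, i))
    simp only [proj_apply, frame, Equiv.symm_apply_apply] at this
    rw [c.form_symm]; simpa using this
  · have := congrFun h (finProdFinEquiv (1, i))
    simp only [proj_apply, frame, Equiv.symm_apply_apply] at this
    rw [c.form_symm]; simpa using this

lemma frame_mem (k : Fin (2 * S.n)) : frame S.X S.Y k ∈ c.tPerp := by
  obtain ⟨⟨a, i⟩, rfl⟩ := finProdFinEquiv.surjective k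
  simp only [frame, Equiv.symm_apply_apply]
  fin_cases a
  · exact S.X_mem i
  · exact S.Y_mem i

lemma proj_eq_zero {Z : E} (h : Z ∈ c.t) : S.proj Z = 0 := by
  ext k
  exact S.frame_mem k Z h

variable (c) in
lemma apply_adL_eq_form (ξ : Dual E) (Z Z' : E) :
    ξ (adL G Z Z') = c.form (adL G (c.sharp ξ) Z) Z' := by
  rw [← form_sharp c ξ, c.form_symm, form_adL, c.form_symm, adL_swap Z]
  simp

lemma apply_adL_t {ξ : Dual E} (hξ : ξ ∈ c.tDual) {H : E} (hH : H ∈ c.t) (Z : E) :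
    ξ (adL G H Z) = 0 := by
  rw [apply_adL_eq_form c, c.adL_t (c.sharp_mem_t hξ) hH]
  simp

/-- The Gram matrix of the form `⟨ξ, [·, ·]⟩`. -/
def gram (ξ : Dual E) : Matrix (Fin (2 * S.n)) (Fin (2 * S.n)) ℝ :=
  Matrix.of fun k l => ξ (adL G (frame S.X S.Y k) (frame S.X S.Y l))

lemma apply_adL {ξ : Dual E} (hξ : ξ ∈ c.tDual) (Z Z' : E) :
    ξ (adL G Z Z') = ∑ k, ∑ l, S.proj Z k * S.proj Z' l * S.gram ξ k l := by
  have h1 : ∀ Z, Z - combo (frame S.X S.Y) (S.proj Z) ∈ c.t := fun Z =>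
    S.mem_t_of_proj_eq_zero (by rw [map_sub, proj_combo, sub_self])
  have h2 : ∀ Z Z', ξ (adL G Z Z') = ξ (adL G (combo (frame S.X S.Y) (S.proj Z)) Z') := by
    intro Z Z'
    have := apply_adL_t hξ (h1 Z) Z'
    rw [map_sub, sub_apply, map_sub] at this
    linarith
  rw [h2, adL_swap, map_neg, h2, ← map_neg, ← adL_swap]
  simp only [combo_apply, map_sum, map_smul, sum_apply, smul_apply, smul_sum, smul_eq_mul]
  rw [sum_comm]
  refine sum_congr rfl fun i _ => sum_congr rfl fun j _ => ?_
  simp only [gram, Matrix.of_apply]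
  ring

/-- The product of the scalar products of `ξ` with the positive roots. -/
def rootProd (ξ : Dual E) : ℝ := ∏ i, ξ (c.sharp (S.α i))

lemma det_gram {ξ : Dual E} (hξ : ξ ∈ c.tDual) : (S.gram ξ).det = S.rootProd ξ ^ 2 := by
  have h1 : S.gram ξ = (Matrix.blockDiagonal fun i : Fin S.n =>
      !![0, -ξ (c.sharp (S.α i)); ξ (c.sharp (S.α i)), 0]).submatrix
      finProdFinEquiv.symm finProdFinEquiv.symm := by
    ext k l
    obtain ⟨⟨a, i⟩, rfl⟩ := finProdFinEquiv.surjective k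
    obtain ⟨⟨b, j⟩, rfl⟩ := finProdFinEquiv.surjective l
    have hp := S.isRootBasis.pair i _ (c.sharp_mem_t hξ)
    have hs : ξ (c.sharp (S.α i)) = S.α i (c.sharp ξ) := by
      rw [← form_sharp c ξ, c.form_symm, form_sharp]
    simp only [gram, Matrix.of_apply, frame, Equiv.symm_apply_apply, Matrix.submatrix_apply,
      Matrix.blockDiagonal_apply, apply_adL_eq_form c, hs]
    rcases eq_or_ne i j with rfl | hij <;> fin_cases a <;> fin_cases b <;>
      simp [hp.1, hp.2, S.isRootBasis.formXX, S.isRootBasis.formXY, S.isRootBasis.formYY,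
        c.form_symm (S.Y i) (S.X _), *]
  rw [h1, Matrix.det_submatrix_equiv_self, Matrix.det_blockDiagonal, rootProd,
    ← Finset.prod_pow]
  refine Finset.prod_congr rfl fun i _ => ?_
  rw [Matrix.det_fin_two]
  simp; ring

/-- The transversal coordinates. -/
def s (u : Fin (2 * S.n) → ℝ) : G := prodCurve S.γ u

lemma s_zero : S.s 0 = 1 := prodCurve_zero fun k => (S.isOneParam k).map_zero

lemma contMDiff_s : ContMDiff 𝓘(ℝ, Fin (2 * S.n) → ℝ) 𝓔 ∞ S.s :=
  contMDiff_prodCurve fun k => (S.isOneParam k).contMDiff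

/-- The slice parametrization of the orbit of `ξ`. -/
def param (ξ : Dual E) (u : Fin (2 * S.n) → ℝ) : Dual E := coAd (S.s u) ξ

lemma contDiff_param (ξ : Dual E) : ContDiff ℝ ∞ (S.param ξ) :=
  contDiff_const.clm_comp S.contDiff_Ad_inv

lemma param_zero (ξ : Dual E) : S.param ξ 0 = ξ := by rw [param, s_zero, coAd_one]

lemma hasFDerivAt_Ad_inv (u : Fin (2 * S.n) → ℝ) (v : Fin (2 * S.n) → ℝ) :
    fderiv ℝ (fun u => (Ad (S.s u)⁻¹ : E →L[ℝ] E)) u v =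
      -((adL G (S.A u v)).comp (Ad (S.s u)⁻¹)) := by
  have h2 := (S.contDiff_Ad_inv.differentiable (by simp) u).hasFDerivAt
  have h3 := (S.hasFDerivAt_Ad u).clm_comp h2
  have h4 : (fun u => (Ad (prodCurve S.γ u) : E →L[ℝ] E).comp (Ad (prodCurve S.γ u)⁻¹)) =
      fun _ => ContinuousLinearMap.id ℝ E := funext fun u => Ad_comp_inv _
  rw [h4] at h3
  have h5 := h3.unique (hasFDerivAt_const _ u)
  have h6 := congrArg (fun f : _ →L[ℝ] (E →L[ℝ] E) => (Ad (S.s u)⁻¹ : E →L[ℝ] E).comp (f v)) h5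
  ext Z
  have h7 := congrArg (fun f : E →L[ℝ] E => f Z) h6
  simp [s, Ad_inv_apply] at h7
  simp only [s, neg_apply, comp_apply]
  exact eq_neg_of_add_eq_zero_left h7

lemma fderiv_param (ξ : Dual E) (u v : Fin (2 * S.n) → ℝ) :
    fderiv ℝ (S.param ξ) u v = coAd (S.s u) (-(ξ.comp (adL G (S.A u v)))) := by
  have h1 : HasFDerivAt (S.param ξ) _ u :=
    (hasFDerivAt_const ξ u).clm_comp
      (S.contDiff_Ad_inv.differentiable (by simp) u).hasFDerivAt
  rw [h1.fderiv]
  have h2 := S.hasFDerivAt_Ad_inv u v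
  ext Z
  have h3 := congrArg (fun f : E →L[ℝ] E => ξ (f Z)) h2
  simpa [coAd_apply, s] using h3

lemma isInfCoad_param (ξ : Dual E) (u v : Fin (2 * S.n) → ℝ) :
    IsInfCoad G (Ad (S.s u) (S.A u v)) (S.param ξ u) (fderiv ℝ (S.param ξ) u v) := by
  rw [fderiv_param]
  exact IsInfCoad.coAd (isInfCoad_iff.2 rfl) _

/-- The logarithmic derivative modulo `𝔱`. -/
def P (u : Fin (2 * S.n) → ℝ) : (Fin (2 * S.n) → ℝ) →L[ℝ] (Fin (2 * S.n) → ℝ) :=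
  S.proj.comp (S.A u)

lemma P_zero : S.P 0 = ContinuousLinearMap.id ℝ _ := by
  ext u k
  simp only [P, S.A_zero, comp_apply, proj_combo]
  rfl

lemma continuous_det_P : Continuous fun u => (S.P u).det := by
  have h1 : Continuous S.P := continuous_const.clm_comp S.contDiff_A.continuous
  exact ContinuousLinearMap.continuous_det.comp h1

lemma injective_P {u : Fin (2 * S.n) → ℝ} (hu : (S.P u).det ≠ 0) :
    Function.Bijective (S.P u) := by
  have h1 : IsUnit (S.P u).toLinearMap := (LinearMap.isUnit_iff_isUnit_det _).2 hu.isUnit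
  exact (Module.End.isUnit_iff _).1 h1

lemma fderiv_param_injective {ξ : Dual E} (hξ : ξ ∈ c.openChamber) {u : Fin (2 * S.n) → ℝ}
    (hu : (S.P u).det ≠ 0) : Injective (fderiv ℝ (S.param ξ) u) := by
  rw [injective_iff_map_eq_zero]
  intro v hv
  rw [fderiv_param] at hv
  have h1 := congrArg (coAd (S.s u)⁻¹) hv
  rw [coAd_inv_coAd] at h1
  have h2 : S.A u v ∈ c.t := by
    refine S.isRootBasis.eq_zero_of_adL hξ (c.eq_of_form_eq fun Z => ?_)
    rw [← apply_adL_eq_form c]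
    have := congrArg (fun f : Dual E => f Z) h1
    simpa [coAd_apply] using this
  refine (S.injective_P hu).1 ?_
  rw [map_zero]
  exact S.proj_eq_zero h2

lemma range_fderiv_param {ξ : Dual E} (hξ : ξ ∈ c.tDual) {u : Fin (2 * S.n) → ℝ}
    (hu : (S.P u).det ≠ 0) :
    Set.range (fderiv ℝ (S.param ξ) u) = {v | ∃ X, IsInfCoad G X (S.param ξ u) v} := by
  ext v
  constructor
  · rintro ⟨w, rfl⟩
    exact ⟨_, S.isInfCoad_param ξ u w⟩
  · rintro ⟨X, hX⟩
    obtain ⟨w, hw⟩ := (S.injective_P hu).2 (S.proj (Ad (S.s u)⁻¹ X))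
    refine ⟨w, ?_⟩
    rw [fderiv_param]
    have h1 := hX.coAd (S.s u)⁻¹
    rw [param, coAd_inv_coAd, isInfCoad_iff] at h1
    have h2 : ξ.comp (adL G (S.A u w)) = ξ.comp (adL G (Ad (S.s u)⁻¹ X)) := by
      ext Z
      simp only [comp_apply]
      rw [S.apply_adL hξ, S.apply_adL hξ]
      have : S.proj (S.A u w) = S.proj (Ad (S.s u)⁻¹ X) := hw
      rw [this]
    rw [h2, ← h1, coAd_coAd_inv]

lemma det_kksMatrix_param {ξ : Dual E} (hξ : ξ ∈ c.tDual) (u : Fin (2 * S.n) → ℝ) :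
    (kksMatrix G (S.param ξ) u).det = ((S.P u).det * S.rootProd ξ) ^ 2 := by
  have h1 : kksMatrix G (S.param ξ) u =
      (LinearMap.toMatrix' (S.P u).toLinearMap).transpose * S.gram ξ *
        LinearMap.toMatrix' (S.P u).toLinearMap := by
    ext i j
    rw [kksMatrix, Matrix.of_apply, kksForm_eq G (S.isInfCoad_param ξ u _) (S.isInfCoad_param ξ u _),
      ← adL_apply, ← Ad_adL, param, coAd_apply, Ad_inv_apply, S.apply_adL hξ]
    simp only [Matrix.mul_apply, Matrix.transpose_apply, sum_mul]
    rw [sum_comm]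
    refine sum_congr rfl fun k _ => sum_congr rfl fun l _ => ?_
    simp only [LinearMap.toMatrix'_apply, coe_coe, P,
      comp_apply]
    ring
  rw [h1, Matrix.det_mul, Matrix.det_mul, Matrix.det_transpose, S.det_gram hξ,
    LinearMap.det_toMatrix']
  change (S.P u).det * _ * (S.P u).det = _
  ring

end Slice
end CartanData

end

section

lemma IsLocalParam.aemeasurable {O : Set (Dual E)} {d : ℕ} {U : Set (Fin d → ℝ)}
    {ψ : (Fin d → ℝ) → Dual E} (h : IsLocalParam G O d U ψ) (f : (Fin d → ℝ) → ENNReal) :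
    AEMeasurable ψ ((volume.restrict U).withDensity f) :=
  (h.contDiffOn.continuousOn.aemeasurable h.isOpen.measurableSet).mono_ac
    (withDensity_absolutelyContinuous _ _)

lemma IsLocalParam.measurableSet {O : Set (Dual E)} {d : ℕ} {U : Set (Fin d → ℝ)}
    {ψ : (Fin d → ℝ) → Dual E} (h : IsLocalParam G O d U ψ) {B : Set (Dual E)}
    (hB : MeasurableSet B) : MeasurableSet (U ∩ ψ ⁻¹' B) := by
  have h1 := (continuousOn_iff_continuous_domRestrict.1 h.contDiffOn.continuousOn).measurable hB
  have h2 := h.isOpen.measurableSet.subtype_image h1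
  convert h2 using 1
  ext u
  simp [Set.domRestrict]
  exact and_comm

variable (G) in
/-- The density of the canonical measure in a chart. -/
def chartDensity {d : ℕ} (ψ : (Fin d → ℝ) → Dual E) (u : Fin d → ℝ) : ENNReal :=
  ofReal (((2 * π) ^ (d / 2))⁻¹ * Real.sqrt (kksMatrix G ψ u).det)

lemma IsLocalParam.liouvilleInChart_apply {O : Set (Dual E)} {d : ℕ} {U : Set (Fin d → ℝ)}
    {ψ : (Fin d → ℝ) → Dual E} (h : IsLocalParam G O d U ψ) {B : Set (Dual E)}
    (hB : MeasurableSet B) :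
    liouvilleInChart G U ψ B = ∫⁻ u in U ∩ ψ ⁻¹' B, chartDensity G ψ u := by
  rw [liouvilleInChart, Measure.map_apply_of_aemeasurable (h.aemeasurable _) hB,
    withDensity_apply', Measure.restrict_restrict' h.isOpen.measurableSet, Set.inter_comm]
  rfl

lemma det_kksMatrix_of_fderiv_eq {d : ℕ} {ψ φ : (Fin d → ℝ) → Dual E} {u v : Fin d → ℝ}
    {T : (Fin d → ℝ) →L[ℝ] (Fin d → ℝ)} (h0 : ψ u = φ v)
    (h : fderiv ℝ ψ u = (fderiv ℝ φ v).comp T)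
    (hφ : ∀ w, ∃ X, IsInfCoad G X (φ v) (fderiv ℝ φ v w)) :
    (kksMatrix G ψ u).det = T.det ^ 2 * (kksMatrix G φ v).det := by
  have h1 : kksMatrix G ψ u = (LinearMap.toMatrix' T.toLinearMap).transpose * kksMatrix G φ v *
        LinearMap.toMatrix' T.toLinearMap := by
    choose X hX using fun k => hφ (single k 1)
    have h2 : ∀ i, fderiv ℝ ψ u (single i 1) =
        ∑ k, T (single i 1) k • fderiv ℝ φ v (single k 1) := by
      intro i
      rw [h, comp_apply]
      conv_lhs => rw [← Finset.univ_sum_single (T (single i 1)), map_sum]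
      refine sum_congr rfl fun k _ => ?_
      rw [← map_smul]
      congr 1
      ext j
      simp [Pi.single_apply]
    ext i j
    rw [kksMatrix, Matrix.of_apply, h2, h2, h0, kksForm_sum hX]
    simp only [Matrix.mul_apply, Matrix.transpose_apply, sum_mul]
    rw [sum_comm]
    refine sum_congr rfl fun k _ => sum_congr rfl fun l _ => ?_
    simp only [LinearMap.toMatrix'_apply, coe_coe, kksMatrix, Matrix.of_apply]
    ring
  rw [h1, Matrix.det_mul, Matrix.det_mul, Matrix.det_transpose, LinearMap.det_toMatrix']
  change T.det * _ * T.det = _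
  ring

lemma fderiv_coAd_comp {d : ℕ} {ψ : (Fin d → ℝ) → Dual E} {u : Fin d → ℝ}
    (h : DifferentiableAt ℝ ψ u) (g : G) (w : Fin d → ℝ) :
    fderiv ℝ (fun u => coAd g (ψ u)) u w = coAd g (fderiv ℝ ψ u w) := by
  have := ((coAdL E g).hasFDerivAt.comp u h.hasFDerivAt).fderiv
  rw [show (fun u => coAd g (ψ u)) = (coAdL E g) ∘ ψ from rfl, this]
  rfl

lemma IsLocalParam.differentiableAt {O : Set (Dual E)} {d : ℕ} {U : Set (Fin d → ℝ)}
    {ψ : (Fin d → ℝ) → Dual E} (h : IsLocalParam G O d U ψ) {u : Fin d → ℝ} (hu : u ∈ U) :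
    DifferentiableAt ℝ ψ u :=
  (h.contDiffOn.contDiffAt (h.isOpen.mem_nhds hu)).differentiableAt (by simp)

lemma measurable_coAd (g : G) : Measurable (coAd g : Dual E → Dual E) :=
  (coAdL E g).continuous.measurable

lemma coAd_injective (g : G) : Injective (coAd g : Dual E → Dual E) := fun x y h => by
  rw [← coAd_inv_coAd g x, h, coAd_inv_coAd]

lemma IsLocalParam.coAd {ξ : Dual E} {d : ℕ} {U : Set (Fin d → ℝ)}
    {ψ : (Fin d → ℝ) → Dual E} (h : IsLocalParam G (coadjointOrbit G ξ) d U ψ) (g : G) :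
    IsLocalParam G (coadjointOrbit G ξ) d U (fun u => coAd g (ψ u)) where
  isOpen := h.isOpen
  contDiffOn := (coAdL E g).contDiff.comp_contDiffOn h.contDiffOn
  injOn := fun x hx y hy hxy => h.injOn hx hy (coAd_injective g hxy)
  mapsTo := fun u hu => coAd_mem_orbit (h.mapsTo hu)
  immersion := fun u hu x y hxy => by
    rw [fderiv_coAd_comp (h.differentiableAt hu), fderiv_coAd_comp (h.differentiableAt hu)] at hxy
    exact h.immersion u hu (coAd_injective g hxy)
  range_eq := fun u hu => by
    ext v
    constructor
    · rintro ⟨w, rfl⟩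
      rw [fderiv_coAd_comp (h.differentiableAt hu)]
      obtain ⟨X, hX⟩ : fderiv ℝ ψ u w ∈ {v | ∃ X, IsInfCoad G X (ψ u) v} :=
        h.range_eq u hu ▸ ⟨w, rfl⟩
      exact ⟨_, hX.coAd g⟩
    · rintro ⟨X, hX⟩
      have h1 := hX.coAd g⁻¹
      rw [coAd_inv_coAd] at h1
      obtain ⟨w, hw⟩ : QuasiPolyAsymptotics.coAd g⁻¹ v ∈ Set.range (fderiv ℝ ψ u) :=
        h.range_eq u hu ▸ ⟨_, h1⟩
      exact ⟨w, by rw [fderiv_coAd_comp (h.differentiableAt hu), hw, coAd_coAd_inv]⟩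

lemma IsLocalParam.liouvilleInChart_coAd {ξ : Dual E} {d : ℕ} {U : Set (Fin d → ℝ)}
    {ψ : (Fin d → ℝ) → Dual E} (h : IsLocalParam G (coadjointOrbit G ξ) d U ψ) (g : G)
    {B : Set (Dual E)} (hB : MeasurableSet B) :
    liouvilleInChart G U (fun u => QuasiPolyAsymptotics.coAd g (ψ u)) B =
      liouvilleInChart G U ψ (QuasiPolyAsymptotics.coAd g ⁻¹' B) := by
  have hB' : MeasurableSet (QuasiPolyAsymptotics.coAd g ⁻¹' B : Set (Dual E)) :=
    (coAdL E g).continuous.measurable hB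
  rw [(h.coAd g).liouvilleInChart_apply hB, h.liouvilleInChart_apply hB']
  refine setLIntegral_congr_fun (h.measurableSet hB') fun u hu => ?_
  have : kksMatrix G (fun u => QuasiPolyAsymptotics.coAd g (ψ u)) u = kksMatrix G ψ u := by
    ext i j
    have hw : ∀ w, ∃ X, IsInfCoad G X (ψ u) (fderiv ℝ ψ u w) := fun w => by
      have : fderiv ℝ ψ u w ∈ {v | ∃ X, IsInfCoad G X (ψ u) v} := h.range_eq u hu.1 ▸ ⟨w, rfl⟩
      exact this
    obtain ⟨X, hX⟩ := hw (single i 1)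
    obtain ⟨Y, hY⟩ := hw (single j 1)
    simp only [kksMatrix, Matrix.of_apply]
    rw [fderiv_coAd_comp (h.differentiableAt hu.1), fderiv_coAd_comp (h.differentiableAt hu.1),
      kksForm_coAd hX hY]
  rw [chartDensity, chartDensity, this]

lemma le_liouville {ξ : Dual E} {d : ℕ} {U : Set (Fin d → ℝ)}
    {ψ : (Fin d → ℝ) → Dual E} (h : IsLocalParam G (coadjointOrbit G ξ) d U ψ) :
    liouvilleInChart G U ψ ≤ liouville G ξ :=
  le_sSup ⟨d, U, ψ, h, rfl⟩

lemma liouville_le {ξ : Dual E} {μ : Measure (Dual E)}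
    (h : ∀ (d : ℕ) (U : Set (Fin d → ℝ)) (ψ : (Fin d → ℝ) → Dual E),
      IsLocalParam G (coadjointOrbit G ξ) d U ψ → liouvilleInChart G U ψ ≤ μ) :
    liouville G ξ ≤ μ := by
  refine sSup_le ?_
  rintro _ ⟨d, U, ψ, hψ, rfl⟩
  exact h d U ψ hψ

lemma liouville_preimage_coAd {ξ : Dual E} (g : G) {B : Set (Dual E)} (hB : MeasurableSet B) :
    liouville G ξ (coAd g ⁻¹' B) = liouville G ξ B := by
  have key : ∀ g : G, liouville G ξ ≤ (liouville G ξ).map (coAd g) := by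
    intro g
    refine liouville_le fun d U ψ hψ => ?_
    rw [Measure.le_iff]
    intro B hB
    rw [Measure.map_apply (measurable_coAd g) hB]
    have h1 := (hψ.coAd g⁻¹).liouvilleInChart_coAd g hB
    simp only [coAd_coAd_inv] at h1
    rw [h1]
    exact le_liouville (hψ.coAd g⁻¹) _
  have key2 : ∀ (g : G) {B : Set (Dual E)}, MeasurableSet B →
      liouville G ξ B ≤ liouville G ξ (coAd g ⁻¹' B) := by
    intro g B hB
    have := key g B
    rwa [Measure.map_apply (measurable_coAd g) hB] at this
  refine le_antisymm ?_ (key2 g hB)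
  have h1 := key2 g⁻¹ ((coAdL E g).continuous.measurable hB)
  refine h1.trans (le_of_eq ?_)
  congr 1
  ext η
  simp [coAd_coAd_inv]

lemma isCompact_orbit (ξ : Dual E) : IsCompact (coadjointOrbit G ξ) :=
  isCompact_range (continuous_coAd.comp (by fun_prop : Continuous fun g : G => (g, ξ)))

lemma liouville_compl_orbit (ξ : Dual E) :
    liouville G ξ (coadjointOrbit G ξ)ᶜ = 0 := by
  have hm : MeasurableSet (coadjointOrbit G ξ) := (isCompact_orbit ξ).measurableSet
  have h1 : liouville G ξ ≤ (liouville G ξ).restrict (coadjointOrbit G ξ) := by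
    refine liouville_le fun d U ψ hψ => ?_
    rw [Measure.le_iff]
    intro B hB
    rw [Measure.restrict_apply hB]
    refine le_trans (le_of_eq ?_) (le_liouville hψ _)
    rw [hψ.liouvilleInChart_apply hB, hψ.liouvilleInChart_apply (hB.inter hm)]
    congr 2
    ext u
    exact ⟨fun h => ⟨h.1, h.2, hψ.mapsTo h.1⟩, fun h => ⟨h.1, h.2.1⟩⟩
  have h2 := h1 (coadjointOrbit G ξ)ᶜ
  rw [Measure.restrict_apply hm.compl, Set.compl_inter_self, measure_empty] at h2
  exact le_antisymm h2 bot_le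

namespace CartanData
namespace Slice

variable {c : CartanData E G} (S : c.Slice)

variable (c) in
lemma Ad_p_of_mem_t (τ : Fin c.ℓ → ℝ) {H : E} (hH : H ∈ c.t) : Ad (c.p τ) H = H := by
  obtain ⟨v, rfl⟩ := hH
  exact (c.isTorusParam.isOneParam v).Ad_eq_of_comm fun s => by
    rw [← c.isTorusParam.map_add, add_comm, c.isTorusParam.map_add]

/-- An element that centralizes `𝔱` fixes `𝔱*`. -/
lemma coAd_eq_self_of_centralizes {g : G} (hg : ∀ H ∈ c.t, Ad g H = H) {ξ : Dual E}
    (hξ : ξ ∈ c.tDual) : coAd g ξ = ξ := by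
  rw [comp_Ad_eq_iff]
  refine tDual_ext (comp_Ad_mem_tDual (fun H hH => by rw [hg H hH]; exact hH) hξ) hξ fun H hH => ?_
  rw [comp_apply, hg H hH]

lemma map_nhds_mul_p : map (fun z : (Fin (2 * S.n) → ℝ) × (Fin c.ℓ → ℝ) => S.s z.1 * c.p z.2)
    (nhds 0) = nhds 1 := by
  obtain ⟨h1, h2⟩ := hasFDerivAt_mul_pair S.s_zero (map_zero_of_map_add c.isTorusParam.map_add)
    (S.contMDiff_s 0) (c.isTorusParam.smooth 0) (hasFDerivAt_prodCurve S.isOneParam)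
    c.isTorusParam.hasFDerivAt
  refine map_nhds_eq_of_surjective
    (by simp [S.s_zero, map_zero_of_map_add c.isTorusParam.map_add]) h1 h2 fun Z => ?_
  obtain ⟨τ, hτ⟩ : Z - combo (frame S.X S.Y) (S.proj Z) ∈ c.t :=
    S.mem_t_of_proj_eq_zero (by rw [map_sub, proj_combo, sub_self])
  refine ⟨(S.proj Z, τ), ?_⟩
  rw [coprod_apply]
  have : velocity (E := E) G c.p τ = Z - combo (frame S.X S.Y) (S.proj Z) := hτ
  rw [this]; simp

lemma exists_open_inter_orbit_subset {ξ : Dual E} (hξ : ξ ∈ c.tDual)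
    {V : Set (Fin (2 * S.n) → ℝ)} (hV : V ∈ nhds 0) :
    ∃ Ω : Set (Dual E), IsOpen Ω ∧ ξ ∈ Ω ∧ coadjointOrbit G ξ ∩ Ω ⊆ S.param ξ '' V := by
  have h1 : (fun z : (Fin (2 * S.n) → ℝ) × (Fin c.ℓ → ℝ) => S.s z.1 * c.p z.2) '' (V ×ˢ Set.univ) ∈
      nhds (1 : G) := S.map_nhds_mul_p ▸ image_mem_map (prod_mem_nhds hV univ_mem)
  obtain ⟨O, hO, hOo, hO1⟩ := mem_nhds_iff.1 h1
  let st : Set G := {g | coAd g ξ = ξ}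
  let C : Set G := (⋃ h ∈ st, (fun g => g * h⁻¹) ⁻¹' O)ᶜ
  have hC : IsClosed C := (isOpen_biUnion fun h _ => hOo.preimage (by fun_prop)).isClosed_compl
  have hcont : Continuous fun g : G => coAd g ξ :=
    continuous_coAd.comp (by fun_prop : Continuous fun g : G => (g, ξ))
  have hCc : IsCompact ((fun g : G => coAd g ξ) '' C) := hC.isCompact.image hcont
  refine ⟨((fun g : G => coAd g ξ) '' C)ᶜ, hCc.isClosed.isOpen_compl, ?_, ?_⟩
  · rintro ⟨g, hg, hgξ⟩
    refine hg (Set.mem_biUnion (show g ∈ st from hgξ) ?_)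
    simpa using hO1
  · rintro _ ⟨⟨g, rfl⟩, hg⟩
    have hg' : g ∉ C := fun h => hg ⟨g, h, rfl⟩
    simp only [C, Set.mem_compl_iff, not_not, Set.mem_iUnion, Set.mem_preimage] at hg'
    obtain ⟨h, hh, hgO⟩ := hg'
    obtain ⟨⟨u, τ⟩, ⟨hu, -⟩, huτ⟩ := hO hgO
    refine ⟨u, hu, ?_⟩
    change S.s u * c.p τ = g * h⁻¹ at huτ
    have h2 : g = S.s u * c.p τ * h := by rw [huτ]; group
    change coAd (S.s u) ξ = coAd g ξ
    rw [h2, coAd_mul, show coAd h ξ = ξ from hh, coAd_mul,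
      coAd_eq_self_of_centralizes (fun H hH => Ad_p_of_mem_t c τ hH) hξ]

/-- The domain of a slice chart, with a smooth retraction of a neighbourhood onto it. -/
structure IsSliceNhds (ξ : Dual E) (V : Set (Fin (2 * S.n) → ℝ)) (Ω : Set (Dual E))
    (r : Dual E → Fin (2 * S.n) → ℝ) : Prop where
  isOpen : IsOpen V
  zero_mem : 0 ∈ V
  subset : V ⊆ Metric.closedBall 0 1
  det_ne : ∀ u ∈ V, (S.P u).det ≠ 0
  isOpen_image : IsOpen Ω
  image_eq : S.param ξ '' V = coadjointOrbit G ξ ∩ Ω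
  left_inv : ∀ u ∈ V, r (S.param ξ u) = u
  differentiableAt : ∀ u ∈ V, DifferentiableAt ℝ r (S.param ξ u)

lemma exists_isSliceNhds {ξ : Dual E} (hξ : ξ ∈ c.openChamber) :
    ∃ V Ω r, S.IsSliceNhds ξ V Ω r := by
  have hP0 : (S.P 0).det ≠ 0 := by rw [P_zero]; simp [ContinuousLinearMap.det]
  have hinj := S.fderiv_param_injective hξ hP0
  have hsd : HasStrictFDerivAt (S.param ξ) (fderiv ℝ (S.param ξ) 0) 0 :=
    (S.contDiff_param ξ).contDiffAt.hasStrictFDerivAt (by simp)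
  obtain ⟨Q, hQ⟩ := (fderiv ℝ (S.param ξ) 0).toLinearMap.exists_leftInverse_of_injective
    (LinearMap.ker_eq_bot.2 hinj)
  let Q' := toContinuousLinearMap Q
  let f : (Fin (2 * S.n) → ℝ) → (Fin (2 * S.n) → ℝ) := fun u => Q' (S.param ξ u)
  have hf : ContDiff ℝ ∞ f := Q'.contDiff.comp (S.contDiff_param ξ)
  have h2 : HasStrictFDerivAt f
      ((ContinuousLinearEquiv.refl ℝ (Fin (2 * S.n) → ℝ) : _ ≃L[ℝ] _) : _ →L[ℝ] _) 0 := by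
    have := Q'.hasStrictFDerivAt.comp (0 : Fin (2 * S.n) → ℝ) hsd
    refine this.congr_fderiv ?_
    ext v
    exact congrArg (fun f : _ →ₗ[ℝ] (Fin (2 * S.n) → ℝ) => f _ _) hQ
  set e := h2.toOpenPartialHomeomorph f with he
  have hdetf : Continuous fun u => (fderiv ℝ f u).det :=
    ContinuousLinearMap.continuous_det.comp (hf.continuous_fderiv (by simp))
  let V0 : Set (Fin (2 * S.n) → ℝ) :=
    e.source ∩ {u | (S.P u).det ≠ 0} ∩ {u | (fderiv ℝ f u).det ≠ 0} ∩ Metric.ball 0 1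
  have hV0 : IsOpen V0 := ((e.open_source.inter (isOpen_ne_fun S.continuous_det_P
    continuous_const)).inter (isOpen_ne_fun hdetf continuous_const)).inter Metric.isOpen_ball
  have h0 : (0 : Fin (2 * S.n) → ℝ) ∈ V0 := by
    refine ⟨⟨⟨h2.mem_toOpenPartialHomeomorph_source, hP0⟩, ?_⟩, by simp⟩
    simp only [Set.mem_ofPred_eq]
    rw [h2.hasFDerivAt.fderiv]
    simp [ContinuousLinearMap.det]
  obtain ⟨Ω, hΩ, hξΩ, hsub⟩ := S.exists_open_inter_orbit_subset hξ.1 (hV0.mem_nhds h0)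
  refine ⟨V0 ∩ S.param ξ ⁻¹' Ω, Ω, fun η => e.symm (Q' η), ?_, ?_, ?_, ?_, hΩ, ?_, ?_, ?_⟩
  · exact hV0.inter (hΩ.preimage (S.contDiff_param ξ).continuous)
  · exact ⟨h0, by simpa [param_zero] using hξΩ⟩
  · exact fun u hu => Metric.ball_subset_closedBall hu.1.2
  · exact fun u hu => hu.1.1.1.2
  · ext η
    constructor
    · rintro ⟨u, hu, rfl⟩
      exact ⟨⟨_, rfl⟩, hu.2⟩
    · intro hη
      obtain ⟨u, hu, rfl⟩ := hsub hη
      exact ⟨u, ⟨hu, hη.2⟩, rfl⟩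
  · intro u hu
    exact e.left_inv hu.1.1.1.1
  · intro u hu
    have hus := hu.1.1.1.1
    have hu' : (fderiv ℝ f u).det ≠ 0 := hu.1.1.2
    have h3 : HasFDerivAt e.symm _ (e u) :=
      e.hasFDerivAt_symm (f' := (fderiv ℝ f u).toContinuousLinearEquivOfDetNeZero hu')
        (e.map_source hus) (by
          rw [e.left_inv hus, ContinuousLinearMap.coe_toContinuousLinearEquivOfDetNeZero]
          exact (hf.differentiable (by simp) u).hasFDerivAt)
    have h4 : DifferentiableAt ℝ e.symm (Q' (S.param ξ u)) := h3.differentiableAt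
    exact h4.comp _ Q'.differentiableAt

variable {S} {ξ : Dual E} {V : Set (Fin (2 * S.n) → ℝ)} {Ω : Set (Dual E)}
  {r : Dual E → Fin (2 * S.n) → ℝ}

lemma IsSliceNhds.isLocalParam (h : S.IsSliceNhds ξ V Ω r) (hξ : ξ ∈ c.openChamber) :
    IsLocalParam G (coadjointOrbit G ξ) (2 * S.n) V (S.param ξ) where
  isOpen := h.isOpen
  contDiffOn := (S.contDiff_param ξ).contDiffOn
  injOn := fun x hx y hy hxy => by rw [← h.left_inv x hx, hxy, h.left_inv y hy]
  mapsTo := fun u _ => ⟨_, rfl⟩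
  immersion := fun u hu => S.fderiv_param_injective hξ (h.det_ne u hu)
  range_eq := fun u hu => S.range_fderiv_param hξ.1 (h.det_ne u hu)

lemma IsSliceNhds.liouvilleInChart_le (h : S.IsSliceNhds ξ V Ω r) (hξ : ξ ∈ c.openChamber)
    {d : ℕ} {U : Set (Fin d → ℝ)} {ψ : (Fin d → ℝ) → Dual E}
    (hψ : IsLocalParam G (coadjointOrbit G ξ) d U ψ) {B : Set (Dual E)} (hB : MeasurableSet B)
    (hBΩ : B ⊆ Ω) : liouvilleInChart G U ψ B ≤ liouvilleInChart G V (S.param ξ) B := by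
  have hS := h.isLocalParam hξ
  rw [hψ.liouvilleInChart_apply hB, hS.liouvilleInChart_apply hB]
  rcases Set.eq_empty_or_nonempty (U ∩ ψ ⁻¹' B) with he | ⟨u0, hu0⟩
  · simp [he]
  have hex : ∀ u ∈ U, ψ u ∈ Ω → r (ψ u) ∈ V ∧ S.param ξ (r (ψ u)) = ψ u := by
    intro u hu hu'
    have : ψ u ∈ S.param ξ '' V := h.image_eq ▸ ⟨hψ.mapsTo hu, hu'⟩
    obtain ⟨v, hv, hvu⟩ := this
    rw [← hvu, h.left_inv v hv]
    exact ⟨hv, rfl⟩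
  obtain rfl : d = 2 * S.n := by
    obtain ⟨h1, h2⟩ := hex u0 hu0.1 (hBΩ hu0.2)
    have e1 := hψ.range_eq u0 hu0.1
    have e2 := hS.range_eq _ h1
    rw [h2, ← e1] at e2
    have e3 : LinearMap.range (fderiv ℝ (S.param ξ) (r (ψ u0))).toLinearMap =
        LinearMap.range (fderiv ℝ ψ u0).toLinearMap := 
        SetLike.ext' (by rw [LinearMap.coe_range, LinearMap.coe_range]; exact e2)
    have e4 := LinearMap.finrank_range_of_inj (f := (fderiv ℝ ψ u0).toLinearMap)
      (hψ.immersion u0 hu0.1)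
    have e5 := LinearMap.finrank_range_of_inj (f := (fderiv ℝ (S.param ξ) (r (ψ u0))).toLinearMap)
      (hS.immersion _ h1)
    rw [e3, e4] at e5
    simpa using e5
  let T : (Fin (2 * S.n) → ℝ) → (Fin (2 * S.n) → ℝ) →L[ℝ] (Fin (2 * S.n) → ℝ) := fun u =>
    (fderiv ℝ r (ψ u)).comp (fderiv ℝ ψ u)
  have hT : ∀ u ∈ U, ψ u ∈ Ω → HasFDerivAt (fun u => r (ψ u)) (T u) u := by
    intro u hu hu'
    obtain ⟨h1, h2⟩ := hex u hu hu'
    have h3 := h.differentiableAt _ h1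
    rw [h2] at h3
    exact h3.hasFDerivAt.comp u (hψ.differentiableAt hu).hasFDerivAt
  have hfd : ∀ u ∈ U, ψ u ∈ Ω → fderiv ℝ ψ u = (fderiv ℝ (S.param ξ) (r (ψ u))).comp (T u) := by
    intro u hu hu'
    have h1 : ψ =ᶠ[nhds u] fun u => S.param ξ (r (ψ u)) := by
      have h2 : ψ ⁻¹' Ω ∈ nhds u :=
        (hψ.differentiableAt hu).continuousAt.preimage_mem_nhds (h.isOpen_image.mem_nhds hu')
      filter_upwards [hψ.isOpen.mem_nhds hu, h2] with w hw hw'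
      exact (hex w hw hw').2.symm
    rw [h1.fderiv_eq]
    exact HasFDerivAt.fderiv (HasFDerivAt.comp (g := S.param ξ) u
      ((S.contDiff_param ξ).differentiable (by simp) _).hasFDerivAt (hT u hu hu'))
  have hinj : Set.InjOn (fun u => r (ψ u)) (U ∩ ψ ⁻¹' B) := by
    intro x hx y hy hxy
    refine hψ.injOn hx.1 hy.1 ?_
    rw [← (hex x hx.1 (hBΩ hx.2)).2, ← (hex y hy.1 (hBΩ hy.2)).2]
    exact congrArg _ hxy
  have hcv := lintegral_image_eq_lintegral_abs_det_fderiv_mul volume (hψ.measurableSet hB)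
    (fun u hu => (hT u hu.1 (hBΩ hu.2)).hasFDerivWithinAt) hinj (chartDensity G (S.param ξ))
  have h5 : ∫⁻ u in U ∩ ψ ⁻¹' B, chartDensity G ψ u =
      ∫⁻ u in U ∩ ψ ⁻¹' B, ofReal |(T u).det| * chartDensity G (S.param ξ) (r (ψ u)) := by
    refine setLIntegral_congr_fun (hψ.measurableSet hB) fun u hu => ?_
    have h6 := hex u hu.1 (hBΩ hu.2)
    have h7 := det_kksMatrix_of_fderiv_eq (G := G) (h6.2.symm) (hfd u hu.1 (hBΩ hu.2))
      (fun w => ⟨_, S.isInfCoad_param ξ _ w⟩)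
    simp only [chartDensity]
    rw [h7, ← ENNReal.ofReal_mul (abs_nonneg _), Real.sqrt_mul (sq_nonneg _), Real.sqrt_sq_eq_abs]
    congr 1
    ring
  rw [h5, ← hcv]
  refine lintegral_mono_set ?_
  rintro _ ⟨u, hu, rfl⟩
  obtain ⟨h6, h7⟩ := hex u hu.1 (hBΩ hu.2)
  exact ⟨h6, by simpa [h7] using hu.2⟩

/-- In a slice chart the canonical measure is given by the chart density. -/
lemma IsSliceNhds.liouville_apply (h : S.IsSliceNhds ξ V Ω r) (hξ : ξ ∈ c.openChamber)
    {B : Set (Dual E)} (hB : MeasurableSet B) (hBΩ : B ⊆ Ω) :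
    liouville G ξ B = ∫⁻ u in V ∩ S.param ξ ⁻¹' B, chartDensity G (S.param ξ) u := by
  have hS := h.isLocalParam hξ
  rw [← hS.liouvilleInChart_apply hB]
  refine le_antisymm ?_ (le_liouville hS B)
  have h1 : liouville G ξ ≤ liouvilleInChart G V (S.param ξ) + (liouville G ξ).restrict Ωᶜ := by
    refine liouville_le fun d U ψ hψ => ?_
    rw [Measure.le_iff]
    intro B hB
    rw [← measure_inter_add_sdiff B h.isOpen_image.measurableSet, Measure.add_apply,
      Measure.restrict_apply hB]
    refine add_le_add ?_ ?_
    · exact (h.liouvilleInChart_le hξ hψ (hB.inter h.isOpen_image.measurableSet)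
        Set.inter_subset_right).trans (measure_mono Set.inter_subset_left)
    · exact le_liouville hψ _
  refine (h1 B).trans (le_of_eq ?_)
  rw [Measure.add_apply, Measure.restrict_apply hB]
  have : B ∩ Ωᶜ = ∅ := by
    rw [← Set.sdiff_eq, Set.sdiff_eq_empty]; exact hBΩ
  rw [this]; simp

lemma IsSliceNhds.chartDensity_eq (hξ : ξ ∈ c.openChamber) (u : Fin (2 * S.n) → ℝ) :
    chartDensity G (S.param ξ) u = ofReal (S.rootProd ξ) *
      ofReal (((2 * π) ^ S.n)⁻¹ * |(S.P u).det|) := by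
  have hpos : 0 < S.rootProd ξ :=
    prod_pos fun i _ => (S.isRootBasis.mem_openChamber_iff.1 hξ).2 i
  rw [chartDensity, S.det_kksMatrix_param hξ.1, Real.sqrt_sq_eq_abs, abs_mul, abs_of_pos hpos,
    ← ENNReal.ofReal_mul hpos.le, Nat.mul_div_cancel_left _ two_pos]
  congr 1
  ring

lemma isFiniteMeasure_liouville (S : c.Slice) {ξ : Dual E}
    (hξ : ξ ∈ c.openChamber) : IsFiniteMeasure (liouville G ξ) := by
  obtain ⟨V, Ω, r, h⟩ := S.exists_isSliceNhds hξ
  have hΩm := h.isOpen_image.measurableSet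
  have hfin : liouville G ξ Ω < ⊤ := by
    rw [h.liouville_apply hξ hΩm le_rfl]
    obtain ⟨C, hC⟩ := (isCompact_closedBall (0 : Fin (2 * S.n) → ℝ) 1).exists_bound_of_continuousOn
      S.continuous_det_P.continuousOn
    have hb : ∀ u ∈ V ∩ S.param ξ ⁻¹' Ω, chartDensity G (S.param ξ) u ≤
        ofReal (S.rootProd ξ) * ofReal (((2 * π) ^ S.n)⁻¹ * C) := by
      intro u hu
      rw [IsSliceNhds.chartDensity_eq hξ]
      gcongr
      exact hC u (h.subset hu.1)
    calc _ ≤ ∫⁻ u in V ∩ S.param ξ ⁻¹' Ω,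
          ofReal (S.rootProd ξ) * ofReal (((2 * π) ^ S.n)⁻¹ * C) :=
          setLIntegral_mono' ((h.isLocalParam hξ).measurableSet hΩm) hb
      _ ≤ ∫⁻ u in Metric.closedBall 0 1,
          ofReal (S.rootProd ξ) * ofReal (((2 * π) ^ S.n)⁻¹ * C) :=
          lintegral_mono_set (Set.inter_subset_left.trans h.subset)
      _ < ⊤ := by
        rw [setLIntegral_const]
        exact ENNReal.mul_lt_top (ENNReal.mul_lt_top ENNReal.ofReal_lt_top ENNReal.ofReal_lt_top)
          (isCompact_closedBall _ _).measure_lt_top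
  have hξΩ : ξ ∈ Ω := by
    have : S.param ξ 0 ∈ coadjointOrbit G ξ ∩ Ω := h.image_eq ▸ ⟨0, h.zero_mem, rfl⟩
    rw [param_zero] at this
    exact this.2
  obtain ⟨t, ht⟩ := (isCompact_orbit (G := G) ξ).elim_finite_subcover
    (fun g : G => (coAd g ⁻¹' Ω : Set (Dual E)))
    (fun g => h.isOpen_image.preimage (coAdL E g).continuous) (by
      rintro _ ⟨g, rfl⟩
      exact Set.mem_iUnion.2 ⟨g⁻¹, by simpa [coAd_inv_coAd] using hξΩ⟩)
  refine ⟨?_⟩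
  rw [← Set.union_compl_self (coadjointOrbit G ξ)]
  refine (measure_union_le _ _).trans_lt ?_
  rw [liouville_compl_orbit, add_zero]
  refine (measure_mono ht).trans_lt ((measure_biUnion_finset_le _ _).trans_lt ?_)
  refine ENNReal.sum_lt_top.2 fun g _ => ?_
  rw [liouville_preimage_coAd g hΩm]
  exact hfin

end Slice
end CartanData

end

section

variable [MeasurableSpace G] [BorelSpace G]

lemma measure_preimage_mul_right_of_isProbabilityMeasure (μ : Measure G)
    [μ.IsHaarMeasure] [IsProbabilityMeasure μ] (h : G) (B : Set G) :
    μ ((fun g => g * h) ⁻¹' B) = μ B := by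
  have h1 : IsProbabilityMeasure (μ.map fun g => g * h) :=
    Measure.isProbabilityMeasure_map (measurable_mul_const h).aemeasurable
  have h2 := Measure.isHaarMeasure_eq_of_isProbabilityMeasure (μ.map fun g => g * h) μ
  conv_rhs => rw [← h2]
  exact ((Homeomorph.mulRight h).toMeasurableEquiv.map_apply B).symm

variable (μ : Measure G) [μ.IsHaarMeasure] [IsProbabilityMeasure μ]

lemma continuous_coAd_left (ξ : Dual E) : Continuous fun g : G => coAd g ξ :=
  continuous_coAd.comp (by fun_prop : Continuous fun g : G => (g, ξ))

/-- The canonical measure of an orbit is a multiple of the invariant probability measure. -/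
lemma liouville_eq_mul_haar (ξ : Dual E) [IsFiniteMeasure (liouville G ξ)] {B : Set (Dual E)}
    (hB : MeasurableSet B) :
    liouville G ξ B = liouville G ξ Set.univ * μ ((fun g : G => coAd g ξ) ⁻¹' B) := by
  have := FiniteDimensional.proper ℝ (Dual E)
  have hm : Measurable fun z : G × Dual E => coAd z.1 z.2 := continuous_coAd.measurable
  have hswap := lintegral_lintegral_swap (μ := μ) (ν := liouville G ξ)
    (f := fun g η => (B.indicator 1 (coAd g η) : ENNReal))
    ((measurable_one.indicator hB).comp hm).aemeasurable
  have h1 : ∀ g : G, ∫⁻ η, (B.indicator 1 (coAd g η) : ENNReal) ∂liouville G ξ =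
      liouville G ξ B := by
    intro g
    rw [← liouville_preimage_coAd g hB, ← lintegral_indicator_one (measurable_coAd g hB)]
    rfl
  have h2 : ∀ᵐ η ∂liouville G ξ, ∫⁻ g, (B.indicator 1 (coAd g η) : ENNReal) ∂μ =
      μ ((fun g : G => coAd g ξ) ⁻¹' B) := by
    have : ∀ᵐ η ∂liouville G ξ, η ∈ coadjointOrbit G ξ := by
      rw [ae_iff]; exact liouville_compl_orbit ξ
    filter_upwards [this] with η hη
    obtain ⟨h, rfl⟩ := hη
    rw [← measure_preimage_mul_right_of_isProbabilityMeasure μ h,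
      ← lintegral_indicator_one (by
        rw [← Set.preimage_comp]
        exact ((continuous_coAd_left ξ).comp (continuous_mul_const h)).measurable hB)]
    refine lintegral_congr fun g => ?_
    simp only [← coAd_mul]
    rfl
  simp only [h1] at hswap
  rw [lintegral_congr_ae h2] at hswap
  simpa [mul_comm] using hswap

namespace CartanData

variable (c : CartanData E G)

/-- The fixed vectors of a matrix acting on `𝔱*`. -/
def fixes (M : Matrix (Fin c.ℓ) (Fin c.ℓ) ℤ) (x : Fin c.ℓ → ℝ) : Prop :=
  ∀ j, ∑ i, x i * M i j = x j

/-- The order of the stabilizer in the Weyl group. -/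
def stabCard (x : Fin c.ℓ → ℝ) : ℕ := {M ∈ c.weyl | c.fixes M x}.ncard

lemma stabCard_pos (x : Fin c.ℓ → ℝ) : 0 < c.stabCard x := by
  rw [stabCard, Set.ncard_pos (c.weyl_finite.subset fun _ h => h.1)]
  refine ⟨1, ⟨1, fun v => ?_⟩, fun j => ?_⟩
  · simp [Ad_one]
  · simp [Matrix.one_apply]

variable {c}

lemma IsWeylMatrix.eq {M M' : Matrix (Fin c.ℓ) (Fin c.ℓ) ℤ} {g g' : G} (h : c.IsWeylMatrix M g)
    (h' : c.IsWeylMatrix M' g') (hH : ∀ H ∈ c.t, Ad g H = Ad g' H) : M = M' := by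
  ext i j
  have h1 := hH _ (c.velocity_mem_t (single j 1))
  rw [h, h'] at h1
  have h2 := congrFun (c.isTorusParam.velocity_injective h1) i
  simp at h2
  exact h2

namespace Slice

variable (S : c.Slice)

/-- The part of `G` over a set of slice parameters. -/
def tube (A₀ : Set (Fin (2 * S.n) → ℝ)) : Set G :=
  {g | ∃ u ∈ A₀, ∃ k : G, (∀ H ∈ c.t, Ad k H = H) ∧ g = S.s u * k}

lemma isCompact_tube {A₀ : Set (Fin (2 * S.n) → ℝ)} (hA : IsCompact A₀) :
    IsCompact (S.tube A₀) := by
  have hK : IsCompact {k : G | ∀ H ∈ c.t, Ad k H = H} := by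
    refine IsClosed.isCompact ?_
    have : {k : G | ∀ H ∈ c.t, Ad k H = H} = ⋂ H ∈ c.t, {k : G | Ad k H = H} := by
      ext k; simp
    rw [this]
    refine isClosed_biInter fun H _ => isClosed_eq ?_ continuous_const
    exact (continuous_Ad (E := E) (G := G)).clm_apply continuous_const
  have hs : IsCompact (S.s '' A₀) := hA.image S.contMDiff_s.continuous
  convert hs.mul hK using 1
  ext g
  simp only [tube, Set.mem_mul, Set.mem_image, Set.mem_ofPred_eq]
  constructor
  · rintro ⟨u, hu, k, hk, rfl⟩
    exact ⟨_, ⟨u, hu, rfl⟩, k, hk, rfl⟩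
  · rintro ⟨_, ⟨u, hu, rfl⟩, k, hk, rfl⟩
    exact ⟨u, hu, k, hk, rfl⟩

lemma tube_mem_nhds {A₀ : Set (Fin (2 * S.n) → ℝ)} (hA : A₀ ∈ nhds 0) :
    S.tube A₀ ∈ nhds (1 : G) := by
  rw [← S.map_nhds_mul_p]
  refine mem_of_superset (image_mem_map (prod_mem_nhds hA univ_mem)) ?_
  rintro _ ⟨⟨u, τ⟩, ⟨hu, -⟩, rfl⟩
  exact ⟨u, hu, c.p τ, fun H hH => Ad_p_of_mem_t c τ hH, rfl⟩

variable {S} {ξ : Dual E} {V : Set (Fin (2 * S.n) → ℝ)} {Ω : Set (Dual E)}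
  {r : Dual E → Fin (2 * S.n) → ℝ}

lemma IsSliceNhds.haar_preimage (h : S.IsSliceNhds ξ V Ω r) (hξ : ξ ∈ c.openChamber)
    {A₀ : Set (Fin (2 * S.n) → ℝ)} (hA : IsCompact A₀) (hAV : A₀ ⊆ V) :
    μ ((fun g : G => coAd g ξ) ⁻¹' (S.param ξ '' A₀)) =
      c.stabCard (c.coord ξ) * μ (S.tube A₀) := by
  set F := {M ∈ c.weyl | c.fixes M (c.coord ξ)} with hF
  have hFfin : F.Finite := c.weyl_finite.subset fun _ h => h.1
  have hex : ∀ M : Matrix (Fin c.ℓ) (Fin c.ℓ) ℤ, ∃ g : G, M ∈ F → c.IsWeylMatrix M g := by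
    intro M
    by_cases hM : M ∈ F
    · obtain ⟨g, hg⟩ := hM.1
      exact ⟨g, fun _ => hg⟩
    · exact ⟨1, fun h => absurd h hM⟩
  choose w hw using hex
  have hfix : ∀ M ∈ F, coAd (w M) ξ = ξ := fun M hM => ((hw M hM).coAd_eq_iff hξ.1).2 hM.2
  have hset : ((fun g : G => coAd g ξ) ⁻¹' (S.param ξ '' A₀)) =
      ⋃ M ∈ hFfin.toFinset, (fun g => g * (w M)⁻¹) ⁻¹' S.tube A₀ := by
    ext g
    simp only [Set.mem_preimage, Set.mem_image, Set.mem_iUnion, Set.Finite.mem_toFinset]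
    constructor
    · rintro ⟨u, hu, hug⟩
      have h1 : coAd ((S.s u)⁻¹ * g) ξ = ξ := by
        rw [coAd_mul, ← hug]; exact coAd_inv_coAd _ _
      have h2 := fun H (hH : H ∈ c.t) => S.isRootBasis.Ad_mem_t_of_coAd_eq hξ h1 hH
      obtain ⟨M, hM⟩ := c.exists_isWeylMatrix h2
      have hMF : M ∈ F := ⟨⟨_, hM⟩, (hM.coAd_eq_iff hξ.1).1 h1⟩
      refine ⟨M, hMF, u, hu, (S.s u)⁻¹ * g * (w M)⁻¹, fun H hH => ?_, by group⟩
      rw [Ad_mul, comp_apply]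
      obtain ⟨v, hv⟩ := Ad_inv_mem_t (fun H hH => (hw M hMF).Ad_mem_t hH) hH
      have hv : velocity (E := E) G c.p v = Ad (w M)⁻¹ H := hv
      rw [← hv, hM v, ← hw M hMF v, hv, Ad_apply_inv]
    · rintro ⟨M, hM, u, hu, k, hk, hg⟩
      refine ⟨u, hu, ?_⟩
      have h1 : g = S.s u * k * w M := by rw [← hg]; group
      rw [h1, coAd_mul, hfix M hM, coAd_mul, coAd_eq_self_of_centralizes hk hξ.1]
      rfl
  have hinj := (h.isLocalParam hξ).injOn
  rw [hset, measure_biUnion_finset]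
  · simp only [measure_preimage_mul_right_of_isProbabilityMeasure]
    rw [Finset.sum_const, nsmul_eq_mul, stabCard, ← hF, Set.ncard_eq_toFinset_card F hFfin]
  · intro M hM M' hM' hne
    rw [Function.onFun, Set.disjoint_left]
    rintro g ⟨u, hu, k, hk, hg⟩ ⟨u', hu', k', hk', hg'⟩
    have hM : M ∈ F := by simpa using hM
    have hM' : M' ∈ F := by simpa using hM'
    refine hne ?_
    have e1 : g = S.s u * (k * w M) := by rw [← mul_assoc, ← hg]; group
    have e2 : g = S.s u' * (k' * w M') := by rw [← mul_assoc, ← hg']; group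
    have e3 : S.param ξ u = coAd g ξ := by
      rw [e1, coAd_mul, coAd_mul, hfix M hM, coAd_eq_self_of_centralizes hk hξ.1]; rfl
    have e4 : S.param ξ u' = coAd g ξ := by
      rw [e2, coAd_mul, coAd_mul, hfix M' hM', coAd_eq_self_of_centralizes hk' hξ.1]; rfl
    have e5 : u = u' := hinj (hAV hu) (hAV hu') (e3.trans e4.symm)
    rw [e1, e5] at e2
    have e6 : k * w M = k' * w M' := mul_left_cancel e2
    refine (hw M hM).eq (hw M' hM') fun H hH => ?_
    have e7 := congrArg (fun g : G => Ad g H) e6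
    simp only [Ad_mul, comp_apply] at e7
    rwa [hk _ ((hw M hM).Ad_mem_t hH), hk' _ ((hw M' hM').Ad_mem_t hH)] at e7
  · intro M _
    exact (S.isCompact_tube hA).measurableSet.preimage (continuous_mul_const _).measurable

lemma IsSliceNhds.liouville_image (h : S.IsSliceNhds ξ V Ω r) (hξ : ξ ∈ c.openChamber)
    {A₀ : Set (Fin (2 * S.n) → ℝ)} (hA : IsCompact A₀) (hAV : A₀ ⊆ V) :
    liouville G ξ (S.param ξ '' A₀) = ofReal (S.rootProd ξ) *
      ∫⁻ u in A₀, ofReal (((2 * π) ^ S.n)⁻¹ * |(S.P u).det|) := by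
  have hm : MeasurableSet (S.param ξ '' A₀) :=
    (hA.image (S.contDiff_param ξ).continuous).measurableSet
  rw [h.liouville_apply hξ hm ((Set.image_mono hAV).trans
    (h.image_eq.subset.trans Set.inter_subset_right))]
  have h1 : V ∩ S.param ξ ⁻¹' (S.param ξ '' A₀) = A₀ := by
    ext u
    constructor
    · rintro ⟨hu, u', hu', he⟩
      rwa [← (h.isLocalParam hξ).injOn (hAV hu') hu he]
    · exact fun hu => ⟨hAV hu, u, hu, rfl⟩
  rw [h1]
  simp only [IsSliceNhds.chartDensity_eq hξ]
  rw [lintegral_const_mul']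
  exact ENNReal.ofReal_ne_top

lemma rootProd_pos (S : c.Slice) {ξ : Dual E} (hξ : ξ ∈ c.openChamber) : 0 < S.rootProd ξ :=
  prod_pos fun i _ => (S.isRootBasis.mem_openChamber_iff.1 hξ).2 i

/-- The canonical volumes of two regular orbits. -/
lemma volume_ratio (S : c.Slice) {ξ η : Dual E} (hξ : ξ ∈ c.openChamber) (hη : η ∈ c.openChamber) :
    liouville G ξ Set.univ * c.stabCard (c.coord ξ) * ofReal (S.rootProd η) =
      liouville G η Set.univ * c.stabCard (c.coord η) * ofReal (S.rootProd ξ) := by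
  have : IsFiniteMeasure (liouville G ξ) := isFiniteMeasure_liouville S hξ
  have : IsFiniteMeasure (liouville G η) := isFiniteMeasure_liouville S hη
  let μ : Measure G := Measure.haarMeasure ⊤
  have hμ : IsProbabilityMeasure μ := ⟨by
    have := Measure.haarMeasure_self (K₀ := (⊤ : PositiveCompacts G)); simpa using this⟩
  obtain ⟨V, Ω, r, h⟩ := S.exists_isSliceNhds hξ
  obtain ⟨V', Ω', r', h'⟩ := S.exists_isSliceNhds hη
  obtain ⟨ε, hε, hsub⟩ := Metric.nhds_basis_closedBall.mem_iff.1
    (inter_mem (h.isOpen.mem_nhds h.zero_mem) (h'.isOpen.mem_nhds h'.zero_mem))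
  have hc := isCompact_closedBall (0 : Fin (2 * S.n) → ℝ) ε
  have key : ∀ {ξ : Dual E} (hξ : ξ ∈ c.openChamber) {V Ω r} (h : S.IsSliceNhds ξ V Ω r)
      (hV : Metric.closedBall 0 ε ⊆ V) [IsFiniteMeasure (liouville G ξ)],
      ofReal (S.rootProd ξ) * ∫⁻ u in Metric.closedBall 0 ε,
        ofReal (((2 * π) ^ S.n)⁻¹ * |(S.P u).det|) =
      liouville G ξ Set.univ * c.stabCard (c.coord ξ) * μ (S.tube (Metric.closedBall 0 ε)) := by
    intro ξ hξ V Ω r h hV _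
    rw [← h.liouville_image hξ hc hV, liouville_eq_mul_haar μ ξ
      (hc.image (S.contDiff_param ξ).continuous).measurableSet,
      h.haar_preimage μ hξ hc hV, mul_assoc]
  have k1 := key hξ h (hsub.trans Set.inter_subset_left)
  have k2 := key hη h' (hsub.trans Set.inter_subset_right)
  have hm0 : μ (S.tube (Metric.closedBall 0 ε)) ≠ 0 :=
    (Measure.measure_pos_of_mem_nhds μ (S.tube_mem_nhds (Metric.closedBall_mem_nhds 0 hε))).ne'
  have hm1 : μ (S.tube (Metric.closedBall 0 ε)) ≠ ⊤ := measure_ne_top _ _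
  rw [← ENNReal.mul_left_inj hm0 hm1]
  calc _ = liouville G ξ Set.univ * c.stabCard (c.coord ξ) * μ (S.tube (Metric.closedBall 0 ε)) *
        ofReal (S.rootProd η) := by ring
    _ = _ := by rw [← k1]
    _ = ofReal (S.rootProd η) * (∫⁻ u in Metric.closedBall 0 ε,
        ofReal (((2 * π) ^ S.n)⁻¹ * |(S.P u).det|)) *
        ofReal (S.rootProd ξ) := by ring
    _ = _ := by rw [k2]; ring

/-- Integration over the regular orbits. -/
theorem exists_integral_liouville (S : c.Slice) : ∃ C : ℝ, ∀ ξ ∈ c.openChamber,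
    ∀ f : Dual E → ℝ, Continuous f →
      ∫ η, f η ∂liouville G ξ =
        C * (S.rootProd ξ / c.stabCard (c.coord ξ)) * ∫ g, f (coAd g ξ) ∂μ := by
  by_cases hne : ∃ η, η ∈ c.openChamber
  swap
  · exact ⟨0, fun ξ hξ => absurd ⟨ξ, hξ⟩ hne⟩
  obtain ⟨η, hη⟩ := hne
  refine ⟨(liouville G η Set.univ).toReal * c.stabCard (c.coord η) / S.rootProd η,
    fun ξ hξ f hf => ?_⟩
  have : IsFiniteMeasure (liouville G ξ) := isFiniteMeasure_liouville S hξ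
  have h1 : liouville G ξ =
      liouville G ξ Set.univ • μ.map (fun g : G => coAd g ξ) := by
    ext B hB
    rw [Measure.smul_apply, Measure.map_apply (continuous_coAd_left ξ).measurable hB, smul_eq_mul]
    exact liouville_eq_mul_haar μ ξ hB
  rw [h1, integral_smul_measure, integral_map (continuous_coAd_left ξ).measurable.aemeasurable
    hf.aestronglyMeasurable, smul_eq_mul]
  congr 1
  have h2 := congrArg ENNReal.toReal (volume_ratio S hξ hη)
  have p1 := S.rootProd_pos hξ
  have p2 := S.rootProd_pos hη
  simp only [ENNReal.toReal_mul, ENNReal.toReal_natCast, ENNReal.toReal_ofReal p1.le,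
    ENNReal.toReal_ofReal p2.le] at h2
  have p3 : (0 : ℝ) < c.stabCard (c.coord ξ) := by exact_mod_cast c.stabCard_pos _
  field_simp
  linarith

end Slice
end CartanData

end

section

namespace CartanData

variable (c : CartanData E G)

/-- The linear map that sends `x` to the element of `𝔱*` with coordinates `x / 2`. -/
def halfLift : (Fin c.ℓ → ℝ) →L[ℝ] Dual E := (1 / 2 : ℝ) • c.lift

/-- The element of `𝔱*` with half-integral coordinates `x / 2`. -/
def halfWeight (x : Fin c.ℓ → ℤ) : Dual E := c.halfLift fun i => (x i : ℝ)

lemma coord_halfLift (y : Fin c.ℓ → ℝ) : c.coord (c.halfLift y) = (1 / 2 : ℝ) • y := by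
  rw [halfLift, smul_apply, map_smul, coord_lift]

lemma halfLift_mem (y : Fin c.ℓ → ℝ) : c.halfLift y ∈ c.tDual :=
  smul_mem _ _ (c.lift_mem y)

lemma halfLift_two_coord {ξ : Dual E} (hξ : ξ ∈ c.tDual) : c.halfLift ((2 : ℝ) • c.coord ξ) = ξ := by
  rw [halfLift, smul_apply, map_smul, lift_coord c hξ, smul_smul]; norm_num

lemma halfWeight_mem (x : Fin c.ℓ → ℤ) : c.halfWeight x ∈ c.tDual := c.halfLift_mem _

lemma smul_halfWeight (x : Fin c.ℓ → ℤ) (k : ℕ) :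
    (k : ℝ)⁻¹ • c.halfWeight x = c.halfLift (scaled x k) := by
  rw [halfWeight, ← map_smul]
  congr 1
  funext i
  simp [scaled, div_eq_inv_mul]

lemma halfWeight_add (x y : Fin c.ℓ → ℤ) (n : ℤ) :
    c.halfWeight (x + n • y) = c.halfWeight x + (n : ℝ) • c.halfWeight y := by
  rw [halfWeight, halfWeight, halfWeight, ← map_smul, ← map_add]
  congr 1
  funext i
  simp

lemma two_smul_halfWeight_mem (x : Fin c.ℓ → ℤ) : (2 : ℝ) • c.halfWeight x ∈ c.weightLattice := by
  rw [mem_weightLattice_iff]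
  refine ⟨smul_mem _ _ (c.halfLift_mem _), fun i => ⟨x i, ?_⟩⟩
  rw [map_smul, halfWeight, coord_halfLift, smul_smul]
  norm_num

lemma halfWeight_injective : Injective c.halfWeight := by
  intro x y h
  have := congrArg c.coord h
  simp only [halfWeight, coord_halfLift] at this
  funext i
  have := congrFun this i
  simpa using this

/-- The coordinates of `2ρ`. -/
def twoRho : Fin c.ℓ → ℤ := fun i => (c.mem_weightLattice_iff.1 c.two_smul_rho_mem).2 i |>.choose

lemma rho_eq_halfWeight : c.rho = c.halfWeight c.twoRho := by
  have h := c.mem_weightLattice_iff.1 c.two_smul_rho_mem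
  have h1 : c.coord ((2 : ℝ) • c.rho) = fun i => (c.twoRho i : ℝ) := by
    funext i; exact (h.2 i).choose_spec
  have h2 : c.rho ∈ c.tDual := by
    have := c.tDual.smul_mem (1 / 2 : ℝ) h.1
    rwa [smul_smul, show (1 / 2 : ℝ) * 2 = 1 by norm_num, one_smul] at this
  rw [halfWeight, ← h1, map_smul, halfLift_two_coord c h2]

lemma halfWeight_sub_rho_mem_iff (x : Fin c.ℓ → ℤ) :
    c.halfWeight x - c.rho ∈ c.weightLattice ↔ ∀ i, x i ≡ c.twoRho i [ZMOD 2] := by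
  have h0 : c.halfWeight x - c.rho = c.halfLift fun i => (x i - c.twoRho i : ℝ) := by
    rw [rho_eq_halfWeight, halfWeight, halfWeight, ← map_sub]; rfl
  rw [h0, mem_weightLattice_iff, coord_halfLift, and_iff_right (c.halfLift_mem _)]
  refine forall_congr' fun i => ?_
  rw [Int.modEq_comm, Int.modEq_iff_dvd]
  refine exists_congr fun n => ?_
  simp only [Pi.smul_apply, smul_eq_mul]
  constructor
  · intro h
    have : (x i - c.twoRho i : ℝ) = 2 * n := by linarith
    exact_mod_cast this
  · intro h
    have : (x i - c.twoRho i : ℝ) = 2 * n := by exact_mod_cast h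
    rw [this]; ring

lemma exists_halfWeight_eq {l : Dual E} (hl : l - c.rho ∈ c.weightLattice) :
    ∃ x, c.halfWeight x = l := by
  obtain ⟨h1, h2⟩ := c.mem_weightLattice_iff.1 hl
  choose n hn using h2
  refine ⟨c.twoRho + (2 : ℤ) • n, ?_⟩
  rw [halfWeight_add, ← rho_eq_halfWeight]
  have : ((2 : ℤ) : ℝ) • c.halfWeight n = l - c.rho := by
    rw [halfWeight, ← map_smul, ← halfLift_two_coord c h1]
    congr 1
    funext i
    change ((2 : ℤ) : ℝ) * (n i : ℝ) = 2 * c.coord (l - c.rho) i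
    rw [hn]; norm_num
  rw [this]; abel

lemma stepInd_rho_mem :
    stepInd (fun x _ => c.halfWeight x - c.rho ∈ c.weightLattice) ∈ stepAlg c.ℓ := by
  refine IsPer.mem_stepAlg ⟨2, two_pos, fun x y k j => ?_⟩
  simp only [stepInd, halfWeight_sub_rho_mem_iff]
  congr 1
  simp [Int.ModEq]

lemma stepInd_openChamber_mem (S : c.Slice) :
    stepInd (fun x _ => c.halfWeight x ∈ c.openChamber) ∈ stepAlg c.ℓ := by
  choose r q hr hq using fun i => S.isRootBasis.exists_rational i
  have h1 : ∀ x : Fin c.ℓ → ℤ, c.halfWeight x ∈ c.openChamber ↔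
      ∀ i ∈ Finset.univ, 0 < ∑ j, (q i j : ℝ) * x j + (0 : ℚ) * (0 : ℕ) := by
    intro x
    rw [S.isRootBasis.mem_openChamber_iff, and_iff_right (c.halfWeight_mem _)]
    refine forall_congr' fun i => ?_
    rw [hq i _ (c.halfWeight_mem _), mul_pos_iff_of_pos_left (hr i), halfWeight, coord_halfLift]
    simp only [Pi.smul_apply, smul_eq_mul, mem_univ, true_imp_iff]
    have : ∑ j, (q i j : ℝ) * (1 / 2 * (x j : ℝ)) = 1 / 2 * ∑ j, (q i j : ℝ) * x j := by
      rw [mul_sum]; exact sum_congr rfl fun j _ => by ring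
    rw [this]
    simp
  simp only [h1]
  refine stepInd_forall_mem _ fun i _ => ?_
  simpa using stepInd_lt_mem (q i) 0

lemma fixes_smul_iff (M : Matrix (Fin c.ℓ) (Fin c.ℓ) ℤ) {t : ℝ} (ht : t ≠ 0) (x : Fin c.ℓ → ℝ) :
    c.fixes M (t • x) ↔ c.fixes M x := by
  refine forall_congr' fun j => ?_
  simp only [Pi.smul_apply, smul_eq_mul, mul_assoc, ← mul_sum]
  exact mul_right_inj' ht

lemma stabCard_smul {t : ℝ} (ht : t ≠ 0) (x : Fin c.ℓ → ℝ) : c.stabCard (t • x) = c.stabCard x := by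
  simp only [stabCard, c.fixes_smul_iff _ ht]

lemma stepInd_fixes_mem (M : Matrix (Fin c.ℓ) (Fin c.ℓ) ℤ) :
    stepInd (fun x _ => c.fixes M fun i => (x i : ℝ)) ∈ stepAlg c.ℓ := by
  have h1 : ∀ x : Fin c.ℓ → ℤ, (c.fixes M fun i => (x i : ℝ)) ↔ ∀ j ∈ Finset.univ,
      ∑ i, (((M i j - if i = j then 1 else 0 : ℤ) : ℚ) : ℝ) * x i = 0 := by
    intro x
    simp only [mem_univ, true_imp_iff]
    refine forall_congr' fun j => ?_
    have h2 : ∀ i, (((M i j - if i = j then 1 else 0 : ℤ) : ℚ) : ℝ) =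
        M i j - if i = j then 1 else 0 := fun i => by split_ifs <;> simp
    simp only [h2, sub_mul, sum_sub_distrib, ite_mul, one_mul, zero_mul, Finset.sum_ite_eq',
      mem_univ, if_true, sub_eq_zero]
    simp only [mul_comm]
  simp only [h1]
  exact stepInd_forall_mem _ fun j _ => stepInd_eq_zero_mem _

lemma inv_stabCard_mem :
    (fun x _ => ((c.stabCard fun i => (x i : ℝ) : ℕ) : ℂ)⁻¹) ∈ stepAlg c.ℓ := by
  classical
  let s := c.weyl_finite.toFinset
  have h1 : (fun x _ => ((c.stabCard fun i => (x i : ℝ) : ℕ) : ℂ)⁻¹) =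
      ∑ T ∈ s.powerset, (T.card : ℂ)⁻¹ •
        stepInd (fun x (_ : ℕ) => ∀ M ∈ s, (c.fixes M (fun i => (x i : ℝ)) ↔ M ∈ T)) := by
    funext x k
    have hsplit : ∀ T ∈ s.powerset, (∀ M ∈ s, (c.fixes M (fun i => (x i : ℝ)) ↔ M ∈ T)) ↔
        T = {M ∈ s | c.fixes M fun i => (x i : ℝ)} := by
      intro T hT
      rw [Finset.mem_powerset] at hT
      constructor
      · intro h
        ext M
        rw [Finset.mem_filter]
        exact ⟨fun hM => ⟨hT hM, (h M (hT hM)).2 hM⟩, fun hM => (h M hM.1).1 hM.2⟩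
      · rintro rfl M hM
        simp [hM]
    simp only [Finset.sum_apply, Pi.smul_apply, smul_eq_mul, stepInd]
    have hmem : {M ∈ s | c.fixes M fun i => (x i : ℝ)} ∈ s.powerset :=
      Finset.mem_powerset.2 (Finset.filter_subset _ _)
    rw [Finset.sum_eq_single_of_mem _ hmem]
    · rw [if_pos ((hsplit _ hmem).2 rfl), mul_one, stabCard]
      congr 2
      rw [← Set.ncard_coe_finset]
      congr 1
      ext M; simp [s]
    · intro T hT hne
      rw [if_neg fun h => hne ((hsplit T hT).1 h), mul_zero]
  rw [h1]
  refine sum_mem fun T _ => Subalgebra.smul_mem _ (stepInd_forall_mem _ fun M _ => ?_) _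
  by_cases hM : M ∈ T
  · simpa [hM] using c.stepInd_fixes_mem M
  · simpa [hM] using stepInd_not_mem (c.stepInd_fixes_mem M)

end CartanData

variable (c : CartanData E G)

lemma mem_coneOver_iff {P : Set (Dual E)} {ξ : Dual E} {k : ℕ} (hk : 0 < k) :
    (ξ, (k : ℝ)) ∈ coneOver P ↔ (k : ℝ)⁻¹ • ξ ∈ P := by
  have hk' : (k : ℝ) ≠ 0 := by positivity
  constructor
  · rintro ⟨s, -, η, hη, h⟩
    obtain ⟨rfl, rfl⟩ := Prod.mk.inj h
    rwa [smul_smul, inv_mul_cancel₀ hk', one_smul]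
  · intro h
    exact ⟨k, by positivity, _, h, by rw [smul_smul, mul_inv_cancel₀ hk', one_smul]⟩

lemma exists_stepAlg_cone {P : Set (Dual E)} (hP : IsRationalPolyhedron c P) :
    ∃ h ∈ stepAlg c.ℓ, ∀ (x : Fin c.ℓ → ℤ) (k : ℕ), 0 < k →
      ((c.halfWeight x, (k : ℝ)) ∈ coneOver P → h x k = 1) ∧
      ((c.halfWeight x, (k : ℝ)) ∉ coneOver P → h x k = 0) := by
  obtain ⟨N, a, b, ha, rfl⟩ := hP
  have hr : ∀ i j, ∃ q : ℚ, a i (c.halfLift (single j 1)) = q := by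
    intro i j
    have h1 : (2 : ℝ) • c.halfWeight (single j 1) ∈ c.extLattice :=
      AddSubgroup.mem_sup_left (c.two_smul_halfWeight_mem _)
    obtain ⟨q, hq⟩ := ha i _ h1
    refine ⟨q / 2, ?_⟩
    have h2 : c.halfWeight (single j 1) = c.halfLift (single j 1) := by
      rw [CartanData.halfWeight]; congr 1; funext m
      by_cases h : m = j
      · subst h; simp
      · simp [h]
    rw [map_smul, h2, smul_eq_mul] at hq
    push_cast
    rw [← hq]; ring
  choose q hq using hr
  refine ⟨_, stepInd_forall_mem Finset.univ fun i _ => stepInd_le_mem (q i) (-b i), fun x k hk => ?_⟩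
  have hk' : (0 : ℝ) < k := by exact_mod_cast hk
  have h1 : (c.halfWeight x, (k : ℝ)) ∈ coneOver {ξ | ξ ∈ c.tDual ∧ ∀ i, (b i : ℝ) ≤ a i ξ} ↔
      ∀ i ∈ Finset.univ, 0 ≤ ∑ j, (q i j : ℝ) * x j + ((-b i : ℚ) : ℝ) * k := by
    rw [mem_coneOver_iff hk, Set.mem_ofPred_eq, and_iff_right (c.tDual.smul_mem _ (c.halfWeight_mem x))]
    simp only [mem_univ, true_imp_iff]
    refine forall_congr' fun i => ?_
    have h2 : a i (c.halfWeight x) = ∑ j, (q i j : ℝ) * x j := by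
      rw [CartanData.halfWeight, ← Finset.univ_sum_single (fun j => (x j : ℝ)), map_sum, map_sum]
      refine sum_congr rfl fun j _ => ?_
      rw [← hq, show single j (x j : ℝ) = (x j : ℝ) • (single j 1 : Fin c.ℓ → ℝ) by
        rw [← Pi.single_smul]; simp, map_smul, map_smul, smul_eq_mul, mul_comm]
    rw [map_smul, smul_eq_mul, h2, ← div_eq_inv_mul, le_div_iff₀ hk']
    push_cast
    constructor <;> intro h <;> linarith
  exact ⟨fun h => if_pos (h1.1 h), fun h => if_neg fun h' => h (h1.2 h')⟩

lemma smul_mem_latticeOver {P : Set (Dual E)} {D : ℕ} (hD : 0 < D) {u : Fin c.ℓ → ℤ} {v : ℤ}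
    (h : ((2 * D : ℕ) : ℝ) • ((c.halfWeight u, (v : ℝ)) : Dual E × ℝ) ∈ latticeOver c P) :
    (2 : ℝ) • ((c.halfWeight u, (v : ℝ)) : Dual E × ℝ) ∈ latticeOver c P := by
  refine ⟨⟨AddSubgroup.mem_sup_left (c.two_smul_halfWeight_mem u), ⟨2 * v, by simp⟩⟩, ?_⟩
  have hD' : (D : ℝ) ≠ 0 := by positivity
  have h1 := (spanOver P).smul_mem (D : ℝ)⁻¹ h.2
  rw [smul_smul] at h1
  push_cast at h1
  rwa [show (D : ℝ)⁻¹ * (2 * D) = 2 by field_simp] at h1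

open Classical in
/-- The extension of a periodic function on `Λ̃_P`. -/
def periodicExtension {P : Set (Dual E)} (D : ℕ) (f : latticeOver c P → ℂ) (x : Fin c.ℓ → ℤ)
    (k : ℕ) : ℂ :=
  if h : ∃ z : latticeOver c P, ∃ (u : Fin c.ℓ → ℤ) (v : ℤ), ((c.halfWeight x, (k : ℝ)) : Dual E × ℝ) =
    z + ((2 * D : ℕ) : ℝ) • ((c.halfWeight u, (v : ℝ)) : Dual E × ℝ) then f h.choose else 0

lemma periodicExtension_eq {P : Set (Dual E)} {D : ℕ} (hD : 0 < D) {f : latticeOver c P → ℂ}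
    (hf : ∀ x₀ x, f (x₀ + D • x) = f x₀) {x : Fin c.ℓ → ℤ} {k : ℕ} (z : latticeOver c P)
    (u : Fin c.ℓ → ℤ) (v : ℤ) (h : ((c.halfWeight x, (k : ℝ)) : Dual E × ℝ) =
      z + ((2 * D : ℕ) : ℝ) • ((c.halfWeight u, (v : ℝ)) : Dual E × ℝ)) :
    periodicExtension c D f x k = f z := by
  have hex : ∃ z : latticeOver c P, ∃ (u : Fin c.ℓ → ℤ) (v : ℤ),
      ((c.halfWeight x, (k : ℝ)) : Dual E × ℝ) =
      z + ((2 * D : ℕ) : ℝ) • ((c.halfWeight u, (v : ℝ)) : Dual E × ℝ) := ⟨z, u, v, h⟩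
  rw [periodicExtension, dif_pos hex]
  obtain ⟨u', v', h'⟩ := hex.choose_spec
  set z' := hex.choose
  have h1 : ((2 * D : ℕ) : ℝ) • ((c.halfWeight (u + (-1 : ℤ) • u'), ((v - v' : ℤ) : ℝ)) : Dual E × ℝ) =
      ((z' - z : latticeOver c P) : Dual E × ℝ) := by
    have h2 : ((c.halfWeight (u + (-1 : ℤ) • u'), ((v - v' : ℤ) : ℝ)) : Dual E × ℝ) =
        (c.halfWeight u, (v : ℝ)) - (c.halfWeight u', (v' : ℝ)) := by
      rw [CartanData.halfWeight_add, Prod.mk_sub_mk]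
      refine Prod.ext ?_ (by simp)
      change c.halfWeight u + ((-1 : ℤ) : ℝ) • c.halfWeight u' = c.halfWeight u - c.halfWeight u'
      push_cast
      module
    rw [h2, smul_sub, AddSubgroup.coe_sub, sub_eq_sub_iff_add_eq_add, add_comm, ← h, h', add_comm]
  have h3 := smul_mem_latticeOver c hD (P := P) (h1 ▸ (z' - z).2)
  rw [← hf z ⟨_, h3⟩]
  congr 1
  rw [← sub_eq_iff_eq_add']
  apply Subtype.ext
  rw [← h1, AddSubgroup.coe_nsmul, ← Nat.cast_smul_eq_nsmul ℝ, smul_smul]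
  push_cast
  rw [mul_comm]

lemma isPer_periodicExtension {P : Set (Dual E)} {D : ℕ} (hD : 0 < D) {f : latticeOver c P → ℂ}
    (hf : ∀ x₀ x, f (x₀ + D • x) = f x₀) : IsPer (periodicExtension c D f) := by
  refine ⟨2 * D, by positivity, fun x y k j => ?_⟩
  have hs : ((c.halfWeight (x + ((2 * D : ℕ) : ℤ) • y), ((k + 2 * D * j : ℕ) : ℝ)) : Dual E × ℝ) =
      (c.halfWeight x, (k : ℝ)) + ((2 * D : ℕ) : ℝ) • ((c.halfWeight y, ((j : ℤ) : ℝ)) : Dual E × ℝ) := by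
    rw [CartanData.halfWeight_add, Prod.smul_mk, Prod.mk_add_mk]
    push_cast
    simp
  have hadd : ∀ (u u' : Fin c.ℓ → ℤ) (v v' : ℤ) (ε : ℤ),
      ((c.halfWeight (u + ε • u'), ((v + ε * v' : ℤ) : ℝ)) : Dual E × ℝ) =
      (c.halfWeight u, (v : ℝ)) + (ε : ℝ) • ((c.halfWeight u', (v' : ℝ)) : Dual E × ℝ) := by
    intro u u' v v' ε
    rw [CartanData.halfWeight_add, Prod.smul_mk, Prod.mk_add_mk]
    push_cast
    simp
  by_cases hex : ∃ z : latticeOver c P, ∃ (u : Fin c.ℓ → ℤ) (v : ℤ),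
      ((c.halfWeight x, (k : ℝ)) : Dual E × ℝ) =
      z + ((2 * D : ℕ) : ℝ) • ((c.halfWeight u, (v : ℝ)) : Dual E × ℝ)
  · obtain ⟨z, u, v, h⟩ := hex
    rw [periodicExtension_eq c hD hf z u v h]
    refine periodicExtension_eq c hD hf z (u + (1 : ℤ) • y) (v + 1 * j) ?_
    rw [hs, h, hadd]
    simp only [Int.cast_one, one_smul, smul_add, add_assoc]
  · rw [periodicExtension, periodicExtension, dif_neg hex, dif_neg]
    rintro ⟨z, u, v, h⟩
    refine hex ⟨z, u + (-1 : ℤ) • y, v + -1 * j, ?_⟩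
    rw [hs, ← eq_sub_iff_add_eq] at h
    rw [h, hadd]
    push_cast
    module

lemma exists_quasiAlg_eq {P : Set (Dual E)} {f : latticeOver c P → ℂ}
    (hf : f ∈ quasiPolynomials (latticeOver c P)) :
    ∃ F ∈ quasiAlg c.ℓ, ∀ (x : Fin c.ℓ → ℤ) (k : ℕ), 0 < k →
      ∀ h : (c.halfWeight x, (k : ℝ)) ∈ latticeOver c P, F x k = f ⟨_, h⟩ := by
  induction hf using Algebra.adjoin_induction with
  | mem f hf =>
    rcases hf with ⟨D, hD, hper⟩ | ⟨l, hl⟩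
    · refine ⟨_, stepAlg_le_quasiAlg (isPer_periodicExtension c hD hper).mem_stepAlg,
        fun x k _ h => periodicExtension_eq c hD hper ⟨_, h⟩ 0 0 ?_⟩
      simp [CartanData.halfWeight, ← Pi.zero_def]
    · let g : (Fin c.ℓ → ℝ) → ℂ := fun y => ((l (c.halfLift y, 1) : ℝ) : ℂ)
      have hg : ContDiff ℝ ∞ g := by
        have h1 : ContDiff ℝ ∞ fun y => l.toContinuousLinearMap (c.halfLift y, 1) :=
          l.toContinuousLinearMap.contDiff.comp (c.halfLift.contDiff.prodMk contDiff_const)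
        exact Complex.ofRealCLM.contDiff.comp h1
      refine ⟨_, quasiGen_subset ⟨1, g, hg, 1, one_mem _, rfl⟩, fun x k hk h => ?_⟩
      have hk' : (k : ℝ) ≠ 0 := by positivity
      rw [hl]
      simp only [g, pow_one, Pi.one_apply, mul_one]
      rw [← c.smul_halfWeight, ← Complex.ofReal_natCast, ← ofReal_mul, ← smul_eq_mul (k : ℝ),
        ← map_smul, Prod.smul_mk, smul_smul, mul_inv_cancel₀ hk', one_smul, smul_eq_mul, mul_one]
  | algebraMap r => exact ⟨_, Subalgebra.algebraMap_mem _ r, fun _ _ _ _ => rfl⟩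
  | add f g _ _ hf hg =>
    obtain ⟨F, hF, hf⟩ := hf
    obtain ⟨F', hF', hg⟩ := hg
    exact ⟨_, add_mem hF hF', fun x k hk h => by
      rw [Pi.add_apply, Pi.add_apply, hf x k hk h, hg x k hk h, Pi.add_apply]⟩
  | mul f g _ _ hf hg =>
    obtain ⟨F, hF, hf⟩ := hf
    obtain ⟨F', hF', hg⟩ := hg
    exact ⟨_, mul_mem hF hF', fun x k hk h => by
      rw [mul_apply, mul_apply, hf x k hk h, hg x k hk h, mul_apply]⟩

lemma extLattice_of_sub_rho_mem {l : Dual E} (h : l - c.rho ∈ c.weightLattice) :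
    l ∈ c.extLattice := by
  rw [← sub_add_cancel l c.rho]
  exact add_mem (AddSubgroup.mem_sup_left h) (AddSubgroup.mem_sup_right ⟨1, by simp⟩)

lemma exists_quasiAlg_indicator {P : Set (Dual E)} (hP : IsRationalPolyhedron c P)
    {q : Dual E × ℝ → ℂ}
    (hq : (fun x : latticeOver c P => q x) ∈ quasiPolynomials (latticeOver c P)) :
    ∃ F ∈ quasiAlg c.ℓ, ∀ (x : Fin c.ℓ → ℤ) (k : ℕ), 0 < k →
      c.halfWeight x - c.rho ∈ c.weightLattice →
      (coneOver P).indicator q (c.halfWeight x, (k : ℝ)) = F x k := by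
  obtain ⟨h, hh, hcone⟩ := exists_stepAlg_cone c hP
  obtain ⟨F, hF, hFq⟩ := exists_quasiAlg_eq c hq
  refine ⟨h * F, mul_mem (stepAlg_le_quasiAlg hh) hF, fun x k hk hx => ?_⟩
  by_cases hm : (c.halfWeight x, (k : ℝ)) ∈ coneOver P
  · rw [Set.indicator_of_mem hm, mul_apply, mul_apply, (hcone x k hk).1 hm, one_mul]
    refine (hFq x k hk ⟨⟨extLattice_of_sub_rho_mem c hx, ⟨k, by simp⟩⟩, ?_⟩).symm
    obtain ⟨s, -, ξ, hξ, e⟩ := hm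
    rw [e, show (s • ξ, s) = s • ((ξ, 1) : Dual E × ℝ) by simp]
    exact (spanOver P).smul_mem s (subset_span ⟨ξ, hξ, rfl⟩)
  · rw [Set.indicator_of_notMem hm, mul_apply, mul_apply, (hcone x k hk).2 hm, zero_mul]

end

section

/-- A linear functional on test functions that satisfies bounds of order zero is a distribution. -/
lemma exists_distr_of_bound (T : Test E → ℂ) (hadd : ∀ φ ψ, T (φ + ψ) = T φ + T ψ)
    (hsmul : ∀ (a : ℝ) φ, T (a • φ) = a • T φ)
    (hb : ∀ K : Compacts (Dual E), ∃ C : ℝ, 0 ≤ C ∧ ∀ φ : Test E, tsupport φ ⊆ K →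
      ∀ M, (∀ ξ, ‖φ ξ‖ ≤ M) → ‖T φ‖ ≤ C * M) : ∃ A : Distr E, ∀ φ, A φ = T φ := by
  refine ⟨TestFunction.mkCLM ℝ T hadd hsmul fun K hK => ?_, fun φ => rfl⟩
  obtain ⟨C, hC0, hC⟩ := hb K
  exact (ContDiffMapSupportedIn.mkCLMtoNormedSpace ℝ (fun f => T (ofSupportedIn hK f))
    (fun f g => hadd (ofSupportedIn hK f) (ofSupportedIn hK g)) (fun a f => hsmul a (ofSupportedIn hK f)) ⟨{0}, C, hC0, fun f => by
      rw [Finset.sup_singleton]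
      exact hC _ f.tsupport_subset _ fun ξ => ContDiffMapSupportedIn.norm_apply_le_seminorm ℝ⟩).continuous

variable (G) in
/-- The union of the orbits that meet `K`. -/
def saturation (K : Set (Dual E)) : Set (Dual E) := (fun z : G × Dual E => coAd z.1 z.2) '' (Set.univ ×ˢ K)

lemma isCompact_saturation {K : Set (Dual E)} (hK : IsCompact K) : IsCompact (saturation G K) :=
  (isCompact_univ.prod hK).image continuous_coAd

lemma mem_saturation {K : Set (Dual E)} {g : G} {ξ : Dual E} (h : coAd g ξ ∈ K) :
    ξ ∈ saturation G K := ⟨(g⁻¹, coAd g ξ), ⟨trivial, h⟩, coAd_inv_coAd g ξ⟩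

variable (c : CartanData E G)

open CartanData in
lemma exists_average (S : c.Slice) {φ : Dual E → ℝ} (hφ : ContDiff ℝ ∞ φ)
    (hs : HasCompactSupport φ) : ∃ Φ : Dual E → ℂ, ContDiff ℝ ∞ Φ ∧
      (∀ ξ, Φ ξ ≠ 0 → ξ ∈ saturation G (tsupport φ)) ∧
      ∀ ξ ∈ c.openChamber, ((∫ η, φ η ∂liouville G ξ : ℝ) : ℂ) =
        (S.rootProd ξ : ℂ) * (c.stabCard (c.coord ξ) : ℂ)⁻¹ * Φ ξ := by
  let _ : MeasurableSpace G := borel G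
  have : BorelSpace G := ⟨rfl⟩
  let μ : Measure G := Measure.haarMeasure ⊤
  have hμ : IsProbabilityMeasure μ := ⟨by
    simpa using Measure.haarMeasure_self (K₀ := (⊤ : PositiveCompacts G))⟩
  obtain ⟨C, hC⟩ := Slice.exists_integral_liouville μ S
  have hcoAdL : Continuous fun g : G => coAdL E g := by
    refine continuous_clm_apply.2 fun ξ => ?_
    exact continuous_coAd_left ξ
  obtain ⟨CL, hCL⟩ := (isCompact_univ (X := G)).exists_bound_of_continuousOn
    (E := Dual E →L[ℝ] Dual E) (f := fun g : G => coAdL E g) hcoAdL.continuousOn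
  have hφC : ContDiff ℝ ∞ fun ξ => (φ ξ : ℂ) := Complex.ofRealCLM.contDiff.comp hφ
  have hsC : HasCompactSupport fun ξ => (φ ξ : ℂ) := hs.comp_left (g := ((↑) : ℝ → ℂ)) rfl
  have h1 : ContDiff ℝ ∞ fun ξ : Dual E => ∫ g : G, C • (φ (coAdL E g ξ + 0) : ℂ) ∂μ :=
    contDiff_integral_comp_affine (τ := fun _ => 0) (w := fun _ => C) (Cw := ‖C‖) hcoAdL
      (fun g => hCL g trivial) continuous_const continuous_const (fun _ => le_rfl) hφC hsC
  refine ⟨_, h1, fun ξ hξ => ?_, fun ξ hξ => ?_⟩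
  · by_contra hn
    refine hξ (integral_eq_zero_of_ae (of_forall fun g => ?_))
    have : φ (coAd g ξ) = 0 := by
      by_contra h0
      exact hn (mem_saturation (g := g) (subset_tsupport _ h0))
    simp [this]
  · rw [hC ξ hξ φ hφ.continuous]
    simp only [coAdL_apply, add_zero, integral_smul]
    push_cast
    rw [← integral_complex_ofReal, real_smul]
    ring

namespace CartanData

lemma smul_mem_openChamber {ξ : Dual E} (S : c.Slice) {t : ℝ} (ht : 0 < t) (hξ : ξ ∈ c.openChamber) :
    t • ξ ∈ c.openChamber := by
  rw [S.isRootBasis.mem_openChamber_iff] at hξ ⊢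
  exact ⟨c.tDual.smul_mem t hξ.1, fun i => by
    rw [smul_apply, smul_eq_mul]; exact mul_pos ht (hξ.2 i)⟩

end CartanData

/-- The summand of `Θ_k(m)`. -/
def thetaTerm (m : Dual E → ℕ → ℂ) (k : ℕ) (φ : Dual E → ℝ) (l : Dual E) : ℂ :=
  (k : ℂ) ^ c.r * (m l k * ((∫ ξ, φ ξ ∂(liouville G ((k : ℝ)⁻¹ • l)) : ℝ) : ℂ))

open Classical in
/-- The summand of `Θ_k(m)`, on the lattice of half-integral weights. -/
def latTerm (m : Dual E → ℕ → ℂ) (k : ℕ) (φ : Dual E → ℝ) (x : Fin c.ℓ → ℤ) : ℂ :=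
  if c.halfWeight x ∈ c.admissible then thetaTerm c m k φ (c.halfWeight x) else 0

/-- `R` bounds twice the coordinates of the points of `K`. -/
def CoordBound (K : Set (Dual E)) (R : ℕ) : Prop := ∀ ξ ∈ K, ∀ i, |2 * c.coord ξ i| ≤ R

lemma exists_coordBound {K : Set (Dual E)} (hK : IsCompact K) : ∃ R, CoordBound c K R := by
  obtain ⟨C, hC⟩ := hK.exists_bound_of_continuousOn (f := fun ξ => (2 : ℝ) • c.coord ξ) (by fun_prop)
  refine ⟨⌈C⌉₊, fun ξ hξ i => ?_⟩
  exact ((norm_le_pi_norm ((2 : ℝ) • c.coord ξ) i).trans (hC ξ hξ)).trans (Nat.le_ceil C)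

lemma exists_latTerm_eq (S : c.Slice) {φ : Dual E → ℝ} (hφ : ContDiff ℝ ∞ φ)
    (hs : HasCompactSupport φ) : ∃ f : (Fin c.ℓ → ℝ) → ℂ, ContDiff ℝ ∞ f ∧
      (∀ y, f y ≠ 0 → c.halfLift y ∈ saturation G (tsupport φ)) ∧
      ∀ x (k : ℕ), 0 < k → c.halfWeight x ∈ c.openChamber →
        ((∫ η, φ η ∂liouville G ((k : ℝ)⁻¹ • c.halfWeight x) : ℝ) : ℂ) =
          ((c.stabCard fun i => (x i : ℝ) : ℕ) : ℂ)⁻¹ * f (scaled x k) := by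
  obtain ⟨Φ, hΦ, hsupp, hint⟩ := exists_average c S hφ hs
  have hroot : ContDiff ℝ ∞ fun y => (S.rootProd (c.halfLift y) : ℂ) := by
    have h0 : ContDiff ℝ ∞ fun y => S.rootProd (c.halfLift y) := contDiff_prod fun i _ =>
      ((ContinuousLinearMap.apply ℝ ℝ (c.sharp (S.α i))).comp c.halfLift).contDiff
    exact Complex.ofRealCLM.contDiff.comp h0
  refine ⟨fun y => (S.rootProd (c.halfLift y) : ℂ) * Φ (c.halfLift y),
    hroot.mul (hΦ.comp c.halfLift.contDiff), fun y hy => hsupp _ (right_ne_zero_of_mul hy),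
    fun x k hk hx => ?_⟩
  have hk' : (0 : ℝ) < (k : ℝ)⁻¹ := by positivity
  rw [hint _ (c.smul_mem_openChamber S hk' hx), map_smul, c.stabCard_smul hk'.ne', CartanData.halfWeight,
    c.coord_halfLift, c.stabCard_smul (by norm_num), ← CartanData.halfWeight, c.smul_halfWeight]
  ring

lemma suppIn_of_coordBound {K : Set (Dual E)} {R : ℕ} (hR : CoordBound c K R)
    {f : (Fin c.ℓ → ℝ) → ℂ} (hf : ∀ y, f y ≠ 0 → c.halfLift y ∈ K) : SuppIn R f := by
  intro y hy i
  have := hR _ (hf y hy) i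
  rw [c.coord_halfLift] at this
  simpa using this

lemma latTerm_eq_zero (S : c.Slice) (m : Dual E → ℕ → ℂ) {φ : Dual E → ℝ} (hφ : ContDiff ℝ ∞ φ)
    (hs : HasCompactSupport φ) {R : ℕ} (hR : CoordBound c (saturation G (tsupport φ)) R) {k : ℕ}
    (hk : 0 < k) {x : Fin c.ℓ → ℤ} (hx : x ∉ latBox c.ℓ R k) : latTerm c m k φ x = 0 := by
  obtain ⟨f, hf, hsupp, hint⟩ := exists_latTerm_eq c S hφ hs
  rw [latTerm]
  split_ifs with h
  · have h0 : f (scaled x k) = 0 := by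
      by_contra hne
      refine hx ?_
      have := suppIn_of_coordBound c hR hsupp _ hne
      simp only [latBox, Fintype.mem_piFinset, mem_Icc]
      intro i
      have hi := this i
      have hk' : (0 : ℝ) < k := by exact_mod_cast hk
      rw [scaled, abs_div, abs_of_pos hk', div_le_iff₀ hk'] at hi
      exact abs_le.1 (by exact_mod_cast hi)
    rw [thetaTerm, hint x k hk h.2, h0, mul_zero, mul_zero, mul_zero]
  · rfl

lemma hasSum_thetaTerm (S : c.Slice) (m : Dual E → ℕ → ℂ) {φ : Dual E → ℝ} (hφ : ContDiff ℝ ∞ φ)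
    (hs : HasCompactSupport φ) {R : ℕ} (hR : CoordBound c (saturation G (tsupport φ)) R) {k : ℕ}
    (hk : 0 < k) : HasSum (fun l : c.admissible => thetaTerm c m k φ l)
      (∑ x ∈ latBox c.ℓ R k, latTerm c m k φ x) := by
  have h1 : HasSum (latTerm c m k φ) (∑ x ∈ latBox c.ℓ R k, latTerm c m k φ x) :=
    hasSum_sum_of_ne_finset_zero fun x hx => latTerm_eq_zero c S m hφ hs hR hk hx
  choose ι hι using fun l : c.admissible => c.exists_halfWeight_eq l.2.1
  have hinj : Injective ι := fun l l' h => Subtype.ext (by rw [← hι l, h, hι l'])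
  have h2 := (hinj.hasSum_iff (f := latTerm c m k φ) fun x hx => by
    rw [latTerm, if_neg]
    exact fun h => hx ⟨⟨_, h⟩, c.halfWeight_injective (hι _)⟩).2 h1
  refine h2.congr_fun fun l => ?_
  simp only [Function.comp, latTerm, hι, l.2, if_true]

lemma exists_hasExp_latTerm {𝒜 : Set (Set (Dual E))} {q : Set (Dual E) → Dual E × ℝ → ℂ}
    {m : Dual E → ℕ → ℂ} (S : c.Slice) (hm : IsDecomposition c 𝒜 q m) (𝓕 : Finset (Set (Dual E)))
    (h𝓕 : (𝓕 : Set (Set (Dual E))) ⊆ 𝒜) : ∃ (n₀ : ℤ) (D : ℤ → ℕ), ∀ φ : Dual E → ℝ, ContDiff ℝ ∞ φ →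
      HasCompactSupport φ → (∀ P ∈ 𝒜, P ∉ 𝓕 → Disjoint P (saturation G (tsupport φ))) →
      ∀ R, CoordBound c (saturation G (tsupport φ)) R →
      ∃ p, HasExp n₀ D (fun k => ∑ x ∈ latBox c.ℓ R k, latTerm c m k φ x) p := by
  classical
  have hF : ∀ P, ∃ F ∈ quasiAlg c.ℓ, P ∈ 𝓕 → ∀ (x : Fin c.ℓ → ℤ) (k : ℕ), 0 < k →
      c.halfWeight x - c.rho ∈ c.weightLattice →
      (coneOver P).indicator (q P) (c.halfWeight x, (k : ℝ)) = F x k := by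
    intro P
    by_cases hP : P ∈ 𝓕
    · obtain ⟨F, hF, h⟩ := exists_quasiAlg_indicator c (hm.polyhedron P (h𝓕 hP))
        (hm.quasiPolynomial P (h𝓕 hP))
      exact ⟨F, hF, fun _ => h⟩
    · exact ⟨0, zero_mem _, fun h => absurd h hP⟩
  choose F hF hFq using hF
  let W : (Fin c.ℓ → ℤ) → ℕ → ℂ := (fun _ (k : ℕ) => (k : ℂ) ^ c.r) *
    (stepInd (fun x _ => c.halfWeight x - c.rho ∈ c.weightLattice ∧ c.halfWeight x ∈ c.openChamber) *
      fun x (_ : ℕ) => ((c.stabCard fun i => (x i : ℝ) : ℕ) : ℂ)⁻¹) * ∑ P ∈ 𝓕, F P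
  have hW : W ∈ quasiAlg c.ℓ := by
    refine mul_mem (mul_mem ?_ (stepAlg_le_quasiAlg (mul_mem
      (stepInd_and_mem c.stepInd_rho_mem (c.stepInd_openChamber_mem S)) c.inv_stabCard_mem)))
      (sum_mem fun P _ => hF P)
    exact quasiGen_subset ⟨c.r, fun _ => 1, contDiff_const, 1, one_mem _, by funext; simp⟩
  obtain ⟨n₀, D, hD⟩ := HasLatticeExp.of_mem_quasiAlg hW
  refine ⟨n₀, D, fun φ hφ hs hdisj R hR => ?_⟩
  obtain ⟨f, hf, hsupp, hint⟩ := exists_latTerm_eq c S hφ hs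
  obtain ⟨p, hp⟩ := hD f hf R (suppIn_of_coordBound c hR hsupp)
  refine ⟨p, hp.congr ?_⟩
  filter_upwards [eventually_gt_atTop 0] with k hk
  refine sum_congr rfl fun x _ => ?_
  simp only [W, mul_apply, Finset.sum_apply, stepInd, latTerm]
  by_cases hx : c.halfWeight x ∈ c.admissible
  swap
  · rw [if_neg hx, if_neg (show ¬ (_ ∧ _) from hx)]; simp
  rw [if_pos hx, if_pos (show _ ∧ _ from hx), thetaTerm, hint x k hk hx.2,
    hm.eq_sum _ (extLattice_of_sub_rho_mem c hx.1) k hk]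
  by_cases h0 : f (scaled x k) = 0
  · simp [h0]
  have hsum : ∑ᶠ P ∈ 𝒜, (coneOver P).indicator (q P) (c.halfWeight x, (k : ℝ)) =
      ∑ P ∈ 𝓕, F P x k := by
    rw [finsum_mem_eq_sum_of_inter_support_eq (t := 𝓕)]
    · exact sum_congr rfl fun P hP => hFq P hP x k hk hx.1
    · ext P
      simp only [Set.mem_inter_iff, Finset.mem_coe]
      refine and_congr_left fun hP => ⟨fun hPA => ?_, fun h => h𝓕 h⟩
      by_contra hPF
      refine hP (Set.indicator_of_notMem ?_ _)
      rw [mem_coneOver_iff hk, c.smul_halfWeight]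
      exact fun hmem => Set.disjoint_left.1 (hdisj P hPA hPF) hmem (hsupp _ h0)
  rw [hsum]
  ring

variable {c} in
lemma isFiniteMeasure_of_admissible (S : c.Slice) {l : Dual E} (hl : l ∈ c.admissible) {k : ℕ}
    (hk : 0 < k) : IsFiniteMeasure (liouville G ((k : ℝ)⁻¹ • l)) :=
  CartanData.Slice.isFiniteMeasure_liouville S
    (c.smul_mem_openChamber S (by positivity) hl.2)

lemma Test.integrable (φ : Test E) (μ : Measure (Dual E)) [IsFiniteMeasure μ] :
    Integrable (fun ξ => φ ξ) μ := by
  obtain ⟨C, -, hC⟩ := exists_bound_of_hasCompactSupport φ.contDiff.continuous φ.hasCompactSupport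
  exact Integrable.of_bound φ.contDiff.continuous.aestronglyMeasurable C (of_forall hC)

lemma saturation_mono {K K' : Set (Dual E)} (h : K ⊆ K') : saturation G K ⊆ saturation G K' :=
  Set.image_mono (Set.prod_mono_right h)

/-- `A` satisfies bounds of order zero, that is, it is a measure. -/
def IsOrderZero (A : Distr E) : Prop := ∀ K : Compacts (Dual E), ∃ C : ℝ, 0 ≤ C ∧
  ∀ φ : Test E, tsupport φ ⊆ K → ∀ M, (∀ ξ, ‖φ ξ‖ ≤ M) → ‖A φ‖ ≤ C * M

lemma exists_theta (S : c.Slice) (m : Dual E → ℕ → ℂ) : ∃ Θ : ℕ → Distr E, ∀ k, 0 < k →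
    IsTheta c m k (Θ k) ∧ IsOrderZero (Θ k) := by
  suffices h : ∀ k : ℕ, ∃ A : Distr E, 0 < k → IsTheta c m k A ∧ IsOrderZero A by
    choose Θ hΘ using h
    exact ⟨Θ, hΘ⟩
  intro k
  rcases Nat.eq_zero_or_pos k with rfl | hk
  · exact ⟨0, fun h => absurd h (lt_irrefl _)⟩
  have hfin := fun l (hl : l ∈ c.admissible) => isFiniteMeasure_of_admissible S hl hk
  have hsum : ∀ (φ : Test E) R, CoordBound c (saturation G (tsupport φ)) R →
      HasSum (fun l : c.admissible => thetaTerm c m k φ l)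
        (∑ x ∈ latBox c.ℓ R k, latTerm c m k φ x) := fun φ R hR =>
    hasSum_thetaTerm c S m φ.contDiff φ.hasCompactSupport hR hk
  have hsummable : ∀ φ : Test E, Summable fun l : c.admissible => thetaTerm c m k φ l := fun φ => by
    obtain ⟨R, hR⟩ := exists_coordBound c
      (isCompact_saturation (G := G) (K := tsupport φ) φ.hasCompactSupport)
    exact (hsum φ R hR).summable
  suffices hb : ∀ K : Compacts (Dual E), ∃ C : ℝ, 0 ≤ C ∧ ∀ φ : Test E, tsupport φ ⊆ K →
      ∀ M, (∀ ξ, ‖φ ξ‖ ≤ M) → ‖∑' l : c.admissible, thetaTerm c m k φ l‖ ≤ C * M by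
    suffices h : ∃ A : Distr E, ∀ φ, A φ = ∑' l : c.admissible, thetaTerm c m k φ l by
      obtain ⟨A, hA⟩ := h
      refine ⟨A, fun _ => ⟨⟨hfin, fun φ => hA φ ▸ (hsummable φ).hasSum⟩, fun K => ?_⟩⟩
      simpa only [hA] using hb K
    refine exists_distr_of_bound (fun φ => ∑' l : c.admissible, thetaTerm c m k φ l) ?_ ?_ hb
    · intro φ ψ
      rw [← (hsummable φ).tsum_add (hsummable ψ)]
      refine tsum_congr fun l => ?_
      have := hfin l l.2
      simp only [thetaTerm, add_apply]
      rw [integral_add (Test.integrable φ _) (Test.integrable ψ _)]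
      push_cast
      ring
    · intro a φ
      rw [← tsum_const_smul'']
      refine tsum_congr fun l => ?_
      simp only [thetaTerm, smul_apply, smul_eq_mul]
      rw [integral_const_mul, real_smul]
      push_cast
      ring
  intro K
  obtain ⟨R, hR⟩ := exists_coordBound c (isCompact_saturation (G := G) K.isCompact)
  refine ⟨∑ x ∈ latBox c.ℓ R k, ‖(k : ℂ) ^ c.r‖ * (‖m (c.halfWeight x) k‖ *
    (liouville G ((k : ℝ)⁻¹ • c.halfWeight x)).real Set.univ),
    sum_nonneg fun _ _ => by positivity, fun φ hφ M hM => ?_⟩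
  have hM0 : 0 ≤ M := (norm_nonneg _).trans (hM 0)
  rw [(hsum φ R fun ξ hξ => hR ξ (saturation_mono hφ hξ)).tsum_eq, sum_mul]
  refine (norm_sum_le _ _).trans (sum_le_sum fun x _ => ?_)
  rw [latTerm]
  split_ifs with hx
  · have := hfin _ hx
    rw [thetaTerm, norm_mul, norm_mul, norm_real, mul_assoc, mul_assoc]
    gcongr
    rw [mul_comm]
    exact norm_integral_le_of_norm_le_const (of_forall hM)
  · rw [norm_zero]; positivity

lemma exists_hasExp_theta {𝒜 : Set (Set (Dual E))} {q : Set (Dual E) → Dual E × ℝ → ℂ}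
    {m : Dual E → ℕ → ℂ} (S : c.Slice) (hm : IsDecomposition c 𝒜 q m) {𝓕 : Set (Set (Dual E))}
    (hfin : 𝓕.Finite) (h𝓕 : 𝓕 ⊆ 𝒜) {Θ : ℕ → Distr E} (hΘ : ∀ k, 0 < k → IsTheta c m k (Θ k)) :
    ∃ (n₀ : ℤ) (D : ℤ → ℕ), ∀ φ : Test E,
      (∀ P ∈ 𝒜, P ∉ 𝓕 → Disjoint P (saturation G (tsupport φ))) →
      ∃ p, HasExp n₀ D (fun k => Θ k φ) p := by
  obtain ⟨n₀, D, h⟩ := exists_hasExp_latTerm c S hm hfin.toFinset (by simpa using h𝓕)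
  refine ⟨n₀, D, fun φ hφ => ?_⟩
  obtain ⟨R, hR⟩ := exists_coordBound c
    (isCompact_saturation (G := G) (K := tsupport φ) φ.hasCompactSupport)
  obtain ⟨p, hp⟩ := h φ φ.contDiff φ.hasCompactSupport (by simpa using hφ) R hR
  refine ⟨p, hp.congr ?_⟩
  filter_upwards [eventually_gt_atTop 0] with k hk
  exact (hasSum_thetaTerm c S m φ.contDiff φ.hasCompactSupport hR hk).unique ((hΘ k hk).2 φ)

lemma IsTheta.isInvariant {m : Dual E → ℕ → ℂ} {k : ℕ} {A : Distr E} (h : IsTheta c m k A) :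
    IsInvariant G A := by
  intro g φ ψ hψ
  refine (h.2 ψ).unique ?_
  have := h.2 φ
  convert this using 5 with l
  simp only [hψ]
  have hm : (liouville G ((k : ℝ)⁻¹ • (l : Dual E))).map (coAd g) =
      liouville G ((k : ℝ)⁻¹ • (l : Dual E)) := by
    ext s hs
    rw [Measure.map_apply (measurable_coAd g) hs, liouville_preimage_coAd g hs]
  conv_rhs => rw [← hm]
  rw [integral_map (measurable_coAd g).aemeasurable φ.contDiff.continuous.aestronglyMeasurable]

end

section Coefficients

variable {n₀ : ℤ} {D : ℤ → ℕ} {a : ℕ → ℂ} {p : ℤ → ℕ → ℂ}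

open Classical in
/-- The coefficients of the asymptotic expansion of `a`, if there is one. -/
def expCoeff (a : ℕ → ℂ) : ℤ → ℕ → ℂ :=
  if h : ∃ p n₀ D, HasExp n₀ D a p then h.choose else 0

lemma HasExp.expCoeff_eq (h : HasExp n₀ D a p) : expCoeff a = p := by
  have hex : ∃ p n₀ D, HasExp n₀ D a p := ⟨p, n₀, D, h⟩
  rw [expCoeff, dif_pos hex]
  obtain ⟨n₁, D₁, h₁⟩ := hex.choose_spec
  have hpos : ∀ n, 0 < D n * D₁ n := fun n => mul_pos (h.pos n) (h₁.pos n)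
  exact ((h₁.mono_bound (min_le_right n₀ n₁)).mono_period hpos fun n => Dvd.intro_left _ rfl).unique
    ((h.mono_bound (min_le_left n₀ n₁)).mono_period hpos fun n => Dvd.intro _ rfl)

lemma HasExp.tendsto_coeff (h : HasExp n₀ D a p) (n : ℤ) (r : ℕ) :
    Tendsto (fun j : ℕ => ((r + D n * j : ℕ) : ℂ) ^ n * (a (r + D n * j) -
      ∑ i ∈ Icc n₀ (n - 1), ((r + D n * j : ℕ) : ℂ) ^ (-i) * p i (r + D n * j)))
      atTop (nhds (p n r)) := by
  have hk : Tendsto (fun j : ℕ => r + D n * j) atTop atTop :=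
    tendsto_atTop_mono (fun j => by have := h.pos n; simp only [id]; nlinarith) tendsto_id
  have h1 : Tendsto (fun k : ℕ => (k : ℂ) ^ n * (a k -
      ∑ i ∈ Icc n₀ n, (k : ℂ) ^ (-i) * p i k)) atTop (nhds 0) := by
    refine (isLittleO_one_iff ℝ).1 ?_
    have h2 : (fun k : ℕ => (k : ℂ) ^ n) =O[atTop] fun k : ℕ => (k : ℝ) ^ n := by
      simpa using isBigO_zpow_mul (n := n) (f := fun _ => 1) (C := 1) (by simp)
    refine (h2.mul_isLittleO (h.isLittleO n)).congr' EventuallyEq.rfl ?_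
    filter_upwards [eventually_gt_atTop 0] with k hk
    rw [← zpow_add₀ (by positivity), add_neg_cancel, zpow_zero]
  have h3 := (h1.comp hk).add_const (p n r)
  rw [zero_add] at h3
  refine h3.congr' ?_
  filter_upwards [hk.eventually (eventually_gt_atTop 0)] with j hj
  have hj' : ((r + D n * j : ℕ) : ℂ) ≠ 0 := by exact_mod_cast hj.ne'
  simp only [Function.comp]
  rcases lt_or_ge n n₀ with hn | hn
  · rw [Finset.Icc_eq_empty (by omega), Finset.Icc_eq_empty (by omega), h.eq_zero n hn, add_zero]
  · have : Icc n₀ n = insert n (Icc n₀ (n - 1)) := by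
      ext; simp only [mem_Icc, Finset.mem_insert]; omega
    rw [this, Finset.sum_insert (by simp), periodic_mul (h.periodic n)]
    have h4 : ((r + D n * j : ℕ) : ℂ) ^ n * ((r + D n * j : ℕ) : ℂ) ^ (-n) = 1 := by
      rw [← zpow_add₀ hj', add_neg_cancel, zpow_zero]
    linear_combination (-p n r) * h4

/-- By the Banach-Steinhaus theorem, the coefficients of pointwise asymptotic expansions of
functionals are continuous. -/
lemma exists_coeffCLM {W : Type*} [AddCommGroup W] [Module ℝ W] [UniformSpace W]
    [IsUniformAddGroup W] [ContinuousSMul ℝ W] [BarrelledSpace ℝ W]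
    (A : ℕ → W →L[ℝ] ℂ) {p : W → ℤ → ℕ → ℂ} (hp : ∀ f, HasExp n₀ D (fun k => A k f) (p f))
    (n : ℤ) (r : ℕ) : ∃ T : W →L[ℝ] ℂ, ∀ f, T f = p f n r := by
  suffices H : ∀ m : ℕ, ∀ n < n₀ + m, ∀ r, ∃ T : W →L[ℝ] ℂ, ∀ f, T f = p f n r from
    H (n - n₀ + 1).toNat n (by omega) r
  intro m
  induction m with
  | zero => exact fun n hn r => ⟨0, fun f => ((hp f).eq_zero n (by simpa using hn) r).symm⟩
  | succ m ih =>
    intro n hn r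
    choose! T hT using ih
    let g : ℕ → W →L[ℝ] ℂ := fun j => ((r + D n * j : ℕ) : ℂ) ^ n • (A (r + D n * j) -
      ∑ i ∈ Icc n₀ (n - 1), ((r + D n * j : ℕ) : ℂ) ^ (-i) • T i (r + D n * j))
    have h : Tendsto (fun j f => g j f) atTop (nhds fun f => p f n r) := by
      refine tendsto_pi_nhds.2 fun f => ((hp f).tendsto_coeff n r).congr fun j => ?_
      simp only [g, smul_apply, sub_apply, smul_eq_mul, sum_apply]
      congr 2
      refine sum_congr rfl fun i hi => ?_
      rw [hT i (by have := Finset.mem_Icc.1 hi; push_cast at hn; omega)]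
    exact ⟨continuousLinearMapOfTendsto g h, fun f => rfl⟩

lemma sum_nthRoots {D : ℕ} (hD : 0 < D) (k r : ℕ) :
    ∑ ζ ∈ Polynomial.nthRootsFinset D (1 : ℂ), ζ ^ k * ζ⁻¹ ^ r =
      if k % D = r % D then (D : ℂ) else 0 := by
  have : NeZero D := ⟨hD.ne'⟩
  have hw := Complex.isPrimitiveRoot_exp D hD.ne'
  set w := exp (2 * π * I / D)
  have hw0 : w ≠ 0 := Complex.exp_ne_zero _
  have h1 : ∑ ζ ∈ Polynomial.nthRootsFinset D (1 : ℂ), ζ ^ k * ζ⁻¹ ^ r =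
      ∑ i ∈ range D, (w ^ k * w⁻¹ ^ r) ^ i := by
    symm
    refine Finset.sum_bij (fun i _ => w ^ i) (fun i _ => ?_) (fun i hi j hj h => ?_)
      (fun ζ hζ => ?_) (fun i _ => ?_)
    · rw [Polynomial.mem_nthRootsFinset hD, ← pow_mul, mul_comm, pow_mul, hw.pow_eq_one, one_pow]
    · exact hw.pow_inj (Finset.mem_range.1 hi) (Finset.mem_range.1 hj) h
    · obtain ⟨i, hi, h⟩ := hw.eq_pow_of_pow_eq_one ((Polynomial.mem_nthRootsFinset hD _).1 hζ)
      exact ⟨i, Finset.mem_range.2 hi, h⟩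
    · rw [mul_pow, ← pow_mul, ← pow_mul, ← pow_mul, inv_pow, inv_pow, ← pow_mul, mul_comm k,
        mul_comm r]
  rw [h1]
  have h2 : w ^ k * w⁻¹ ^ r = 1 ↔ k % D = r % D := by
    rw [inv_pow, mul_inv_eq_one₀ (pow_ne_zero _ hw0), pow_eq_pow_mod k hw.pow_eq_one,
      pow_eq_pow_mod r hw.pow_eq_one]
    exact ⟨hw.pow_inj (Nat.mod_lt _ hD) (Nat.mod_lt _ hD), fun h => by rw [h]⟩
  split_ifs with h
  · rw [h2.2 h]; simp
  · have h3 : (w ^ k * w⁻¹ ^ r) ^ D = 1 := by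
      rw [mul_pow, ← pow_mul, ← pow_mul, mul_comm k, mul_comm r, pow_mul, pow_mul, inv_pow,
        hw.pow_eq_one]
      simp
    have h4 := geom_sum_mul (w ^ k * w⁻¹ ^ r) D
    rw [h3, sub_self] at h4
    exact (mul_eq_zero.1 h4).resolve_right fun h5 => h (h2.1 (sub_eq_zero.1 h5))

lemma finsum_le_eq_sum_Icc {f : ℤ → ℂ} {n₀ : ℤ} (hf : ∀ n < n₀, f n = 0) (N : ℤ) :
    ∑ᶠ (n : ℤ) (_ : n ≤ N), f n = ∑ n ∈ Icc n₀ N, f n := by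
  refine finsum_mem_eq_sum_of_inter_support_eq (s := {n | n ≤ N}) f ?_
  ext n
  simp only [Set.mem_inter_iff, Set.mem_ofPred_eq, Function.mem_support, Finset.coe_Icc, Set.mem_Icc]
  refine and_congr_left fun h => ⟨fun h1 => ⟨not_lt.1 fun h2 => h (hf n h2), h1⟩, And.right⟩

end Coefficients

section Construction

lemma isPeriodicOn_of_add {K : Set (Dual E)} {τ : ℕ → Distr E} {D : ℕ} (hD : 0 < D)
    (h : ∀ k, ∀ φ : Test E, tsupport φ ⊆ K → τ (k + D) φ = τ k φ) : IsPeriodicOn K τ := by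
  have hD' : (D : ℂ) ≠ 0 := by exact_mod_cast hD.ne'
  refine ⟨D, hD, fun ζ => (D : ℂ)⁻¹ • ∑ r ∈ range D, ζ⁻¹ ^ r • τ r, fun k _ φ hφ => ?_⟩
  simp only [smul_apply, sum_apply, smul_eq_mul, mul_sum]
  rw [sum_comm]
  have h1 : ∀ r ∈ range D, ∑ ζ ∈ Polynomial.nthRootsFinset D (1 : ℂ),
      ζ ^ k * ((D : ℂ)⁻¹ * (ζ⁻¹ ^ r * τ r φ)) = if r = k % D then τ r φ else 0 := by
    intro r hr
    have : ∀ ζ : ℂ, ζ ^ k * ((D : ℂ)⁻¹ * (ζ⁻¹ ^ r * τ r φ)) =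
      ((D : ℂ)⁻¹ * τ r φ) * (ζ ^ k * ζ⁻¹ ^ r) := fun ζ => by ring
    simp only [this]
    rw [← mul_sum, sum_nthRoots hD, Nat.mod_eq_of_lt (Finset.mem_range.1 hr)]
    simp only [eq_comm (a := r)]
    split_ifs
    · field_simp
    · simp
  rw [sum_congr rfl h1, Finset.sum_ite_eq' (range D), if_pos (Finset.mem_range.2 (Nat.mod_lt _ hD))]
  conv_lhs => rw [← Nat.mod_add_div k D]
  exact periodic_mul (f := fun k => τ k φ) (fun k => h k φ hφ) _ _

/-- Pointwise asymptotic expansions, uniform on test functions supported in a given compact set, give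
an asymptotic expansion of distributions. -/
theorem exists_isAsymptoticExpansion {Θ : ℕ → Distr E} (hinv : ∀ k, 1 ≤ k → IsInvariant G (Θ k))
    (hΘ : ∀ K : Compacts (Dual E), ∃ n₀ D, ∀ φ : Test E, tsupport φ ⊆ K →
      ∃ p, HasExp n₀ D (fun k => Θ k φ) p) :
    ∃ AS, IsAsymptoticExpansion G Θ AS ∧ (∀ n k φ, AS n k φ = expCoeff (fun k => Θ k φ) n k) ∧
      ((∃ n₀ D, ∀ φ : Test E, ∃ p, HasExp n₀ D (fun k => Θ k φ) p) → IsGlobal AS) := by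
  have hco : ∀ (n₀ : ℤ) (D : ℤ → ℕ) (φ : Test E), (∃ p, HasExp n₀ D (fun k => Θ k φ) p) →
      HasExp n₀ D (fun k => Θ k φ) (expCoeff fun k => Θ k φ) := fun n₀ D φ ⟨p, hp⟩ =>
    hp.expCoeff_eq ▸ hp
  have hK : ∀ (n : ℤ) (k : ℕ) (K : Compacts (Dual E)) (hK : (K : Set (Dual E)) ⊆ (⊤ : Opens (Dual E))),
      ∃ T : 𝓓_{K}(Dual E, ℝ) →L[ℝ] ℂ, ∀ f,
        expCoeff (fun k => Θ k (ofSupportedIn hK f)) n k = T f := by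
    intro n k K hK
    obtain ⟨n₀, D, h⟩ := hΘ K
    obtain ⟨T, hT⟩ := exists_coeffCLM (n₀ := n₀) (D := D)
      (fun k => (Θ k).comp (TestFunction.ofSupportedInCLM ℝ hK))
      (p := fun f => expCoeff fun k => Θ k (ofSupportedIn hK f))
      (fun f => hco _ _ _ (h _ f.tsupport_subset)) n k
    exact ⟨T, fun f => (hT f).symm⟩
  choose T hT using hK
  let AS : ℤ → ℕ → Distr E := fun n k =>
    TestFunction.limitCLM ℝ (fun φ => expCoeff (fun k => Θ k φ) n k) (T n k) (hT n k)
  have hAS : ∀ n k φ, AS n k φ = expCoeff (fun k => Θ k φ) n k := fun n k φ => rfl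
  have hbelow : ∀ (K : Set (Dual E)) (n₀ : ℤ) (D : ℤ → ℕ), (∀ φ : Test E, tsupport φ ⊆ K →
      ∃ p, HasExp n₀ D (fun k => Θ k φ) p) → IsBoundedBelowOn K AS ∧ ∀ n, IsPeriodicOn K (AS n) := by
    intro K n₀ D h
    refine ⟨⟨n₀, fun n hn k _ φ hφ => (hco _ _ _ (h φ hφ)).eq_zero n hn k⟩, fun n => ?_⟩
    obtain ⟨p, hp⟩ := h 0 (by simp)
    exact isPeriodicOn_of_add (hp.pos n) fun k φ hφ => (hco _ _ _ (h φ hφ)).periodic n k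
  refine ⟨AS, ⟨hinv, fun n k hk g φ ψ hψ => ?_, fun K hK => ?_, fun K hK n => ?_, fun φ N => ?_⟩,
    hAS, fun ⟨n₀, D, h⟩ => hbelow Set.univ n₀ D fun φ _ => h φ⟩
  · obtain ⟨n₀, D, h⟩ := hΘ ⟨tsupport φ, φ.hasCompactSupport⟩
    obtain ⟨p, hp⟩ := h φ subset_rfl
    rw [hAS, hAS, hp.expCoeff_eq, (hp.congr (b := fun k => Θ k ψ) ?_).expCoeff_eq]
    filter_upwards [eventually_ge_atTop 1] with k hk
    exact (hinv k hk g φ ψ hψ).symm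
  · obtain ⟨n₀, D, h⟩ := hΘ ⟨K, hK⟩
    exact (hbelow K n₀ D h).1
  · obtain ⟨n₀, D, h⟩ := hΘ ⟨K, hK⟩
    exact (hbelow K n₀ D h).2 n
  · obtain ⟨n₀, D, h⟩ := hΘ ⟨tsupport φ, φ.hasCompactSupport⟩
    have hp := hco _ _ _ (h φ subset_rfl)
    refine (hp.isLittleO N).congr_left fun k => ?_
    rw [finsum_le_eq_sum_Icc (n₀ := n₀) fun n hn => by rw [hAS, hp.eq_zero n hn, mul_zero]]
    rfl

end Construction

section ComplexMeasures

variable {X : Type*} [MeasurableSpace X]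

lemma integral_eq_sum_of_forall {ι : Type*} [Fintype ι] {B : ComplexMeasure X} {μ : ι → Measure X}
    [∀ i, IsFiniteMeasure (μ i)] {ε : ι → ℂ} (hε : ∀ i, ‖ε i‖ ≤ 1)
    (hB : ∀ S, MeasurableSet S → B S = ∑ i, ε i * (μ i).real S) {f : X → ℝ}
    (hf : ∀ i, Integrable f (μ i)) :
    B.integral f (lsmul ℝ ℝ) = ∑ i, ε i * ((∫ x, f x ∂μ i : ℝ) : ℂ) := by
  have hvar : B.variation ≤ ∑ i, μ i := by
    refine VectorMeasure.variation_le_of_forall_enorm_le fun S hS => ?_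
    rw [hB S hS, Measure.finsetSum_apply]
    refine (enorm_sum_le _ _).trans (sum_le_sum fun i _ => ?_)
    rw [enorm_mul, ← ofReal_norm, ← ofReal_norm, norm_real,
      Real.norm_of_nonneg measureReal_nonneg, measureReal_def, ENNReal.ofReal_toReal (by finiteness)]
    exact mul_le_of_le_one_left' (ENNReal.ofReal_le_one.2 (hε i))
  have hle : ∀ i, μ i ≤ ∑ i, μ i := fun i => Measure.le_iff.2 fun S hS => by
    rw [Measure.finsetSum_apply]
    exact single_le_sum (f := fun i => μ i S) (fun _ _ => zero_le) (mem_univ i)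
  have hint : ∀ {f : X → ℝ}, Integrable f (∑ i, μ i) → B.Integrable f := fun h => h.mono_measure hvar
  have hi : ∀ {f : X → ℝ}, Integrable f (∑ i, μ i) → ∀ i, Integrable f (μ i) := fun h i =>
    (integrable_finsetSum_measure.1 h) i (mem_univ i)
  let P : (X → ℝ) → Prop := fun f => B.integral f (lsmul ℝ ℝ) =
    ∑ i, ε i * ((∫ x, f x ∂μ i : ℝ) : ℂ)
  suffices H : ∀ f, Integrable f (∑ i, μ i) → P f from
    H f (integrable_finsetSum_measure.2 fun i _ => hf i)
  refine Integrable.induction P ?_ ?_ ?_ ?_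
  · intro c S hS hfin
    change B.integral _ _ = _
    rw [VectorMeasure.integral_eq_setToFun, setToFun_indicator_const _ hS
      (((hvar S).trans_lt hfin).ne)]
    change c • B S = _
    simp only [integral_indicator_const _ hS, hB S hS, smul_sum]
    refine sum_congr rfl fun i _ => ?_
    rw [real_smul, smul_eq_mul]
    push_cast
    ring
  · intro f g _ hf hg h1 h2
    change B.integral (fun x => (f + g) x) _ = _
    rw [VectorMeasure.integral_add (hint hf) (hint hg), h1, h2, ← sum_add_distrib]
    refine sum_congr rfl fun i _ => ?_
    rw [integral_add' (hi hf i) (hi hg i)]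
    push_cast
    ring
  · have hE : ∀ {ρ : Measure X}, ρ ≤ ∑ i, μ i → ∀ f : X →₁[∑ i, μ i] ℝ,
        Tendsto (fun g : X →₁[∑ i, μ i] ℝ => ∫⁻ x, ‖g x - f x‖ₑ ∂ρ) (nhds f) (nhds 0) := by
      intro ρ hρ f
      refine tendsto_of_tendsto_of_tendsto_of_le_of_le tendsto_const_nhds
        (tendsto_iff_edist_tendsto_0.1 (tendsto_id (x := nhds f))) (fun _ => zero_le) fun g => ?_
      simp only [id, Lp.edist_def, eLpNorm_one_eq_lintegral_enorm]
      exact lintegral_mono' hρ le_rfl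
    refine isClosed_eq (continuous_iff_continuousAt.2 fun f => ?_) ?_
    · exact VectorMeasure.tendsto_integral_of_L1 _ (hint (L1.integrable_coeFn f)).1
        (of_forall fun g => hint (L1.integrable_coeFn g)) (hE hvar f)
    · refine continuous_finsetSum _ fun i _ => continuous_const.mul (Complex.continuous_ofReal.comp
        (continuous_iff_continuousAt.2 fun f => ?_))
      exact tendsto_integral_of_L1 _ (hi (L1.integrable_coeFn f) i).1
        (of_forall fun g => hi (L1.integrable_coeFn g) i) (hE (hle i) f)
  · intro f g hfg hf h
    change B.integral _ _ = _
    rw [← VectorMeasure.integral_congr_ae (hfg.filter_mono (ae_mono hvar)), show B.integral f _ = _ from h]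
    refine sum_congr rfl fun i _ => ?_
    rw [integral_congr_ae (hfg.filter_mono (ae_mono (hle i)))]

end ComplexMeasures

section Support

/-- A compactly supported complex measure is a combination of finite measures on a compact space. -/
lemma exists_compact_decomposition {B : ComplexMeasure (Dual E)} (hB : HasCompactSupportMeasure B) :
    ∃ (K : Set (Dual E)) (_ : IsCompact K) (ν : Fin 4 → Measure K) (ε : Fin 4 → ℂ),
      (∀ i, IsFiniteMeasure (ν i)) ∧ ∀ f : Dual E → ℝ, Continuous f →
        B.integral f (lsmul ℝ ℝ) = ∑ i, ε i * ((∫ z, f z ∂ν i : ℝ) : ℂ) := by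
  obtain ⟨K, hK, h0⟩ := hB
  let JR := (ComplexMeasure.re B).toJordanDecomposition
  let JI := (ComplexMeasure.im B).toJordanDecomposition
  let μ : Fin 4 → Measure (Dual E) := ![JR.posPart, JR.negPart, JI.posPart, JI.negPart]
  let ε : Fin 4 → ℂ := ![1, -1, I, -I]
  have hμ : ∀ i, IsFiniteMeasure (μ i) := by
    intro i
    fin_cases i
    exacts [JR.posPart_finite, JR.negPart_finite, JI.posPart_finite, JI.negPart_finite]
  have hε : ∀ i, ‖ε i‖ ≤ 1 := by intro i; fin_cases i <;> simp [ε]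
  have h1 : ∀ S, MeasurableSet S → B S = ∑ i, ε i * ((μ i).restrict K).real S := by
    intro S hS
    have h2 : B S = B (S ∩ K) := by
      rw [← VectorMeasure.of_add_of_sdiff (hS.inter hK.measurableSet) hS Set.inter_subset_left,
        h0 (S \ (S ∩ K)) (hS.diff (hS.inter hK.measurableSet)) ?_, add_zero]
      rw [Set.sdiff_self_inter]
      exact Set.disjoint_sdiff_left
    have h3 : MeasurableSet (S ∩ K) := hS.inter hK.measurableSet
    have hR := SignedMeasure.apply_eq_posPart_real_sub_negPart_real (ComplexMeasure.re B) h3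
    have hI := SignedMeasure.apply_eq_posPart_real_sub_negPart_real (ComplexMeasure.im B) h3
    have hr : (B (S ∩ K)).re = ComplexMeasure.re B (S ∩ K) := rfl
    have hi : (B (S ∩ K)).im = ComplexMeasure.im B (S ∩ K) := rfl
    rw [h2, ← Complex.re_add_im (B (S ∩ K)), hr, hi, hR, hI]
    simp only [Fin.sum_univ_four, measureReal_restrict_apply hS]
    simp [ε, μ, JR, JI]
    ring
  refine ⟨K, hK, fun i => (μ i).comap (↑), ε, ?_, fun f hf => ?_⟩
  · exact fun i => ⟨by
      rw [(MeasurableEmbedding.subtype_coe hK.measurableSet).comap_apply]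
      exact measure_lt_top _ _⟩
  · have hi : ∀ i, Integrable f ((μ i).restrict K) := fun i =>
      hf.continuousOn.integrableOn_compact hK
    rw [integral_eq_sum_of_forall hε h1 hi]
    refine sum_congr rfl fun i _ => ?_
    rw [integral_subtype_comap hK.measurableSet]

end Support

section

/-- Iterated line derivatives of test functions, `m 0` being the first direction to be used. -/
def revDeriv : {l : ℕ} → (Fin l → Dual E) → Test E →L[ℝ] Test E
  | 0, _ => .id ℝ _
  | _ + 1, m => (revDeriv (tail m)).comp (TestFunction.lineDerivCLM ℝ (m 0))

lemma iteratedLineDerivOp_distr_apply {l : ℕ} (m : Fin l → Dual E) (A : Distr E) (φ : Test E) :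
    (∂^{m} A) φ = (-1) ^ l * A (revDeriv m φ) := by
  induction l generalizing φ with
  | zero => simp [revDeriv]
  | succ l ih =>
    rw [LineDeriv.iteratedLineDerivOp_succ_left, Distribution.lineDerivOp_apply_apply, map_neg, ih,
      pow_succ, TestFunction.lineDerivOp_eq_lineDerivCLM ℝ]
    simp [revDeriv]

lemma test_lineDeriv_apply (v : Dual E) (φ : Test E) (ξ : Dual E) :
    (∂_{v} φ) ξ = fderiv ℝ φ ξ v := by
  rw [TestFunction.lineDerivOp_eq_lineDerivCLM ℝ, TestFunction.lineDerivCLM_eq_fderivCLM,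
    TestFunction.fderivCLM_apply_of_le _ (by simp)]

lemma tsupport_revDeriv_subset {l : ℕ} (m : Fin l → Dual E) (φ : Test E) :
    tsupport (revDeriv m φ) ⊆ tsupport φ := by
  induction l generalizing φ with
  | zero => simp [revDeriv]
  | succ l ih =>
    refine (ih (tail m) (∂_{m 0} φ)).trans (closure_minimal (fun ξ hξ => ?_) isClosed_closure)
    refine tsupport_fderiv_subset ℝ (subset_closure fun h => hξ ?_)
    rw [test_lineDeriv_apply, h, zero_apply]

lemma dual_eq_sum (v : Dual E) : v = ∑ b, v (basis E b) • dualVec E b := by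
  refine ContinuousLinearMap.coe_injective ((basis E).ext fun i => ?_)
  simp [dualVec, Finsupp.single_apply]

lemma iterate_lineDeriv_eq_sum (v : Dual E) (l : ℕ) (φ : Test E) :
    ∂_{v}^[l] φ = ∑ a : Fin l → Fin (finrank ℝ E),
      (∏ i, v (basis E (a i))) • revDeriv (fun i => dualVec E (a i)) φ := by
  induction l generalizing φ with
  | zero => simp [revDeriv]
  | succ l ih =>
    have h1 : ∂_{v} φ = ∑ b, v (basis E b) • ∂_{dualVec E b} φ := by
      conv_lhs => rw [dual_eq_sum v]
      simp only [LineDeriv.lineDerivOp_left_sum, LineDeriv.lineDerivOp_left_smul]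
    rw [Function.iterate_succ_apply, ih, h1, ← (Fin.consEquiv _).sum_comp, Fintype.sum_prod_type_right]
    refine sum_congr rfl fun a _ => ?_
    rw [map_sum, smul_sum]
    refine sum_congr rfl fun b _ => ?_
    rw [map_smul, smul_smul, Fin.prod_univ_succ, mul_comm]
    rfl

lemma hasDerivAt_test (φ : Test E) (ξ v : Dual E) (s : ℝ) :
    HasDerivAt (fun s : ℝ => φ (ξ + s • v)) ((∂_{v} φ) (ξ + s • v)) s := by
  rw [test_lineDeriv_apply]
  have h1 : HasDerivAt (fun s : ℝ => ξ + s • v) v s := by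
    simpa using ((hasDerivAt_id s).smul_const v).const_add ξ
  exact ((φ.contDiff.differentiable (by simp)).differentiableAt.hasFDerivAt).comp_hasDerivAt s h1

lemma test_taylor (φ : Test E) (ξ v : Dual E) (L : ℕ) :
    φ (ξ + v) = ∑ l ∈ range (L + 1), (l.factorial : ℝ)⁻¹ * (∂_{v}^[l] φ) ξ +
      ∫ s in (0 : ℝ)..1, ((1 - s) ^ L / L.factorial) * (∂_{v}^[L + 1] φ) (ξ + s • v) := by
  have h1 : ContDiff ℝ ∞ fun s : ℝ => φ (ξ + s • v) := φ.contDiff.comp (by fun_prop)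
  have h2 : ∀ l, ∀ s ∈ Set.uIcc (0 : ℝ) 1,
      iteratedDerivWithin l (fun s : ℝ => φ (ξ + s • v)) (Set.uIcc 0 1) s = (∂_{v}^[l] φ) (ξ + s • v) := by
    intro l
    induction l with
    | zero => simp
    | succ l ih =>
      intro s hs
      rw [iteratedDerivWithin_succ, derivWithin_congr ih (ih s hs), Function.iterate_succ_apply']
      exact (hasDerivAt_test _ ξ v s).hasDerivWithinAt.derivWithin
        (uniqueDiffOn_uIcc zero_ne_one s hs)
  have h3 := taylor_integral_remainder (x₀ := 0) (x := 1) (n := L)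
    (h1.of_le (by exact_mod_cast le_top)).contDiffOn
  rw [sub_eq_iff_eq_add', one_smul, taylor_within_apply] at h3
  rw [h3]
  congr 1
  · refine sum_congr rfl fun l _ => ?_
    rw [h2 l 0 Set.left_mem_uIcc]
    simp
  · refine intervalIntegral.integral_congr fun s hs => ?_
    simp only [h2 (L + 1) s hs, smul_eq_mul]

variable {Z : Type*} [TopologicalSpace Z] [CompactSpace Z] [MeasurableSpace Z]
  [OpensMeasurableSpace Z] (ν : Measure Z) [IsFiniteMeasure ν]

/-- The averages of translates of a test function form a bounded family of test functions. -/
lemma exists_translate_average {τ : Z → Dual E} (hτ : Continuous τ) {w : Z → ℝ} (hw : Continuous w)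
    (f : Test E) {K : Compacts (Dual E)}
    (hK : ∀ p ∈ tsupport f, ∀ t ∈ Set.Icc (0 : ℝ) 1, ∀ z, p - t • τ z ∈ K) :
    ∃ F : Set.Icc (0 : ℝ) 1 → 𝓓_{K}(Dual E, ℝ),
      (∀ t ξ, F t ξ = ∫ z, w z * f (ξ + (t : ℝ) • τ z) ∂ν) ∧
      ∀ i, ∃ C, 0 ≤ C ∧ ∀ t, ContDiffMapSupportedIn.seminorm ℝ (Dual E) ℝ ⊤ K i (F t) ≤ C := by
  let Φ : ℝ × Dual E → ℝ := fun y => ∫ z, w z * f (y.2 + y.1 • τ z) ∂ν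
  have hΦ : ContDiff ℝ ∞ Φ := by
    obtain ⟨Cτ, hCτ⟩ := (isCompact_univ (X := Z)).exists_bound_of_continuousOn hτ.continuousOn
    obtain ⟨Cw, hCw⟩ := (isCompact_univ (X := Z)).exists_bound_of_continuousOn hw.continuousOn
    let M : Z → (ℝ × Dual E →L[ℝ] Dual E) := fun z => ContinuousLinearMap.snd ℝ ℝ (Dual E) +
      (ContinuousLinearMap.fst ℝ ℝ (Dual E)).smulRight (τ z)
    have hM : Continuous M := by
      refine continuous_clm_apply.2 fun y => ?_
      change Continuous fun z => y.2 + y.1 • τ z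
      fun_prop
    obtain ⟨CM, hCM⟩ := (isCompact_univ (X := Z)).exists_bound_of_continuousOn
      (E := ℝ × Dual E →L[ℝ] Dual E) (f := M) hM.continuousOn
    have h1 := contDiff_integral_comp_affine (μ := ν) hM (fun z => hCM z trivial) continuous_const
      (τ := fun _ => (0 : Dual E)) hw (fun z => hCw z trivial)
      (φ := fun ξ => (f ξ : ℂ)) (Complex.ofRealCLM.contDiff.comp f.contDiff)
      (f.hasCompactSupport.comp_left ofReal_zero)
    have h2 : Φ = reCLM ∘ fun y => ∫ z, w z • ((f (M z y + 0) : ℝ) : ℂ) ∂ν := by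
      ext y
      simp only [Function.comp, Complex.reCLM_apply, real_smul, ← ofReal_mul, Φ]
      rw [integral_complex_ofReal, Complex.ofReal_re]
      simp [M]
    rw [h2]
    exact Complex.reCLM.contDiff.comp h1
  have hsmooth : ∀ t : ℝ, ContDiff ℝ ∞ fun ξ => Φ (t, ξ) := fun t => hΦ.comp (by fun_prop)
  have h0 : ∀ t : Set.Icc (0 : ℝ) 1, Set.EqOn (fun ξ => Φ (t, ξ)) 0 (K : Set (Dual E))ᶜ := by
    intro t ξ hξ
    refine integral_eq_zero_of_ae (of_forall fun z => ?_)
    by_contra h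
    have h1 := hK (ξ + (t : ℝ) • τ z) (subset_closure fun h' => h (by simp [h'])) t t.2 z
    rw [add_sub_cancel_right] at h1
    exact hξ h1
  refine ⟨fun t => ⟨_, hsmooth t, h0 t⟩, fun t ξ => rfl, fun i => ?_⟩
  have hcont : Continuous (iteratedFDeriv ℝ i Φ) := hΦ.continuous_iteratedFDeriv (by exact_mod_cast le_top)
  obtain ⟨C, hC⟩ := (isCompact_Icc (a := (0 : ℝ)) (b := 1)).prod K.isCompact
    |>.exists_bound_of_continuousOn (E := ℝ × Dual E [×i]→L[ℝ] ℝ)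
      (f := iteratedFDeriv ℝ i Φ) hcont.continuousOn
  let inr := inr ℝ ℝ (Dual E)
  refine ⟨max C 0 * ‖inr‖ ^ i, by positivity, fun t => ?_⟩
  rw [ContDiffMapSupportedIn.seminorm_top_le_iff ℝ (by positivity)]
  intro ξ hξ
  change ‖iteratedFDeriv ℝ i (fun ξ => Φ (t, ξ)) ξ‖ ≤ _
  have h2 : (fun ξ => Φ (t, ξ)) = (fun y => Φ (((t : ℝ), (0 : Dual E)) + y)) ∘ inr := by
    ext ξ; simp [inr]
  have h3 : ContDiff ℝ ∞ fun y => Φ (((t : ℝ), (0 : Dual E)) + y) := hΦ.comp (by fun_prop)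
  rw [h2, inr.iteratedFDeriv_comp_right h3 ξ (by exact_mod_cast le_top),
    iteratedFDeriv_comp_add_left]
  refine (ContinuousMultilinearMap.norm_compContinuousLinearMap_le _ _).trans ?_
  rw [Finset.prod_const, Finset.card_univ, Fintype.card_fin]
  gcongr
  refine (hC _ ⟨?_, ?_⟩).trans (le_max_left _ _)
  · simp [inr]
  · simpa [inr] using hξ

end

section

variable {K : Set (Dual E)} (ν : Measure K) [IsFiniteMeasure ν]

/-- The moments of a measure on `K`, with respect to the coordinates given by the basis. -/
def moment {l : ℕ} (a : Fin l → Fin (finrank ℝ E)) : ℝ :=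
  ∫ z : K, ∏ i, (z : Dual E) (basis E (a i)) ∂ν

/-- The compact set that contains the supports of the translates by `-t z`, `0 ≤ t ≤ 1`, `z ∈ K`, of
functions supported in `K₀`. -/
def translateHull (K₀ : Compacts (Dual E)) (hK : IsCompact K) : Compacts (Dual E) :=
  ⟨(fun x : Dual E × ℝ × Dual E => x.1 - x.2.1 • x.2.2) '' ((K₀ : Set (Dual E)) ×ˢ Set.Icc 0 1 ×ˢ K),
    (K₀.isCompact.prod (isCompact_Icc.prod hK)).image (by fun_prop)⟩

variable {ν} in
lemma integral_test_taylor (hK : IsCompact K) (φ : Test E) (L : ℕ) (t : ℝ) (ξ : Dual E) :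
    ∫ z : K, φ (ξ + t • (z : Dual E)) ∂ν = ∑ l ∈ range (L + 1), t ^ l *
        ∑ a : Fin l → Fin (finrank ℝ E), ((l.factorial : ℝ)⁻¹ * moment ν a) *
          revDeriv (fun i => dualVec E (a i)) φ ξ +
      t ^ (L + 1) * ∑ a : Fin (L + 1) → Fin (finrank ℝ E), ∫ x : K × unitInterval,
        ((∏ i, (x.1 : Dual E) (basis E (a i))) * ((1 - (x.2 : ℝ)) ^ L / L.factorial)) *
          revDeriv (fun i => dualVec E (a i)) φ (ξ + t • (x.2 : ℝ) • (x.1 : Dual E)) ∂ν.prod volume := by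
  have : CompactSpace K := isCompact_iff_compactSpace.1 hK
  have hint : ∀ {f : K → ℝ}, Continuous f → Integrable f ν := fun h =>
    h.integrable_of_hasCompactSupport (HasCompactSupport.of_compactSpace _)
  have hint2 : ∀ {f : K × unitInterval → ℝ}, Continuous f → Integrable f (ν.prod volume) := fun h =>
    h.integrable_of_hasCompactSupport (HasCompactSupport.of_compactSpace _)
  have hφc : ∀ {l : ℕ} (a : Fin l → Fin (finrank ℝ E)),
    Continuous (revDeriv (fun i => dualVec E (a i)) φ) := fun a => TestFunction.contDiff _ |>.continuous
  have hev : ∀ X : E, Continuous fun z : K => (z : Dual E) X := fun X =>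
    (ContinuousLinearMap.apply ℝ ℝ X).continuous.comp continuous_subtype_val
  have hprod : ∀ {l : ℕ} (a : Fin l → Fin (finrank ℝ E)),
      Continuous fun z : K => ∏ i, (z : Dual E) (basis E (a i)) := fun a =>
    continuous_finsetProd _ fun i _ => hev _
  have h1 : ∀ z : K, φ (ξ + t • (z : Dual E)) = ∑ l ∈ range (L + 1), t ^ l *
        ∑ a : Fin l → Fin (finrank ℝ E), ((l.factorial : ℝ)⁻¹ *
          ∏ i, (z : Dual E) (basis E (a i))) * revDeriv (fun i => dualVec E (a i)) φ ξ +
      t ^ (L + 1) * ∑ a : Fin (L + 1) → Fin (finrank ℝ E), ∫ s : unitInterval,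
        ((∏ i, (z : Dual E) (basis E (a i))) * ((1 - (s : ℝ)) ^ L / L.factorial)) *
          revDeriv (fun i => dualVec E (a i)) φ (ξ + t • (s : ℝ) • (z : Dual E)) := by
    intro z
    have hexp : ∀ l η, (∂_{t • (z : Dual E)}^[l] φ) η = t ^ l *
        ∑ a : Fin l → Fin (finrank ℝ E), (∏ i, (z : Dual E) (basis E (a i))) *
          revDeriv (fun i => dualVec E (a i)) φ η := by
      intro l η
      rw [iterate_lineDeriv_eq_sum, mul_sum, sum_apply]
      refine sum_congr rfl fun a _ => ?_
      simp only [smul_apply, smul_eq_mul, Finset.prod_mul_distrib, Finset.prod_const,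
        Finset.card_univ, Fintype.card_fin, mul_assoc]
    rw [test_taylor φ ξ _ L]
    congr 1
    · refine sum_congr rfl fun l _ => ?_
      rw [hexp, mul_left_comm, mul_sum]
      simp only [mul_assoc]
    · have h2 : ∀ f : ℝ → ℝ, ∫ s : unitInterval, f s = ∫ s in (0 : ℝ)..1, f s := fun f => by
        rw [intervalIntegral.integral_of_le zero_le_one, ← integral_Icc_eq_integral_Ioc,
          ← integral_subtype_comap measurableSet_Icc]
        rfl
      rw [← integral_finsetSum _ fun a _ => ?_, ← integral_const_mul, ← h2]
      · refine integral_congr_ae (of_forall fun s => ?_)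
        simp only [hexp, mul_sum, smul_comm t]
        exact sum_congr rfl fun a _ => by ring
      · refine Continuous.integrable_of_hasCompactSupport ?_ (HasCompactSupport.of_compactSpace _)
        have := hφc a
        fun_prop
  have h3 : ∀ a : Fin (L + 1) → Fin (finrank ℝ E), Integrable (fun x : K × unitInterval =>
        ((∏ i, (x.1 : Dual E) (basis E (a i))) * ((1 - (x.2 : ℝ)) ^ L / L.factorial)) *
          revDeriv (fun i => dualVec E (a i)) φ (ξ + t • (x.2 : ℝ) • (x.1 : Dual E)))
        (ν.prod volume) := fun a => by
    refine hint2 ?_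
    have := hφc a
    fun_prop
  rw [integral_congr_ae (of_forall h1), integral_add, integral_finsetSum]
  · congr 1
    · refine sum_congr rfl fun l _ => ?_
      rw [integral_const_mul, integral_finsetSum _ fun a _ => ?_]
      · simp only [integral_mul_const, integral_const_mul, moment]
      · exact hint (by fun_prop)
    · rw [integral_const_mul, integral_finsetSum _ fun a _ => (h3 a).integral_prod_left]
      congr 1
      exact sum_congr rfl fun a _ => (integral_prod _ (h3 a)).symm
  · exact fun l _ => hint (by fun_prop)
  · exact hint (by fun_prop)
  · exact (integrable_finsetSum _ fun a _ => (h3 a).integral_prod_left).const_mul _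

lemma exists_translateAverage (hK : IsCompact K) (K₀ : Compacts (Dual E)) (φ : Test E)
    (hφ : tsupport φ ⊆ K₀) (t : Set.Icc (0 : ℝ) 1) :
    ∃ ψ : Test E, (∀ ξ, ψ ξ = ∫ z : K, φ (ξ + (t : ℝ) • (z : Dual E)) ∂ν) ∧
      tsupport ψ ⊆ translateHull K₀ hK := by
  have : CompactSpace K := isCompact_iff_compactSpace.1 hK
  obtain ⟨F, hF, -⟩ := exists_translate_average ν (τ := fun z : K => (z : Dual E))
    continuous_subtype_val (w := fun _ => 1) continuous_const φ (K := translateHull K₀ hK)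
    (fun p hp t ht z => ⟨(p, t, z), ⟨hφ hp, ht, z.2⟩, rfl⟩)
  exact ⟨ofSupportedIn (fun _ _ => trivial) (F t), fun ξ => (hF t ξ).trans (by simp),
    (F t).tsupport_subset⟩

/-- The Taylor expansion of the averages of the translates by `t z`, with a remainder that is bounded
in the space of test functions. -/
lemma exists_remainder (hK : IsCompact K) {K₀ : Compacts (Dual E)} {φ : Test E}
    (hφ : tsupport φ ⊆ K₀) (L : ℕ) :
    ∃ R : Set.Icc (0 : ℝ) 1 → 𝓓_{translateHull K₀ hK}(Dual E, ℝ),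
      (∀ i, ∃ C, 0 ≤ C ∧ ∀ t, ContDiffMapSupportedIn.seminorm ℝ (Dual E) ℝ ⊤ _ i (R t) ≤ C) ∧
      ∀ (t : Set.Icc (0 : ℝ) 1) (ψ : Test E), (∀ ξ, ψ ξ = ∫ z : K, φ (ξ + (t : ℝ) • (z : Dual E)) ∂ν) →
        ψ = ∑ l ∈ range (L + 1), (t : ℝ) ^ l •
            ∑ a : Fin l → Fin (finrank ℝ E), ((l.factorial : ℝ)⁻¹ * moment ν a) •
              revDeriv (fun i => dualVec E (a i)) φ +
          (t : ℝ) ^ (L + 1) • ofSupportedIn (Ω := ⊤) (fun _ _ => trivial) (R t) := by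
  have : CompactSpace K := isCompact_iff_compactSpace.1 hK
  have key : ∀ a : Fin (L + 1) → Fin (finrank ℝ E), _ := fun a =>
    exists_translate_average (ν.prod (volume : Measure unitInterval))
    (τ := fun x : K × unitInterval => (x.2 : ℝ) • (x.1 : Dual E)) (by fun_prop)
    (w := fun x => (∏ i, (x.1 : Dual E) (basis E (a i))) * ((1 - (x.2 : ℝ)) ^ L / L.factorial))
    (by fun_prop) (revDeriv (fun i => dualVec E (a i)) φ) (K := translateHull K₀ hK) (by
      intro p hp t ht x
      refine ⟨(p, t * x.2, x.1), ⟨hφ (tsupport_revDeriv_subset _ _ hp),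
        ⟨mul_nonneg ht.1 x.2.2.1, mul_le_one₀ ht.2 x.2.2.1 x.2.2.2⟩, x.1.2⟩, ?_⟩
      simp [mul_smul])
  choose F hF hb using key
  refine ⟨fun t => ∑ a, F a t, fun i => ?_, fun t ψ hψ => ?_⟩
  · choose C hC0 hC using fun a => hb a i
    refine ⟨∑ a, C a, sum_nonneg fun a _ => hC0 a, fun t => ?_⟩
    refine (Finset.le_sum_of_subadditive _ (map_zero _).le (map_add_le_add _) _ _).trans (sum_le_sum fun a _ => hC a t)
  · ext ξ
    rw [hψ, integral_test_taylor hK φ L]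
    simp only [add_apply, sum_apply, smul_apply, smul_eq_mul]
    congr 2
    change _ = (∑ a, F a t : 𝓓_{translateHull K₀ hK}(Dual E, ℝ)) ξ
    rw [sum_apply]
    exact sum_congr rfl fun a _ => (hF a t ξ).symm

end

section

lemma HasExp.sum {n₀ : ℤ} {D : ℤ → ℕ} (hD : ∀ n, 0 < D n) {ι : Type*} (s : Finset ι)
    {a : ι → ℕ → ℂ} {p : ι → ℤ → ℕ → ℂ} (h : ∀ i ∈ s, HasExp n₀ D (a i) (p i)) :
    HasExp n₀ D (fun k => ∑ i ∈ s, a i k) (fun n k => ∑ i ∈ s, p i n k) := by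
  classical
  induction s using Finset.induction_on with
  | empty => simpa using HasExp.zero hD
  | insert i s hi ih =>
    simp only [Finset.sum_insert hi]
    exact (h i (Finset.mem_insert_self _ _)).add (ih fun j hj => h j (Finset.mem_insert_of_mem hj))

variable {Θ : ℕ → Distr E} {AS : ℤ → ℕ → Distr E}

lemma IsPeriodicOn.exists_period {K : Set (Dual E)} {τ : ℕ → Distr E} (h : IsPeriodicOn K τ) :
    ∃ D : ℕ, 0 < D ∧ ∀ k, 1 ≤ k → ∀ φ : Test E, tsupport φ ⊆ K → τ (k + D) φ = τ k φ := by
  obtain ⟨D, hD, σ, hσ⟩ := h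
  refine ⟨D, hD, fun k hk φ hφ => ?_⟩
  rw [hσ _ (by omega) φ hφ, hσ _ hk φ hφ]
  refine sum_congr rfl fun ζ hζ => ?_
  rw [pow_add, (Polynomial.mem_nthRootsFinset hD _).1 hζ, mul_one]

lemma IsAsymptoticExpansion.exists_hasExp (h : IsAsymptoticExpansion G Θ AS) {K : Set (Dual E)}
    (hb : IsBoundedBelowOn K AS) (hp : ∀ n, IsPeriodicOn K (AS n)) :
    ∃ (n₀ : ℤ) (D : ℤ → ℕ), (∀ n, 0 < D n) ∧ ∀ φ : Test E, tsupport φ ⊆ K →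
      HasExp n₀ D (fun k => Θ k φ) (fun n k => AS n (k + D n) φ) ∧
      ∀ n k, 1 ≤ k → AS n (k + D n) φ = AS n k φ := by
  obtain ⟨n₀, hn₀⟩ := hb
  choose D hD hper using fun n => (hp n).exists_period
  refine ⟨n₀, D, hD, fun φ hφ => ⟨⟨hD, fun n k => ?_, fun n hn k => ?_, fun N => ?_⟩,
    fun n k hk => hper n k hk φ hφ⟩⟩
  · exact hper n _ (by have := hD n; omega) φ hφ
  · exact hn₀ n hn _ (by have := hD n; omega) φ hφ
  · refine (h.expansion φ N).congr' ?_ EventuallyEq.rfl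
    filter_upwards [eventually_ge_atTop 1] with k hk
    rw [finsum_le_eq_sum_Icc (n₀ := n₀) fun n hn => by rw [hn₀ n hn k hk φ hφ, mul_zero]]
    congr 1
    exact sum_congr rfl fun n _ => by rw [hper n k hk φ hφ]

/-- The distributions `Θ k` are bounded by a power of `k` on bounded sets of test functions. -/
lemma IsAsymptoticExpansion.exists_growth (h : IsAsymptoticExpansion G Θ AS)
    (K : Compacts (Dual E)) : ∃ M : ℤ, ∀ {ι : Type} (R : ι → 𝓓_{K}(Dual E, ℝ)),
      (∀ i, ∃ C, 0 ≤ C ∧ ∀ t, ContDiffMapSupportedIn.seminorm ℝ (Dual E) ℝ ⊤ K i (R t) ≤ C) →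
      ∃ C, ∀ k : ℕ, 1 ≤ k → ∀ t,
        ‖Θ k (ofSupportedIn (fun _ _ => trivial) (R t))‖ ≤ C * (k : ℝ) ^ M := by
  obtain ⟨n₀, hn₀⟩ := h.boundedBelow K K.isCompact
  have hsub : (K : Set (Dual E)) ⊆ (⊤ : Opens (Dual E)) := fun _ _ => trivial
  refine ⟨-(n₀ - 1), fun {ι} R hR => ?_⟩
  obtain ⟨s, C, hC, hA⟩ := exists_uniform_bound (fun k : ℕ => (k : ℂ) ^ (n₀ - 1) •
    (Θ k).comp (TestFunction.ofSupportedInCLM ℝ hsub)) fun f => by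
      have h1 := h.expansion (ofSupportedIn hsub f) (n₀ - 1)
      have h2 : Tendsto (fun k : ℕ => (k : ℂ) ^ (n₀ - 1) * Θ k (ofSupportedIn hsub f))
          atTop (nhds 0) := by
        refine (isLittleO_one_iff ℝ).1 ?_
        have h3 : (fun k : ℕ => (k : ℂ) ^ (n₀ - 1)) =O[atTop] fun k : ℕ => (k : ℝ) ^ (n₀ - 1) := by
          simpa using isBigO_zpow_mul (n := n₀ - 1) (f := fun _ => 1) (C := 1) (by simp)
        refine (h3.mul_isLittleO h1).congr' ?_ ?_
        · filter_upwards [eventually_ge_atTop 1] with k hk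
          rw [finsum_le_eq_sum_Icc (n₀ := n₀) fun n hn => by
            rw [hn₀ n hn k hk _ f.tsupport_subset, mul_zero], Finset.Icc_eq_empty (by omega)]
          simp
        · filter_upwards [eventually_gt_atTop 0] with k hk
          rw [← zpow_add₀ (by positivity), add_neg_cancel, zpow_zero]
      obtain ⟨B, hB⟩ := h2.norm.bddAbove_range
      exact ⟨B, fun k => hB ⟨k, rfl⟩⟩
  choose C' hC0 hC' using hR
  refine ⟨C * ∑ i ∈ s, C' i, fun k hk t => ?_⟩
  have hk' : (0 : ℝ) < k := by exact_mod_cast hk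
  have h1 := hA k (R t)
  have h2 : (s.sup fun j => ContDiffMapSupportedIn.seminorm ℝ (Dual E) ℝ ⊤ K j) (R t) ≤
      ∑ i ∈ s, C' i := Seminorm.finset_sup_apply_le (sum_nonneg fun i _ => hC0 i) fun i hi =>
    (hC' i t).trans (single_le_sum (fun i _ => hC0 i) hi)
  rw [smul_apply, norm_smul, norm_zpow, Complex.norm_natCast] at h1
  rw [zpow_neg, ← div_eq_mul_inv, le_div_iff₀ (by positivity), mul_comm]
  exact h1.trans (mul_le_mul_of_nonneg_left h2 hC)

variable {K : Set (Dual E)} {Q : Type} [Fintype Q] {ν : Q → Measure K} [∀ i, IsFiniteMeasure (ν i)]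
  {ε : Q → ℂ}

/-- The asymptotic expansion of a convolution, from the moments of the measure. -/
lemma IsAsymptoticExpansion.hasExp_convolution (h : IsAsymptoticExpansion G Θ AS) (hK : IsCompact K)
    {n₀ : ℤ} {D : ℤ → ℕ} (hD : ∀ n, 0 < D n) {φ : Test E}
    (hΘ : ∀ ψ : Test E, tsupport ψ ⊆ tsupport φ →
      HasExp n₀ D (fun k => Θ k ψ) (fun n k => AS n (k + D n) ψ)) {b : ℕ → ℂ}
    (hb : ∀ k : ℕ, 1 ≤ k → ∃ ψ : Q → Test E,
      (∀ i ξ, ψ i ξ = ∫ z : K, φ (ξ + (k : ℝ)⁻¹ • (z : Dual E)) ∂ν i) ∧ b k = ∑ i, ε i * Θ k (ψ i)) :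
    HasExp n₀ (fun n => ∏ j ∈ range (n - n₀ + 1).toNat, D (n - j)) b
      (fun n k => ∑ l ∈ range (n - n₀ + 1).toNat, ∑ a : Fin l → Fin (finrank ℝ E),
        ((l.factorial : ℂ)⁻¹ * ∑ i, ε i * (moment (ν i) a : ℂ)) *
          AS (n - l) (k + D (n - l)) (revDeriv (fun i => dualVec E (a i)) φ)) := by
  let K₀ : Compacts (Dual E) := ⟨tsupport φ, φ.hasCompactSupport⟩
  obtain ⟨M, hM⟩ := h.exists_growth (translateHull K₀ hK)
  let c : ∀ l : ℕ, (Fin l → Fin (finrank ℝ E)) → ℂ := fun l a =>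
    (l.factorial : ℂ)⁻¹ * ∑ i, ε i * (moment (ν i) a : ℂ)
  have hterm : ∀ l : ℕ, HasExp n₀ D
      (fun k => ∑ a, c l a * Θ k (revDeriv (fun i => dualVec E (a i)) φ))
      (fun n k => ∑ a, c l a * AS n (k + D n) (revDeriv (fun i => dualVec E (a i)) φ)) := fun l =>
    HasExp.sum hD _ fun a _ =>
      (hΘ _ (tsupport_revDeriv_subset (fun i => dualVec E (a i)) φ)).const_mul (c l a)
  refine HasExp.series hterm M fun J => ?_
  choose R hRb hR using fun i => exists_remainder (ν i) hK (K₀ := K₀) (φ := φ) subset_rfl J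
  choose C hC using fun i => hM (R i) (hRb i)
  refine (IsBigO.of_bound (∑ i, ‖ε i‖ * C i) ?_ : _ =O[atTop]
    fun k : ℕ => (k : ℝ) ^ (M - J - 1)).trans (zpow_isBigO (by omega))
  filter_upwards [eventually_ge_atTop 1] with k hk
  have hk0 : (0 : ℝ) < k := by exact_mod_cast hk
  have hkC : (k : ℂ) ≠ 0 := by exact_mod_cast hk0.ne'
  obtain ⟨ψ, hψ, hbk⟩ := hb k hk
  let t : Set.Icc (0 : ℝ) 1 := ⟨(k : ℝ)⁻¹, by positivity, inv_le_one_of_one_le₀ (by exact_mod_cast hk)⟩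
  have h1 : b k - ∑ l ∈ range (J + 1), (k : ℂ) ^ (-(l : ℤ)) *
      ∑ a : Fin l → Fin (finrank ℝ E),
        ((l.factorial : ℂ)⁻¹ * ∑ i, ε i * (moment (ν i) a : ℂ)) *
          Θ k (revDeriv (fun i => dualVec E (a i)) φ) =
      ∑ i, ε i * ((k : ℂ) ^ (-(J + 1 : ℕ) : ℤ) *
        Θ k (ofSupportedIn (fun _ _ => trivial) (R i t))) := by
    rw [hbk, sub_eq_iff_eq_add']
    have h2 : ∀ i, Θ k (ψ i) = ∑ l ∈ range (J + 1), (k : ℂ) ^ (-(l : ℤ)) *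
        ∑ a : Fin l → Fin (finrank ℝ E), ((l.factorial : ℂ)⁻¹ * (moment (ν i) a : ℂ)) *
          Θ k (revDeriv (fun i => dualVec E (a i)) φ) + (k : ℂ) ^ (-(J + 1 : ℕ) : ℤ) *
        Θ k (ofSupportedIn (fun _ _ => trivial) (R i t)) := by
      intro i
      rw [hR i t (ψ i) (hψ i)]
      simp only [map_add, map_sum, map_smul, real_smul, t, zpow_neg, zpow_natCast]
      push_cast
      simp only [inv_pow]
    simp only [h2, mul_add, sum_add_distrib]
    congr 1
    simp only [mul_sum, sum_mul]
    rw [sum_comm]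
    refine sum_congr rfl fun l _ => ?_
    rw [sum_comm]
    refine sum_congr rfl fun a _ => sum_congr rfl fun i _ => ?_
    ring
  rw [h1]
  refine (norm_sum_le _ _).trans ?_
  rw [sum_mul]
  refine sum_le_sum fun i _ => ?_
  rw [norm_mul, norm_mul, norm_zpow, Complex.norm_natCast, norm_zpow, Real.norm_natCast, mul_assoc,
    show M - J - 1 = -((J + 1 : ℕ) : ℤ) + M by push_cast; ring, zpow_add₀ hk0.ne', mul_left_comm (C i)]
  gcongr
  exact hC i k hk t

end

section

variable {K : Set (Dual E)}

lemma hasDerivAt_integral_exp (hK : IsCompact K) (ν : Measure K) [IsFiniteMeasure ν] {w : K → ℂ}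
    (hw : Continuous w) (X v : E) :
    HasDerivAt (fun t : ℝ => ∫ z : K, w z * exp (I * ((z : Dual E) (X + t • v) : ℝ)) ∂ν)
      (∫ z : K, I * (((z : Dual E) v : ℝ) * w z) *
        exp (I * ((z : Dual E) X : ℝ)) ∂ν) 0 := by
  have : CompactSpace K := isCompact_iff_compactSpace.1 hK
  have hint : ∀ {f : K → ℂ}, Continuous f → Integrable f ν := fun h =>
    h.integrable_of_hasCompactSupport (HasCompactSupport.of_compactSpace _)
  have hc : ∀ t : ℝ, Continuous fun z : K =>
      w z * exp (I * ((z : Dual E) (X + t • v) : ℝ)) := fun t => by fun_prop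
  have hc' : ∀ t : ℝ, Continuous fun z : K => I * (((z : Dual E) v : ℝ) * w z) *
      exp (I * ((z : Dual E) (X + t • v) : ℝ)) := fun t => by fun_prop
  have hb : Continuous fun z : K => ‖I * (((z : Dual E) v : ℝ) * w z)‖ := by fun_prop
  have h1 := hasDerivAt_integral_of_dominated_loc_of_deriv_le (μ := ν) (x₀ := (0 : ℝ)) (s := Set.univ)
    (F := fun t z => w z * exp (I * ((z : Dual E) (X + t • v) : ℝ)))
    (F' := fun t z => I * (((z : Dual E) v : ℝ) * w z) *
      exp (I * ((z : Dual E) (X + t • v) : ℝ))) Filter.univ_mem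
    (of_forall fun t => (hint (hc t)).1) (hint (hc 0)) (hint (hc' 0)).1
    (bound := fun z => ‖I * (((z : Dual E) v : ℝ) * w z)‖)
    (of_forall fun z t _ => ?_)
    (hb.integrable_of_hasCompactSupport (HasCompactSupport.of_compactSpace _))
    (of_forall fun z t _ => ?_)
  · simpa using h1.2
  · rw [norm_mul, mul_comm I (Complex.ofReal _), Complex.norm_exp_ofReal_mul_I, mul_one]
  · have h2 : HasDerivAt (fun t : ℝ => (((z : Dual E) (X + t • v) : ℝ) : ℂ)) ((z : Dual E) v : ℝ) t := by
      refine HasDerivAt.ofReal_comp ?_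
      simpa using ((hasDerivAt_id t).mul_const ((z : Dual E) v)).const_add ((z : Dual E) X)
    refine (((h2.const_mul I).cexp).const_mul (w z)).congr_deriv ?_
    ring

variable {Q : Type} [Fintype Q] {ν : Q → Measure K} [∀ i, IsFiniteMeasure (ν i)]
  {ε : Q → ℂ}

variable (ν ε) in
/-- The characteristic function of the image of the measure `∑ εᵢ νᵢ` under `τ`. -/
def charFn (τ : K → Dual E) (X : E) : ℂ := ∑ i, ε i * ∫ z, exp (I * (τ z X : ℝ)) ∂ν i

lemma iteratedFDeriv_eq_of_char (hK : IsCompact K) {j : E → ℂ} (hj : ContDiff ℝ ∞ j)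
    (hchar : j = charFn ν ε Subtype.val)
    {l : ℕ} (X : E) (m : Fin l → E) :
    iteratedFDeriv ℝ l j X m = I ^ l * ∑ i, ε i * ∫ z : K,
      (((∏ p, (z : Dual E) (m p) : ℝ)) : ℂ) * exp (I * ((z : Dual E) X : ℝ)) ∂ν i := by
  induction l generalizing X with
  | zero => simp [hchar, charFn]
  | succ l ih =>
    rw [iteratedFDeriv_succ_apply_left]
    have hd : DifferentiableAt ℝ (iteratedFDeriv ℝ l j) X :=
      (hj.differentiable_iteratedFDeriv (m := l) (by exact_mod_cast WithTop.coe_lt_top l)) X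
    have h1 : HasDerivAt (fun t : ℝ => X + t • m 0) (m 0) 0 := by
      simpa using ((hasDerivAt_id (0 : ℝ)).smul_const (m 0)).const_add X
    let A := ContinuousMultilinearMap.apply ℝ (fun _ : Fin l => E) ℂ (tail m)
    have h2 : HasFDerivAt (fun Y => iteratedFDeriv ℝ l j Y (tail m))
        (A.comp (fderiv ℝ (iteratedFDeriv ℝ l j) X)) (X + (0 : ℝ) • m 0) := by
      rw [zero_smul, add_zero]
      exact A.hasFDerivAt.comp X hd.hasFDerivAt
    have h3 := h2.comp_hasDerivAt (0 : ℝ) h1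
    simp only [Function.comp_def, ih] at h3
    have h4 := HasDerivAt.const_mul (I ^ l) (HasDerivAt.fun_sum fun i (_ : i ∈ Finset.univ) =>
      (hasDerivAt_integral_exp hK (ν i) (w := fun z => ((∏ p, (z : Dual E) (tail m p) : ℝ) : ℂ))
        (by fun_prop) X (m 0)).const_mul (ε i))
    refine (h3.unique h4).trans ?_
    rw [pow_succ, mul_assoc]
    congr 1
    rw [mul_sum]
    refine sum_congr rfl fun i _ => ?_
    rw [mul_left_comm, ← integral_const_mul I]
    refine congrArg (ε i * ·) (integral_congr_ae (of_forall fun z => ?_))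
    simp only []
    rw [Fin.prod_univ_succ]
    push_cast
    simp only [tail]
    ring

end

section FourierInversion

open scoped FourierTransform SchwartzMap RealInnerProductSpace

lemma fourier_modulate {V : Type*} [NormedAddCommGroup V] [InnerProductSpace ℝ V]
    [FiniteDimensional ℝ V] [MeasurableSpace V] [BorelSpace V] (S : V → ℂ) {e : ℝ} (he : 0 < e)
    (w₀ w : V) : 𝓕 (fun y => S (e • y) * exp ((2 * π * ⟪y, w₀⟫ : ℝ) * I)) w =
      ((e ^ finrank ℝ V)⁻¹ : ℝ) • 𝓕 S (e⁻¹ • (w - w₀)) := by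
  rw [Real.fourier_eq', Real.fourier_eq', ← Measure.integral_comp_smul_of_nonneg _ _ e (hR := he.le)]
  refine integral_congr_ae (of_forall fun y => ?_)
  simp only [smul_eq_mul]
  rw [mul_left_comm, ← Complex.exp_add, mul_comm]
  congr 2
  rw [inner_smul_left, inner_smul_right, inner_sub_right]
  simp only [conj_trivial]
  rw [mul_inv_cancel_left₀ he.ne', ← add_mul]
  push_cast
  ring_nf

lemma integrable_growth_mul {V : Type*} [NormedAddCommGroup V] [InnerProductSpace ℝ V]
    [FiniteDimensional ℝ V] [MeasurableSpace V] [BorelSpace V] {C : ℝ} {N : ℕ} (S : 𝓢(V, ℂ)) :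
    Integrable fun x => C * (1 + ‖x‖) ^ N * ‖S x‖ := by
  have h1 := ((S.integrable_pow_mul volume 0).add (S.integrable_pow_mul volume N)).const_mul
    (|C| * 2 ^ (N - 1))
  refine h1.mono' (by fun_prop) (of_forall fun x => ?_)
  rw [norm_mul, norm_mul, norm_norm, Real.norm_eq_abs, Real.norm_of_nonneg (by positivity)]
  have h2 := add_pow_le (zero_le_one' ℝ) (norm_nonneg x) N
  simp only [one_pow, Pi.add_apply, pow_zero, ← add_mul] at h2 ⊢
  exact (mul_le_mul_of_nonneg_right (mul_le_mul_of_nonneg_left h2 (abs_nonneg C))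
    (norm_nonneg (S x))).trans (le_of_eq (by ring))

lemma tendsto_integral_modulate {V : Type*} [NormedAddCommGroup V] [InnerProductSpace ℝ V]
    [FiniteDimensional ℝ V] [MeasurableSpace V] [BorelSpace V] {J : V → ℂ} (hJ : Continuous J)
    {C : ℝ} {N : ℕ} (hC : 0 ≤ C) (hb : ∀ x, ‖J x‖ ≤ C * (1 + ‖x‖) ^ N) (S : 𝓢(V, ℂ)) (w₀ : V) :
    Tendsto (fun n : ℕ => ∫ w, J w * 𝓕 (fun y => S ((n + 1 : ℝ)⁻¹ • y) *
      exp ((2 * π * ⟪y, w₀⟫ : ℝ) * I)) w) atTop (nhds (J w₀ * S 0)) := by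
  have h1 : ∀ n : ℕ, ∫ w, J w * 𝓕 (fun y => S ((n + 1 : ℝ)⁻¹ • y) *
      exp ((2 * π * ⟪y, w₀⟫ : ℝ) * I)) w =
      ∫ u, J ((n + 1 : ℝ)⁻¹ • u + w₀) * 𝓕 S u := by
    intro n
    have he : (0 : ℝ) < (n + 1 : ℝ)⁻¹ := by positivity
    set e := (n + 1 : ℝ)⁻¹
    rw [← integral_add_right_eq_self _ w₀]
    simp only [fourier_modulate S he, add_sub_cancel_right]
    have h2 := Measure.integral_comp_inv_smul_of_nonneg volume
      (fun u => J (e • u + w₀) * 𝓕 S u) he.le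
    simp only [smul_inv_smul₀ he.ne'] at h2
    simp only [mul_smul_comm, integral_smul]
    refine (congrArg _ h2).trans ?_
    rw [smul_smul, inv_mul_cancel₀ (by positivity), one_smul]
  have hS : ∫ u, 𝓕 S u = S 0 := by
    have := congrArg (fun f : 𝓢(V, ℂ) => f 0) (FourierTransform.fourierInv_fourier_eq (E := 𝓢(V, ℂ)) (F := 𝓢(V, ℂ)) S)
    simp only [SchwartzMap.fourierInv_coe, Real.fourierInv_eq'] at this
    simpa using this
  simp only [h1, ← hS, ← integral_const_mul]
  refine tendsto_integral_of_dominated_convergence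
    (fun u => C * (1 + ‖w₀‖) ^ N * (1 + ‖u‖) ^ N * ‖𝓕 S u‖) (fun n => ?_) ?_ (fun n => ?_) ?_
  · exact ((hJ.comp (by fun_prop)).mul (𝓕 S).continuous).aestronglyMeasurable
  · exact integrable_growth_mul (𝓕 S)
  · refine of_forall fun u => ?_
    rw [norm_mul]
    gcongr
    refine (hb _).trans ?_
    rw [mul_assoc, ← mul_pow]
    gcongr
    have h3 : ‖(n + 1 : ℝ)⁻¹ • u + w₀‖ ≤ ‖u‖ + ‖w₀‖ := by
      refine (norm_add_le _ _).trans (add_le_add_left ?_ _)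
      rw [norm_smul, Real.norm_of_nonneg (by positivity)]
      exact mul_le_of_le_one_left (norm_nonneg _) (inv_le_one_of_one_le₀ (by simp))
    nlinarith [mul_nonneg (norm_nonneg u) (norm_nonneg w₀)]
  · refine of_forall fun u => Tendsto.mul_const _ ?_
    have h3 : Tendsto (fun n : ℕ => (n + 1 : ℝ)⁻¹ • u + w₀) atTop (nhds ((0 : ℝ) • u + w₀)) :=
      (((tendsto_natCast_atTop_atTop.atTop_add tendsto_const_nhds).inv_tendsto_atTop).smul_const u).add_const w₀
    rw [zero_smul, zero_add] at h3
    exact (hJ.tendsto w₀).comp h3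

variable (E) in
/-- The coordinates of `𝔤`, in Euclidean space. -/
abbrev Coord : Type := EuclideanSpace ℝ (Fin (finrank ℝ E))

lemma sum_dualVec_apply (y x : Fin (finrank ℝ E) → ℝ) :
    (∑ a, y a • dualVec E a : Dual E) (∑ a, x a • basis E a) = ∑ a, y a * x a := by
  simp only [sum_apply, smul_apply, smul_eq_mul]
  refine sum_congr rfl fun a _ => ?_
  change y a * (basis E).repr _ a = _
  rw [Module.Basis.repr_sum_self]

lemma fourierPairing_eq (j : E → ℂ) (φ : Test E) : fourierPairing j φ =
    ∫ w : Coord E, j (∑ a, (2 * π * w a) • basis E a) *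
      𝓕 (fun y : Coord E => ((φ (∑ a, y a • dualVec E a) : ℝ) : ℂ)) w := by
  have hpi : (0 : ℝ) < 2 * π := by positivity
  have h1 : ∀ w : Coord E, fourierHat φ (∑ a, (2 * π * w a) • basis E a) =
      ((2 * π : ℂ) ^ finrank ℝ E)⁻¹ *
        𝓕 (fun y : Coord E => ((φ (∑ a, y a • dualVec E a) : ℝ) : ℂ)) w := by
    intro w
    rw [fourierHat, Real.fourier_eq', ← (PiLp.volume_preserving_ofLp _).integral_comp
      (MeasurableEquiv.toLp 2 _).symm.measurableEmbedding]
    congr 1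
    refine integral_congr_ae (of_forall fun y => ?_)
    simp only [smul_eq_mul]
    rw [mul_comm]
    congr 2
    have h2 : (∑ a, y a • dualVec E a : Dual E) (∑ a, (2 * π * w a) • basis E a) =
        2 * π * ⟪y, w⟫ := by
      rw [sum_dualVec_apply, PiLp.inner_apply, mul_sum]
      exact sum_congr rfl fun a _ => by simp; ring
    rw [h2]
    push_cast
    ring
  rw [fourierPairing, ← (PiLp.volume_preserving_ofLp _).integral_comp
      (MeasurableEquiv.toLp 2 _).symm.measurableEmbedding]
  have h3 := Measure.integral_comp_smul_of_nonneg volume (fun x : Coord E =>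
    j (∑ a, x a • basis E a) * fourierHat φ (∑ a, x a • basis E a)) (2 * π) (hR := hpi.le)
  simp only [PiLp.smul_apply, smul_eq_mul, h1, finrank_euclideanSpace, Fintype.card_fin] at h3
  have h4 := (eq_inv_smul_iff₀ (by positivity)).1 h3
  refine h4.symm.trans ?_
  simp only [mul_left_comm (j _), integral_const_mul]
  rw [real_smul]
  push_cast
  rw [mul_inv_cancel_left₀ (pow_ne_zero _ (mul_ne_zero two_ne_zero (Complex.ofReal_ne_zero.2 Real.pi_ne_zero)))]

variable {K : Set (Dual E)} {Q : Type} [Fintype Q] {ν : Q → Measure K} [∀ i, IsFiniteMeasure (ν i)]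
  {ε : Q → ℂ}

lemma exists_integral_test_eq (φ : Test E) : ∃ S : 𝓢(Coord E, ℂ),
    (∀ y, S y = φ (∑ a, y a • dualVec E a)) ∧ ∀ τ : K → Dual E, Continuous τ →
      ∑ i, ε i * ((∫ z, φ (τ z) ∂ν i : ℝ) : ℂ) =
        ∫ w, charFn ν ε τ (∑ a, (2 * π * w a) • basis E a) * 𝓕 S w := by
  have h1 : HasCompactSupport fun y : Coord E => ((φ (∑ a, y a • dualVec E a) : ℝ) : ℂ) := by
    refine HasCompactSupport.intro (K := (fun ξ : Dual E => WithLp.toLp 2 fun a => ξ (basis E a)) ''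
      tsupport φ) (φ.hasCompactSupport.isCompact.image (by fun_prop)) fun y hy => ?_
    by_contra h
    refine hy ⟨_, subset_closure fun h0 => h (by rw [h0, ofReal_zero]), ?_⟩
    ext b
    simpa [Pi.single_apply] using sum_dualVec_apply (E := E) y (single b 1)
  let S : 𝓢(Coord E, ℂ) := h1.toSchwartzMap (Complex.ofRealCLM.contDiff.comp (φ.contDiff.comp
    (by fun_prop)))
  have hS : ∀ ξ : Dual E, (φ ξ : ℂ) = ∫ w, 𝓕 S w * exp
      (I * (ξ (∑ a, (2 * π * w a) • basis E a) : ℝ)) := by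
    intro ξ
    have h2 := congrArg (fun f : 𝓢(Coord E, ℂ) => f (WithLp.toLp 2 fun a => ξ (basis E a)))
      (FourierTransform.fourierInv_fourier_eq (E := 𝓢(Coord E, ℂ)) (F := 𝓢(Coord E, ℂ)) S)
    simp only [SchwartzMap.fourierInv_coe, Real.fourierInv_eq'] at h2
    have h3 : S (WithLp.toLp 2 fun a => ξ (basis E a)) = (φ ξ : ℂ) := by
      change ((φ (∑ a, ξ (basis E a) • dualVec E a) : ℝ) : ℂ) = _
      rw [← dual_eq_sum]
    rw [← h3, ← h2]
    refine integral_congr_ae (of_forall fun w => ?_)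
    simp only [smul_eq_mul]
    rw [mul_comm]
    congr 2
    rw [mul_comm]
    congr 2
    simp only [map_sum, map_smul, smul_eq_mul, PiLp.inner_apply, mul_sum]
    exact sum_congr rfl fun a _ => by simp; ring
  refine ⟨S, fun y => rfl, fun τ hτ => ?_⟩
  have hI : ∀ i, Integrable (fun x : K × Coord E => 𝓕 S x.2 * exp
      (I * (τ x.1 (∑ a, (2 * π * x.2 a) • basis E a) : ℝ))) ((ν i).prod volume) := fun i => by
    refine ((𝓕 S).integrable.norm.comp_snd (ν i)).mono' (Continuous.aestronglyMeasurable ?_)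
      (of_forall fun x => ?_)
    · fun_prop
    · rw [norm_mul, mul_comm I, Complex.norm_exp_ofReal_mul_I, mul_one]
  have hI' := fun i => (hI i).integral_prod_right.const_mul (ε i)
  simp only [integral_const_mul] at hI'
  simp only [charFn, mul_comm _ (𝓕 S _), mul_sum, mul_left_comm (𝓕 S _)]
  rw [integral_finsetSum _ fun i _ => hI' i]
  refine sum_congr rfl fun i _ => ?_
  rw [integral_const_mul, ← integral_complex_ofReal]
  simp only [hS]
  rw [integral_integral_swap (hI i)]
  simp only [integral_const_mul]

lemma sum_integral_test_congr {τ τ' : K → Dual E} (hτ : Continuous τ) (hτ' : Continuous τ')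
    (h : charFn ν ε τ = charFn ν ε τ') (φ : Test E) :
    ∑ i, ε i * ((∫ z, φ (τ z) ∂ν i : ℝ) : ℂ) = ∑ i, ε i * ((∫ z, φ (τ' z) ∂ν i : ℝ) : ℂ) := by
  obtain ⟨S, -, hS⟩ := exists_integral_test_eq (ν := ν) (ε := ε) φ
  rw [hS τ hτ, hS τ' hτ', h]

/-- The function `j` is the characteristic function of its Fourier transform. -/
lemma eq_charFn {j : E → ℂ} (hj : Continuous j) (hg : HasPolynomialGrowth j)
    {B : ComplexMeasure (Dual E)} (hjB : IsFourierTransform j B) (hK : IsCompact K)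
    (hB : ∀ f : Dual E → ℝ, Continuous f →
      B.integral f (lsmul ℝ ℝ) = ∑ i, ε i * ((∫ z, f z ∂ν i : ℝ) : ℂ)) :
    j = charFn ν ε Subtype.val := by
  have : CompactSpace K := isCompact_iff_compactSpace.1 hK
  ext X
  let M : Coord E →L[ℝ] E := toContinuousLinearMap
    { toFun := fun w => ∑ a, (2 * π * w a) • basis E a
      map_add' := fun x y => by simp [mul_add, add_smul, sum_add_distrib]
      map_smul' := fun c x => by simp [mul_left_comm, mul_smul, smul_sum] }
  let w₀ : Coord E := (2 * π)⁻¹ • WithLp.toLp 2 fun a => (basis E).repr X a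
  have hw₀ : ∀ a, 2 * π * w₀ a = (basis E).repr X a := fun a => by
    simp only [w₀, PiLp.smul_apply, smul_eq_mul]
    rw [mul_inv_cancel_left₀ (by positivity)]
  have hM : M w₀ = X := by
    change ∑ a, (2 * π * w₀ a) • basis E a = X
    simp only [hw₀, Module.Basis.sum_repr]
  have hX : ∀ y : Coord E, 2 * π * ⟪y, w₀⟫ = (∑ a, y a • dualVec E a : Dual E) X := fun y => by
    have := sum_dualVec_apply (E := E) y ((basis E).repr X)
    rw [Module.Basis.sum_repr] at this
    rw [this, PiLp.inner_apply, mul_sum]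
    refine sum_congr rfl fun a _ => ?_
    rw [← hw₀]
    simp
    ring
  let χ : ContDiffBump (0 : Dual E) := ⟨1, 2, one_pos, one_lt_two⟩
  obtain ⟨S, hS, -⟩ := exists_integral_test_eq (ν := ν) (ε := ε)
    ⟨χ, χ.contDiff, χ.hasCompactSupport, fun _ _ => trivial⟩
  have hχ : ∀ n : ℕ, ContDiff ℝ ∞ fun ξ : Dual E => χ ((n + 1 : ℝ)⁻¹ • ξ) :=
    fun n => χ.contDiff.comp (by fun_prop)
  have hχ' : ∀ n : ℕ, HasCompactSupport fun ξ : Dual E => χ ((n + 1 : ℝ)⁻¹ • ξ) :=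
    fun n => χ.hasCompactSupport.comp_smul (by positivity)
  have hX' : ContDiff ℝ ∞ fun ξ : Dual E => ξ X := by fun_prop
  choose T₁ h1 h1' using fun n => exists_integral_test_eq (ν := ν) (ε := ε)
    ⟨_, (hχ n).mul (Real.contDiff_cos.comp hX'), (hχ' n).mul_right, fun _ _ => trivial⟩
  choose T₂ h2 h2' using fun n => exists_integral_test_eq (ν := ν) (ε := ε)
    ⟨_, (hχ n).mul (Real.contDiff_sin.comp hX'), (hχ' n).mul_right, fun _ _ => trivial⟩
  have h3 : ∀ n : ℕ, (fun y : Coord E => S ((n + 1 : ℝ)⁻¹ • y) *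
      exp ((2 * π * ⟪y, w₀⟫ : ℝ) * I)) = ⇑(T₁ n + I • T₂ n) := by
    intro n
    ext y
    rw [add_apply, smul_apply, h1, h2, hS, hX, Complex.exp_mul_I, ← Complex.ofReal_cos,
      ← Complex.ofReal_sin]
    change (χ (∑ a, ((n + 1 : ℝ)⁻¹ * y a) • dualVec E a) : ℂ) * _ = ((χ _ * cos _ : ℝ) : ℂ) +
      _ • ((χ _ * sin _ : ℝ) : ℂ)
    simp only [smul_sum, mul_smul]
    push_cast
    rw [smul_eq_mul]
    ring
  have key : ∀ f : E → ℂ, Continuous f → HasPolynomialGrowth f →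
      Tendsto (fun n => (∫ w, f (M w) * 𝓕 (T₁ n) w) + I * ∫ w, f (M w) * 𝓕 (T₂ n) w) atTop
        (nhds (f X)) := by
    rintro f hf ⟨C, N, h⟩
    have hb : ∀ w, ‖f (M w)‖ ≤ |C| * (1 + ‖M‖) ^ N * (1 + ‖w‖) ^ N := fun w => by
      refine (h _).trans ?_
      rw [mul_assoc, ← mul_pow]
      gcongr
      · exact le_abs_self C
      · nlinarith [M.le_opNorm w, norm_nonneg M, norm_nonneg w]
    have hI : ∀ T : 𝓢(Coord E, ℂ), Integrable fun w => f (M w) * 𝓕 T w := fun T =>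
      (integrable_growth_mul (𝓕 T)).mono'
        ((hf.comp M.continuous).mul (𝓕 T).continuous).aestronglyMeasurable (of_forall fun w => by
          rw [norm_mul]
          exact mul_le_mul_of_nonneg_right (hb w) (norm_nonneg _))
    have hlim := tendsto_integral_modulate (hf.comp M.continuous) (by positivity) hb S w₀
    have hS0 : S 0 = 1 := by
      rw [hS]
      change (χ (∑ a, (0 : ℝ) • dualVec E a) : ℂ) = 1
      simp only [zero_smul, Finset.sum_const_zero]
      rw [χ.one_of_mem_closedBall (Metric.mem_closedBall_self χ.rIn_pos.le), ofReal_one]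
    simp only [Function.comp_apply, hM, hS0, mul_one, h3] at hlim
    refine hlim.congr fun n => ?_
    rw [← integral_const_mul, ← integral_add (hI _) ((hI _).const_mul _)]
    refine integral_congr_ae (of_forall fun w => ?_)
    simp only [← SchwartzMap.fourier_coe, FourierTransform.fourier_add,
      FourierTransform.fourier_smul, add_apply, smul_apply, smul_eq_mul]
    ring
  have hB' : ∀ (φ : Test E) (T : 𝓢(Coord E, ℂ)), (∀ y, T y = φ (∑ a, y a • dualVec E a)) →
      ∫ w, j (M w) * 𝓕 T w = ∑ i, ε i * ((∫ z : K, φ z ∂ν i : ℝ) : ℂ) := fun φ T hT => by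
    rw [← hB φ φ.contDiff.continuous, hjB φ, fourierPairing_eq, ← funext hT]
    rfl
  refine tendsto_nhds_unique (key j hj hg) ((key (charFn ν ε Subtype.val) ?_ ?_).congr fun n => ?_)
  · refine continuous_finsetSum _ fun i _ => continuous_const.mul (continuous_of_dominated
      (bound := fun _ => 1) (fun X => ?_) (fun X => of_forall fun z => ?_) (integrable_const _)
      (of_forall fun z => by fun_prop))
    · exact Continuous.aestronglyMeasurable (by fun_prop)
    · rw [mul_comm, Complex.norm_exp_ofReal_mul_I]
  · refine ⟨∑ i, ‖ε i‖ * (1 * (ν i).real Set.univ), 0, fun X => ?_⟩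
    rw [pow_zero, mul_one]
    refine norm_sum_le_of_le _ fun i _ => ?_
    rw [norm_mul]
    refine mul_le_mul_of_nonneg_left (norm_integral_le_of_norm_le_const (of_forall fun z => ?_))
      (norm_nonneg _)
    rw [mul_comm, Complex.norm_exp_ofReal_mul_I]
  · rw [hB' _ _ (h1 n), hB' _ _ (h2 n)]
    exact congrArg₂ (· + I * ·) (h1' n _ continuous_subtype_val).symm
      (h2' n _ continuous_subtype_val).symm

end FourierInversion

section

open scoped FourierTransform SchwartzMap RealInnerProductSpace

variable {K : Set (Dual E)} {Q : Type} [Fintype Q] {ν : Q → Measure K} [∀ i, IsFiniteMeasure (ν i)]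
  {ε : Q → ℂ}

variable (ν ε) in
/-- `C = B ⋆ A` for the image `B` of the measure `∑ εᵢ νᵢ` under scaling by `t`. -/
def IsAveraged (t : ℝ) (A C : Distr E) : Prop := ∀ φ : Test E, ∃ ψ : Q → Test E,
  (∀ i ξ, ψ i ξ = ∫ z : K, φ (ξ + t • (z : Dual E)) ∂ν i) ∧ C φ = ∑ i, ε i * A (ψ i)

lemma exists_isAveraged (hK : IsCompact K) {A : Distr E} (hA : IsOrderZero A) {t : ℝ}
    (ht : t ∈ Set.Icc (0 : ℝ) 1) : ∃ C, IsAveraged ν ε t A C := by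
  have : CompactSpace K := isCompact_iff_compactSpace.1 hK
  choose ψ hψ hs using fun (i : Q) (K₀ : Compacts (Dual E)) (φ : {φ : Test E // tsupport φ ⊆ K₀}) =>
    exists_translateAverage (ν i) hK K₀ φ.1 φ.2 ⟨t, ht⟩
  let Ψ : Q → Test E → Test E := fun i φ => ψ i ⟨tsupport φ, φ.hasCompactSupport⟩ ⟨φ, subset_rfl⟩
  have hΨ : ∀ i φ ξ, Ψ i φ ξ = ∫ z : K, φ (ξ + t • (z : Dual E)) ∂ν i := fun i φ => hψ i _ _
  have hint : ∀ (i) (φ : Test E) (ξ), Integrable (fun z : K => φ (ξ + t • (z : Dual E))) (ν i) :=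
    fun i φ ξ => Continuous.integrable_of_hasCompactSupport
      (φ.contDiff.continuous.comp (by fun_prop)) (HasCompactSupport.of_compactSpace _)
  obtain ⟨C, hC⟩ := exists_distr_of_bound (fun φ => ∑ i, ε i * A (Ψ i φ)) (fun φ φ' => by
      have : ∀ i, Ψ i (φ + φ') = Ψ i φ + Ψ i φ' := fun i => by
        ext ξ
        simp only [hΨ, add_apply]
        exact integral_add (hint i φ ξ) (hint i φ' ξ)
      simp only [this, map_add, mul_add, sum_add_distrib]) (fun a φ => by
      have : ∀ i, Ψ i (a • φ) = a • Ψ i φ := fun i => by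
        ext ξ
        simp only [hΨ, smul_apply, smul_eq_mul, integral_const_mul]
      simp only [this, map_smul, mul_smul_comm, smul_sum]) (fun K₀ => by
      obtain ⟨C, hC0, hC⟩ := hA (translateHull K₀ hK)
      refine ⟨∑ i, ‖ε i‖ * (C * (ν i).real Set.univ),
        sum_nonneg fun _ _ => by positivity, fun φ hφ M hM => ?_⟩
      rw [sum_mul]
      refine (norm_sum_le _ _).trans (sum_le_sum fun i _ => ?_)
      rw [norm_mul, mul_assoc, mul_assoc]
      have h0 : Ψ i φ = ψ i K₀ ⟨φ, hφ⟩ := by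
        ext ξ
        rw [hΨ, hψ]
      refine mul_le_mul_of_nonneg_left (hC _ (h0 ▸ hs i K₀ _) _ fun ξ => ?_) (norm_nonneg _)
      rw [hΨ, mul_comm]
      exact norm_integral_le_of_norm_le_const (of_forall fun z => hM _))
  exact ⟨C, fun φ => ⟨fun i => Ψ i φ, fun i => hΨ i φ, hC φ⟩⟩

lemma evalComplex_sum (A : Distr E) (ψ : Q → Test E) : ∃ Ψ : TestFunction (⊤ : Opens (Dual E)) ℂ ⊤,
    (∀ ξ, Ψ ξ = ∑ i, ε i * (ψ i ξ : ℂ)) ∧ A.evalComplex Ψ = ∑ i, ε i * A (ψ i) := by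
  let L : ℂ → ℝ →L[ℝ] ℂ := fun e => (lsmul ℝ ℝ).flip e
  let Ψ : TestFunction (⊤ : Opens (Dual E)) ℂ ⊤ := ∑ i, postcompCLM (L (ε i)) (ψ i)
  have hΨ : ∀ ξ, Ψ ξ = ∑ i, ε i * (ψ i ξ : ℂ) := fun ξ => by
    rw [show Ψ = ∑ i, postcompCLM (L (ε i)) (ψ i) from rfl, sum_apply]
    exact sum_congr rfl fun i _ => by
      rw [postcompCLM_apply, Function.comp_apply, mul_comm]
      exact real_smul
  refine ⟨Ψ, hΨ, ?_⟩
  have h1 : postcompCLM reCLM Ψ = ∑ i, (ε i).re • ψ i := by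
    ext ξ
    rw [postcompCLM_apply, Function.comp_apply, hΨ, sum_apply, map_sum]
    exact sum_congr rfl fun i _ => by simp
  have h2 : postcompCLM imCLM Ψ = ∑ i, (ε i).im • ψ i := by
    ext ξ
    rw [postcompCLM_apply, Function.comp_apply, hΨ, sum_apply, map_sum]
    exact sum_congr rfl fun i _ => by simp
  rw [Distr.evalComplex, h1, h2, map_sum, map_sum, mul_sum, ← sum_add_distrib]
  refine sum_congr rfl fun i _ => ?_
  rw [map_smul, map_smul, real_smul, real_smul]
  conv_rhs => rw [← Complex.re_add_im (ε i)]
  ring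

lemma IsAveraged.isConvolution {B : ComplexMeasure (Dual E)}
    (hB : ∀ f : Dual E → ℝ, Continuous f →
      B.integral f (lsmul ℝ ℝ) = ∑ i, ε i * ((∫ z, f z ∂ν i : ℝ) : ℂ))
    {k : ℕ} (hk : 1 ≤ k) {A C : Distr E} (h : IsAveraged ν ε (k : ℝ)⁻¹ A C) :
    IsConvolution (rescale k B) A C := by
  intro φ
  obtain ⟨ψ, hψ, hC⟩ := h φ
  obtain ⟨Ψ, hΨ, hΨA⟩ := evalComplex_sum (ε := ε) A ψ
  refine ⟨Ψ, fun ξ => ?_, hC.trans hΨA.symm⟩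
  have hk' : (k : ℝ)⁻¹ ≠ 0 := by positivity
  have h1 := (Homeomorph.smulOfNeZero _ hk').isClosedEmbedding.integral_map_vectorMeasure (μ := B)
    (B := lsmul ℝ ℝ) (f := fun η : Dual E => φ (ξ + η))
  refine Eq.trans ?_ h1.symm
  refine Eq.trans ?_ (hB (fun η => φ (ξ + (k : ℝ)⁻¹ • η))
    (φ.contDiff.continuous.comp (by fun_prop))).symm
  simp only [hΨ, hψ]

lemma IsAveraged.isInvariant
    {j : E → ℂ} (hinv : ∀ (g : G) (X : E), j (Ad g X) = j X)
    (hchar : j = charFn ν ε Subtype.val)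
    {t : ℝ} {A C : Distr E} (hA : IsInvariant G A) (h : IsAveraged ν ε t A C) : IsInvariant G C := by
  intro g φ φ' hφ
  obtain ⟨ψ, hψ, hC⟩ := h φ
  obtain ⟨ψ', hψ', hC'⟩ := h φ'
  obtain ⟨Ψ, hΨ, hΨA⟩ := evalComplex_sum (ε := ε) A ψ
  obtain ⟨Ψ', hΨ', hΨA'⟩ := evalComplex_sum (ε := ε) A ψ'
  have key : ∀ ξ, Ψ' ξ = Ψ (coAd g ξ) := by
    intro ξ
    rw [hΨ, hΨ']
    simp only [hψ, hψ', hφ]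
    have hc : Continuous fun ξ : Dual E => coAd g ξ :=
      (ContinuousLinearMap.precomp ℝ (Ad g⁻¹ : E →L[ℝ] E)).continuous
    refine sum_integral_test_congr (τ := fun z : K => coAd g (ξ + t • (z : Dual E)))
      (τ' := fun z => coAd g ξ + t • (z : Dual E)) (hc.comp (by fun_prop)) (by fun_prop)
      (funext fun X => ?_) φ
    have h1 : ∀ i (Y : E), ∫ z : K, exp (I * ((ξ (Ad g⁻¹ X) + t * (z : Dual E) Y : ℝ) : ℂ)) ∂ν i =
        exp (I * (ξ (Ad g⁻¹ X) : ℝ)) *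
          ∫ z : K, exp (I * ((z : Dual E) (t • Y) : ℝ)) ∂ν i := fun i Y => by
      rw [← integral_const_mul]
      refine integral_congr_ae (of_forall fun z => ?_)
      simp only [← Complex.exp_add, ← mul_add, map_smul, smul_eq_mul, Complex.ofReal_add]
    change ∑ i, ε i * ∫ z : K, exp (I * ((ξ (Ad g⁻¹ X) + t * (z : Dual E) (Ad g⁻¹ X) : ℝ) : ℂ)) ∂ν i =
      ∑ i, ε i * ∫ z : K, exp (I * ((ξ (Ad g⁻¹ X) + t * (z : Dual E) X : ℝ) : ℂ)) ∂ν i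
    simp only [h1, mul_left_comm (ε _), ← mul_sum]
    have h2 := hinv g⁻¹ (t • X)
    rw [map_smul, hchar] at h2
    exact congrArg _ h2
  rw [hC, hC', ← hΨA, ← hΨA', Distr.evalComplex, Distr.evalComplex]
  have hre := hA g (postcompCLM reCLM Ψ) (postcompCLM reCLM Ψ')
    fun ξ => congrArg Complex.re (key ξ)
  have him := hA g (postcompCLM imCLM Ψ) (postcompCLM imCLM Ψ')
    fun ξ => congrArg Complex.im (key ξ)
  rw [hre, him]

lemma taylorOp_apply (hK : IsCompact K) {j : E → ℂ} (hj : ContDiff ℝ ∞ j)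
    (hchar : j = charFn ν ε Subtype.val)
    (l : ℕ) (A : Distr E) (φ : Test E) : taylorOp j l A φ =
      ∑ a : Fin l → Fin (finrank ℝ E),
        ((l.factorial : ℂ)⁻¹ * ∑ i, ε i * (moment (ν i) a : ℂ)) *
          A (revDeriv (fun i => dualVec E (a i)) φ) := by
  rw [taylorOp, smul_apply, sum_apply, smul_eq_mul, mul_sum]
  refine sum_congr rfl fun a _ => ?_
  rw [smul_apply, iteratedLineDerivOp_distr_apply, iteratedFDeriv_eq_of_char hK hj hchar, smul_eq_mul]
  have h1 : ∀ i, ∫ z : K, ((∏ p, (z : Dual E) (basis E (a p)) : ℝ) : ℂ) *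
      exp (I * ((z : Dual E) 0 : ℝ)) ∂ν i = (moment (ν i) a : ℂ) := fun i => by
    simp only [map_zero, ofReal_zero, mul_zero, Complex.exp_zero, mul_one]
    exact integral_complex_ofReal
  simp only [h1]
  have h2 : I ^ l * I ^ l * (-1) ^ l = 1 := by
    rw [← mul_pow, ← mul_pow, Complex.I_mul_I]; simp
  linear_combination ((l.factorial : ℂ)⁻¹ * (∑ i, ε i * (moment (ν i) a : ℂ)) *
          A (revDeriv (fun i => dualVec E (a i)) φ)) * h2

/-- The asymptotic expansion of the convolution with a compactly supported measure whose
characteristic function is `j`. -/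
lemma IsAsymptoticExpansion.exists_taylorImage (hK : IsCompact K) {j : E → ℂ} (hj : ContDiff ℝ ∞ j)
    (hinv : ∀ (g : G) (X : E), j (Ad g X) = j X)
    (hchar : j = charFn ν ε Subtype.val)
    {Θ BΘ : ℕ → Distr E} (hBΘ : ∀ k : ℕ, 1 ≤ k → IsAveraged ν ε (k : ℝ)⁻¹ (Θ k) (BΘ k))
    {AS : ℤ → ℕ → Distr E} (h : IsAsymptoticExpansion G Θ AS) :
    ∃ S, IsTaylorImage j AS S ∧ IsAsymptoticExpansion G BΘ S ∧ (IsGlobal AS → IsGlobal S) := by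
  have key : ∀ K' : Set (Dual E), IsBoundedBelowOn K' AS → (∀ n, IsPeriodicOn K' (AS n)) →
      ∃ n₀ D, ∀ φ : Test E, tsupport φ ⊆ K' → ∃ p, HasExp n₀ D (fun k => BΘ k φ) p ∧
        ∀ (n : ℤ) (k : ℕ), 1 ≤ k → HasSum (fun l : ℕ => taylorOp j l (AS (n - l) k) φ) (p n k) := by
    intro K' hb hp
    obtain ⟨n₀, D, hD, hΘ⟩ := h.exists_hasExp hb hp
    refine ⟨n₀, _, fun φ hφ => ⟨_, h.hasExp_convolution hK hD
      (fun ψ hψ => (hΘ ψ (hψ.trans hφ)).1) (fun k hk => hBΘ k hk φ), fun n k hk => ?_⟩⟩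
    have hper : ∀ (l : ℕ) (a : Fin l → Fin (finrank ℝ E)),
        AS (n - l) (k + D (n - l)) (revDeriv (fun i => dualVec E (a i)) φ) =
          AS (n - l) k (revDeriv (fun i => dualVec E (a i)) φ) := fun l a =>
      (hΘ _ ((tsupport_revDeriv_subset _ φ).trans hφ)).2 _ k hk
    simp only [hper, ← taylorOp_apply hK hj hchar]
    refine hasSum_sum_of_ne_finset_zero fun l hl => ?_
    rw [taylorOp_apply hK hj hchar]
    refine Finset.sum_eq_zero fun a _ => ?_
    rw [← hper, (hΘ _ ((tsupport_revDeriv_subset _ φ).trans hφ)).1.eq_zero _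
      (by rw [mem_range] at hl; omega), mul_zero]
  obtain ⟨S, hS, hcoeff, hglob⟩ := exists_isAsymptoticExpansion (G := G) (Θ := BΘ)
    (fun k hk => (hBΘ k hk).isInvariant hinv hchar (h.invariant k hk)) fun K' => by
      obtain ⟨n₀, D, hD⟩ := key K' (h.boundedBelow K' K'.isCompact) (h.periodic K' K'.isCompact)
      exact ⟨n₀, D, fun φ hφ => (hD φ hφ).imp fun _ => And.left⟩
  refine ⟨S, fun n k hk φ => ?_, hS, fun hg => hglob ?_⟩
  · have hc : IsCompact (tsupport φ) := φ.hasCompactSupport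
    obtain ⟨n₀, D, hD⟩ := key _ (h.boundedBelow _ hc) (h.periodic _ hc)
    obtain ⟨p, hp, hsum⟩ := hD φ subset_rfl
    rw [hcoeff, hp.expCoeff_eq]
    exact hsum n k hk
  · obtain ⟨n₀, D, hD⟩ := key _ hg.1 hg.2
    exact ⟨n₀, D, fun φ => (hD φ (Set.subset_univ _)).imp fun _ => And.left⟩

end

end

end QuasiPolyAsymptotics

end

open QuasiPolyAsymptotics in
theorem proposition2
    {E : Type*} [NormedAddCommGroup E] [NormedSpace ℝ E] [FiniteDimensional ℝ E]
    {G : Type*} [TopologicalSpace G] [T2Space G] [CompactSpace G] [ConnectedSpace G]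
    [ChartedSpace E G] [Group G] [LieGroup 𝓘(ℝ, E) ∞ G]
    (c : CartanData E G)
    (m : Dual E → ℕ → ℂ) (hm : IsPiecewiseQuasiPolynomial c m)
    (j : E → ℂ) (hj : AnalyticOnNhd ℝ j Set.univ)
    (hj_inv : ∀ (g : G) (X : E), j (Ad g X) = j X)
    (hj_growth : HasPolynomialGrowth j)
    (B : ComplexMeasure (Dual E)) (hB : HasCompactSupportMeasure B)
    (hjB : IsFourierTransform j B) :
    ∃ Θ BΘ : ℕ → Distr E,
      (∀ k : ℕ, 1 ≤ k → IsTheta c m k (Θ k)) ∧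
      (∀ k : ℕ, 1 ≤ k → IsConvolution (rescale k B) (Θ k) (BΘ k)) ∧
      (∃ AS : ℤ → ℕ → Distr E,
        IsAsymptoticExpansion G Θ AS ∧ (IsFinitelyPiecewise c m → IsGlobal AS)) ∧
      ∀ AS : ℤ → ℕ → Distr E, IsAsymptoticExpansion G Θ AS →
        ∃ S : ℤ → ℕ → Distr E, IsTaylorImage j AS S ∧ IsAsymptoticExpansion G BΘ S ∧
          (IsGlobal AS → IsGlobal S) := by
  have := FiniteDimensional.complete ℝ E
  have := topologicalGroup_of_lieGroup 𝓘(ℝ, E) ∞ (G := G)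
  obtain ⟨s⟩ := c.nonempty_slice
  obtain ⟨Θ, hΘ⟩ := exists_theta c s m
  obtain ⟨K, hK, ν, ε, hν, hB'⟩ := exists_compact_decomposition hB
  have hsmooth : ContDiff ℝ ∞ j := contDiffOn_univ.1 (hj.contDiffOn uniqueDiffOn_univ)
  have hchar := eq_charFn hsmooth.continuous hj_growth hjB hK hB'
  have hconv : ∀ k : ℕ, ∃ C : Distr E, 1 ≤ k → IsAveraged ν ε (k : ℝ)⁻¹ (Θ k) C := by
    intro k
    by_cases hk : 1 ≤ k
    · obtain ⟨C, hC⟩ := exists_isAveraged (ν := ν) (ε := ε) hK (hΘ k hk).2 (t := (k : ℝ)⁻¹)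
        ⟨by positivity, inv_le_one_of_one_le₀ (by exact_mod_cast hk)⟩
      exact ⟨C, fun _ => hC⟩
    · exact ⟨0, fun h => absurd h hk⟩
  choose BΘ hBΘ using hconv
  refine ⟨Θ, BΘ, fun k hk => (hΘ k hk).1, fun k hk => (hBΘ k hk).isConvolution hB' hk, ?_,
    fun AS hAS => hAS.exists_taylorImage hK hsmooth hj_inv hchar hBΘ⟩
  obtain ⟨𝒜, q, hd⟩ := hm
  obtain ⟨AS, hAS, -, hglob⟩ := exists_isAsymptoticExpansion (G := G) (Θ := Θ)
    (fun k hk => (hΘ k hk).1.isInvariant) fun K' => by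
      obtain ⟨n₀, D, h⟩ := exists_hasExp_theta c s hd
        (hd.locallyFinite _ (isCompact_saturation (G := G) K'.isCompact)) (Set.sep_subset _ _)
        (fun k hk => (hΘ k hk).1)
      refine ⟨n₀, D, fun φ hφ => h φ fun P hP hPn => ?_⟩
      rw [Set.disjoint_iff_inter_eq_empty, ← Set.not_nonempty_iff_eq_empty]
      exact fun hne => hPn ⟨hP, hne.mono (Set.inter_subset_inter_right _ (saturation_mono hφ))⟩
  refine ⟨AS, hAS, fun ⟨𝒜', q', hfin, hd'⟩ => hglob ?_⟩
  obtain ⟨n₀, D, h⟩ := exists_hasExp_theta c s hd' hfin subset_rfl (fun k hk => (hΘ k hk).1)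
  exact ⟨n₀, D, fun φ => h φ fun P hP hPn => absurd hP hPn⟩
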